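/- **Setting.** Let $n\ge 1$. Distributions are over $\{-1,1\}^n$, ordered coordinatewise. A concept class $\mathscr C$ is a set of functions $f:\{-1,1\}^n\to\{0,1\}$; it is *closed under restriction* if $f\in\mathscr C$ implies $f_{i=b}\in\mathscr C$ for all $i\in[n]$, $b\in\{-1,1\}$, where $f_{i=b}(x)=f(x_{i=b})$ and $x_{i=b}$ is $x$ with its $i$-th coordinate overwritten by $b$. A distribution $\mathcal D$ is *monotone* if $\mathcal D(x)\le\mathcal D(y)$ whenever $x\le y$, and *representable by a depth-$d$ decision tree* if its probability mass function is computed by a decision tree of depth at most $d$. A randomized algorithm *$(\varepsilon,\delta)$-learns $\mathscr C$ for a set $\mathscr D$ of distributions using $m$ samples* if for all $\mathcal D\in\mathscr D$ and $f^\star\in\mathscr C$, given $m$ independent labeled samples $(x,f^\star(x))$, $x\sim\mathcal D$, it outputs with probability at least $1-\delta$ a hypothesis $h$ (a Boolean circuit) with $\Pr_{x\sim\mathcal D}[f^\star(x)\ne h(x)]\le\varepsilon$. A *subcube conditional sample* from $\mathcal D$ is a draw from $\mathcal D$ conditioned on a subcube specified, adaptively, by the algorithm (a uniform draw from the subcube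 if it has probability $0$). All algorithms are uniform randomized programs. The given learner receives $n$ and $\lceil 1/\varepsilon\rceil$ as additional input, the constructed ones receive $n,d,m$ and $\lceil 1/\varepsilon\rceil$. **Theorem.** For every $\kappa>0$ there is a constant $K$, depending only on $\kappa$, such that the following holds. For every algorithm $\mathcal A$ that uses only labeled random samples, and every polynomial time bound in $n$, $m$ and $\lceil 1/\varepsilon\rceil$, there are algorithms $\mathcal B_1,\mathcal B_2$ and a polynomial $q$ such that for all integers $n,m,d\ge 1$, every $\varepsilon>0$ and every concept class $\mathscr C$ of functions $\{-1,1\}^n\to\{0,1\}$ closed under restriction: if $\mathcal A$ runs within that time bound on $m$ samples and $(\varepsilon,\frac12)$-learns $\mathscr C$ for the uniform distribution using $m$ samples, then with $$M=\Big\lceil K\,n^{K}\Big(\frac{dm}{\varepsilon}\Big)^{Kd}\Big\rceil$$ * $\mathcal B_1$, which uses only labeled random samples, $((1+\kappa)\varepsilon,\frac16)$-learns $\mathscr C$ using $M$ samples for the monotone distributions representable by a depth-$d$ decision tree; * $\mathcal B_2$, which additionally makes at most $M$ draws of (unlabeled) subcube conditional samples from $\mathcal D$, $((1+\kappa)\varepsilon,\frac16)$-learns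 $\mathscr C$ using $M$ labeled random samples for all (not necessarily monotone) distributions representable by a depth-$d$ decision tree. Both $\mathcal B_1$ and $\mathcal B_2$ always run in time at most $q(n+M)$. -/

import Mathlib

open scoped ENNReal

noncomputable section

namespace Lift

/-! ### A randomized machine model with a step count

Programs of a WHILE language over binary trees, with fair coins and an oracle. A step is one
elementary operation (reading a variable, `nil`, `cons`, `head`, `tail`, a test, a coin toss, a
call, an oracle query). Structural equality of trees is not an elementary operation, so the step
count is polynomially related to Turing machine time. -/

/-- The data of the machine: binary trees. `nil` also plays the role of `false`, `0` and `[]`. -/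
inductive Data : Type
  | nil : Data
  | cons : Data → Data → Data

namespace Data

def head : Data → Data
  | nil => nil
  | cons a _ => a

def tail : Data → Data
  | nil => nil
  | cons _ b => b

/-- A tree read as a bit: `nil` is `false`, everything else is `true`. -/
def toBool : Data → Bool
  | nil => false
  | cons _ _ => true

/-- A tree read as a natural number (in unary): the length of its right spine. -/
def toNat : Data → ℕ
  | nil => 0
  | cons _ b => b.toNat + 1

/-- A tree read as a list of trees. -/
def toList : Data → List Data
  | nil => []
  | cons a b => a :: b.toList

def ofBool : Bool → Data
  | false => nil
  | true => cons nil nil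

def ofNat : ℕ → Data
  | 0 => nil
  | k + 1 => cons nil (ofNat k)

def ofList : List Data → Data
  | [] => nil
  | a :: l => cons a (ofList l)

end Data

/-- Expressions over the variables `0, 1, 2, …`. -/
inductive Expr : Type
  | var : ℕ → Expr
  | nil : Expr
  | cons : Expr → Expr → Expr
  | head : Expr → Expr
  | tail : Expr → Expr

/-- The memory: every variable holds a tree. -/
abbrev Store : Type := ℕ → Data

namespace Expr

def eval (s : Store) : Expr → Data
  | var x => s x
  | nil => Data.nil
  | cons e₁ e₂ => Data.cons (e₁.eval s) (e₂.eval s)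
  | head e => (e.eval s).head
  | tail e => (e.eval s).tail

/-- The number of elementary operations that evaluating the expression takes. -/
def size : Expr → ℕ
  | var _ => 1
  | nil => 1
  | cons e₁ e₂ => e₁.size + e₂.size + 1
  | head e => e.size + 1
  | tail e => e.size + 1

end Expr

/-- Programs. -/
inductive Cmd : Type
  /-- do nothing -/
  | skip : Cmd
  /-- `assign x e` stores the value of `e` in `x` -/
  | assign : ℕ → Expr → Cmd
  | seq : Cmd → Cmd → Cmd
  /-- `branch e c₁ c₂` runs `c₁` if the value of `e` is not `nil`, and `c₂` otherwise -/
  | branch : Expr → Cmd → Cmd → Cmd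
  /-- `loop e c` repeats `c` as long as the value of `e` is not `nil` -/
  | loop : Expr → Cmd → Cmd
  /-- `call x p e` runs the program `p`, with local variables of its own, on the value of `e`
  and stores the output in `x` -/
  | call : ℕ → Cmd → Expr → Cmd
  /-- `coin x` stores a fair random bit in `x` -/
  | coin : ℕ → Cmd
  /-- `query x e` sends the value of `e` to the oracle and stores the answer in `x` -/
  | query : ℕ → Expr → Cmd

/-- The result of a halting run: the final memory, the number of steps, and the number of oracle
queries. -/
structure Outcome : Type where
  store : Store
  steps : ℕ
  queries : ℕ

/-- The initial memory: the input is in variable `0`, all other variables are `nil`. -/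
def initStore (input : Data) : Store := Function.update (fun _ => Data.nil) 0 input

/-- The output is the final content of variable `0`. -/
def Outcome.output (o : Outcome) : Data := o.store 0

/-- Continue a (possibly unfinished) run with `next`, adding `t` steps, and adding up the steps and
the queries of both parts. `none` stands for an unfinished run. -/
def andThen (t : ℕ) (r : PMF (Option Outcome)) (next : Store → PMF (Option Outcome)) :
    PMF (Option Outcome) :=
  r.bind fun o => match o with
    | none => PMF.pure none
    | some o₁ => (next o₁.store).map (Option.map fun o₂ =>
        ⟨o₂.store, t + o₁.steps + o₂.steps, o₁.queries + o₂.queries⟩)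

/-- A finished run: final memory `s` after `t` steps without oracle query. -/
def done (s : Store) (t : ℕ) : PMF (Option Outcome) := PMF.pure (some ⟨s, t, 0⟩)

namespace Cmd

/-- `exec O k c s` is the distribution of the result of running `c` from the memory `s`, with the
oracle `O` that answers the query `q` by a fresh draw from `O q`. The number `k` only cuts off the
nesting depth of the evaluation, so that the function is total: the result is `none` if `k` is
too small. -/
def exec (O : Data → PMF Data) : ℕ → Cmd → Store → PMF (Option Outcome)
  | 0, _, _ => PMF.pure none
  | _ + 1, skip, s => done s 1
  | _ + 1, assign x e, s => done (Function.update s x (e.eval s)) (e.size + 1)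
  | k + 1, seq c₁ c₂, s => andThen 1 (exec O k c₁ s) fun s₁ => exec O k c₂ s₁
  | k + 1, branch e c₁ c₂, s =>
      andThen 1 (done s e.size) fun s₁ =>
        match e.eval s with
        | Data.nil => exec O k c₂ s₁
        | Data.cons _ _ => exec O k c₁ s₁
  | k + 1, loop e c, s =>
      match e.eval s with
      | Data.nil => done s (e.size + 1)
      | Data.cons _ _ =>
          andThen (e.size + 1) (exec O k c s) fun s₁ => exec O k (loop e c) s₁
  | k + 1, call x p e, s =>
      andThen (e.size + 1) (exec O k p (initStore (e.eval s))) fun s₁ =>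
        done (Function.update s x (s₁ 0)) 1
  | _ + 1, coin x, s =>
      (PMF.uniformOfFintype Bool).map fun b =>
        some ⟨Function.update s x (Data.ofBool b), 1, 0⟩
  | _ + 1, query x e, s =>
      (O (e.eval s)).map fun a => some ⟨Function.update s x a, e.size + 1, 1⟩

/-- The program contains no oracle query. -/
def QueryFree : Cmd → Prop
  | skip => True
  | assign _ _ => True
  | seq c₁ c₂ => c₁.QueryFree ∧ c₂.QueryFree
  | branch _ c₁ c₂ => c₁.QueryFree ∧ c₂.QueryFree
  | loop _ c => c.QueryFree
  | call _ p _ => p.QueryFree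
  | coin _ => True
  | query _ _ => False

end Cmd

/-! ### The cube, decision trees, distributions -/

/-- The cube `{-1, 1}ⁿ`, with `false` for `-1` and `true` for `1`. -/
abbrev Cube (n : ℕ) : Type := Fin n → Bool

/-- Decision trees over `n` bits with real labels at the leaves; `node i l r` queries the
coordinate `i` and goes to `l` if it is `-1`, and to `r` if it is `1`. -/
inductive DecisionTree (n : ℕ) : Type
  | leaf : ℝ → DecisionTree n
  | node : Fin n → DecisionTree n → DecisionTree n → DecisionTree n

namespace DecisionTree

variable {n : ℕ}

def eval (x : Cube n) : DecisionTree n → ℝ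
  | leaf p => p
  | node i l r => if x i = true then r.eval x else l.eval x

def depth : DecisionTree n → ℕ
  | leaf _ => 0
  | node _ l r => max l.depth r.depth + 1

end DecisionTree

/-- The probability mass function of `D` is computed by a decision tree of depth at most `d`. -/
def IsDecisionTreeDist {n : ℕ} (d : ℕ) (D : PMF (Cube n)) : Prop :=
  ∃ T : DecisionTree n, T.depth ≤ d ∧ ∀ x, (D x).toReal = T.eval x

/-- The probability mass function of `D` is monotone in the coordinatewise order. -/
def IsMonotoneDist {n : ℕ} (D : PMF (Cube n)) : Prop :=
  ∀ x y : Cube n, x ≤ y → D x ≤ D y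

/-- A concept class is closed under restriction. -/
def ClosedUnderRestriction {n : ℕ} (C : Set (Cube n → Bool)) : Prop :=
  ∀ f ∈ C, ∀ (i : Fin n) (b : Bool), (fun x => f (Function.update x i b)) ∈ C

/-- `m` independent draws from `p`. -/
def iid {α : Type} (p : PMF α) : ℕ → PMF (List α)
  | 0 => PMF.pure []
  | m + 1 => p.bind fun x => (iid p m).map fun l => x :: l

/-- The points of the subcube in which the coordinates `i` with `ρ i = some b` are fixed to `b`,
and those with `ρ i = none` are free. -/
def subcube {n : ℕ} (ρ : Fin n → Option Bool) : Set (Cube n) :=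
  {x | ∀ i b, ρ i = some b → x i = b}

open Classical in
/-- `D` conditioned on a subcube. If the subcube has probability zero, the uniform distribution
on the subcube. -/
def condSubcube {n : ℕ} (D : PMF (Cube n)) (ρ : Fin n → Option Bool) : PMF (Cube n) :=
  if h : ∃ x ∈ subcube ρ, x ∈ D.support then D.filter (subcube ρ) h
  else (PMF.uniformOfFintype (Cube n)).map fun y i => (ρ i).getD (y i)

/-! ### Encodings -/

def encodePoint {n : ℕ} (x : Cube n) : Data :=
  Data.ofList ((List.ofFn x).map Data.ofBool)

/-- An example: the label, followed by the point. -/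
def encodeExample {n : ℕ} (z : Cube n × Bool) : Data :=
  Data.cons (Data.ofBool z.2) (encodePoint z.1)

/-- The input of a learner: a list of numerical parameters (in unary) and a list of labeled
examples. -/
def encodeInput {n : ℕ} (params : List ℕ) (S : List (Cube n × Bool)) : Data :=
  Data.cons (Data.ofList (params.map Data.ofNat)) (Data.ofList (S.map encodeExample))

/-- A query read as a subcube: the `i`-th entry of the list is `nil` if the coordinate `i` is
free, and has the value of the coordinate as its head if it is fixed. -/
def decodeSubcube (n : ℕ) (q : Data) : Fin n → Option Bool := fun i =>
  match q.toList.getD i Data.nil with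
  | Data.nil => none
  | Data.cons b _ => some b.toBool

/-- The oracle for subcube conditional samples from `D`. -/
def subcubeOracle {n : ℕ} (D : PMF (Cube n)) (q : Data) : PMF Data :=
  (condSubcube D (decodeSubcube n q)).map encodePoint

/-! ### Hypotheses: Boolean circuits -/

/-- The values of all wires of a circuit of NAND gates on the input `x`. The wires `0, …, n - 1`
carry the input, and the wire `n + j` carries the value of the `j`-th gate; a gate is given by the
numbers of the two wires that it reads (a wire that does not exist yet reads as `false`). -/
def wireValues {n : ℕ} (gates : List (ℕ × ℕ)) (x : Cube n) : List Bool :=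
  gates.foldl (fun w g => w ++ [!(w.getD g.1 false && w.getD g.2 false)]) (List.ofFn x)

/-- The function computed by a circuit: the value of its last wire. -/
def evalCircuit {n : ℕ} (gates : List (ℕ × ℕ)) (x : Cube n) : Bool :=
  (wireValues gates x).getLastD false

/-- The circuit that a tree describes: a list of pairs of numbers. -/
def decodeCircuit (t : Data) : List (ℕ × ℕ) :=
  t.toList.map fun g => (g.head.toNat, g.tail.toNat)

/-- The hypothesis that a learner outputs, as a function on the cube. -/
def Outcome.hypothesis (o : Outcome) (n : ℕ) : Cube n → Bool :=
  evalCircuit (decodeCircuit o.output)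

/-! ### Learning -/

/-- The probability under `D` that `h` errs on `f`. -/
def err {n : ℕ} (D : PMF (Cube n)) (f h : Cube n → Bool) : ℝ≥0∞ :=
  D.toOuterMeasure {x | f x ≠ h x}

/-- The run of `P` on the input given by `params` and the labeled sample `S`, with the oracle for
subcube conditional samples from `D` (which a query-free program does not use). -/
def runOn {n : ℕ} (P : Cmd) (params : List ℕ) (D : PMF (Cube n)) (k : ℕ)
    (S : List (Cube n × Bool)) : PMF (Option Outcome) :=
  P.exec (subcubeOracle D) k (initStore (encodeInput params S))

/-- The program `P`, given `params`, `(ε, δ)`-learns `C` for the distributions in `𝒟` from `m`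
labeled random examples: with probability at least `1 - δ` over the examples, the coins and the
oracle answers it halts with a hypothesis of error at most `ε`. -/
def Learns {n : ℕ} (P : Cmd) (params : List ℕ) (ε δ : ℝ) (C : Set (Cube n → Bool))
    (𝒟 : Set (PMF (Cube n))) (m : ℕ) : Prop :=
  ∀ D ∈ 𝒟, ∀ f ∈ C, ∃ k : ℕ,
    ENNReal.ofReal (1 - δ) ≤
      ((iid (D.map fun x => (x, f x)) m).bind fun S => runOn P params D k S).toOuterMeasure
        {r | ∃ o : Outcome, r = some o ∧ err D f (o.hypothesis n) ≤ ENNReal.ofReal ε}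

/-- On every list of `m` labeled points of the `n`-cube, whatever the distribution behind the
oracle, and for all coins and oracle answers, the run of `P` halts with an outcome that
satisfies `Q`. -/
def AlwaysHaltsWith (P : Cmd) (params : List ℕ) (n m : ℕ) (Q : Outcome → Prop) : Prop :=
  ∀ (D : PMF (Cube n)) (S : List (Cube n × Bool)), S.length = m →
    ∃ k : ℕ, ∀ r ∈ (runOn P params D k S).support, ∃ o : Outcome, r = some o ∧ Q o

/-- `P` runs in time `t` on `m` examples. -/
def RunsInTime (P : Cmd) (params : List ℕ) (n m t : ℕ) : Prop :=
  AlwaysHaltsWith P params n m fun o => o.steps ≤ t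

/-- `P` makes at most `q` oracle queries on `m` examples. -/
def MakesQueries (P : Cmd) (params : List ℕ) (n m q : ℕ) : Prop :=
  AlwaysHaltsWith P params n m fun o => o.queries ≤ q

/-- The number `K nᴷ (d m / ε) ^ (K d)`, rounded up. -/
def sampleSize (K n m d : ℕ) (ε : ℝ) : ℕ :=
  ⌈(K : ℝ) * (n : ℝ) ^ K * ((d : ℝ) * (m : ℝ) / ε) ^ (K * d)⌉₊

end Lift

end

/-!
# Lifting a learner for the uniform distribution to decision tree distributions

If the density is a decision tree of depth `d`, then it is constant on the subcube of each of its
leaves. On such a subcube the conditional distribution is uniform, so that overwriting the fixed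
coordinates of the examples by random bits gives uniform examples of a restriction of the target
function, and the given learner can be applied. The tree is not known, however, and the number of
all decision trees of depth `d` is about `n ^ (2 ^ d)`. The learner is a dynamic program over the
subcubes that are reached by at most `d` subdivisions along *candidates*: coordinates that seem to
influence the density on the subcube. On each of these subcubes it runs the given learner, and it
keeps the decision tree, with hypotheses at the leaves, that makes the fewest errors on fresh
examples.

**Few candidates suffice.** A point is sensitive to at most `d` coordinates
(`DecisionTree.card_sensitive_le`). If every example comes with bits whose biases detect influence
(`Detects`), then the biases sum to at most `d` times the mass of the subcube
(`Detects.sum_bias_le`). Hence for a threshold `1 / T` there are at most `T ^ 2` candidates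
(`influence_le_of_not_mem_cands`), and the search space has at most `(4 * T ^ 2) ^ d` elements
(`length_seg`); it does not depend exponentially on `n`. A query of a coordinate of small influence
can be skipped, by passing to the better half of the tree (`exists_restrict`), so that the search
finds a hypothesis that is not much worse than one on the leaves of the true tree
(`IsOpt.value_le`).

**Detecting influence.** For a monotone distribution the bits are the coordinates of the example
itself, whose bias is the influence (`detects_of_monotone`). In general, the `i`-th bit tells
whether a sample from the edge at the example `x` in the direction `i` agrees with `x`
(`detects_edges`). On an edge with densities `a` and `b` the bias is `(a - b) ^ 2 / (a + b)`, and the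
Cauchy-Schwarz inequality bounds the square of the influence by the mass times the bias.

**The hypotheses on a subcube.** On a subcube that is neither light nor far from constant density,
the examples for the given learner are so close to uniform that a run succeeds with probability
bounded away from zero. Its hypothesis is used with the fixed coordinates overwritten by one random
point, which by Markov's inequality costs the factor `1 + κ` (`ex_hypLaw_le`), and `T ^ 5` runs are
enough for all subcubes (`ex_jobs_le`, `pr_allResLaw_le`). All estimates are by Chernoff bounds
(`pr_countP_dev_le`) and union bounds. The probability of failure and the excess of the error are
collected in `pr_learner_le`; the choice of the parameters is justified in `failure_le`, `error_le`
and `le_sampleSize`.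

**The programs.** Deterministic computations are composed from polynomial-time functions between
types whose elements are encoded as trees (`PT`), and the randomized program is put together from
these, coins, the given learner and queries (`RP`, `exists_learner`, `exists_lifted_learner`). The
search is carried out on a stack, by code in postfix notation (`codeOf`, `bestLeaves`), and the
resulting tree is compiled to a circuit (`compileLeaves`, `evalGates_compileLeaves`). Running times
are bounded by means of the height of the trees, which grows by at most one in each step.
-/

open scoped ENNReal

noncomputable section

namespace Lift

/-! ### Halting runs -/

theorem pmf_bind_congr {α β : Type} (p : PMF α) {f g : α → PMF β}
    (h : ∀ a ∈ p.support, f a = g a) : p.bind f = p.bind g := by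
  ext b
  rw [PMF.bind_apply, PMF.bind_apply]
  refine tsum_congr fun a => ?_
  by_cases ha : p a = 0
  · simp [ha]
  · rw [h a ((PMF.mem_support_iff _ _).2 ha)]

theorem pmf_map_congr {α β : Type} (p : PMF α) {f g : α → β}
    (h : ∀ a ∈ p.support, f a = g a) : p.map f = p.map g :=
  pmf_bind_congr p fun a ha => by simp [h a ha]

theorem pmf_eq_of_le {α : Type} (p q : PMF α) (h : ∀ x, p x ≤ q x) : p = q := by
  ext x
  refine le_antisymm (h x) (not_lt.1 fun hlt => ?_)
  have := ENNReal.tsum_lt_tsum (f := p) (g := q) (by rw [p.tsum_coe]; simp) h hlt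
  rw [p.tsum_coe, q.tsum_coe] at this
  exact lt_irrefl _ this

theorem finite_support_map {α β : Type} {p : PMF α} (hp : p.support.Finite) (f : α → β) :
    (p.map f).support.Finite := by
  rw [PMF.support_map]; exact hp.image f

theorem finite_support_bind {α β : Type} {p : PMF α} (hp : p.support.Finite) (f : α → PMF β)
    (hf : ∀ a ∈ p.support, (f a).support.Finite) : (p.bind f).support.Finite := by
  rw [PMF.support_bind]
  exact hp.biUnion hf

theorem map_some_apply {α : Type} (p : PMF α) (a : α) : p.map some (some a) = p a := by
  classical
  rw [PMF.map_apply, tsum_eq_single a]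
  · simp
  · intro b hb; simp [Ne.symm hb]

/-- The combination of the outcomes of two consecutive runs. -/
def Outcome.comb (t : ℕ) (o₁ o₂ : Outcome) : Outcome :=
  ⟨o₂.store, t + o₁.steps + o₂.steps, o₁.queries + o₂.queries⟩

theorem andThen_map_some (t : ℕ) (R : PMF Outcome) (next : Store → PMF (Option Outcome))
    (R₂ : Outcome → PMF Outcome) (h : ∀ o ∈ R.support, next o.store = (R₂ o).map some) :
    andThen t (R.map some) next = (R.bind fun o => (R₂ o).map (o.comb t)).map some := by
  unfold andThen
  rw [PMF.bind_map, PMF.map_bind]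
  refine pmf_bind_congr _ fun o ho => ?_
  simp only [Function.comp]
  rw [h o ho, PMF.map_comp, PMF.map_comp]
  rfl

/-- The family `F`, indexed by the cut-off of the evaluation, is eventually a halting run with
final memory distributed as `P`, that takes at most `t` steps and `q` queries. The runs considered
have finitely many outcomes, so that the cut-off can be chosen for all of them at once. -/
def Halts (F : ℕ → PMF (Option Outcome)) (P : PMF Store) (t q : ℕ) : Prop :=
  ∃ R : PMF Outcome, R.support.Finite ∧ (∃ k₀, ∀ k, k₀ ≤ k → F k = R.map some) ∧
    R.map Outcome.store = P ∧ ∀ o ∈ R.support, o.steps ≤ t ∧ o.queries ≤ q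

theorem Halts.mono {F : ℕ → PMF (Option Outcome)} {P : PMF Store} {t q t' q' : ℕ}
    (h : Halts F P t q) (ht : t ≤ t') (hq : q ≤ q') : Halts F P t' q' := by
  obtain ⟨R, h1, h2, h3, h4⟩ := h
  exact ⟨R, h1, h2, h3, fun o ho => ⟨(h4 o ho).1.trans ht, (h4 o ho).2.trans hq⟩⟩

theorem Halts.done (s : Store) (t : ℕ) : Halts (fun _ => done s t) (PMF.pure s) t 0 := by
  refine ⟨PMF.pure ⟨s, t, 0⟩, by simp, ⟨0, fun k _ => ?_⟩, by simp [PMF.pure_map], ?_⟩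
  · simp [Lift.done, PMF.pure_map]
  · simp

theorem Halts.andThen {F : ℕ → PMF (Option Outcome)} {G : ℕ → Store → PMF (Option Outcome)}
    {P₁ : PMF Store} {P₂ : Store → PMF Store} {t t₁ t₂ q₁ q₂ : ℕ} (h₁ : Halts F P₁ t₁ q₁)
    (h₂ : ∀ s ∈ P₁.support, Halts (fun k => G k s) (P₂ s) t₂ q₂) :
    Halts (fun k => andThen t (F k) (G k)) (P₁.bind P₂) (t + t₁ + t₂) (q₁ + q₂) := by
  obtain ⟨R, hf, ⟨k₁, hk₁⟩, hP, hb⟩ := h₁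
  have key : ∀ o : Outcome, ∃ R₂ : PMF Outcome, ∃ k₂ : ℕ, o ∈ R.support →
      R₂.support.Finite ∧ (∀ k, k₂ ≤ k → G k o.store = R₂.map some) ∧
      R₂.map Outcome.store = P₂ o.store ∧ ∀ o' ∈ R₂.support, o'.steps ≤ t₂ ∧ o'.queries ≤ q₂ := by
    intro o
    by_cases ho : o ∈ R.support
    · obtain ⟨R₂, a, ⟨k₂, b⟩, c, d⟩ := h₂ o.store (by
        rw [← hP, PMF.support_map]; exact ⟨o, ho, rfl⟩)
      exact ⟨R₂, k₂, fun _ => ⟨a, b, c, d⟩⟩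
    · exact ⟨R, 0, fun h => absurd h ho⟩
  choose R₂ k₂ h using key
  refine ⟨R.bind fun o => (R₂ o).map (o.comb t), ?_, ?_, ?_, ?_⟩
  · exact finite_support_bind hf _ fun o ho => finite_support_map (h o ho).1 _
  · refine ⟨max k₁ (hf.toFinset.sup k₂), fun k hk => ?_⟩
    simp only [hk₁ k ((le_max_left _ _).trans hk)]
    refine andThen_map_some t R _ R₂ fun o ho => (h o ho).2.1 k ?_
    exact (Finset.le_sup (f := k₂) (hf.mem_toFinset.2 ho)).trans ((le_max_right _ _).trans hk)
  · rw [PMF.map_bind, ← hP, PMF.bind_map]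
    refine pmf_bind_congr _ fun o ho => ?_
    rw [PMF.map_comp, Function.comp, ← (h o ho).2.2.1]
    rfl
  · intro o ho
    rw [PMF.support_bind] at ho
    simp only [PMF.support_map, Set.mem_iUnion, Set.mem_image] at ho
    obtain ⟨o₁, ho₁, o₂, ho₂, rfl⟩ := ho
    have a := hb o₁ ho₁
    have b := (h o₁ ho₁).2.2.2 o₂ ho₂
    simp only [Outcome.comb]
    omega

theorem Halts.congr {F G : ℕ → PMF (Option Outcome)} {P : PMF Store} {t q : ℕ}
    (h : Halts F P t q) (hFG : ∀ k, G (k + 1) = F k) : Halts G P t q := by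
  obtain ⟨R, h1, ⟨k₀, h2⟩, h3⟩ := h
  refine ⟨R, h1, ⟨k₀ + 1, fun k hk => ?_⟩, h3⟩
  obtain ⟨k, rfl⟩ : ∃ j, k = j + 1 := ⟨k - 1, by omega⟩
  rw [hFG, h2 k (by omega)]

/-- From the memory `s` the program `c` halts, for all coins and oracle answers, within `t` steps
and `q` queries, and its final memory is distributed as `P`. -/
def SRuns (O : Data → PMF Data) (c : Cmd) (s : Store) (P : PMF Store) (t q : ℕ) : Prop :=
  Halts (fun k => c.exec O k s) P t q

/-- On the input `x` the program `c` halts, for all coins and oracle answers, within `t` steps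
and `q` queries, and its output is distributed as `p`. -/
def Runs (O : Data → PMF Data) (c : Cmd) (x : Data) (p : PMF Data) (t q : ℕ) : Prop :=
  ∃ P : PMF Store, SRuns O c (initStore x) P t q ∧ P.map (fun s => s 0) = p

section rules

variable {O : Data → PMF Data} {s : Store} {t t₁ t₂ q q₁ q₂ : ℕ}

theorem SRuns.mono {c : Cmd} {P : PMF Store} {t' q' : ℕ} (h : SRuns O c s P t q) (ht : t ≤ t')
    (hq : q ≤ q') : SRuns O c s P t' q' := Halts.mono h ht hq

theorem Runs.mono {c : Cmd} {x : Data} {p : PMF Data} {t' q' : ℕ} (h : Runs O c x p t q)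
    (ht : t ≤ t') (hq : q ≤ q') : Runs O c x p t' q' := by
  obtain ⟨P, h1, h2⟩ := h
  exact ⟨P, h1.mono ht hq, h2⟩

theorem SRuns.assign (x : ℕ) (e : Expr) :
    SRuns O (.assign x e) s (PMF.pure (Function.update s x (e.eval s))) (e.size + 1) 0 :=
  (Halts.done _ _).congr fun _ => rfl

theorem SRuns.seq {c₁ c₂ : Cmd} {P₁ : PMF Store} {P₂ : Store → PMF Store}
    (h₁ : SRuns O c₁ s P₁ t₁ q₁) (h₂ : ∀ s' ∈ P₁.support, SRuns O c₂ s' (P₂ s') t₂ q₂) :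
    SRuns O (.seq c₁ c₂) s (P₁.bind P₂) (1 + t₁ + t₂) (q₁ + q₂) :=
  (Halts.andThen (G := fun k s' => c₂.exec O k s') h₁ h₂).congr fun _ => rfl

/-- A deterministic first part. -/
theorem SRuns.seq_pure {c₁ c₂ : Cmd} {s₁ : Store} {P₂ : PMF Store}
    (h₁ : SRuns O c₁ s (PMF.pure s₁) t₁ 0) (h₂ : SRuns O c₂ s₁ P₂ t₂ q) :
    SRuns O (.seq c₁ c₂) s P₂ (1 + t₁ + t₂) q := by
  have := SRuns.seq (P₂ := fun _ => P₂) h₁ (fun s' hs' => by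
    simp only [PMF.support_pure, Set.mem_singleton_iff] at hs'
    subst hs'; exact h₂)
  rw [PMF.pure_bind, zero_add] at this
  exact this

theorem SRuns.branch_true {e : Expr} {c₁ c₂ : Cmd} {P : PMF Store} (he : e.eval s ≠ Data.nil)
    (h : SRuns O c₁ s P t q) : SRuns O (.branch e c₁ c₂) s P (1 + e.size + t) q := by
  have := Halts.andThen (t := 1) (G := fun k s' => match e.eval s with
        | Data.nil => c₂.exec O k s'
        | Data.cons _ _ => c₁.exec O k s') (P₂ := fun _ => P) (Halts.done s e.size)
    (t₂ := t) (q₂ := q) (fun s' hs' => by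
    simp only [PMF.support_pure, Set.mem_singleton_iff] at hs'
    subst hs'
    cases hv : e.eval s' with
    | nil => exact absurd hv he
    | cons a b => exact h)
  rw [PMF.pure_bind, zero_add] at this
  exact this.congr fun _ => rfl

theorem SRuns.branch_false {e : Expr} {c₁ c₂ : Cmd} {P : PMF Store} (he : e.eval s = Data.nil)
    (h : SRuns O c₂ s P t q) : SRuns O (.branch e c₁ c₂) s P (1 + e.size + t) q := by
  have := Halts.andThen (t := 1) (G := fun k s' => match e.eval s with
        | Data.nil => c₂.exec O k s'
        | Data.cons _ _ => c₁.exec O k s') (P₂ := fun _ => P) (Halts.done s e.size)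
    (t₂ := t) (q₂ := q) (fun s' hs' => by
    simp only [PMF.support_pure, Set.mem_singleton_iff] at hs'
    subst hs'
    cases hv : e.eval s' with
    | nil => exact h
    | cons a b => rw [he] at hv; cases hv)
  rw [PMF.pure_bind, zero_add] at this
  exact this.congr fun _ => rfl

theorem SRuns.loop_nil {e : Expr} {c : Cmd} (he : e.eval s = Data.nil) :
    SRuns O (.loop e c) s (PMF.pure s) (e.size + 1) 0 := by
  refine (Halts.done s (e.size + 1)).congr fun k => ?_
  simp only [Cmd.exec, he]

theorem SRuns.loop_cons {e : Expr} {c : Cmd} {P₁ : PMF Store} {P₂ : Store → PMF Store}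
    (he : e.eval s ≠ Data.nil) (h₁ : SRuns O c s P₁ t₁ q₁)
    (h₂ : ∀ s' ∈ P₁.support, SRuns O (.loop e c) s' (P₂ s') t₂ q₂) :
    SRuns O (.loop e c) s (P₁.bind P₂) (e.size + 1 + t₁ + t₂) (q₁ + q₂) := by
  refine (Halts.andThen (t := e.size + 1) (G := fun k s' => (Cmd.loop e c).exec O k s') h₁
    h₂).congr fun k => ?_
  simp only [Cmd.exec]
  cases hv : e.eval s with
  | nil => exact absurd hv he
  | cons a b => rfl

theorem SRuns.call {x : ℕ} {c : Cmd} {e : Expr} {p : PMF Data}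
    (h : Runs O c (e.eval s) p t q) :
    SRuns O (.call x c e) s (p.map fun y => Function.update s x y) (t + e.size + 2) q := by
  obtain ⟨P, h1, rfl⟩ := h
  have := Halts.andThen (t := e.size + 1) (G := fun _ s₁ => done (Function.update s x (s₁ 0)) 1)
    (P₂ := fun s₁ => PMF.pure (Function.update s x (s₁ 0))) h1 (fun s' _ => Halts.done _ 1)
  rw [PMF.map_comp]
  exact (this.congr fun _ => rfl).mono (by omega) (by omega)

theorem SRuns.coin (x : ℕ) :
    SRuns O (.coin x) s ((PMF.uniformOfFintype Bool).map fun b =>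
      Function.update s x (Data.ofBool b)) 1 0 := by
  refine ⟨(PMF.uniformOfFintype Bool).map fun b => ⟨Function.update s x (Data.ofBool b), 1, 0⟩,
    finite_support_map (Set.toFinite _) _, ⟨1, fun k hk => ?_⟩, ?_, ?_⟩
  · obtain ⟨k, rfl⟩ : ∃ j, k = j + 1 := ⟨k - 1, by omega⟩
    rw [PMF.map_comp]; rfl
  · rw [PMF.map_comp]; rfl
  · intro o ho
    rw [PMF.support_map] at ho
    obtain ⟨b, _, rfl⟩ := ho
    simp

theorem SRuns.query {x : ℕ} {e : Expr} (hO : (O (e.eval s)).support.Finite) :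
    SRuns O (.query x e) s ((O (e.eval s)).map fun a => Function.update s x a) (e.size + 1) 1 := by
  refine ⟨(O (e.eval s)).map fun a => ⟨Function.update s x a, e.size + 1, 1⟩,
    finite_support_map hO _, ⟨1, fun k hk => ?_⟩, ?_, ?_⟩
  · obtain ⟨k, rfl⟩ : ∃ j, k = j + 1 := ⟨k - 1, by omega⟩
    rw [PMF.map_comp]; rfl
  · rw [PMF.map_comp]; rfl
  · intro o ho
    rw [PMF.support_map] at ho
    obtain ⟨b, _, rfl⟩ := ho
    simp

theorem SRuns.runs {c : Cmd} {x : Data} {P : PMF Store} (h : SRuns O c (initStore x) P t q) :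
    Runs O c x (P.map fun s => s 0) t q := ⟨P, h, rfl⟩

end rules

/-! ### Monotonicity in the cut-off, and independence of the oracle -/

theorem andThen_some_le {t : ℕ} {r r' : PMF (Option Outcome)}
    {next next' : Store → PMF (Option Outcome)} (hr : ∀ o, r (some o) ≤ r' (some o))
    (hn : ∀ s o, next s (some o) ≤ next' s (some o)) (o : Outcome) :
    andThen t r next (some o) ≤ andThen t r' next' (some o) := by
  classical
  unfold andThen
  rw [PMF.bind_apply, PMF.bind_apply]
  refine ENNReal.tsum_le_tsum fun x => ?_
  cases x with
  | none => simp
  | some o₁ =>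
    refine mul_le_mul' (hr o₁) ?_
    simp only
    rw [PMF.map_apply, PMF.map_apply]
    refine ENNReal.tsum_le_tsum fun y => ?_
    cases y with
    | none => simp
    | some o₂ =>
      split_ifs
      · exact hn _ _
      · exact le_rfl

theorem exec_some_le_succ (O : Data → PMF Data) (k : ℕ) : ∀ (c : Cmd) (s : Store) (o : Outcome),
    c.exec O k s (some o) ≤ c.exec O (k + 1) s (some o) := by
  induction k with
  | zero => intro c s o; simp [Cmd.exec]
  | succ k ih =>
    intro c s o
    cases c with
    | skip => exact le_rfl
    | assign x e => exact le_rfl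
    | coin x => exact le_rfl
    | query x e => exact le_rfl
    | seq c₁ c₂ => exact andThen_some_le (ih c₁ s) (fun s o => ih c₂ s o) o
    | branch e c₁ c₂ =>
      refine andThen_some_le (fun _ => le_rfl) (fun s' o' => ?_) o
      cases hv : e.eval s with
      | nil => exact ih c₂ s' o'
      | cons a b => exact ih c₁ s' o'
    | loop e c =>
      rw [Cmd.exec, Cmd.exec]
      cases hv : e.eval s with
      | nil => exact le_rfl
      | cons a b => exact andThen_some_le (ih c s) (fun s o => ih _ s o) o
    | call x p e => exact andThen_some_le (ih p _) (fun _ _ => le_rfl) o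

theorem exec_some_le (O : Data → PMF Data) (c : Cmd) (s : Store) (o : Outcome) {k k' : ℕ}
    (h : k ≤ k') : c.exec O k s (some o) ≤ c.exec O k' s (some o) := by
  induction h with
  | refl => exact le_rfl
  | step _ ih => exact ih.trans (exec_some_le_succ O _ c s o)

theorem exec_stable {O : Data → PMF Data} {c : Cmd} {s : Store} {k k' : ℕ} {R : PMF Outcome}
    (h : c.exec O k s = R.map some) (hk : k ≤ k') : c.exec O k' s = R.map some := by
  rw [← h]
  refine (pmf_eq_of_le _ _ fun x => ?_).symm
  cases x with
  | none =>
    have : c.exec O k s none = 0 := by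
      rw [h, PMF.apply_eq_zero_iff, PMF.support_map]; simp
    rw [this]; exact zero_le
  | some o => exact exec_some_le O c s o hk

/-- A run that is cut off produces any set of outputs with at most the probability of the full
run. -/
theorem Runs.le {O : Data → PMF Data} {c : Cmd} {x : Data} {p : PMF Data} {t q : ℕ}
    (h : Runs O c x p t q) (k : ℕ) (G : Set Data) :
    (c.exec O k (initStore x)).toOuterMeasure {r | ∃ o : Outcome, r = some o ∧ o.output ∈ G} ≤
      p.toOuterMeasure G := by
  classical
  obtain ⟨P, ⟨R, -, ⟨k₀, hk₀⟩, hP, -⟩, rfl⟩ := h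
  have h1 : (c.exec O k (initStore x)).toOuterMeasure
      {r | ∃ o : Outcome, r = some o ∧ o.output ∈ G} ≤
      (R.map some).toOuterMeasure {r | ∃ o : Outcome, r = some o ∧ o.output ∈ G} := by
    rw [PMF.toOuterMeasure_apply, PMF.toOuterMeasure_apply]
    refine ENNReal.tsum_le_tsum fun r => ?_
    simp only [Set.indicator]
    split_ifs with hr
    · obtain ⟨o, rfl, -⟩ := hr
      have := hk₀ (max k k₀) (le_max_right _ _)
      rw [← this]
      exact exec_some_le O c _ o (le_max_left _ _)
    · exact le_rfl
  refine h1.trans (le_of_eq ?_)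
  rw [← hP, PMF.map_comp, PMF.toOuterMeasure_map_apply, PMF.toOuterMeasure_map_apply]
  congr 1
  ext o
  simp [Outcome.output]

theorem exec_queryFree (O O' : Data → PMF Data) (k : ℕ) : ∀ (c : Cmd) (s : Store), c.QueryFree →
    c.exec O k s = c.exec O' k s := by
  induction k with
  | zero => intro c s _; rfl
  | succ k ih =>
    intro c s hc
    cases c with
    | skip => rfl
    | assign x e => rfl
    | coin x => rfl
    | query x e => exact hc.elim
    | seq c₁ c₂ =>
      rw [Cmd.exec, Cmd.exec, ih c₁ s hc.1]
      congr 1; funext s'; exact ih c₂ s' hc.2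
    | branch e c₁ c₂ =>
      rw [Cmd.exec, Cmd.exec]
      congr 1; funext s'
      cases e.eval s with
      | nil => exact ih c₂ s' hc.2
      | cons a b => exact ih c₁ s' hc.1
    | loop e c =>
      rw [Cmd.exec, Cmd.exec]
      cases e.eval s with
      | nil => rfl
      | cons a b =>
        simp only
        rw [ih c s hc]
        congr 1; funext s'; exact ih _ s' hc
    | call x p e =>
      rw [Cmd.exec, Cmd.exec, ih p _ hc]

theorem exec_support_finite (O : Data → PMF Data) (k : ℕ) : ∀ (c : Cmd) (s : Store), c.QueryFree →
    (c.exec O k s).support.Finite := by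
  have hand : ∀ (t : ℕ) (r : PMF (Option Outcome)) (next : Store → PMF (Option Outcome)),
      r.support.Finite → (∀ s, (next s).support.Finite) →
      (andThen t r next).support.Finite := by
    intro t r next h1 h2
    refine finite_support_bind h1 _ fun o _ => ?_
    cases o with
    | none => simp
    | some o => exact finite_support_map (h2 _) _
  have hd : ∀ s t, (done s t).support.Finite := by intro s t; simp [done]
  induction k with
  | zero => intro c s _; simp [Cmd.exec]
  | succ k ih =>
    intro c s hc
    cases c with
    | skip => exact hd _ _
    | assign x e => exact hd _ _
    | coin x => exact finite_support_map (Set.toFinite _) _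
    | query x e => exact hc.elim
    | seq c₁ c₂ => exact hand _ _ _ (ih c₁ s hc.1) (fun s => ih c₂ s hc.2)
    | branch e c₁ c₂ =>
      refine hand _ _ _ (hd _ _) fun s' => ?_
      cases e.eval s with
      | nil => exact ih c₂ s' hc.2
      | cons a b => exact ih c₁ s' hc.1
    | loop e c =>
      rw [Cmd.exec]
      cases e.eval s with
      | nil => exact hd _ _
      | cons a b => exact hand _ _ _ (ih c s hc) (fun s => ih _ s hc)
    | call x p e => exact hand _ _ _ (ih p _ hc) (fun _ => hd _ _)

theorem exec_queries (O : Data → PMF Data) (k : ℕ) : ∀ (c : Cmd) (s : Store), c.QueryFree →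
    ∀ o, some o ∈ (c.exec O k s).support → o.queries = 0 := by
  have hand : ∀ (t : ℕ) (r : PMF (Option Outcome)) (next : Store → PMF (Option Outcome)),
      (∀ o, some o ∈ r.support → o.queries = 0) →
      (∀ s o, some o ∈ (next s).support → o.queries = 0) →
      ∀ o, some o ∈ (andThen t r next).support → o.queries = 0 := by
    intro t r next h1 h2 o ho
    unfold andThen at ho
    rw [PMF.support_bind] at ho
    simp only [Set.mem_iUnion] at ho
    obtain ⟨x, hx, ho⟩ := ho
    cases x with
    | none => simp at ho
    | some o₁ =>
      simp only [PMF.support_map, Set.mem_image] at ho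
      obtain ⟨y, hy, hyo⟩ := ho
      cases y with
      | none => simp at hyo
      | some o₂ =>
        simp only [Option.map_some, Option.some.injEq] at hyo
        subst hyo
        simp [h1 _ hx, h2 _ _ hy]
  have hd : ∀ s t o, some o ∈ (done s t).support → o.queries = 0 := by
    intro s t o ho; simp [done] at ho; simp [ho]
  induction k with
  | zero => intro c s _ o ho; simp [Cmd.exec] at ho
  | succ k ih =>
    intro c s hc
    cases c with
    | skip => exact hd _ _
    | assign x e => exact hd _ _
    | coin x =>
      intro o ho
      rw [Cmd.exec, PMF.support_map] at ho
      obtain ⟨b, _, hb⟩ := ho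
      simp only [Option.some.injEq] at hb
      simp [← hb]
    | query x e => exact hc.elim
    | seq c₁ c₂ => exact hand _ _ _ (ih c₁ s hc.1) (fun s => ih c₂ s hc.2)
    | branch e c₁ c₂ =>
      refine hand _ _ _ (hd _ _) fun s' => ?_
      cases e.eval s with
      | nil => exact ih c₂ s' hc.2
      | cons a b => exact ih c₁ s' hc.1
    | loop e c =>
      rw [Cmd.exec]
      cases e.eval s with
      | nil => exact hd _ _
      | cons a b => exact hand _ _ _ (ih c s hc) (fun s => ih _ s hc)
    | call x p e => exact hand _ _ _ (ih p _ hc) (fun _ => hd _ _)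

/-- A query-free program that halts for all coins within `t` steps has an output distribution. -/
theorem exists_runs {O : Data → PMF Data} {c : Cmd} (hc : c.QueryFree) {x : Data} {k t : ℕ}
    (h : ∀ r ∈ (c.exec O k (initStore x)).support, ∃ o : Outcome, r = some o ∧ o.steps ≤ t) :
    ∃ p, Runs O c x p t 0 := by
  classical
  set E := c.exec O k (initStore x) with hE
  let g : Option Outcome → Outcome := fun r => r.getD ⟨fun _ => Data.nil, 0, 0⟩
  have hm : E = (E.map g).map some := by
    rw [PMF.map_comp]
    conv_lhs => rw [← PMF.map_id E]
    refine pmf_map_congr _ fun r hr => ?_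
    obtain ⟨o, rfl, -⟩ := h r hr
    rfl
  refine ⟨_, _, ⟨E.map g, ?_, ⟨k, fun k' hk' => exec_stable hm hk'⟩, rfl, ?_⟩, rfl⟩
  · exact finite_support_map (exec_support_finite O k c _ hc) _
  · intro o ho
    rw [PMF.support_map] at ho
    obtain ⟨r, hr, rfl⟩ := ho
    obtain ⟨o, rfl, ho⟩ := h r hr
    exact ⟨ho, (exec_queries O k c _ hc o hr).le⟩

theorem Runs.queryFree {O O' : Data → PMF Data} {c : Cmd} (hc : c.QueryFree) {x : Data}
    {p : PMF Data} {t q : ℕ} (h : Runs O c x p t q) : Runs O' c x p t 0 := by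
  obtain ⟨P, ⟨R, h1, ⟨k₀, h2⟩, h3, h4⟩, h5⟩ := h
  refine ⟨P, ⟨R, h1, ⟨k₀, fun k hk => ?_⟩, h3, fun o ho => ⟨(h4 o ho).1, ?_⟩⟩, h5⟩
  · rw [← h2 k hk]; exact exec_queryFree _ _ _ _ _ hc
  · refine (exec_queries O k₀ c (initStore x) hc o ?_).le
    rw [show c.exec O k₀ (initStore x) = _ from h2 k₀ le_rfl, PMF.support_map]
    exact ⟨o, ho, rfl⟩

/-! ### The height of trees -/

namespace Data

/-- The height of a binary tree. It bounds what a program can build up in a given number of steps: the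
size of a tree can double in one step, the height grows by at most one. -/
def height : Data → ℕ
  | nil => 0
  | cons a b => max a.height b.height + 1

theorem height_head (x : Data) : x.head.height ≤ x.height := by
  cases x <;> simp [head, height]; omega

theorem height_tail (x : Data) : x.tail.height ≤ x.height := by
  cases x <;> simp [tail, height]; omega

end Data

theorem Expr.height_eval (e : Expr) {s : Store} {H : ℕ} (h : ∀ v, (s v).height ≤ H) :
    (e.eval s).height ≤ H + e.size := by
  induction e with
  | var x => simp only [eval]; exact (h x).trans (by omega)
  | nil => simp [eval, Data.height]
  | cons e₁ e₂ h₁ h₂ => simp only [eval, Data.height, size]; omega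
  | head e ih => simp only [eval, size]; exact (Data.height_head _).trans (by omega)
  | tail e ih => simp only [eval, size]; exact (Data.height_tail _).trans (by omega)

/-- An elementary operation increases the height of the data in the memory by at most one. -/
theorem exec_height (O : Data → PMF Data) (k : ℕ) : ∀ (c : Cmd) (s : Store) (H : ℕ),
    c.QueryFree → (∀ v, (s v).height ≤ H) → ∀ o, some o ∈ (c.exec O k s).support →
    ∀ v, (o.store v).height ≤ H + o.steps := by
  have hand : ∀ (t H : ℕ) (r : PMF (Option Outcome)) (next : Store → PMF (Option Outcome)),
      (∀ o, some o ∈ r.support → ∀ o', some o' ∈ (next o.store).support →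
        ∀ v, (o'.store v).height ≤ H + o.steps + o'.steps + t) →
      ∀ o, some o ∈ (andThen t r next).support → ∀ v, (o.store v).height ≤ H + o.steps := by
    intro t H r next h2 o ho v
    unfold andThen at ho
    rw [PMF.support_bind] at ho
    simp only [Set.mem_iUnion] at ho
    obtain ⟨x, hx, ho⟩ := ho
    cases x with
    | none => simp at ho
    | some o₁ =>
      simp only [PMF.support_map, Set.mem_image] at ho
      obtain ⟨y, hy, hyo⟩ := ho
      cases y with
      | none => simp at hyo
      | some o₂ =>
        simp only [Option.map_some, Option.some.injEq] at hyo
        subst hyo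
        have := h2 _ hx _ hy v
        simp only
        omega
  have hd : ∀ (s : Store) t o, some o ∈ (done s t).support → o = ⟨s, t, 0⟩ := by
    intro s t o ho; simpa [done] using ho
  induction k with
  | zero => intro c s H _ _ o ho; simp [Cmd.exec] at ho
  | succ k ih =>
    intro c s H hc hs
    cases c with
    | skip => intro o ho v; rw [hd _ _ _ ho]; exact (hs v).trans (by simp)
    | assign x e =>
      intro o ho v
      rw [hd _ _ _ ho]
      simp only [Function.update_apply]
      have := e.height_eval hs
      split_ifs
      · omega
      · exact (hs v).trans (by omega)
    | coin x =>
      intro o ho v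
      rw [Cmd.exec, PMF.support_map] at ho
      obtain ⟨b, _, hb⟩ := ho
      simp only [Option.some.injEq] at hb
      subst hb
      simp only [Function.update_apply]
      split_ifs
      · cases b <;> simp [Data.ofBool, Data.height]
      · exact (hs v).trans (by omega)
    | query x e => exact hc.elim
    | seq c₁ c₂ =>
      refine hand _ _ _ _ fun o ho o' ho' v => ?_
      have := ih c₂ o.store _ hc.2 (ih c₁ s H hc.1 hs o ho) o' ho' v
      omega
    | branch e c₁ c₂ =>
      refine hand _ _ _ _ fun o ho o' ho' v => ?_
      have h1 := hd _ _ _ ho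
      subst h1
      simp only at ho' ⊢
      cases hv : e.eval s with
      | nil => rw [hv] at ho'; have := ih c₂ s H hc.2 hs o' ho' v; omega
      | cons a b => rw [hv] at ho'; have := ih c₁ s H hc.1 hs o' ho' v; omega
    | loop e c =>
      rw [Cmd.exec]
      cases e.eval s with
      | nil => intro o ho v; rw [hd _ _ _ ho]; exact (hs v).trans (by simp)
      | cons a b =>
        refine hand _ _ _ _ fun o ho o' ho' v => ?_
        have := ih (.loop e c) o.store _ hc (ih c s H hc hs o ho) o' ho' v
        omega
    | call x p e =>
      refine hand _ _ _ _ fun o ho o' ho' v => ?_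
      have h1 := hd _ _ _ ho'
      subst h1
      have h2 := ih p (initStore (e.eval s)) (H + e.size) hc (fun v => by
        simp only [initStore, Function.update_apply]
        split_ifs
        · exact e.height_eval hs
        · simp [Data.height]) o ho 0
      simp only [Function.update_apply]
      split_ifs
      · omega
      · exact (hs v).trans (by omega)

theorem Runs.height_le {O : Data → PMF Data} {c : Cmd} (hc : c.QueryFree) {x : Data}
    {p : PMF Data} {t q : ℕ} (h : Runs O c x p t q) {y : Data} (hy : y ∈ p.support) :
    y.height ≤ x.height + t := by
  obtain ⟨P, ⟨R, h1, ⟨k₀, h2⟩, rfl, h4⟩, rfl⟩ := h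
  rw [PMF.map_comp, PMF.support_map] at hy
  obtain ⟨o, ho, rfl⟩ := hy
  have := exec_height O k₀ c (initStore x) x.height hc (fun v => by
    simp only [initStore, Function.update_apply]
    split_ifs
    · exact le_rfl
    · simp [Data.height]) o (by
      rw [show c.exec O k₀ (initStore x) = _ from h2 k₀ le_rfl, PMF.support_map]
      exact ⟨o, ho, rfl⟩) 0
  have h5 := (h4 o ho).1
  simp only [Function.comp]
  omega

/-! ### Polynomial-time functions between encoded types -/

/-- A type whose elements are represented as trees. -/
class Enc (α : Type) where
  enc : α → Data

open Enc (enc)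

instance : Enc Data := ⟨id⟩
instance : Enc Unit := ⟨fun _ => Data.nil⟩
instance : Enc Bool := ⟨Data.ofBool⟩
instance : Enc ℕ := ⟨Data.ofNat⟩
instance {α β : Type} [Enc α] [Enc β] : Enc (α × β) := ⟨fun p => Data.cons (enc p.1) (enc p.2)⟩
instance {α : Type} [Enc α] : Enc (List α) := ⟨fun l => Data.ofList (l.map enc)⟩
instance {α : Type} [Enc α] : Enc (Option α) :=
  ⟨fun o => match o with
    | none => Data.nil
    | some a => Data.cons (enc a) Data.nil⟩

theorem foldl_replicate {σ : Type} (F : σ → σ) (k : ℕ) (s : σ) :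
    (List.replicate k ()).foldl (fun s _ => F s) s = F^[k] s := by
  induction k generalizing s with
  | zero => rfl
  | succ k ih => simp [List.replicate_succ, ih]

section

variable {α β γ σ : Type} [Enc α] [Enc β] [Enc γ] [Enc σ]

/-- The height of the tree that represents `a`. -/
def hgt (a : α) : ℕ := (enc a).height

theorem enc_pair (a : α) (b : β) : enc (a, b) = Data.cons (enc a) (enc b) := rfl
theorem enc_nil : enc ([] : List α) = Data.nil := rfl
theorem enc_cons (a : α) (l : List α) : enc (a :: l) = Data.cons (enc a) (enc l) := rfl
theorem enc_none : enc (none : Option α) = Data.nil := rfl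
theorem enc_some (a : α) : enc (some a) = Data.cons (enc a) Data.nil := rfl

theorem enc_units (k : ℕ) : enc (List.replicate k ()) = enc k := by
  induction k with
  | zero => rfl
  | succ k ih => rw [List.replicate_succ, enc_cons, ih]; rfl

theorem hgt_pair (a : α) (b : β) : hgt (a, b) = max (hgt a) (hgt b) + 1 := rfl
theorem hgt_nil : hgt ([] : List α) = 0 := rfl
theorem hgt_cons (a : α) (l : List α) : hgt (a :: l) = max (hgt a) (hgt l) + 1 := rfl
theorem hgt_none : hgt (none : Option α) = 0 := rfl
theorem hgt_some (a : α) : hgt (some a) = hgt a + 1 := by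
  show max _ 0 + 1 = _; simp [hgt]

theorem hgt_nat (k : ℕ) : hgt k = k := by
  induction k with
  | zero => rfl
  | succ k ih => show max 0 (hgt k) + 1 = _; omega

theorem hgt_bool (b : Bool) : hgt b ≤ 1 := by cases b <;> simp [hgt, enc, Data.ofBool, Data.height]

theorem length_le_hgt (l : List α) : l.length ≤ hgt l := by
  induction l with
  | nil => simp
  | cons a l ih => rw [hgt_cons, List.length_cons]; omega

theorem hgt_le_of_mem {a : α} {l : List α} (h : a ∈ l) : hgt a ≤ hgt l := by
  induction h with
  | head l => rw [hgt_cons]; omega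
  | tail b _ ih => rw [hgt_cons]; omega

theorem hgt_list_le {l : List α} {B : ℕ} (h : ∀ a ∈ l, hgt a ≤ B) : hgt l ≤ l.length + B := by
  induction l with
  | nil => simp [hgt_nil]
  | cons a l ih =>
    have h1 := ih fun b hb => h b (List.mem_cons_of_mem _ hb)
    have h2 := h a List.mem_cons_self
    rw [hgt_cons, List.length_cons]; omega

theorem hgt_append (l l' : List α) : hgt (l ++ l') ≤ hgt l + hgt l' := by
  induction l with
  | nil => simp
  | cons a l ih => rw [List.cons_append, hgt_cons, hgt_cons]; omega

theorem hgt_tail (l : List α) : hgt l.tail ≤ hgt l := by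
  cases l with
  | nil => simp
  | cons a l => simp only [List.tail_cons, hgt_cons]; omega

theorem polyEval_mono (P : Polynomial ℕ) {a b : ℕ} (h : a ≤ b) : P.eval a ≤ P.eval b := by
  rw [Polynomial.eval_eq_sum, Polynomial.eval_eq_sum]
  exact Finset.sum_le_sum fun n _ => Nat.mul_le_mul_left _ (Nat.pow_le_pow_left h n)

/-- The function is computed by a deterministic program in time polynomial in the height of the
tree that represents the argument. -/
def PT (F : α → β) : Prop :=
  ∃ (c : Cmd) (P : Polynomial ℕ), c.QueryFree ∧
    ∀ O a, Runs O c (enc a) (PMF.pure (enc (F a))) (P.eval (hgt a)) 0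

theorem PT.height {F : α → β} (h : PT F) : ∃ P : Polynomial ℕ, ∀ a, hgt (F a) ≤ P.eval (hgt a) := by
  obtain ⟨c, P, hc, h⟩ := h
  refine ⟨.X + P, fun a => ?_⟩
  have := (h (fun _ => PMF.pure Data.nil) a).height_le hc (y := enc (F a)) (by simp)
  simpa [hgt] using this

theorem SRuns.call_pure {O : Data → PMF Data} {s : Store} {x : ℕ} {c : Cmd} {e : Expr} {y : Data}
    {t q : ℕ} (h : Runs O c (e.eval s) (PMF.pure y) t q) :
    SRuns O (.call x c e) s (PMF.pure (Function.update s x y)) (t + e.size + 2) q := by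
  have := SRuns.call (x := x) h
  rwa [PMF.pure_map] at this

theorem SRuns.runs_pure {O : Data → PMF Data} {c : Cmd} {x : Data} {s : Store} {t q : ℕ}
    (h : SRuns O c (initStore x) (PMF.pure s) t q) : Runs O c x (PMF.pure (s 0)) t q := by
  have := h.runs
  rwa [PMF.pure_map] at this

theorem SRuns.runs_out {O : Data → PMF Data} {c : Cmd} {x y : Data} {s : Store} {t t' q : ℕ}
    (h : SRuns O c (initStore x) (PMF.pure s) t q) (hy : s 0 = y) (ht : t ≤ t') :
    Runs O c x (PMF.pure y) t' q := by
  rw [← hy]; exact h.runs_pure.mono ht le_rfl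

theorem PT.of_expr {F : α → β} (e : Expr)
    (h : ∀ a, e.eval (initStore (enc a)) = enc (F a)) : PT F := by
  refine ⟨.assign 0 e, .C (e.size + 1), trivial, fun O a => ?_⟩
  have := (SRuns.assign (O := O) (s := initStore (enc a)) 0 e).runs_pure
  simpa [h] using this

theorem PT.comp {F : β → γ} {G : α → β} (hF : PT F) (hG : PT G) : PT (fun a => F (G a)) := by
  obtain ⟨Q, hQ⟩ := hG.height
  obtain ⟨c₁, P₁, q₁, h₁⟩ := hF
  obtain ⟨c₂, P₂, q₂, h₂⟩ := hG
  refine ⟨.seq (.call 0 c₂ (.var 0)) (.call 0 c₁ (.var 0)), P₂ + P₁.comp Q + 7, ⟨q₂, q₁⟩,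
    fun O a => ?_⟩
  have r1 : SRuns O (.call 0 c₂ (.var 0)) (initStore (enc a)) _ _ 0 :=
    SRuns.call_pure (x := 0) (h₂ O a)
  have r2 := SRuns.call_pure (x := 0) (e := .var 0) (s := Function.update (initStore (enc a)) 0
    (enc (G a))) (c := c₁) (O := O) (y := enc (F (G a))) (t := P₁.eval (hgt (G a))) (q := 0)
    (by simpa [Expr.eval] using h₁ O (G a))
  refine (r1.seq_pure r2).runs_out (by simp) ?_
  have := polyEval_mono P₁ (hQ a)
  simp [Expr.size]; omega

theorem PT.id : PT (fun a : α => a) := PT.of_expr (.var 0) fun _ => rfl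

theorem PT.pair {F : α → β} {G : α → γ} (hF : PT F) (hG : PT G) : PT (fun a => (F a, G a)) := by
  obtain ⟨c₁, P₁, q₁, h₁⟩ := hF
  obtain ⟨c₂, P₂, q₂, h₂⟩ := hG
  refine ⟨.seq (.call 1 c₁ (.var 0)) (.seq (.call 2 c₂ (.var 0))
    (.assign 0 (.cons (.var 1) (.var 2)))), P₁ + P₂ + 15, ⟨q₁, q₂, trivial⟩, fun O a => ?_⟩
  have r1 : SRuns O (.call 1 c₁ (.var 0)) (initStore (enc a)) _ _ 0 :=
    SRuns.call_pure (x := 1) (h₁ O a)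
  have r2 := SRuns.call_pure (x := 2) (e := .var 0) (s := Function.update (initStore (enc a)) 1
    (enc (F a))) (c := c₂) (O := O) (y := enc (G a)) (t := P₂.eval (hgt a)) (q := 0)
    (by simpa [Expr.eval, initStore] using h₂ O a)
  refine (r1.seq_pure (r2.seq_pure (SRuns.assign _ _))).runs_out (by
    simp [Expr.eval, enc_pair]) ?_
  simp [Expr.size]; omega

theorem PT.fst {F : α → β × γ} (hF : PT F) : PT (fun a => (F a).1) :=
  PT.comp (F := fun p : β × γ => p.1) (PT.of_expr (.head (.var 0)) fun _ => rfl) hF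

theorem PT.snd {F : α → β × γ} (hF : PT F) : PT (fun a => (F a).2) :=
  PT.comp (F := fun p : β × γ => p.2) (PT.of_expr (.tail (.var 0)) fun _ => rfl) hF

/-- An expression with constant value. -/
def constExpr : Data → Expr
  | .nil => .nil
  | .cons a b => .cons (constExpr a) (constExpr b)

theorem constExpr_eval (s : Store) (x : Data) : (constExpr x).eval s = x := by
  induction x with
  | nil => rfl
  | cons a b ha hb => simp [constExpr, Expr.eval, ha, hb]

theorem PT.const (b : β) : PT (fun _ : α => b) :=
  PT.of_expr (constExpr (enc b)) fun _ => constExpr_eval _ _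

/-- Branching on the value `T a`, which is `nil` exactly if `b a` is false; the first branch also
gets the value as an argument. -/
theorem PT.branch {T : α → Data} (b : α → Bool) {F : α × Data → γ} {G : α → γ} (hT : PT T)
    (hb : ∀ a, T a = Data.nil ↔ b a = false) (hF : PT F) (hG : PT G) :
    PT (fun a => if b a then F (a, T a) else G a) := by
  obtain ⟨Q, hQ⟩ := hT.height
  obtain ⟨c₀, P₀, q₀, h₀⟩ := hT
  obtain ⟨c₁, P₁, q₁, h₁⟩ := hF
  obtain ⟨c₂, P₂, q₂, h₂⟩ := hG
  refine ⟨.seq (.call 1 c₀ (.var 0)) (.branch (.var 1) (.call 0 c₁ (.cons (.var 0) (.var 1)))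
    (.call 0 c₂ (.var 0))), P₀ + P₁.comp (.X + Q + 1) + P₂ + 15, ⟨q₀, q₁, q₂⟩, fun O a => ?_⟩
  have r1 : SRuns O (.call 1 c₀ (.var 0)) (initStore (enc a)) _ _ 0 :=
    SRuns.call_pure (x := 1) (h₀ O a)
  set s₁ := Function.update (initStore (enc a)) 1 (enc (T a)) with hs₁
  have s10 : s₁ 0 = enc a := by simp [hs₁, initStore]
  have s11 : s₁ 1 = T a := by simp [hs₁]; rfl
  cases hba : b a with
  | true =>
    have hne : T a ≠ Data.nil := fun h => by rw [hb, hba] at h; cases h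
    have r2 := SRuns.call_pure (x := 0) (e := .cons (.var 0) (.var 1)) (s := s₁) (c := c₁) (O := O)
      (y := enc (F (a, T a))) (t := P₁.eval (hgt (a, T a))) (q := 0)
      (by simp only [Expr.eval, s10, s11]; exact h₁ O (a, T a))
    have r3 := SRuns.branch_true (c₂ := .call 0 c₂ (.var 0)) (e := .var 1) (by
      simpa [Expr.eval, s11] using hne) r2
    refine (r1.seq_pure r3).runs_out (by simp [hba]) ?_
    have : P₁.eval (hgt (a, T a)) ≤ P₁.eval (hgt a + Q.eval (hgt a) + 1) :=
      polyEval_mono P₁ (by rw [hgt_pair]; have := hQ a; omega)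
    simp [Expr.size]; omega
  | false =>
    have hne : T a = Data.nil := (hb a).2 hba
    have r2 := SRuns.call_pure (x := 0) (e := .var 0) (s := s₁) (c := c₂) (O := O)
      (y := enc (G a)) (t := P₂.eval (hgt a)) (q := 0)
      (by simp only [Expr.eval, s10]; exact h₂ O a)
    have r3 := SRuns.branch_false (c₁ := .call 0 c₁ (.cons (.var 0) (.var 1))) (e := .var 1) (by
      simpa [Expr.eval, s11] using hne) r2
    refine (r1.seq_pure r3).runs_out (by simp [hba]) ?_
    simp [Expr.size]; omega

theorem PT.ite {b : α → Bool} {F G : α → γ} (hb : PT b) (hF : PT F) (hG : PT G) :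
    PT (fun a => if b a then F a else G a) := by
  have hT : PT (fun a => enc (b a)) := hb
  refine PT.branch b (F := fun p : α × Data => F p.1) hT (fun a => ?_)
    (PT.comp hF (PT.fst PT.id)) hG
  cases b a <;> simp [enc, Data.ofBool]

theorem PT.option_elim {o : α → Option β} {F : α → β → γ} {G : α → γ} (ho : PT o)
    (hF : PT (fun p : α × β => F p.1 p.2)) (hG : PT G) :
    PT (fun a => (o a).elim (G a) (F a)) := by
  have hT : PT (fun a => enc (o a)) := ho
  obtain ⟨Q, hQ⟩ := ho.height
  obtain ⟨c₀, P₀, q₀, h₀⟩ := ho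
  obtain ⟨c₁, P₁, q₁, h₁⟩ := hF
  obtain ⟨c₂, P₂, q₂, h₂⟩ := hG
  refine ⟨.seq (.call 1 c₀ (.var 0)) (.branch (.var 1) (.call 0 c₁ (.cons (.var 0) (.head (.var 1))))
    (.call 0 c₂ (.var 0))), P₀ + P₁.comp (.X + Q + 1) + P₂ + 15, ⟨q₀, q₁, q₂⟩, fun O a => ?_⟩
  have r1 : SRuns O (.call 1 c₀ (.var 0)) (initStore (enc a)) _ _ 0 :=
    SRuns.call_pure (x := 1) (h₀ O a)
  set s₁ := Function.update (initStore (enc a)) 1 (enc (o a)) with hs₁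
  have s10 : s₁ 0 = enc a := by simp [hs₁, initStore]
  have s11 : s₁ 1 = enc (o a) := by simp [hs₁]
  have hq := hQ a
  cases hba : o a with
  | some b =>
    rw [hba] at s11 hq
    have r2 := SRuns.call_pure (x := 0) (e := .cons (.var 0) (.head (.var 1))) (s := s₁) (c := c₁)
      (O := O) (y := enc (F a b)) (t := P₁.eval (hgt (a, b))) (q := 0)
      (by simp only [Expr.eval, s10, s11]; exact h₁ O (a, b))
    have r3 := SRuns.branch_true (c₂ := .call 0 c₂ (.var 0)) (e := .var 1) (by
      simp [Expr.eval, s11, enc_some]) r2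
    refine (r1.seq_pure r3).runs_out (by simp [hba]) ?_
    have : P₁.eval (hgt (a, b)) ≤ P₁.eval (hgt a + Q.eval (hgt a) + 1) :=
      polyEval_mono P₁ (by rw [hgt_pair]; rw [hgt_some] at hq; omega)
    simp [Expr.size]; omega
  | none =>
    rw [hba] at s11
    have r2 := SRuns.call_pure (x := 0) (e := .var 0) (s := s₁) (c := c₂) (O := O)
      (y := enc (G a)) (t := P₂.eval (hgt a)) (q := 0)
      (by simp only [Expr.eval, s10]; exact h₂ O a)
    have r3 := SRuns.branch_false (c₁ := .call 0 c₁ (.cons (.var 0) (.head (.var 1)))) (e := .var 1)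
      (by simp [Expr.eval, s11, enc_none]) r2
    refine (r1.seq_pure r3).runs_out (by simp [hba]) ?_
    simp [Expr.size]; omega

/-! ### Iteration -/

/-- The loop of a program that iterates over a list: the list is in the variable `1`, the state in
the variable `2`, and a parameter in the variable `0`. -/
def foldLoop (c : Cmd) : Cmd :=
  .loop (.var 1) (.seq (.call 2 c (.cons (.var 0) (.cons (.head (.var 1)) (.var 2))))
    (.assign 1 (.tail (.var 1))))

theorem foldLoop_runs (O : Data → PMF Data) (c : Cmd) (f : α → β → σ → σ) (a : α) (B : ℕ) :
    ∀ (l : List β) (acc : σ) (s : Store), s 0 = enc a → s 1 = enc l → s 2 = enc acc →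
    (∀ l₁ x l₂, l = l₁ ++ x :: l₂ → Runs O c (enc (a, x, l₁.foldl (fun s x => f a x s) acc))
      (PMF.pure (enc (f a x (l₁.foldl (fun s x => f a x s) acc)))) B 0) →
    ∃ s', SRuns O (foldLoop c) s (PMF.pure s') (l.length * (B + 20) + 2) 0 ∧
      s' 2 = enc (l.foldl (fun s x => f a x s) acc) := by
  intro l
  induction l with
  | nil =>
    intro acc s h0 h1 h2 _
    exact ⟨s, (SRuns.loop_nil (by simp [Expr.eval, h1, enc_nil])).mono (by simp [Expr.size]) le_rfl,
      h2⟩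
  | cons x l ih =>
    intro acc s h0 h1 h2 h
    have r1 := SRuns.call_pure (O := O) (x := 2) (e := .cons (.var 0) (.cons (.head (.var 1)) (.var 2)))
      (s := s) (c := c) (y := enc (f a x acc)) (t := B) (q := 0)
      (by simp only [Expr.eval, h0, h1, h2]; exact h [] x l rfl)
    have r2 := r1.seq_pure (SRuns.assign 1 (.tail (.var 1)))
    obtain ⟨s', r3, hs'⟩ := ih (f a x acc) (Function.update (Function.update s 2 (enc (f a x acc))) 1
      (enc l)) (by simp [h0]) (by simp) (by simp) (fun l₁ y l₂ e => by
        have := h (x :: l₁) y l₂ (by simp [e])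
        simpa using this)
    refine ⟨s', ?_, by simpa using hs'⟩
    have r4 := SRuns.loop_cons (e := .var 1) (P₂ := fun _ => PMF.pure s')
      (by simp [Expr.eval, h1, enc_cons]) r2 (t₂ := l.length * (B + 20) + 2) (q₂ := 0)
      (fun s'' hs'' => by
        simp only [PMF.support_pure, Set.mem_singleton_iff] at hs''
        rw [hs'']
        simp only [Expr.eval]
        have e1 : (Function.update s 2 (enc (f a x acc)) 1).tail = enc l := by
          simp [h1, enc_cons, Data.tail]
        rw [e1]
        exact r3)
    rw [PMF.pure_bind] at r4
    refine r4.mono ?_ le_rfl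
    simp [Expr.size, Nat.add_mul]
    omega

/-- Iteration over a list. The measure `μ`, which bounds the height of the state, must grow at most
additively. -/
theorem PT.foldl_measure {L : α → List β} {init : α → σ} {f : α → β → σ → σ} (hL : PT L)
    (hI : PT init) (hf : PT (fun p : α × β × σ => f p.1 p.2.1 p.2.2)) (μ : α → σ → ℕ)
    (G : Polynomial ℕ) (h1 : ∀ a s, hgt s ≤ μ a s) (h2 : ∀ a, μ a (init a) ≤ G.eval (hgt a))
    (h3 : ∀ a, ∀ x ∈ L a, ∀ s, μ a (f a x s) ≤ μ a s + G.eval (hgt a)) :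
    PT (fun a => (L a).foldl (fun s x => f a x s) (init a)) := by
  obtain ⟨QL, hQL⟩ := hL.height
  obtain ⟨cL, PL, qL, hL⟩ := hL
  obtain ⟨cI, PI, qI, hI⟩ := hI
  obtain ⟨cS, PS, qS, hS⟩ := hf
  refine ⟨.seq (.call 1 cL (.var 0)) (.seq (.call 2 cI (.var 0)) (.seq (foldLoop cS)
    (.assign 0 (.var 2)))), PL + PI + QL * (PS.comp (.X + QL + G + QL * G + 2) + 20) + 25,
    ⟨qL, qI, ⟨qS, trivial⟩, trivial⟩, fun O a => ?_⟩
  have r1 : SRuns O (.call 1 cL (.var 0)) (initStore (enc a)) _ _ 0 :=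
    SRuns.call_pure (x := 1) (hL O a)
  have r2 := SRuns.call_pure (x := 2) (e := .var 0) (s := Function.update (initStore (enc a)) 1
    (enc (L a))) (c := cI) (O := O) (y := enc (init a)) (t := PI.eval (hgt a)) (q := 0)
    (by simpa [Expr.eval, initStore] using hI O a)
  have hlen : ∀ l : List β, l.length ≤ (L a).length → l.length ≤ QL.eval (hgt a) := fun l hl =>
    hl.trans ((length_le_hgt _).trans (hQL a))
  have hμ : ∀ l₁ : List β, (∀ x ∈ l₁, x ∈ L a) →
      μ a (l₁.foldl (fun s x => f a x s) (init a)) ≤ G.eval (hgt a) + l₁.length * G.eval (hgt a) := by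
    intro l₁
    induction l₁ using List.reverseRecOn with
    | nil => intro _; simpa using h2 a
    | append_singleton l x ih =>
      intro h
      have e1 := ih fun y hy => h y (by simp [hy])
      have e2 := h3 a x (h x (by simp)) (l.foldl (fun s x => f a x s) (init a))
      simp only [List.foldl_append, List.foldl_cons, List.foldl_nil, List.length_append,
        List.length_cons, List.length_nil, Nat.add_mul]
      omega
  obtain ⟨s', r3, hs'⟩ := foldLoop_runs O cS f a
    (PS.eval (hgt a + QL.eval (hgt a) + G.eval (hgt a) + QL.eval (hgt a) * G.eval (hgt a) + 2))
    (L a) (init a) (Function.update (Function.update (initStore (enc a)) 1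
    (enc (L a))) 2 (enc (init a))) (by simp [initStore]) (by simp) (by simp) (fun l₁ x l₂ e => by
      refine (hS O (a, x, l₁.foldl (fun s x => f a x s) (init a))).mono ?_ le_rfl
      refine polyEval_mono PS ?_
      have e1 := hμ l₁ fun y hy => by rw [e]; simp [hy]
      have e2 := h1 a (l₁.foldl (fun s x => f a x s) (init a))
      have e3 : hgt x ≤ hgt (L a) := hgt_le_of_mem (by rw [e]; simp)
      have e4 := hQL a
      have e5 := hlen l₁ (by rw [e]; simp)
      have e6 := Nat.mul_le_mul_right (G.eval (hgt a)) e5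
      rw [hgt_pair, hgt_pair]
      omega)
  refine (r1.seq_pure (r2.seq_pure (r3.seq_pure (SRuns.assign _ _)))).runs_out (by
    simp [Expr.eval, hs']) ?_
  have e7 := hlen (L a) le_rfl
  have e8 := Nat.mul_le_mul_right (PS.eval (hgt a + QL.eval (hgt a) + G.eval (hgt a) +
    QL.eval (hgt a) * G.eval (hgt a) + 2) + 20) e7
  simp [Expr.size]
  omega

theorem PT.foldl {L : α → List β} {init : α → σ} {f : α → β → σ → σ} (hL : PT L)
    (hI : PT init) (hf : PT (fun p : α × β × σ => f p.1 p.2.1 p.2.2)) (G : Polynomial ℕ)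
    (h3 : ∀ a, ∀ x ∈ L a, ∀ s, hgt (f a x s) ≤ hgt s + G.eval (hgt a + hgt x)) :
    PT (fun a => (L a).foldl (fun s x => f a x s) (init a)) := by
  obtain ⟨QL, hQL⟩ := hL.height
  obtain ⟨QI, hQI⟩ := hI.height
  refine PT.foldl_measure hL hI hf (fun _ s => hgt s) (QI + G.comp (.X + QL)) (fun _ _ => le_rfl)
    (fun a => ?_) fun a x hx s => ?_
  · have := hQI a
    simp; omega
  · have e1 := h3 a x hx s
    have e2 := polyEval_mono G (a := hgt a + hgt x) (b := hgt a + QL.eval (hgt a)) (by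
      have := hgt_le_of_mem hx
      have := hQL a
      omega)
    simp; omega

/-! ### Lists and numbers -/

theorem PT.cons {f : α → β} {g : α → List β} (hf : PT f) (hg : PT g) : PT (fun a => f a :: g a) :=
  PT.comp (F := fun p : β × List β => p.1 :: p.2) (PT.of_expr (.var 0) fun _ => rfl) (hf.pair hg)

theorem PT.tail {g : α → List β} (hg : PT g) : PT (fun a => (g a).tail) :=
  PT.comp (F := fun l : List β => l.tail) (PT.of_expr (.tail (.var 0)) fun l => by
    cases l <;> rfl) hg

theorem PT.head? {g : α → List β} (hg : PT g) : PT (fun a => (g a).head?) := by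
  refine PT.comp (F := fun l : List β => l.head?) ?_ hg
  have h : PT (fun l : List β => if !l.isEmpty then Data.cons (enc l).head Data.nil else
      Data.nil) := by
    refine PT.branch (T := fun l : List β => enc l) (fun l => !l.isEmpty)
      (F := fun p : List β × Data => Data.cons p.2.head Data.nil) PT.id (fun l => ?_) ?_
      (PT.const Data.nil)
    · cases l <;> simp [enc_nil, enc_cons]
    · exact PT.of_expr (.cons (.head (.tail (.var 0))) .nil) fun _ => rfl
  obtain ⟨c, P, hc, h⟩ := h
  refine ⟨c, P, hc, fun O l => ?_⟩
  have := h O l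
  cases l <;> exact this

theorem PT.optSome {f : α → β} (hf : PT f) : PT (fun a => some (f a)) :=
  PT.comp (F := fun b : β => some b) (PT.of_expr (.cons (.var 0) .nil) fun _ => rfl) hf

theorem PT.isSome {f : α → Option β} (hf : PT f) : PT (fun a => (f a).isSome) := by
  have := PT.option_elim (F := fun _ _ => true) (G := fun _ => false) hf (PT.const _) (PT.const _)
  convert this using 2 with a
  cases f a <;> rfl

theorem PT.getD_option {f : α → Option β} {g : α → β} (hf : PT f) (hg : PT g) :
    PT (fun a => (f a).getD (g a)) := by
  have := PT.option_elim (F := fun _ b => b) (G := g) hf (PT.snd PT.id) hg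
  convert this using 2 with a
  cases f a <;> rfl

theorem PT.not {b : α → Bool} (hb : PT b) : PT (fun a => !b a) := by
  convert PT.ite hb (PT.const false) (PT.const true) using 2 with a
  cases b a <;> rfl

theorem PT.and {b b' : α → Bool} (hb : PT b) (hb' : PT b') : PT (fun a => b a && b' a) := by
  convert PT.ite hb hb' (PT.const false) using 2 with a
  cases b a <;> rfl

theorem PT.beq {b b' : α → Bool} (hb : PT b) (hb' : PT b') : PT (fun a => b a == b' a) := by
  convert PT.ite hb hb' hb'.not using 2 with a
  cases b a <;> cases b' a <;> rfl

theorem PT.reverse {g : α → List β} (hg : PT g) : PT (fun a => (g a).reverse) := by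
  have := PT.foldl (f := fun _ x s => x :: s) (init := fun _ => []) hg (PT.const _)
    (PT.cons (PT.fst (PT.snd PT.id)) (PT.snd (PT.snd PT.id))) (.X + 1) (fun a x _ s => by
      rw [hgt_cons]; simp; omega)
  simpa using this

theorem PT.map {L : α → List β} {g : α → β → γ} (hL : PT L)
    (hg : PT (fun p : α × β => g p.1 p.2)) : PT (fun a => (L a).map (g a)) := by
  obtain ⟨Q, hQ⟩ := hg.height
  have h := PT.reverse <| PT.foldl (f := fun a x s => g a x :: s) (init := fun _ => []) hL
    (PT.const _) (PT.cons (PT.comp hg (PT.pair (PT.fst PT.id) (PT.fst (PT.snd PT.id))))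
    (PT.snd (PT.snd PT.id))) (Q.comp (.X + 1) + 1) (fun a x _ s => by
      have h1 := hQ (a, x)
      have h2 := polyEval_mono Q (a := hgt (a, x)) (b := hgt a + hgt x + 1) (by
        rw [hgt_pair]; omega)
      rw [hgt_cons]; simp only [Polynomial.eval_add, Polynomial.eval_comp, Polynomial.eval_X,
        Polynomial.eval_one]
      simp only at h1
      omega)
  convert h using 2 with a
  have : ∀ (l : List β) (s : List γ), l.foldl (fun s x => g a x :: s) s = (l.map (g a)).reverse ++ s := by
    intro l
    induction l with
    | nil => simp
    | cons x l ih => intro s; simp [ih]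
  simp [this]

theorem PT.append {f g : α → List β} (hf : PT f) (hg : PT g) : PT (fun a => f a ++ g a) := by
  have := PT.foldl (f := fun _ x s => x :: s) (init := g) hf.reverse hg
    (PT.cons (PT.fst (PT.snd PT.id)) (PT.snd (PT.snd PT.id))) (.X + 1) (fun a x _ s => by
      rw [hgt_cons]; simp; omega)
  simpa using this

theorem PT.flatten {g : α → List (List β)} (hg : PT g) : PT (fun a => (g a).flatten) := by
  have := PT.foldl (f := fun _ x s => s ++ x) (init := fun _ => []) hg (PT.const _)
    (PT.append (PT.snd (PT.snd PT.id)) (PT.fst (PT.snd PT.id))) .X (fun a x _ s => by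
      have := hgt_append s x
      simp; omega)
  convert this using 2 with a
  have : ∀ (l : List (List β)) (s : List β), l.foldl (fun s x => s ++ x) s = s ++ l.flatten := by
    intro l
    induction l with
    | nil => simp
    | cons x l ih => intro s; simp [ih]
  simp [this]

theorem PT.flatMap {L : α → List β} {g : α → β → List γ} (hL : PT L)
    (hg : PT (fun p : α × β => g p.1 p.2)) : PT (fun a => (L a).flatMap (g a)) := by
  simpa [List.flatMap_def] using PT.flatten (PT.map hL hg)

theorem PT.filter {L : α → List β} {g : α → β → Bool} (hL : PT L)
    (hg : PT (fun p : α × β => g p.1 p.2)) : PT (fun a => (L a).filter (g a)) := by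
  have := PT.flatMap (g := fun a x => if g a x then [x] else []) hL
    (PT.ite hg (PT.cons (PT.snd PT.id) (PT.const [])) (PT.const []))
  convert this using 2 with a
  induction L a with
  | nil => rfl
  | cons x l ih => simp only [List.filter_cons, List.flatMap_cons, ih]; split_ifs <;> rfl

theorem PT.succ {f : α → ℕ} (hf : PT f) : PT (fun a => f a + 1) :=
  PT.comp (F := fun k : ℕ => k + 1) (PT.of_expr (.cons .nil (.var 0)) fun _ => rfl) hf

theorem PT.pred {f : α → ℕ} (hf : PT f) : PT (fun a => f a - 1) :=
  PT.comp (F := fun k : ℕ => k - 1) (PT.of_expr (.tail (.var 0)) fun k => by cases k <;> rfl) hf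

theorem PT.units {f : α → ℕ} (hf : PT f) : PT (fun a => List.replicate (f a) ()) :=
  PT.comp (F := fun k : ℕ => List.replicate k ()) (PT.of_expr (.var 0) fun k =>
    (enc_units k).symm) hf

theorem PT.length {g : α → List β} (hg : PT g) : PT (fun a => (g a).length) := by
  have := PT.foldl (f := fun _ _ s => s + 1) (init := fun _ => 0) hg (PT.const _)
    (PT.succ (PT.snd (PT.snd PT.id))) 1 (fun a x _ s => by simp [hgt_nat])
  simpa using this

theorem PT.add {f g : α → ℕ} (hf : PT f) (hg : PT g) : PT (fun a => f a + g a) := by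
  have := PT.foldl (f := fun _ _ s => s + 1) (init := f) hg.units hf
    (PT.succ (PT.snd (PT.snd PT.id))) 1 (fun a x _ s => by simp [hgt_nat])
  simpa [foldl_replicate (fun s => s + 1)] using this

theorem PT.sub {f g : α → ℕ} (hf : PT f) (hg : PT g) : PT (fun a => f a - g a) := by
  have := PT.foldl (f := fun _ _ s => s - 1) (init := f) hg.units hf
    (PT.pred (PT.snd (PT.snd PT.id))) 1 (fun a x _ s => by simp [hgt_nat]; omega)
  convert this using 2 with a
  rw [foldl_replicate (fun s => s - 1)]
  induction g a with
  | zero => rfl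
  | succ k ih => rw [Function.iterate_succ_apply', ← ih]; omega

theorem PT.mul {f g : α → ℕ} (hf : PT f) (hg : PT g) : PT (fun a => f a * g a) := by
  obtain ⟨Q, hQ⟩ := hf.height
  have := PT.foldl (f := fun a _ s => s + f a) (init := fun _ => 0) hg.units (PT.const _)
    (PT.add (PT.snd (PT.snd PT.id)) (PT.comp hf (PT.fst PT.id))) Q (fun a x _ s => by
      have := hQ a
      simp only [hgt_nat] at *
      exact Nat.add_le_add_left (this.trans (polyEval_mono Q (by omega))) _)
  convert this using 2 with a
  rw [foldl_replicate (fun s => s + f a)]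
  induction g a with
  | zero => rfl
  | succ k ih => rw [Function.iterate_succ_apply', ← ih]; ring

theorem PT.pow {f : α → ℕ} (hf : PT f) (k : ℕ) : PT (fun a => f a ^ k) := by
  induction k with
  | zero => simpa using PT.const 1
  | succ k ih => simpa [pow_succ] using ih.mul hf

theorem PT.isEmpty {f : α → List β} (hf : PT f) : PT (fun a => (f a).isEmpty) := by
  convert (hf.head?.isSome).not using 2 with a
  cases f a <;> rfl

theorem PT.le {f g : α → ℕ} (hf : PT f) (hg : PT g) : PT (fun a => decide (f a ≤ g a)) := by
  convert (hf.sub hg).units.isEmpty using 2 with a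
  cases h : f a - g a with
  | zero => simp; omega
  | succ k => simp; omega

theorem PT.range {f : α → ℕ} (hf : PT f) : PT (fun a => List.range (f a)) := by
  have := PT.reverse <| PT.foldl (f := fun _ _ (s : List ℕ) => s.length :: s) (init := fun _ => [])
    hf.units (PT.const _) (PT.cons (PT.length (PT.snd (PT.snd PT.id))) (PT.snd (PT.snd PT.id))) 1
    (fun a x _ s => by
      have := length_le_hgt s
      simp only [hgt_cons, hgt_nat, Polynomial.eval_one]; omega)
  convert this using 2 with a
  rw [foldl_replicate (fun s : List ℕ => s.length :: s)]
  induction f a with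
  | zero => rfl
  | succ k ih =>
    rw [Function.iterate_succ_apply', List.reverse_cons, ← ih, List.range_succ,
      ← List.length_reverse, ← ih, List.length_range]

theorem PT.drop {f : α → ℕ} {g : α → List β} (hf : PT f) (hg : PT g) :
    PT (fun a => (g a).drop (f a)) := by
  have := PT.foldl (f := fun _ _ s => s.tail) (init := g) hf.units hg
    (PT.tail (PT.snd (PT.snd PT.id))) 0 (fun a x _ s => by simpa using hgt_tail s)
  convert this using 2 with a
  rw [foldl_replicate (fun s : List β => s.tail)]
  induction f a with
  | zero => rfl
  | succ k ih => rw [Function.iterate_succ_apply', ← ih, List.tail_drop]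

theorem PT.take {f : α → ℕ} {g : α → List β} (hf : PT f) (hg : PT g) :
    PT (fun a => (g a).take (f a)) := by
  have hs : PT (fun p : α × Unit × (List β × List β) =>
      (p.2.2.2.head?.elim p.2.2.1 fun x => x :: p.2.2.1, p.2.2.2.tail)) := by
    have h1 : PT (fun p : α × Unit × (List β × List β) => p.2.2.1) := PT.fst (PT.snd (PT.snd PT.id))
    have h2 : PT (fun p : α × Unit × (List β × List β) => p.2.2.2) := PT.snd (PT.snd (PT.snd PT.id))
    exact PT.pair (PT.option_elim h2.head? (PT.cons (PT.snd PT.id)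
      (PT.comp (F := fun p : α × Unit × (List β × List β) => p.2.2.1) h1 (PT.fst PT.id))) h1) h2.tail
  have := PT.reverse <| PT.fst <| PT.foldl (f := fun _ _ (s : List β × List β) =>
    (s.2.head?.elim s.1 fun x => x :: s.1, s.2.tail)) (init := fun a => (([] : List β), g a)) hf.units
    (PT.pair (PT.const []) hg) hs 1 (fun a x _ s => by
      obtain ⟨s1, s2⟩ := s
      cases s2 with
      | nil => simp [hgt_pair]
      | cons y s2 => simp [hgt_pair, hgt_cons]; omega)
  convert this using 2 with a
  rw [foldl_replicate (fun s : List β × List β => (s.2.head?.elim s.1 fun x => x :: s.1, s.2.tail))]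
  have key : ∀ k (s1 s2 : List β), ((fun s : List β × List β =>
      (s.2.head?.elim s.1 fun x => x :: s.1, s.2.tail))^[k] (s1, s2)).1 =
      (s2.take k).reverse ++ s1 := by
    intro k
    induction k with
    | zero => simp
    | succ k ih =>
      intro s1 s2
      rw [Function.iterate_succ_apply]
      cases s2 with
      | nil => simp [ih]
      | cons y s2 => simp [ih]
  simp [key]

theorem PT.getD {f : α → ℕ} {g : α → List β} {d : α → β} (hg : PT g) (hf : PT f) (hd : PT d) :
    PT (fun a => (g a).getD (f a) (d a)) := by
  convert PT.getD_option (PT.head? (hf.drop hg)) hd using 2 with a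
  simp [List.getD_eq_getElem?_getD]

theorem PT.all {L : α → List β} {g : α → β → Bool} (hL : PT L)
    (hg : PT (fun p : α × β => g p.1 p.2)) : PT (fun a => (L a).all (g a)) := by
  convert PT.isEmpty (PT.filter (g := fun a x => !g a x) hL hg.not) using 2 with a
  induction L a with
  | nil => rfl
  | cons x l ih => simp only [List.all_cons, List.filter_cons, ih]; cases g a x <;> simp

theorem PT.set {f : α → ℕ} {g : α → List β} {d : α → β} (hg : PT g) (hf : PT f) (hd : PT d) :
    PT (fun a => (g a).set (f a) (d a)) := by
  convert PT.append (hf.take hg) (PT.ite (hf.drop hg).isEmpty (PT.const [])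
    (PT.cons hd (hf.drop hg).tail)) using 2 with a
  rw [List.set_eq_take_append_cons_drop]
  split_ifs with h1 h2 h2
  · simp at h2; omega
  · simp
  · simp; omega
  · simp at h2; omega

theorem PT.countP {L : α → List β} {g : α → β → Bool} (hL : PT L)
    (hg : PT (fun p : α × β => g p.1 p.2)) : PT (fun a => (L a).countP (g a)) := by
  simpa [List.countP_eq_length_filter] using PT.length (PT.filter hL hg)

end

section

open Enc (enc)

/-! ### Randomized programs -/

/-- Independent draws from `g a`, for all entries `a` of a list. -/
def listM {α β : Type} (g : α → PMF β) : List α → PMF (List β)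
  | [] => PMF.pure []
  | a :: l => (g a).bind fun b => (listM g l).map fun l' => b :: l'

theorem listM_congr {α β : Type} {g g' : α → PMF β} {l : List α} (h : ∀ a ∈ l, g a = g' a) :
    listM g l = listM g' l := by
  induction l with
  | nil => rfl
  | cons a l ih =>
    rw [listM, listM, h a (by simp), ih fun b hb => h b (by simp [hb])]

theorem listM_map_right {α β γ : Type} (g : α → PMF β) (f : β → γ) (l : List α) :
    listM (fun a => (g a).map f) l = (listM g l).map (List.map f) := by
  induction l with
  | nil => simp [listM, PMF.pure_map]
  | cons a l ih =>
    rw [listM, listM, ih, PMF.bind_map, PMF.map_bind]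
    congr 1; funext b
    simp only [Function.comp, PMF.map_comp]
    rfl

theorem listM_map_left {α β γ : Type} (g : β → PMF γ) (f : α → β) (l : List α) :
    listM g (l.map f) = listM (fun a => g (f a)) l := by
  induction l with
  | nil => rfl
  | cons a l ih => rw [List.map_cons, listM, listM, ih]

theorem listM_pure {α β : Type} (f : α → β) (l : List α) :
    listM (fun a => PMF.pure (f a)) l = PMF.pure (l.map f) := by
  induction l with
  | nil => rfl
  | cons a l ih => rw [listM, ih, PMF.pure_bind, PMF.pure_map]; rfl

theorem forall₂_of_mem_listM {α β : Type} {g : α → PMF β} {l : List α} {r : List β}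
    (h : r ∈ (listM g l).support) : List.Forall₂ (fun a b => b ∈ (g a).support) l r := by
  induction l generalizing r with
  | nil => simp [listM] at h; simp [h]
  | cons a l ih =>
    simp only [listM, PMF.support_bind, PMF.support_map, Set.mem_iUnion, Set.mem_image] at h
    obtain ⟨b, hb, r', hr', rfl⟩ := h
    exact List.Forall₂.cons hb (ih hr')

theorem Runs.unique {O : Data → PMF Data} {c : Cmd} {x : Data} {p p' : PMF Data} {t q t' q' : ℕ}
    (h : Runs O c x p t q) (h' : Runs O c x p' t' q') : p = p' := by
  obtain ⟨P, ⟨R, -, ⟨k, hk⟩, rfl, -⟩, rfl⟩ := h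
  obtain ⟨P', ⟨R', -, ⟨k', hk'⟩, rfl, -⟩, rfl⟩ := h'
  have : R = R' := by
    ext o
    rw [← map_some_apply R, ← map_some_apply R', ← hk (max k k') (le_max_left _ _),
      ← hk' (max k k') (le_max_right _ _)]
  rw [this]

theorem Runs.congr {O : Data → PMF Data} {c : Cmd} {x : Data} {p p' : PMF Data} {t q t' q' : ℕ}
    (h : Runs O c x p t q) (hp : p = p') (ht : t ≤ t') (hq : q ≤ q') : Runs O c x p' t' q' :=
  hp ▸ h.mono ht hq

theorem SRuns.congr {O : Data → PMF Data} {c : Cmd} {s : Store} {P P' : PMF Store} {t q t' q' : ℕ}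
    (h : SRuns O c s P t q) (hP : P = P') (ht : t ≤ t') (hq : q ≤ q') : SRuns O c s P' t' q' :=
  hP ▸ h.mono ht hq

/-- First `c₁`, then `c₂`. -/
def compC (c₁ c₂ : Cmd) : Cmd := .seq (.call 0 c₁ (.var 0)) (.call 0 c₂ (.var 0))

theorem Runs.comp {O : Data → PMF Data} {c₁ c₂ : Cmd} {x : Data} {p : PMF Data}
    {p₂ : Data → PMF Data} {t₁ t₂ q₁ q₂ : ℕ} (h₁ : Runs O c₁ x p t₁ q₁)
    (h₂ : ∀ y ∈ p.support, Runs O c₂ y (p₂ y) t₂ q₂) :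
    Runs O (compC c₁ c₂) x (p.bind p₂) (t₁ + t₂ + 7) (q₁ + q₂) := by
  have r1 := SRuns.call (s := initStore x) (x := 0) (e := .var 0) (c := c₁) (O := O) (p := p)
    (t := t₁) (q := q₁) (by simpa [Expr.eval, initStore] using h₁)
  have r2 := r1.seq (c₂ := .call 0 c₂ (.var 0)) (P₂ := fun s => (p₂ (s 0)).map fun y =>
    Function.update s 0 y) (t₂ := t₂ + 3) (q₂ := q₂) (fun s hs => by
      rw [PMF.support_map] at hs
      obtain ⟨y, hy, rfl⟩ := hs
      exact SRuns.call (e := .var 0) (by simpa [Expr.eval] using h₂ y hy))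
  have r3 := r2.runs
  rw [PMF.bind_map, PMF.map_bind] at r3
  refine r3.congr ?_ (by simp [Expr.size]; omega) le_rfl
  congr 1; funext y
  simp only [Function.comp, PMF.map_comp, Function.update_self]
  exact PMF.map_id _

/-- The output of `c`, paired with the input. -/
def keepC (c : Cmd) : Cmd := .seq (.call 1 c (.var 0)) (.assign 0 (.cons (.var 0) (.var 1)))

theorem Runs.keep {O : Data → PMF Data} {c : Cmd} {x : Data} {p : PMF Data} {t q : ℕ}
    (h : Runs O c x p t q) : Runs O (keepC c) x (p.map (Data.cons x)) (t + 8) q := by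
  have r1 := SRuns.call (s := initStore x) (x := 1) (e := .var 0) (c := c) (O := O) (p := p)
    (t := t) (q := q) (by simpa [Expr.eval, initStore] using h)
  have r2 := (r1.seq (c₂ := .assign 0 (.cons (.var 0) (.var 1))) (fun s _ => SRuns.assign _ _)).runs
  rw [PMF.bind_map, PMF.map_bind] at r2
  refine r2.congr ?_ (by simp [Expr.size]; omega) le_rfl
  rw [← PMF.bind_pure_comp]
  congr 1; funext y
  simp [Function.comp, PMF.pure_map, Expr.eval, initStore]

/-- The first loop of `mapC`, which collects the outputs in the variable `1`, in reverse order. -/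
def mapLoop (c : Cmd) : Cmd :=
  .loop (.var 0) (.seq (.call 2 c (.head (.var 0))) (.seq (.assign 1 (.cons (.var 2) (.var 1)))
    (.assign 0 (.tail (.var 0)))))

/-- The second loop of `mapC`, which moves the list in the variable `1` to the variable `0`, in
reverse order. -/
def reverseLoop : Cmd :=
  .loop (.var 1) (.seq (.assign 0 (.cons (.head (.var 1)) (.var 0))) (.assign 1 (.tail (.var 1))))

/-- Apply `c` to all entries of a list. -/
def mapC (c : Cmd) : Cmd := .seq (mapLoop c) reverseLoop

theorem reverseLoop_runs (O : Data → PMF Data) : ∀ (l r : List Data) (s : Store),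
    s 1 = Data.ofList l → s 0 = Data.ofList r →
    ∃ s', SRuns O reverseLoop s (PMF.pure s') (l.length * 20 + 2) 0 ∧
      s' 0 = Data.ofList (l.reverse ++ r) := by
  intro l
  induction l with
  | nil =>
    intro r s h1 h0
    exact ⟨s, (SRuns.loop_nil (by simp [Expr.eval, h1, Data.ofList])).mono (by simp [Expr.size])
      le_rfl, by simp [h0]⟩
  | cons x l ih =>
    intro r s h1 h0
    have r1 := (SRuns.assign (O := O) (s := s) 0 (.cons (.head (.var 1)) (.var 0))).seq_pure
      (SRuns.assign 1 (.tail (.var 1)))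
    obtain ⟨s', r2, hs'⟩ := ih (x :: r) (Function.update (Function.update s 0
      (Data.ofList (x :: r))) 1 (Data.ofList l)) (by simp) (by simp)
    refine ⟨s', ?_, by simpa using hs'⟩
    have r3 := SRuns.loop_cons (e := .var 1) (P₂ := fun _ => PMF.pure s')
      (by simp [Expr.eval, h1, Data.ofList]) r1 (t₂ := l.length * 20 + 2) (q₂ := 0)
      (fun s'' hs'' => by
        simp only [PMF.support_pure, Set.mem_singleton_iff] at hs''
        rw [hs'']
        simpa [Expr.eval, h1, h0, Data.ofList, Data.head, Data.tail, reverseLoop] using r2)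
    rw [PMF.pure_bind] at r3
    refine r3.mono ?_ le_rfl
    simp [Expr.size, Nat.add_mul]
    omega

theorem mapLoop_runs {O : Data → PMF Data} {c : Cmd} {p : Data → PMF Data} {t q : ℕ} :
    ∀ (l : List Data), (∀ x ∈ l, Runs O c x (p x) t q) → ∀ (acc : List Data) (s : Store),
    s 0 = Data.ofList l → s 1 = Data.ofList acc →
    ∃ P, SRuns O (mapLoop c) s P (l.length * (t + 30) + 2) (l.length * q) ∧
      (P.map fun s' => s' 1) = (listM p l).map (fun r => Data.ofList (r.reverse ++ acc)) ∧
      ∀ s' ∈ P.support, s' 0 = Data.nil ∧ ∃ r : List Data, r.length = l.length + acc.length ∧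
        s' 1 = Data.ofList r := by
  intro l
  induction l with
  | nil =>
    intro _ acc s h0 h1
    refine ⟨PMF.pure s, (SRuns.loop_nil (by simp [Expr.eval, h0, Data.ofList])).mono
      (by simp [Expr.size]) (by simp), ?_, ?_⟩
    · simp [listM, PMF.pure_map, h1]
    · intro s' hs'
      simp only [PMF.support_pure, Set.mem_singleton_iff] at hs'
      subst hs'
      exact ⟨by simp [h0, Data.ofList], acc, by simp, h1⟩
  | cons x l ih =>
    intro h acc s h0 h1
    have r1 := SRuns.call (s := s) (x := 2) (e := .head (.var 0)) (c := c) (O := O) (p := p x)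
      (t := t) (q := q) (by
        simpa [Expr.eval, h0, Data.ofList, Data.head] using h x (by simp))
    let st : Data → Store := fun y => Function.update (Function.update (Function.update s 2 y) 1
      (Data.ofList (y :: acc))) 0 (Data.ofList l)
    have r2 : SRuns O (.seq (.call 2 c (.head (.var 0))) (.seq (.assign 1 (.cons (.var 2) (.var 1)))
        (.assign 0 (.tail (.var 0))))) s ((p x).map st) (t + 20) q := by
      have := r1.seq (c₂ := .seq (.assign 1 (.cons (.var 2) (.var 1))) (.assign 0 (.tail (.var 0))))
        (fun s _ => (SRuns.assign _ _).seq_pure (SRuns.assign _ _))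
      refine this.congr ?_ (by simp [Expr.size]; omega) (by omega)
      rw [PMF.bind_map, ← PMF.bind_pure_comp]
      congr 1; funext y
      simp [st, Function.comp, Expr.eval, h0, h1, Data.ofList, Data.tail]
    have key : ∀ y, ∃ P, SRuns O (mapLoop c) (st y) P (l.length * (t + 30) + 2) (l.length * q) ∧
      (P.map fun s' => s' 1) = (listM p l).map (fun r => Data.ofList (r.reverse ++ y :: acc)) ∧
      ∀ s' ∈ P.support, s' 0 = Data.nil ∧ ∃ r : List Data, r.length = l.length + (y :: acc).length ∧
        s' 1 = Data.ofList r := fun y =>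
      ih (fun x hx => h x (by simp [hx])) (y :: acc) (st y) (by simp [st]) (by simp [st])
    choose P hP1 hP2 hP3 using key
    have st2 : ∀ y, st y 2 = y := fun y => by simp [st]
    have r3 := SRuns.loop_cons (e := .var 0) (c := .seq (.call 2 c (.head (.var 0)))
      (.seq (.assign 1 (.cons (.var 2) (.var 1))) (.assign 0 (.tail (.var 0)))))
      (P₂ := fun s' => P (s' 2)) (by simp [Expr.eval, h0, Data.ofList]) r2
      (t₂ := l.length * (t + 30) + 2) (q₂ := l.length * q) (fun s' hs' => by
        rw [PMF.support_map] at hs'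
        obtain ⟨y, _, rfl⟩ := hs'
        rw [st2]
        exact hP1 y)
    rw [PMF.bind_map] at r3
    have e : ((fun s' : Store => P (s' 2)) ∘ st) = P := by funext y; simp [Function.comp, st2]
    rw [e] at r3
    refine ⟨(p x).bind P, r3.mono ?_ ?_, ?_, ?_⟩
    · simp [Expr.size, Nat.add_mul]; omega
    · simp [Nat.add_mul]; omega
    · rw [PMF.map_bind, listM, PMF.map_bind]
      congr 1; funext y
      rw [hP2, PMF.map_comp]
      congr 1; funext r
      simp
    · intro s' hs'
      simp only [PMF.support_bind, Set.mem_iUnion] at hs'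
      obtain ⟨y, _, hy⟩ := hs'
      obtain ⟨a, r, b, c⟩ := hP3 y s' hy
      exact ⟨a, r, by simp at b ⊢; omega, c⟩

theorem Runs.mapC_data {O : Data → PMF Data} {c : Cmd} {p : Data → PMF Data} {t q : ℕ}
    {l : List Data} (h : ∀ x ∈ l, Runs O c x (p x) t q) :
    Runs O (mapC c) (Data.ofList l) ((listM p l).map Data.ofList) (l.length * (t + 50) + 10)
      (l.length * q) := by
  obtain ⟨P, r1, hP1, hP2⟩ := mapLoop_runs l h [] (initStore (Data.ofList l)) (by simp [initStore])
    (by simp [initStore, Data.ofList])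
  have key : ∀ s : Store, ∃ s', s ∈ P.support →
      SRuns O reverseLoop s (PMF.pure s') (l.length * 20 + 2) 0 ∧
      ∀ r : List Data, s 1 = Data.ofList r → s' 0 = Data.ofList r.reverse := by
    intro s
    by_cases hs : s ∈ P.support
    · obtain ⟨h0, r, hr, h1⟩ := hP2 s hs
      obtain ⟨s', a, b⟩ := reverseLoop_runs O r [] s h1 (by simp [h0, Data.ofList])
      refine ⟨s', fun _ => ⟨by simpa [hr] using a, fun r' hr' => ?_⟩⟩
      have hinj : ∀ a b : List Data, Data.ofList a = Data.ofList b → a = b := by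
        intro a
        induction a with
        | nil => intro b hb; cases b <;> simp_all [Data.ofList]
        | cons x a ih =>
          intro b hb
          cases b with
          | nil => simp [Data.ofList] at hb
          | cons y b => simp only [Data.ofList, Data.cons.injEq] at hb; rw [hb.1, ih b hb.2]
      rw [b, hinj r r' (by rw [← h1, hr'])]; simp
    · exact ⟨s, fun h => absurd h hs⟩
  choose f hf using key
  have r2 := (r1.seq (P₂ := fun s => PMF.pure (f s)) (fun s hs => (hf s hs).1)).runs
  refine r2.congr ?_ (by simp [Nat.mul_add]; omega) (by omega)
  rw [PMF.map_bind]
  simp only [PMF.pure_map]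
  have e1 : (P.bind fun s => PMF.pure (f s 0)) = P.map fun s => Data.ofList (s 1).toList.reverse := by
    rw [← PMF.bind_pure_comp]
    have hinv : ∀ r : List Data, (Data.ofList r).toList = r := by
      intro r; induction r with
      | nil => rfl
      | cons a r ih => simp [Data.ofList, Data.toList, ih]
    refine pmf_bind_congr _ fun s hs => ?_
    obtain ⟨h0, r, hr, h1⟩ := hP2 s hs
    simp only [Function.comp]
    rw [(hf s hs).2 r h1, h1, hinv]
  rw [e1]
  have e2 : (P.map fun s => Data.ofList (s 1).toList.reverse) =
      (P.map fun s => s 1).map fun x => Data.ofList x.toList.reverse := by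
    rw [PMF.map_comp]; rfl
  rw [e2, hP1, PMF.map_comp]
  congr 1; funext r
  have hinv : ∀ r : List Data, (Data.ofList r).toList = r := by
    intro r; induction r with
    | nil => rfl
    | cons a r ih => simp [Data.ofList, Data.toList, ih]
  simp [hinv]

section

variable {α β γ : Type} [Enc α] [Enc β] [Enc γ]

/-- `Runs` for a randomized function between encoded types. -/
def TRuns (O : Data → PMF Data) (c : Cmd) (a : α) (p : PMF β) (t q : ℕ) : Prop :=
  Runs O c (enc a) (p.map enc) t q

theorem TRuns.comp {O : Data → PMF Data} {c₁ c₂ : Cmd} {a : α} {p : PMF β} {p₂ : β → PMF γ}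
    {t₁ t₂ q₁ q₂ : ℕ} (h₁ : TRuns O c₁ a p t₁ q₁)
    (h₂ : ∀ b ∈ p.support, TRuns O c₂ b (p₂ b) t₂ q₂) :
    TRuns O (compC c₁ c₂) a (p.bind p₂) (t₁ + t₂ + 7) (q₁ + q₂) := by
  classical
  let g : Data → PMF Data := fun y =>
    if h : ∃ b ∈ p.support, enc b = y then (p₂ h.choose).map enc else PMF.pure y
  have hg : ∀ b ∈ p.support, g (enc b) = (p₂ b).map enc := by
    intro b hb
    have h : ∃ b' ∈ p.support, enc b' = enc b := ⟨b, hb, rfl⟩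
    simp only [g, dif_pos h]
    have := h₂ _ h.choose_spec.1
    unfold TRuns at this
    rw [h.choose_spec.2] at this
    exact Runs.unique this (h₂ b hb)
  have := Runs.comp (p₂ := g) h₁ (c₂ := c₂) (t₂ := t₂) (q₂ := q₂) (fun y hy => by
    rw [PMF.support_map] at hy
    obtain ⟨b, hb, rfl⟩ := hy
    rw [hg b hb]
    exact h₂ b hb)
  unfold TRuns
  convert this using 1
  rw [PMF.map_bind, PMF.bind_map]
  exact pmf_bind_congr _ fun b hb => (hg b hb).symm

theorem TRuns.keep {O : Data → PMF Data} {c : Cmd} {a : α} {p : PMF β} {t q : ℕ}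
    (h : TRuns O c a p t q) : TRuns O (keepC c) a (p.map fun b => (a, b)) (t + 8) q := by
  have := Runs.keep h
  unfold TRuns
  rw [PMF.map_comp] at this ⊢
  exact this

theorem TRuns.mapC {O : Data → PMF Data} {c : Cmd} {p : α → PMF β} {t q : ℕ} {l : List α}
    (h : ∀ a ∈ l, TRuns O c a (p a) t q) :
    TRuns O (mapC c) l (listM p l) (l.length * (t + 50) + 10) (l.length * q) := by
  classical
  let g : Data → PMF Data := fun y =>
    if h : ∃ b ∈ l, enc b = y then (p h.choose).map enc else PMF.pure y
  have hg : ∀ b ∈ l, g (enc b) = (p b).map enc := by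
    intro b hb
    have h' : ∃ b' ∈ l, enc b' = enc b := ⟨b, hb, rfl⟩
    simp only [g, dif_pos h']
    have := h _ h'.choose_spec.1
    unfold TRuns at this
    rw [h'.choose_spec.2] at this
    exact Runs.unique this (h b hb)
  have := Runs.mapC_data (p := g) (l := l.map enc) (O := O) (c := c) (t := t) (q := q) (fun y hy => by
    obtain ⟨b, hb, rfl⟩ := List.mem_map.1 hy
    rw [hg b hb]
    exact h b hb)
  rw [listM_map_left, listM_congr hg, listM_map_right, PMF.map_comp, List.length_map] at this
  exact this

/-- A deterministic program. -/
theorem TRuns.of_pure {O : Data → PMF Data} {c : Cmd} {a : α} {b : β} {t q : ℕ}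
    (h : Runs O c (enc a) (PMF.pure (enc b)) t q) : TRuns O c a (PMF.pure b) t q := by
  unfold TRuns; rwa [PMF.pure_map]

theorem TRuns.mono {O : Data → PMF Data} {c : Cmd} {a : α} {p : PMF β} {t q t' q' : ℕ}
    (h : TRuns O c a p t q) (ht : t ≤ t') (hq : q ≤ q') : TRuns O c a p t' q' :=
  Runs.mono h ht hq

theorem TRuns.coin (O : Data → PMF Data) (a : α) :
    TRuns O (.coin 0) a (PMF.uniformOfFintype Bool) 1 0 := by
  have := (SRuns.coin (O := O) (s := initStore (enc a)) 0).runs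
  rw [PMF.map_comp] at this
  refine Runs.congr this ?_ le_rfl le_rfl
  congr 1

end

end


section

open Enc (enc)

/-! ### The deterministic parts of the learner -/

/-- A point of the cube, as a list. -/
abbrev Pt := List Bool

/-- A restriction, as a list: `none` for a free coordinate, `some b` for one that is fixed. -/
abbrev Rest := List (Option Bool)

/-- The gates of a circuit. -/
abbrev Gates := List (ℕ × ℕ)

/-- The input of the given learner. -/
abbrev Job := List ℕ × List (Bool × Pt)

/-- Membership of the point `x` in the subcube `ρ`. -/
def inCube (ρ : Rest) (x : Pt) : Bool :=
  (List.range ρ.length).all fun i => (ρ.getD i none).elim true fun b => b == x.getD i false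

/-- The point `x`, with the coordinates that `ρ` fixes replaced by those of `u`. -/
def overwrite (ρ : Rest) (x u : Pt) : Pt :=
  (List.range x.length).map fun i =>
    if (ρ.getD i none).isSome then u.getD i false else x.getD i false

/-- The output of the circuit of NAND gates `g` on the point `x`: the list of the values of the wires
starts with the inputs, each gate appends a value, and the last value is the output. -/
def evalGates (g : Gates) (x : Pt) : Bool :=
  (g.foldl (fun w p => w ++ [!(w.getD p.1 false && w.getD p.2 false)]) x).getLastD false

/-- The test for a free coordinate `i` to be worth querying at `ρ`: the number of `w` in `S`
with `w.1` in the subcube `ρ` and the `i`-th bit of `w.2` set exceeds that with this bit not set by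
at least the fraction `1 / T` of the number of points in the subcube. Here `w.1` is an example, and
the bits `w.2` are biased at the coordinates of large influence, see `Detects`. -/
def isCand (T : ℕ) (S : List (Pt × Pt)) (ρ : Rest) (i : ℕ) : Bool :=
  !(ρ.getD i none).isSome && decide
    ((S.countP fun w => inCube ρ w.1 && !w.2.getD i false) * T + (S.countP fun w => inCube ρ w.1) ≤
      (S.countP fun w => inCube ρ w.1 && w.2.getD i false) * T)

/-- The first `T ^ 2` coordinates that pass the test. If the counts are accurate, these are all of
them, see `influence_le_of_not_mem_cands`. -/
def cands (T : ℕ) (S : List (Pt × Pt)) (ρ : Rest) : List ℕ :=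
  ((List.range ρ.length).filter (isCand T S ρ)).take (T ^ 2)

/-- The search space is written in postfix notation: `some (ρ, _)` pushes a hypothesis for the
subcube `ρ`, and `none` combines the three topmost entries of the stack, which are a hypothesis for
a subcube and hypotheses for its two halves. The flag is set for subcubes that are still to be
subdivided. -/
abbrev Item := Option (Rest × Bool)

/-- One round of subdivision: a subcube that is still to be subdivided is replaced by itself, and, for
each candidate `i`, by its two halves in the direction `i` and an instruction to combine them. -/
def expand (T : ℕ) (S : List (Pt × Pt)) (it : Item) : List Item :=
  it.elim [none] fun p => if p.2 then some (p.1, false) :: (cands T S p.1).flatMap fun i =>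
    [some (p.1.set i (some false), true), some (p.1.set i (some true), true), none] else [some p]

/-- The code for the subdivisions of the whole cube along decision trees of depth at most `d`. The
cut-off at the length `L` keeps the running time polynomial on all samples; it has no effect if `L`
is large, see `codeOf_eq_seg`. -/
def codeOf (T : ℕ) (S : List (Pt × Pt)) (n d L : ℕ) : List Item :=
  (List.replicate d ()).foldl (fun s _ => (s.flatMap (expand T S)).take L)
    [some (List.replicate n none, true)]

/-- The `j`-th block of `k` entries. -/
def chunk {α : Type} (k : ℕ) (F : List α) (j : ℕ) : List α := (F.drop (j * k)).take k

/-- The inputs for the given learner at the subcube `ρ`, each of them with a point that will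
overwrite the fixed coordinates in the hypothesis. The second components of the entries of `S` are
the random points that overwrite the fixed coordinates of the examples. -/
def jobs (n E m R : ℕ) (S : List ((Bool × Pt) × Pt)) (ρ : Rest) : List (Pt × Job) :=
  (List.range R).flatMap fun j =>
    if decide (m + 1 ≤ (chunk (m + 1) (S.filter fun e => inCube ρ e.1.2) j).length) then
      [((chunk (m + 1) (S.filter fun e => inCube ρ e.1.2) j).head?.elim [] fun e => e.2, ([n, E],
        (chunk (m + 1) (S.filter fun e => inCube ρ e.1.2) j).tail.map fun e =>
          (e.1.1, overwrite ρ e.1.2 e.2)))]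
    else []

/-- The inputs for the given learner at an instruction of the code. -/
def itemJobs (n E m R : ℕ) (S : List ((Bool × Pt) × Pt)) (it : Item) :
    Option Rest × List (Pt × Job) :=
  it.elim (none, []) fun p => (some p.1, jobs n E m R S p.1)

/-- A hypothesis on a subcube: the subcube, the point that overwrites the fixed coordinates, and a
circuit. -/
abbrev Leaf := Rest × Pt × Gates

/-- The number of errors and the leaves of a hypothesis. -/
abbrev Value := ℕ × List Leaf

/-- The number of examples in `S` that reach the leaf `ℓ` and are misclassified by it. -/
def leafErr (S : List (Bool × Pt)) (ℓ : Leaf) : ℕ :=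
  S.countP fun e => inCube ℓ.1 e.2 && !(evalGates ℓ.2.2 (overwrite ℓ.1 e.2 ℓ.2.1) == e.1)

/-- The better one of two hypotheses. -/
def minV (a b : Value) : Value := if decide (a.1 ≤ b.1) then a else b

/-- The best hypothesis for the subcube `ρ` among those in `hs` and the hypothesis `([], [])` of the
empty circuit. -/
def leafVal (S : List (Bool × Pt)) (ρ : Rest) (hs : List (Pt × Gates)) : Value :=
  hs.foldl (fun s h => minV s (leafErr S (ρ, h), [(ρ, h)])) (leafErr S (ρ, [], []), [(ρ, [], [])])

/-- The topmost entry of a stack. -/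
def topV (st : List Value) : Value := st.head?.getD (0, [])

/-- The action of an instruction on the stack. To combine a hypothesis for a subcube with hypotheses
for its two halves is to keep the better one of the first hypothesis and the union of the two
others. -/
def stackStep (S : List (Bool × Pt)) (it : Option Rest × List (Pt × Gates)) (st : List Value) :
    List Value :=
  it.1.elim (minV (topV st.tail.tail) ((topV st.tail).1 + (topV st).1,
    (topV st.tail).2 ++ (topV st).2) :: st.tail.tail.tail) fun ρ => leafVal S ρ it.2 :: st

/-- The leaves of the best hypothesis in the search space. -/
def bestLeaves (S : List (Bool × Pt)) (res : List (Option Rest × List (Pt × Gates))) : List Leaf :=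
  (topV (res.foldl (fun st it => stackStep S it st) [])).2

/-- The wire that replaces the wire `i` of the circuit of a leaf: the gates are shifted, and the
inputs that are overwritten are replaced by the constants on the wires `n` and `n + 1`. -/
def remap (n : ℕ) (ℓ : Leaf) (base i : ℕ) : ℕ :=
  if decide (i + 1 ≤ n) then
    if (ℓ.1.getD i none).isSome then if ℓ.2.1.getD i false then n else n + 1 else i
  else base + (i - n)

/-- Gates for the conjunction of the wire `s.2` with the condition that `ρ` imposes on the
coordinate `i`. -/
def addLit (n : ℕ) (ρ : Rest) (i : ℕ) (s : Gates × ℕ) : Gates × ℕ :=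
  (ρ.getD i none).elim s fun b =>
    if b then (s.1 ++ [(s.2, i), (n + s.1.length, n + s.1.length)], n + s.1.length + 1)
    else (s.1 ++ [(i, i), (s.2, n + s.1.length), (n + s.1.length + 1, n + s.1.length + 1)],
      n + s.1.length + 2)

/-- Gates for the leaf `ℓ`, appended to the gates `gs`, and the wire with its value: a copy of the
circuit of the leaf, followed by the conjunction with the conditions that define the subcube. -/
def addCube (n : ℕ) (ℓ : Leaf) (gs : Gates) : Gates × ℕ :=
  (List.range n).foldl (fun s i => addLit n ℓ.1 i s)
    (gs ++ ℓ.2.2.map (fun p => (remap n ℓ (n + gs.length) p.1, remap n ℓ (n + gs.length) p.2)),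
      remap n ℓ (n + gs.length) (n + ℓ.2.2.length - 1))

/-- Gates for the disjunction of two wires. -/
def addOr (n a : ℕ) (s : Gates × ℕ) : Gates × ℕ :=
  (s.1 ++ [(a, a), (s.2, s.2), (n + s.1.length, n + s.1.length + 1)], n + s.1.length + 2)

/-- The circuit for the disjunction over the leaves of membership in the subcube and the circuit of
the leaf. The wires `n` and `n + 1` carry the constants true and false. -/
def compileLeaves (n : ℕ) (ls : List Leaf) : Gates :=
  (ls.foldl (fun s ℓ => addOr n s.2 (addCube n ℓ s.1)) ([(n, n), (n, n)], n + 1)).1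

section

variable {α : Type} [Enc α]

theorem PT.lift {β γ : Type} [Enc β] [Enc γ] {f : α → γ} (hf : PT f) :
    PT (fun p : α × β => f p.1) := PT.comp hf (PT.fst PT.id)

theorem PT.arg {β : Type} [Enc β] : PT (fun p : α × β => p.2) := PT.snd PT.id

theorem PT.inCube {f : α → Rest} {g : α → Pt} (hf : PT f) (hg : PT g) :
    PT (fun a => inCube (f a) (g a)) :=
  PT.all (hf.length.range) (PT.option_elim (hf.lift.getD PT.arg (PT.const none))
    (PT.beq PT.arg (PT.lift (hg.lift.getD PT.arg (PT.const false)))) (PT.const true))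

theorem PT.overwrite {f : α → Rest} {g h : α → Pt} (hf : PT f) (hg : PT g) (hh : PT h) :
    PT (fun a => overwrite (f a) (g a) (h a)) :=
  PT.map (hg.length.range) (PT.ite (hf.lift.getD PT.arg (PT.const none)).isSome
    (hh.lift.getD PT.arg (PT.const false)) (hg.lift.getD PT.arg (PT.const false)))

theorem PT.evalGates {f : α → Gates} {g : α → Pt} (hf : PT f) (hg : PT g) :
    PT (fun a => evalGates (f a) (g a)) := by
  have h1 : PT (fun a => (f a).foldl (fun w p => w ++ [!(w.getD p.1 false && w.getD p.2 false)])
      (g a)) := by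
    have hw : PT (fun p : α × (ℕ × ℕ) × Pt => p.2.2) := PT.snd PT.arg
    have hp : PT (fun p : α × (ℕ × ℕ) × Pt => p.2.1) := PT.fst PT.arg
    refine PT.foldl (f := fun _ p w => w ++ [!(w.getD p.1 false && w.getD p.2 false)]) hf hg
      (hw.append (PT.cons ((hw.getD hp.fst (PT.const false)).and
        (hw.getD hp.snd (PT.const false))).not (PT.const []))) 2 fun a x _ s => ?_
    refine (hgt_append _ _).trans ?_
    rw [hgt_cons, hgt_nil]
    have := hgt_bool (!(s.getD x.1 false && s.getD x.2 false))
    simp only [Polynomial.eval_ofNat]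
    omega
  have h2 := PT.getD_option (PT.head? h1.reverse) (PT.const false)
  convert h2 using 2 with a
  rw [Lift.evalGates, List.head?_reverse, List.getLastD_eq_getLast?]

theorem PT.cands {T : α → ℕ} {S : α → List (Pt × Pt)} {f : α → Rest} (hT : PT T) (hS : PT S)
    (hf : PT f) : PT (fun a => cands (T a) (S a) (f a)) := by
  refine PT.take (hT.pow 2) (PT.filter hf.length.range (PT.and (PT.not
    (hf.lift.getD PT.arg (PT.const none)).isSome) (PT.le (PT.add (PT.mul ?_ hT.lift) ?_)
    (PT.mul ?_ hT.lift))))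
  · exact PT.countP hS.lift (PT.and (PT.inCube hf.lift.lift (PT.fst PT.arg))
      (PT.not (PT.getD (PT.snd PT.arg) PT.arg.lift (PT.const false))))
  · exact PT.countP hS.lift (PT.inCube hf.lift.lift (PT.fst PT.arg))
  · exact PT.countP hS.lift (PT.and (PT.inCube hf.lift.lift (PT.fst PT.arg))
      (PT.getD (PT.snd PT.arg) PT.arg.lift (PT.const false)))

theorem PT.expand {T : α → ℕ} {S : α → List (Pt × Pt)} {f : α → Item} (hT : PT T) (hS : PT S)
    (hf : PT f) : PT (fun a => expand (T a) (S a) (f a)) := by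
  refine PT.option_elim (F := fun a p => if p.2 then some (p.1, false) ::
    (Lift.cands (T a) (S a) p.1).flatMap fun i =>
    [some (p.1.set i (some false), true), some (p.1.set i (some true), true), none] else [some p])
    hf ?_ (PT.const [none])
  have hρ : PT (fun p : α × Rest × Bool => p.2.1) := PT.fst PT.arg
  have hs : ∀ b : Bool, PT (fun p : (α × Rest × Bool) × ℕ =>
      (some (p.1.2.1.set p.2 (some b), true) : Item)) := fun b =>
    PT.optSome (PT.pair (PT.set hρ.lift PT.arg (PT.const (some b))) (PT.const true))
  exact PT.ite (PT.snd PT.arg) (PT.cons (PT.optSome (hρ.pair (PT.const false)))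
    (PT.flatMap (PT.cands hT.lift hS.lift hρ) (PT.cons (hs false) (PT.cons (hs true)
      (PT.const [none]))))) (PT.cons (PT.optSome PT.arg) (PT.const []))

/-- The largest height of an entry. -/
def supHgt {β : Type} [Enc β] (l : List β) : ℕ := l.foldr (fun b s => max (hgt b) s) 0

theorem le_supHgt {β : Type} [Enc β] {l : List β} {b : β} (h : b ∈ l) : hgt b ≤ supHgt l := by
  induction h with
  | head l => simp [supHgt]
  | tail c _ ih => exact ih.trans (by simp [supHgt])

theorem supHgt_le {β : Type} [Enc β] {l : List β} {B : ℕ} (h : ∀ b ∈ l, hgt b ≤ B) :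
    supHgt l ≤ B := by
  induction l with
  | nil => simp [supHgt]
  | cons b l ih =>
    have h1 := ih fun c hc => h c (by simp [hc])
    have h2 := h b (by simp)
    simp only [supHgt, List.foldr_cons] at h1 ⊢
    omega

theorem hgt_set {β : Type} [Enc β] (l : List β) (i : ℕ) (b : β) :
    hgt (l.set i b) ≤ hgt l + hgt b := by
  induction l generalizing i with
  | nil => simp
  | cons c l ih =>
    cases i with
    | zero => rw [List.set_cons_zero, hgt_cons, hgt_cons]; omega
    | succ i => rw [List.set_cons_succ, hgt_cons, hgt_cons]; have := ih i; omega

theorem hgt_expand {T : ℕ} {S : List (Pt × Pt)} {it it' : Item} (h : it' ∈ expand T S it) :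
    hgt it' ≤ hgt it + 2 := by
  cases it with
  | none => simp [expand] at h; simp [h, hgt_none]
  | some p =>
    obtain ⟨ρ, b⟩ := p
    cases b with
    | false => simp [expand] at h; rw [h]; omega
    | true =>
      simp only [expand, Option.elim, if_true, List.mem_cons, List.mem_flatMap] at h
      rcases h with rfl | ⟨i, _, h⟩
      · simp only [hgt_some, hgt_pair]
        have : hgt false = 0 := rfl
        omega
      · have hs : ∀ b : Bool, hgt (ρ.set i (some b)) ≤ hgt ρ + 2 := fun b =>
          (hgt_set ρ i (some b)).trans (by rw [hgt_some]; have := hgt_bool b; omega)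
        have h1 := hs false
        have h2 := hs true
        simp only [List.not_mem_nil, or_false] at h
        rcases h with rfl | rfl | rfl
        · simp only [hgt_some, hgt_pair]; omega
        · simp only [hgt_some, hgt_pair]; omega
        · simp [hgt_none]

theorem PT.codeOf {T n d L : α → ℕ} {S : α → List (Pt × Pt)} (hT : PT T) (hS : PT S)
    (hn : PT n) (hd : PT d) (hL : PT L) :
    PT (fun a => codeOf (T a) (S a) (n a) (d a) (L a)) := by
  have hrep : PT (fun a => List.replicate (n a) (none : Option Bool)) := by
    convert PT.map (g := fun _ _ => (none : Option Bool)) hn.units (PT.const none) using 2 with a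
    simp
  have hinit : PT (fun a => ([some (List.replicate (n a) none, true)] : List Item)) :=
    PT.cons (PT.optSome (hrep.pair (PT.const true))) (PT.const [])
  obtain ⟨Q, hQ⟩ := hinit.height
  obtain ⟨QL, hQL⟩ := hL.height
  refine PT.foldl_measure (f := fun a _ s => (s.flatMap (Lift.expand (T a) (S a))).take (L a))
    hd.units hinit ?_ (fun a s => max s.length (L a) + supHgt s) (QL + Q + 3) ?_ ?_ ?_
  · exact PT.take hL.lift (PT.flatMap (PT.snd PT.arg) (PT.expand hT.lift.lift hS.lift.lift PT.arg))
  · intro a s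
    exact (hgt_list_le fun b hb => le_supHgt hb).trans (by omega)
  · intro a
    have h1 := hQ a
    have h2 := hQL a
    rw [hgt_nat] at h2
    have h3 : supHgt ([some (List.replicate (n a) none, true)] : List Item) ≤
        hgt ([some (List.replicate (n a) none, true)] : List Item) :=
      supHgt_le fun b hb => hgt_le_of_mem hb
    simp only [List.length_cons, List.length_nil, Polynomial.eval_add, Polynomial.eval_ofNat]
    omega
  · intro a x _ s
    have h1 : supHgt ((s.flatMap (Lift.expand (T a) (S a))).take (L a)) ≤ supHgt s + 2 := by
      refine supHgt_le fun b hb => ?_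
      obtain ⟨it, hit, hb⟩ := List.mem_flatMap.1 (List.mem_of_mem_take hb)
      have := le_supHgt hit
      have := hgt_expand hb
      omega
    have h2 : ((s.flatMap (Lift.expand (T a) (S a))).take (L a)).length ≤ L a := by simp
    simp only [Polynomial.eval_add, Polynomial.eval_ofNat]
    omega

theorem PT.chunk {β : Type} [Enc β] {k j : α → ℕ} {F : α → List β} (hk : PT k) (hF : PT F)
    (hj : PT j) : PT (fun a => chunk (k a) (F a) (j a)) :=
  PT.take hk (PT.drop (hj.mul hk) hF)

theorem PT.jobs {n E m R : α → ℕ} {S : α → List ((Bool × Pt) × Pt)} {ρ : α → Rest} (hn : PT n)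
    (hE : PT E) (hm : PT m) (hR : PT R) (hS : PT S) (hρ : PT ρ) :
    PT (fun a => jobs (n a) (E a) (m a) (R a) (S a) (ρ a)) := by
  have hF : PT (fun a => (S a).filter fun e => Lift.inCube (ρ a) e.1.2) :=
    PT.filter hS (PT.inCube hρ.lift (PT.snd (PT.fst PT.arg)))
  have hC : PT (fun p : α × ℕ => Lift.chunk (m p.1 + 1)
      ((S p.1).filter fun e => Lift.inCube (ρ p.1) e.1.2) p.2) :=
    PT.chunk hm.lift.succ hF.lift PT.arg
  refine PT.flatMap hR.range (PT.ite (PT.le hm.lift.succ hC.length) (PT.cons (PT.pair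
    (PT.option_elim (F := fun _ e => e.2) hC.head? (PT.snd PT.arg) (PT.const [])) (PT.pair
    (PT.cons hn.lift (PT.cons hE.lift (PT.const []))) (PT.map hC.tail ?_))) (PT.const []))
    (PT.const []))
  exact PT.pair (PT.fst (PT.fst PT.arg)) (PT.overwrite hρ.lift.lift (PT.snd (PT.fst PT.arg))
    (PT.snd PT.arg))

theorem PT.itemJobs {n E m R : α → ℕ} {S : α → List ((Bool × Pt) × Pt)} {f : α → Item} (hn : PT n)
    (hE : PT E) (hm : PT m) (hR : PT R) (hS : PT S) (hf : PT f) :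
    PT (fun a => itemJobs (n a) (E a) (m a) (R a) (S a) (f a)) :=
  PT.option_elim (F := fun a (p : Rest × Bool) =>
    ((some p.1, Lift.jobs (n a) (E a) (m a) (R a) (S a) p.1) : Option Rest × List (Pt × Job))) hf
    (PT.pair (PT.optSome (PT.fst PT.arg)) (PT.jobs hn.lift hE.lift hm.lift hR.lift hS.lift
      (PT.fst PT.arg))) (PT.const _)

theorem PT.leafErr {S : α → List (Bool × Pt)} {f : α → Leaf} (hS : PT S) (hf : PT f) :
    PT (fun a => leafErr (S a) (f a)) :=
  PT.countP hS (PT.and (PT.inCube hf.fst.lift (PT.snd PT.arg)) (PT.not (PT.beq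
    (PT.evalGates hf.snd.snd.lift (PT.overwrite hf.fst.lift (PT.snd PT.arg) hf.snd.fst.lift))
    (PT.fst PT.arg))))

theorem PT.minV {f g : α → Value} (hf : PT f) (hg : PT g) : PT (fun a => minV (f a) (g a)) :=
  PT.ite (PT.le hf.fst hg.fst) hf hg

theorem hgt_minV (a b : Value) : hgt (minV a b) ≤ max (hgt a) (hgt b) := by
  unfold minV; split_ifs <;> omega

theorem PT.leafVal {S : α → List (Bool × Pt)} {ρ : α → Rest} {hs : α → List (Pt × Gates)}
    (hS : PT S) (hρ : PT ρ) (hh : PT hs) : PT (fun a => leafVal (S a) (ρ a) (hs a)) := by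
  have hl : PT (fun p : α × (Pt × Gates) => ((Lift.leafErr (S p.1) (ρ p.1, p.2),
      [(ρ p.1, p.2)]) : Value)) := by
    have h : PT (fun p : α × (Pt × Gates) => ((ρ p.1, p.2) : Leaf)) := PT.pair hρ.lift PT.arg
    exact PT.pair (PT.leafErr hS.lift h) (PT.cons h (PT.const []))
  obtain ⟨Q, hQ⟩ := hl.height
  refine PT.foldl (f := fun a h s => Lift.minV s (Lift.leafErr (S a) (ρ a, h), [(ρ a, h)])) hh
    (PT.comp hl (PT.pair PT.id (PT.const (([], []) : Pt × Gates)))) (PT.minV (PT.snd PT.arg)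
      (PT.comp hl (PT.pair (PT.fst PT.id) (PT.fst PT.arg)))) (Q.comp (.X + 1)) fun a x _ s => ?_
  refine (hgt_minV _ _).trans (max_le (by omega) ?_)
  refine (hQ (a, x)).trans ?_
  have := polyEval_mono Q (a := hgt (a, x)) (b := hgt a + hgt x + 1) (by rw [hgt_pair]; omega)
  simp only [Polynomial.eval_comp, Polynomial.eval_add, Polynomial.eval_X, Polynomial.eval_one]
  omega

theorem PT.topV {f : α → List Value} (hf : PT f) : PT (fun a => topV (f a)) :=
  PT.getD_option hf.head? (PT.const _)

theorem PT.stackStep {S : α → List (Bool × Pt)} {f : α → Option Rest × List (Pt × Gates)}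
    {g : α → List Value} (hS : PT S) (hf : PT f) (hg : PT g) :
    PT (fun a => stackStep (S a) (f a) (g a)) :=
  PT.option_elim (F := fun a ρ => Lift.leafVal (S a) ρ (f a).2 :: g a) hf.fst
    (PT.cons (PT.leafVal hS.lift PT.arg hf.snd.lift) hg.lift)
    (PT.cons (PT.minV hg.tail.tail.topV (PT.pair (PT.add hg.tail.topV.fst hg.topV.fst)
      (PT.append hg.tail.topV.snd hg.topV.snd))) hg.tail.tail.tail)

/-- The weight of a stack, which does not increase when entries are combined. -/
def stackWeight (st : List Value) : ℕ := (st.map fun v => v.1 + hgt v.2 + 2).sum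

theorem hgt_le_stackWeight (st : List Value) : hgt st ≤ stackWeight st := by
  induction st with
  | nil => simp [hgt_nil]
  | cons v st ih =>
    obtain ⟨e, l⟩ := v
    simp only [hgt_cons, hgt_pair, hgt_nat, stackWeight, List.map_cons, List.sum_cons] at ih ⊢
    omega

theorem stackWeight_tail (st : List Value) :
    (topV st).1 + hgt (topV st).2 + stackWeight st.tail ≤ stackWeight st := by
  cases st with
  | nil => simp [topV, stackWeight, hgt_nil]
  | cons v st => simp [topV, stackWeight]

theorem stackWeight_comb (st : List Value) :
    stackWeight (minV (topV st.tail.tail) ((topV st.tail).1 + (topV st).1,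
    (topV st.tail).2 ++ (topV st).2) :: st.tail.tail.tail) ≤ stackWeight st + 2 := by
  have h1 := stackWeight_tail st
  have h2 := stackWeight_tail st.tail
  have h3 := stackWeight_tail st.tail.tail
  have h4 := hgt_append (topV st.tail).2 (topV st).2
  have h5 : stackWeight (minV (topV st.tail.tail) ((topV st.tail).1 + (topV st).1,
    (topV st.tail).2 ++ (topV st).2) :: st.tail.tail.tail) =
    (minV (topV st.tail.tail) ((topV st.tail).1 + (topV st).1,
    (topV st.tail).2 ++ (topV st).2)).1 + hgt (minV (topV st.tail.tail) ((topV st.tail).1 +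
    (topV st).1, (topV st.tail).2 ++ (topV st).2)).2 + 2 + stackWeight st.tail.tail.tail := by
    simp [stackWeight]
  rw [h5]
  unfold minV
  split_ifs <;> (try simp only) <;> omega

theorem PT.bestLeaves {S : α → List (Bool × Pt)} {f : α → List (Option Rest × List (Pt × Gates))}
    (hS : PT S) (hf : PT f) : PT (fun a => bestLeaves (S a) (f a)) := by
  have hl : PT (fun p : α × (Rest × List (Pt × Gates)) => Lift.leafVal (S p.1) p.2.1 p.2.2) :=
    PT.leafVal hS.lift (PT.fst PT.arg) (PT.snd PT.arg)
  obtain ⟨Q, hQ⟩ := hl.height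
  obtain ⟨Qf, hQf⟩ := hf.height
  refine PT.snd (PT.topV (PT.foldl_measure (f := fun a it st => Lift.stackStep (S a) it st) hf
    (PT.const []) (PT.stackStep hS.lift (PT.fst PT.arg) (PT.snd PT.arg))
    (fun _ st => stackWeight st) (2 * Q.comp (.X + Qf + 1) + 2) (fun a s => hgt_le_stackWeight s)
    (fun a => by simp [stackWeight]) fun a x hx s => ?_))
  obtain ⟨o, hs⟩ := x
  cases o with
  | none =>
    refine (stackWeight_comb s).trans ?_
    simp only [Polynomial.eval_add, Polynomial.eval_ofNat]
    omega
  | some ρ =>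
    have h1 := hQ (a, ρ, hs)
    have h2 : hgt ((some ρ, hs) : Option Rest × List (Pt × Gates)) ≤ Qf.eval (hgt a) :=
      (hgt_le_of_mem hx).trans (hQf a)
    have h3 := polyEval_mono Q (a := hgt (a, ρ, hs)) (b := hgt a + Qf.eval (hgt a) + 1) (by
      rw [hgt_pair, hgt_some] at h2
      rw [hgt_pair, hgt_pair]; omega)
    simp only at h1
    set v := Lift.leafVal (S a) ρ hs with hv
    have h4 : hgt v = max v.1 (hgt v.2) + 1 := by
      rw [← hgt_nat v.1]; rfl
    have h5 : stackWeight (Lift.stackStep (S a) (some ρ, hs) s) = v.1 + hgt v.2 + 2 + stackWeight s := by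
      simp [Lift.stackStep, stackWeight, hv]
    simp only [h5, Polynomial.eval_add, Polynomial.eval_mul, Polynomial.eval_comp,
      Polynomial.eval_X, Polynomial.eval_one, Polynomial.eval_ofNat]
    omega

/-- A bound on the size of a partial circuit with a distinguished wire. -/
def circM (n : ℕ) (s : Gates × ℕ) : ℕ := max (n + s.1.length) (max (supHgt s.1) s.2)

theorem hgt_le_circM (n : ℕ) (s : Gates × ℕ) : hgt s ≤ 2 * circM n s + 1 := by
  obtain ⟨g, t⟩ := s
  have := hgt_list_le (l := g) fun b hb => le_supHgt hb
  rw [hgt_pair, hgt_nat]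
  unfold circM
  simp only
  omega

theorem circM_append {n : ℕ} {g new : Gates} {t t' B : ℕ} (h1 : new.length ≤ B)
    (h2 : ∀ p ∈ new, hgt p ≤ circM n (g, t) + B) (h3 : t' ≤ circM n (g, t) + B) :
    circM n (g ++ new, t') ≤ circM n (g, t) + B := by
  have h4 : supHgt (g ++ new) ≤ circM n (g, t) + B := by
    refine supHgt_le fun b hb => ?_
    rcases List.mem_append.1 hb with hb | hb
    · have := le_supHgt hb
      unfold circM; simp only; omega
    · exact h2 b hb
  have h5 : n + g.length ≤ circM n (g, t) := le_max_left _ _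
  unfold circM at h3 h4 h5 ⊢
  simp only [List.length_append] at *
  omega

theorem circM_addLit (n : ℕ) (ρ : Rest) (i : ℕ) (s : Gates × ℕ) :
    circM n (addLit n ρ i s) ≤ circM n s + (i + 5) := by
  obtain ⟨g, t⟩ := s
  have h1 : n + g.length ≤ circM n (g, t) := le_max_left _ _
  have h2 : t ≤ circM n (g, t) := (le_max_right _ _).trans (le_max_right _ _)
  unfold addLit
  cases ρ.getD i none with
  | none => simp
  | some b =>
    cases b
    · refine circM_append (by simp) (fun p hp => ?_) (by simp only; omega)
      simp only [List.mem_cons, List.not_mem_nil, or_false] at hp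
      rcases hp with rfl | rfl | rfl <;> simp only [hgt_pair, hgt_nat] <;> omega
    · refine circM_append (by simp) (fun p hp => ?_) (by simp only; omega)
      simp only [List.mem_cons, List.not_mem_nil, or_false] at hp
      rcases hp with rfl | rfl <;> simp only [hgt_pair, hgt_nat] <;> omega

theorem remap_le (n : ℕ) (ℓ : Leaf) (base i : ℕ) : remap n ℓ base i ≤ base + i + n + 1 := by
  unfold remap; split_ifs <;> omega

theorem circM_addCube (n : ℕ) (ℓ : Leaf) (g : Gates) :
    circM n (addCube n ℓ g) ≤ circM n (g, 0) + (n * (n + 5) + 2 * n + 2 * hgt ℓ.2.2 + 4) := by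
  have h1 : n + g.length ≤ circM n (g, 0) := le_max_left _ _
  have h0 := length_le_hgt ℓ.2.2
  have h2 : circM n (g ++ ℓ.2.2.map (fun p => (remap n ℓ (n + g.length) p.1,
      remap n ℓ (n + g.length) p.2)), remap n ℓ (n + g.length) (n + ℓ.2.2.length - 1)) ≤
      circM n (g, 0) + (2 * n + 2 * hgt ℓ.2.2 + 4) := by
    refine circM_append (by simp; omega) (fun p hp => ?_) ?_
    · obtain ⟨⟨r1, r2⟩, hr, rfl⟩ := List.mem_map.1 hp
      have h3 := remap_le n ℓ (n + g.length) r1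
      have h4 := remap_le n ℓ (n + g.length) r2
      have h5 := hgt_le_of_mem hr
      rw [hgt_pair, hgt_nat, hgt_nat] at h5 ⊢
      simp only
      omega
    · have := remap_le n ℓ (n + g.length) (n + ℓ.2.2.length - 1)
      omega
  have h3 : ∀ (l : List ℕ) (s : Gates × ℕ), (∀ i ∈ l, i ≤ n) →
      circM n (l.foldl (fun s i => addLit n ℓ.1 i s) s) ≤ circM n s + l.length * (n + 5) := by
    intro l
    induction l with
    | nil => intro s _; simp
    | cons i l ih =>
      intro s h
      have e1 := ih (addLit n ℓ.1 i s) fun j hj => h j (by simp [hj])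
      have e2 := circM_addLit n ℓ.1 i s
      have e3 := h i (by simp)
      simp only [List.foldl_cons, List.length_cons, Nat.add_mul]
      omega
  have h4 := h3 (List.range n) _ (fun i hi => (List.mem_range.1 hi).le) |>.trans
    (Nat.add_le_add_right h2 _)
  rw [List.length_range] at h4
  unfold addCube
  omega

theorem PT.remap {n base i : α → ℕ} {f : α → Leaf} (hn : PT n) (hf : PT f) (hb : PT base)
    (hi : PT i) : PT (fun a => remap (n a) (f a) (base a) (i a)) :=
  PT.ite (PT.le hi.succ hn) (PT.ite (PT.getD hf.fst hi (PT.const none)).isSome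
    (PT.ite (PT.getD hf.snd.fst hi (PT.const false)) hn hn.succ) hi) (PT.add hb (PT.sub hi hn))

theorem PT.gate {f g : α → ℕ} {h : α → Gates} (hf : PT f) (hg : PT g) (hh : PT h) :
    PT (fun a => (f a, g a) :: h a) := PT.cons (hf.pair hg) hh

theorem PT.addLit {n i : α → ℕ} {ρ : α → Rest} {s : α → Gates × ℕ} (hn : PT n) (hρ : PT ρ)
    (hi : PT i) (hs : PT s) : PT (fun a => addLit (n a) (ρ a) (i a) (s a)) := by
  have hk : PT (fun a => n a + (s a).1.length) := PT.add hn hs.fst.length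
  have h1 := PT.pair (PT.append hs.fst (PT.gate hs.snd hi (PT.gate hk hk (PT.const [])))) hk.succ
  have h2 := PT.pair (PT.append hs.fst (PT.gate hi hi (PT.gate hs.snd hk (PT.gate hk.succ hk.succ
    (PT.const []))))) hk.succ.succ
  refine PT.option_elim (F := fun a b => if b then ((s a).1 ++ [((s a).2, i a),
    (n a + (s a).1.length, n a + (s a).1.length)], n a + (s a).1.length + 1)
    else ((s a).1 ++ [(i a, i a), ((s a).2, n a + (s a).1.length), (n a + (s a).1.length + 1,
      n a + (s a).1.length + 1)], n a + (s a).1.length + 2)) (PT.getD hρ hi (PT.const none))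
    (PT.ite PT.arg h1.lift h2.lift) hs

theorem PT.addCube {n : α → ℕ} {f : α → Leaf} {g : α → Gates} (hn : PT n) (hf : PT f) (hg : PT g) :
    PT (fun a => addCube (n a) (f a) (g a)) := by
  have hk : PT (fun a => n a + (g a).length) := PT.add hn hg.length
  have hI : PT (fun a => ((g a ++ (f a).2.2.map (fun p => (Lift.remap (n a) (f a)
      (n a + (g a).length) p.1, Lift.remap (n a) (f a) (n a + (g a).length) p.2)),
      Lift.remap (n a) (f a) (n a + (g a).length) (n a + (f a).2.2.length - 1)) : Gates × ℕ)) :=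
    PT.pair (PT.append hg (PT.map hf.snd.snd (PT.pair
      (PT.remap hn.lift hf.lift hk.lift (PT.fst PT.arg))
      (PT.remap hn.lift hf.lift hk.lift (PT.snd PT.arg)))))
      (PT.remap hn hf hk (PT.pred (PT.add hn hf.snd.snd.length)))
  obtain ⟨Q, hQ⟩ := hI.height
  obtain ⟨Qn, hQn⟩ := hn.height
  simp only [hgt_nat] at hQn
  refine PT.foldl_measure (f := fun a i s => Lift.addLit (n a) (f a).1 i s) hn.range hI
    (PT.addLit hn.lift hf.fst.lift (PT.fst PT.arg) (PT.snd PT.arg))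
    (fun a s => 2 * circM (n a) s + 1) (2 * Qn + 4 * Q + 20) (fun a s => hgt_le_circM _ _)
    (fun a => ?_) fun a i hi s => ?_
  · have h1 := hQ a
    have h2 := hQn a
    rw [hgt_pair, hgt_nat] at h1
    set L := g a ++ (f a).2.2.map (fun p => (Lift.remap (n a) (f a)
      (n a + (g a).length) p.1, Lift.remap (n a) (f a) (n a + (g a).length) p.2)) with hL
    have h3 := length_le_hgt L
    have h4 : supHgt L ≤ hgt L := supHgt_le fun b hb => hgt_le_of_mem hb
    unfold circM
    simp only [Polynomial.eval_add, Polynomial.eval_mul, Polynomial.eval_ofNat]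
    omega
  · have h1 := circM_addLit (n a) (f a).1 i s
    have h2 := List.mem_range.1 hi
    have h3 := hQn a
    simp only [Polynomial.eval_add, Polynomial.eval_mul, Polynomial.eval_ofNat]
    omega

theorem PT.compileLeaves {n : α → ℕ} {f : α → List Leaf} (hn : PT n) (hf : PT f) :
    PT (fun a => compileLeaves (n a) (f a)) := by
  obtain ⟨Qn, hQn⟩ := hn.height
  obtain ⟨Qf, hQf⟩ := hf.height
  simp only [hgt_nat] at hQn
  have hn2 : PT (fun p : α × Leaf × (Gates × ℕ) => n p.1) := hn.lift
  have hs : PT (fun p : α × Leaf × (Gates × ℕ) => Lift.addCube (n p.1) p.2.1 p.2.2.1) :=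
    PT.addCube hn2 (PT.fst PT.arg) (PT.fst (PT.snd PT.arg))
  have hk := PT.add hn2 hs.fst.length
  have ha : PT (fun p : α × Leaf × (Gates × ℕ) => p.2.2.2) := PT.snd (PT.snd PT.arg)
  refine PT.fst (PT.foldl_measure (f := fun a ℓ s => addOr (n a) s.2 (Lift.addCube (n a) ℓ s.1)) hf
    (PT.pair (PT.gate hn hn (PT.gate hn hn (PT.const []))) hn.succ)
    (PT.pair (PT.append hs.fst (PT.gate ha ha (PT.gate hs.snd hs.snd (PT.gate hk hk.succ
      (PT.const []))))) hk.succ.succ)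
    (fun a s => 2 * circM (n a) s + 1) (2 * (Qn * (Qn + 5) + 2 * Qn + 2 * Qf + 20))
    (fun a s => hgt_le_circM _ _) (fun a => ?_) fun a ℓ hℓ s => ?_)
  · have h2 := hQn a
    simp only [circM, supHgt, List.foldr_cons, List.foldr_nil, hgt_pair, hgt_nat, List.length_cons,
      List.length_nil, Polynomial.eval_add, Polynomial.eval_mul, Polynomial.eval_ofNat]
    omega
  · have h2 := hQn a
    have h3 := circM_addCube (n a) ℓ s.1
    have h4 : hgt ℓ.2.2 ≤ Qf.eval (hgt a) := by
      have e1 : hgt ℓ ≤ Qf.eval (hgt a) := (hgt_le_of_mem hℓ).trans (hQf a)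
      obtain ⟨l1, l2, l3⟩ := ℓ
      rw [hgt_pair, hgt_pair] at e1
      simp only
      omega
    have h5 : n a * (n a + 5) ≤ Qn.eval (hgt a) * (Qn.eval (hgt a) + 5) :=
      Nat.mul_le_mul h2 (by omega)
    have h6 : circM (n a) (s.1, 0) ≤ circM (n a) s := by unfold circM; simp only; omega
    have h7 : s.2 ≤ circM (n a) s := (le_max_right _ _).trans (le_max_right _ _)
    set s' := Lift.addCube (n a) ℓ s.1 with hs'
    have h8 : circM (n a) (addOr (n a) s.2 s') ≤ max (circM (n a) s') (circM (n a) s) + 4 := by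
      have e0 : circM (n a) s' ≤ circM (n a) (s'.1, max s'.2 s.2) := by
        unfold circM; simp only; omega
      have e1 : circM (n a) (s'.1, max s'.2 s.2) ≤ max (circM (n a) s') (circM (n a) s) := by
        unfold circM at h7 ⊢; simp only at h7 ⊢; omega
      have e2 : n a + s'.1.length ≤ circM (n a) s' := le_max_left _ _
      have e3 : s'.2 ≤ circM (n a) s' := (le_max_right _ _).trans (le_max_right _ _)
      have e4 : s.2 ≤ circM (n a) (s'.1, max s'.2 s.2) := by unfold circM; simp only; omega
      refine (circM_append (t := max s'.2 s.2) (B := 4) (by simp) (fun p hp => ?_) (by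
        omega)).trans (by omega)
      simp only [List.mem_cons, List.not_mem_nil, or_false] at hp
      rcases hp with rfl | rfl | rfl <;> simp only [hgt_pair, hgt_nat] <;> omega
    simp only [Polynomial.eval_add, Polynomial.eval_mul, Polynomial.eval_ofNat]
    omega

theorem PT.toList {f : α → Data} (hf : PT f) : PT (fun a => (f a).toList) :=
  PT.comp (F := fun x : Data => x.toList) (PT.of_expr (.var 0) fun x => by
    have : ∀ x : Data, x = Data.ofList (x.toList.map enc) := by
      intro x
      induction x with
      | nil => rfl
      | cons a b _ ih =>
        simp only [Data.toList, List.map_cons, Data.ofList]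
        rw [← ih]; rfl
    exact this x) hf

theorem PT.toNat {f : α → Data} (hf : PT f) : PT (fun a => (f a).toNat) := by
  convert hf.toList.length using 2 with a
  induction f a with
  | nil => rfl
  | cons x y _ ih => simp [Data.toNat, Data.toList, ih]

theorem PT.decodeCircuit {f : α → Data} (hf : PT f) : PT (fun a => decodeCircuit (f a)) :=
  PT.map hf.toList (PT.pair
    (PT.toNat (PT.comp (F := Data.head) (PT.of_expr (.head (.var 0)) fun _ => rfl) PT.arg))
    (PT.toNat (PT.comp (F := Data.tail) (PT.of_expr (.tail (.var 0)) fun _ => rfl) PT.arg)))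

end

end


section

open Enc (enc)

/-! ### The programs -/

/-- The setting in which a randomized program is run: the oracle, the output distribution of the
given learner, and a bound on its running time. -/
structure Setting : Type where
  O : Data → PMF Data
  law : Data → PMF Data
  time : ℕ

/-- On the arguments in `D` the query-free program `c` computes the randomized function `p` in time
polynomial in the height of the argument and the running time of the given learner. -/
def RP {α β : Type} [Enc α] [Enc β] (c : Cmd) (D : Setting → α → Prop)
    (p : Setting → α → PMF β) : Prop :=
  c.QueryFree ∧ ∃ P : Polynomial ℕ, ∀ γ a, D γ a →
    TRuns γ.O c a (p γ a) (P.eval (hgt a + γ.time)) 0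

/-- Apply `c` to the second component of a pair. -/
def sndC (c : Cmd) : Cmd :=
  .seq (.call 1 c (.tail (.var 0))) (.assign 0 (.cons (.head (.var 0)) (.var 1)))

section

variable {α β γ : Type} [Enc α] [Enc β] [Enc γ]

theorem TRuns.snd {O : Data → PMF Data} {c : Cmd} {a : α} {b : β} {p : PMF γ} {t q : ℕ}
    (h : TRuns O c b p t q) : TRuns O (sndC c) (a, b) (p.map fun y => (a, y)) (t + 10) q := by
  have r1 := SRuns.call (s := initStore (enc (a, b))) (x := 1) (e := .tail (.var 0)) (c := c)
    (O := O) (p := p.map enc) (t := t) (q := q) (by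
      simpa [Expr.eval, initStore, enc_pair, Data.tail, TRuns] using h)
  have r2 := (r1.seq (c₂ := .assign 0 (.cons (.head (.var 0)) (.var 1)))
    (fun s _ => SRuns.assign _ _)).runs
  rw [PMF.bind_map, PMF.map_bind] at r2
  refine r2.congr ?_ (by simp [Expr.size]; omega) le_rfl
  rw [PMF.bind_map, PMF.map_comp, ← PMF.bind_pure_comp]
  congr 1; funext y
  simp [Function.comp, PMF.pure_map, Expr.eval, initStore, enc_pair, Data.head]

theorem TRuns.hgt_le {O : Data → PMF Data} {c : Cmd} (hc : c.QueryFree) {a : α} {p : PMF β}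
    {t q : ℕ} (h : TRuns O c a p t q) {b : β} (hb : b ∈ p.support) : hgt b ≤ hgt a + t :=
  Runs.height_le hc h (y := enc b) (by rw [PMF.support_map]; exact ⟨b, hb, rfl⟩)

theorem RP.comp {c₁ c₂ : Cmd} {D₁ : Setting → α → Prop} {D₂ : Setting → β → Prop}
    {p₁ : Setting → α → PMF β} {p₂ : Setting → β → PMF γ} (h₁ : RP c₁ D₁ p₁) (h₂ : RP c₂ D₂ p₂) :
    RP (compC c₁ c₂) (fun s a => D₁ s a ∧ ∀ b ∈ (p₁ s a).support, D₂ s b)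
      (fun s a => (p₁ s a).bind (p₂ s)) := by
  obtain ⟨q₁, P₁, h₁⟩ := h₁
  obtain ⟨q₂, P₂, h₂⟩ := h₂
  refine ⟨⟨q₁, q₂⟩, P₁ + P₂.comp (.X + P₁) + 7, fun s a ⟨hD₁, hD₂⟩ => ?_⟩
  have := TRuns.comp (h₁ s a hD₁) (p₂ := p₂ s) (c₂ := c₂) (q₂ := 0)
    (t₂ := P₂.eval (hgt a + s.time + P₁.eval (hgt a + s.time))) fun b hb =>
    (h₂ s b (hD₂ b hb)).mono (polyEval_mono _ (by
      have := (h₁ s a hD₁).hgt_le q₁ hb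
      omega)) le_rfl
  exact this.mono (by simp) le_rfl

theorem RP.keep {c : Cmd} {D : Setting → α → Prop} {p : Setting → α → PMF β} (h : RP c D p) :
    RP (keepC c) D (fun s a => (p s a).map fun b => (a, b)) := by
  obtain ⟨q, P, h⟩ := h
  exact ⟨⟨q, trivial⟩, P + 8, fun s a hD => (h s a hD).keep.mono (by simp) le_rfl⟩

theorem RP.snd {c : Cmd} {D : Setting → β → Prop} {p : Setting → β → PMF γ} (h : RP c D p) :
    RP (sndC c) (fun s (x : α × β) => D s x.2) (fun s x => (p s x.2).map fun b => (x.1, b)) := by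
  obtain ⟨q, P, h⟩ := h
  refine ⟨⟨q, trivial⟩, P + 10, fun s x hD => (h s x.2 hD).snd.mono ?_ le_rfl⟩
  have := polyEval_mono P (a := hgt x.2 + s.time) (b := hgt x + s.time) (by
    obtain ⟨x, y⟩ := x; rw [hgt_pair]; simp only; omega)
  simpa using this

theorem RP.map {c : Cmd} {D : Setting → α → Prop} {p : Setting → α → PMF β} (h : RP c D p) :
    RP (mapC c) (fun s l => ∀ a ∈ l, D s a) (fun s l => listM (p s) l) := by
  obtain ⟨q, P, h⟩ := h
  refine ⟨⟨⟨q, trivial, trivial⟩, ⟨trivial, trivial⟩⟩, .X * (P + 50) + 10, fun s l hD => ?_⟩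
  have := TRuns.mapC (O := s.O) (c := c) (p := p s) (t := P.eval (hgt l + s.time)) (q := 0)
    (l := l) fun a ha => (h s a (hD a ha)).mono (polyEval_mono _ (by
      have := hgt_le_of_mem ha; omega)) le_rfl
  refine this.mono ?_ (by simp)
  have h2 : l.length ≤ hgt l + s.time := (length_le_hgt l).trans (by omega)
  simpa using Nat.mul_le_mul_right (P.eval (hgt l + s.time) + 50) h2

theorem PT.rp {F : α → β} (h : PT F) :
    ∃ c, RP c (fun _ _ => True) (fun _ a => PMF.pure (F a)) := by
  obtain ⟨c, P, q, h⟩ := h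
  refine ⟨c, q, P, fun s a _ => TRuns.of_pure ((h s.O a).mono (polyEval_mono _ (by omega)) le_rfl)⟩

theorem RP.congr {c : Cmd} {D D' : Setting → α → Prop} {p p' : Setting → α → PMF β} (h : RP c D p)
    (hD : ∀ s a, D' s a → D s a) (hp : ∀ s a, D' s a → p s a = p' s a) : RP c D' p' := by
  obtain ⟨q, P, h⟩ := h
  exact ⟨q, P, fun s a ha => hp s a ha ▸ h s a (hD s a ha)⟩

end

/-- The length of each of the three parts of the sample. Since `3 ≤ n + 2`, three parts fit into a
sample of length `M`, and since `n ≤ n + 2`, there can be `n` queries for each example of one part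
within a total of `M` queries. -/
def partSize (n M : ℕ) : ℕ := M / (n + 2)

/-- The arguments of a learner. -/
abbrev Inp := List ℕ × List (Bool × Pt)

/-- The dimension. -/
def Inp.n (a : Inp) : ℕ := a.1.getD 0 0
/-- The depth of the decision tree for the density. -/
def Inp.d (a : Inp) : ℕ := a.1.getD 1 0
/-- The number of samples that the given learner needs. -/
def Inp.m (a : Inp) : ℕ := a.1.getD 2 0
/-- The parameter `⌈1 / ε⌉`. -/
def Inp.E (a : Inp) : ℕ := a.1.getD 3 0
/-- The length of each of the three parts of the sample. -/
def Inp.q (a : Inp) : ℕ := partSize a.n a.2.length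
/-- The part of the sample from which the candidates are selected. -/
def Inp.S₁ (a : Inp) : List (Bool × Pt) := a.2.take a.q
/-- The part of the sample that is passed on to the given learner. -/
def Inp.S₂ (a : Inp) : List (Bool × Pt) := (a.2.drop a.q).take a.q
/-- The part of the sample on which the errors of hypotheses are counted. -/
def Inp.S₃ (a : Inp) : List (Bool × Pt) := (a.2.drop (a.q + a.q)).take a.q

/-- The parameter that controls the thresholds, the number of candidates and the number of
repetitions. -/
def Inp.T (c : ℕ) (a : Inp) : ℕ := c * (a.m * a.d * a.E) ^ 2

/-- The inputs for the given learner at all instructions of the code, with `T ^ 5` inputs for each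
subcube. -/
def allJobs (c : ℕ) (a : Inp) (Z : List (Pt × Pt)) (U : List ((Bool × Pt) × Pt)) :
    List (Option Rest × List (Pt × Job)) :=
  (codeOf (a.T c) Z a.n a.d a.2.length).map (itemJobs a.n a.E a.m (a.T c ^ 5) U)

theorem PT.partSize {α : Type} [Enc α] {n M : α → ℕ} (hn : PT n) (hM : PT M) :
    PT (fun a => partSize (n a) (M a)) := by
  convert PT.length (PT.filter (g := fun a j => decide ((j + 1) * (n a + 2) ≤ M a)) hM.range
    (PT.le (PT.mul PT.arg.succ hn.succ.succ.lift) hM.lift)) using 2 with a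
  unfold Lift.partSize
  have : ∀ k M, M / (k + 1) ≤ M := fun k M => Nat.div_le_self _ _
  rw [← List.countP_eq_length_filter]
  have key : ∀ N, (List.range N).countP (fun j => decide ((j + 1) * (n a + 2) ≤ M a)) =
      min N (M a / (n a + 2)) := by
    intro N
    induction N with
    | zero => simp
    | succ N ih =>
      have h1 : (N + 1) * (n a + 2) ≤ M a ↔ N + 1 ≤ M a / (n a + 2) :=
        (Nat.le_div_iff_mul_le (by omega)).symm
      rw [List.range_succ, List.countP_append, ih, List.countP_cons, List.countP_nil]
      by_cases h : (N + 1) * (n a + 2) ≤ M a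
      · have h2 := h1.1 h
        simp only [h, decide_true, if_true]; omega
      · have h2 := fun h3 => h (h1.2 h3)
        simp only [h, decide_false, Bool.false_eq_true, if_false]; omega
  rw [key, min_eq_right (Nat.div_le_self _ _)]

theorem PT.inpPar (k : ℕ) : PT (fun a : Inp => a.1.getD k 0) :=
  PT.getD (PT.fst PT.id) (PT.const k) (PT.const 0)

theorem PT.inpQ : PT Inp.q := PT.partSize (PT.inpPar 0) (PT.length (PT.snd PT.id))

theorem PT.inpS₁ : PT Inp.S₁ := PT.take PT.inpQ (PT.snd PT.id)

theorem PT.inpS₂ : PT Inp.S₂ := PT.take PT.inpQ (PT.drop PT.inpQ (PT.snd PT.id))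

theorem PT.inpS₃ : PT Inp.S₃ :=
  PT.take PT.inpQ (PT.drop (PT.add PT.inpQ PT.inpQ) (PT.snd PT.id))

theorem PT.inpT (c : ℕ) : PT (Inp.T c) :=
  PT.mul (PT.const c) (PT.pow (PT.mul (PT.mul (PT.inpPar 2) (PT.inpPar 1)) (PT.inpPar 3)) 2)

/-- Random points of the length of the examples. -/
def coinLaw (S : List (Bool × Pt)) : PMF (List ((Bool × Pt) × Pt)) :=
  listM (fun e => (listM (fun _ => PMF.uniformOfFintype Bool) e.2).map fun u => (e, u)) S

/-- The results of the runs of the given learner. -/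
def resLaw (law : Data → PMF Data) (l : List (Option Rest × List (Pt × Job))) :
    PMF (List (Option Rest × List (Pt × Gates))) :=
  listM (fun it => (listM (fun j => (law (enc j.2)).map fun g => (j.1, decodeCircuit g)) it.2).map
    fun hs => (it.1, hs)) l

/-- The distribution of the circuit that is computed from the sample with the additional list
`Z`. -/
def circuitLaw (c : ℕ) (law : Data → PMF Data) (a : Inp) (Z : List (Pt × Pt)) : PMF Gates :=
  (coinLaw a.S₂).bind fun U => (resLaw law (allJobs c a Z U)).map fun res =>
    compileLeaves a.n (bestLeaves a.S₃ res)

/-- The part of the learner after the additional list `Z` is computed. -/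
theorem exists_circuit_program (c : ℕ) (A : Cmd) (hA : A.QueryFree) :
    ∃ B : Cmd, RP B (fun s (x : Inp × List (Pt × Pt)) => ∀ U ∈ (coinLaw x.1.S₂).support,
      ∀ it ∈ allJobs c x.1 x.2 U, ∀ j ∈ it.2, Runs s.O A (enc j.2) (s.law (enc j.2)) s.time 0)
      (fun s x => circuitLaw c s.law x.1 x.2) := by
  have hA : RP A (fun s (j : Job) => Runs s.O A (enc j) (s.law (enc j)) s.time 0)
      (fun s j => s.law (enc j)) := by
    refine ⟨hA, .X, fun s j h => ?_⟩
    have : (s.law (enc j)).map (enc : Data → Data) = s.law (enc j) := PMF.map_id _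
    unfold TRuns
    rw [this]
    exact h.mono (by simp) le_rfl
  obtain ⟨cP, hP⟩ := PT.rp (PT.decodeCircuit (PT.id (α := Data)))
  have hitem := ((hA.comp hP).snd (α := Pt)).map.snd (α := Option Rest) |>.map
  obtain ⟨c1, h1⟩ := PT.rp (α := Inp × List (Pt × Pt)) (PT.comp PT.inpS₂ (PT.fst PT.id))
  obtain ⟨cx, hx⟩ := PT.rp (α := Bool × Pt) (PT.snd PT.id)
  have hcoin : RP (.coin 0) (fun _ (_ : Bool) => True) (fun _ _ => PMF.uniformOfFintype Bool) :=
    ⟨trivial, 1, fun s a _ => by simpa using TRuns.coin s.O a⟩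
  have hcoins := h1.comp (hx.comp hcoin.map).keep.map |>.keep
  have hin : PT (fun y : (Inp × List (Pt × Pt)) × List ((Bool × Pt) × Pt) => y.1.1) :=
    (PT.fst PT.id).fst
  have hpar : ∀ k, PT (fun y : (Inp × List (Pt × Pt)) × List ((Bool × Pt) × Pt) =>
      y.1.1.1.getD k 0) := fun k => PT.comp (PT.inpPar k) hin
  have hT : PT (fun y : (Inp × List (Pt × Pt)) × List ((Bool × Pt) × Pt) => y.1.1.T c) :=
    PT.comp (PT.inpT c) hin
  obtain ⟨c2, h2⟩ := PT.rp (α := (Inp × List (Pt × Pt)) × List ((Bool × Pt) × Pt))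
    (F := fun y => allJobs c y.1.1 y.1.2 y.2) (PT.map
    (PT.codeOf hT (PT.snd (PT.fst PT.id)) (hpar 0) (hpar 1) (PT.length hin.snd))
    (PT.itemJobs (hpar 0).lift (hpar 3).lift (hpar 2).lift (hT.pow 5).lift (PT.snd PT.id).lift
      PT.arg))
  have hjobs := (h2.comp hitem).keep
  obtain ⟨c3, h3⟩ := PT.rp (α := ((Inp × List (Pt × Pt)) × List ((Bool × Pt) × Pt)) ×
    List (Option Rest × List (Pt × Gates)))
    (F := fun y => compileLeaves y.1.1.1.n (bestLeaves y.1.1.1.S₃ y.2)) (PT.compileLeaves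
    (hpar 0).lift (PT.bestLeaves (PT.comp PT.inpS₃ hin.lift) (PT.snd PT.id)))
  have hall := hcoins.comp (hjobs.comp h3)
  have hcl : ∀ S : List (Bool × Pt), coinLaw S = (PMF.pure S).bind fun l =>
      listM (fun a => ((PMF.pure a.2).bind fun l => listM (fun _ => PMF.uniformOfFintype Bool) l).map
        fun b => (a, b)) l := by
    intro S
    simp only [PMF.pure_bind]; rfl
  refine ⟨_, hall.congr (fun s x hD => ?_) fun s x _ => ?_⟩
  · refine ⟨⟨trivial, fun _ _ _ _ => ⟨trivial, fun _ _ _ _ => trivial⟩⟩, fun y hy => ?_⟩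
    rw [← hcl, PMF.support_map] at hy
    obtain ⟨U, hU, rfl⟩ := hy
    refine ⟨⟨trivial, fun l hl it hit j hj => ⟨?_, fun _ _ => trivial⟩⟩, fun _ _ => trivial⟩
    simp only [PMF.support_pure, Set.mem_singleton_iff] at hl
    subst hl
    exact hD U hU it hit j hj
  · simp only [PMF.pure_bind, PMF.bind_map]
    unfold circuitLaw
    congr 1; funext U
    have hmap : ∀ (p : PMF Data) (r : Pt), ((p.bind fun g => PMF.pure (decodeCircuit g)).map
        fun b => (r, b)) = p.map fun g => (r, decodeCircuit g) := by
      intro p r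
      rw [PMF.map_bind, ← PMF.bind_pure_comp]
      simp only [PMF.pure_map]
      rfl
    simp only [Function.comp, resLaw, hmap]
    rw [← PMF.bind_pure_comp]
    rfl

/-- The learner. If the last parameter `⌈1 / ε⌉` is at most `1`, then any hypothesis is correct, and
the empty circuit is returned; the sample may be too short for the general case. -/
def learnerC (pre main : Cmd) : Cmd :=
  .branch (.tail (.head (.tail (.tail (.tail (.head (.var 0)))))))
    (.call 0 (compC (keepC pre) main) (.var 0)) (.assign 0 .nil)

/-- The learner as a program, for any program `pre` that computes the additional list `Z`. Only `pre`
makes queries. -/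
theorem exists_learner (c : ℕ) (A : Cmd) (hA : A.QueryFree) :
    ∃ (main : Cmd) (P : Polynomial ℕ), main.QueryFree ∧
      ∀ (pre : Cmd) (s : Setting) (a : Inp) (pz : PMF (List (Pt × Pt))) (tz qz hz : ℕ),
      a.1.length = 4 →
      (a.E ≤ 1 → Runs s.O (learnerC pre main) (enc a) (PMF.pure Data.nil) 30 0) ∧
      (2 ≤ a.E → TRuns s.O pre a pz tz qz → (∀ Z ∈ pz.support, hgt Z ≤ hz) →
        (∀ Z ∈ pz.support, ∀ U ∈ (coinLaw a.S₂).support, ∀ it ∈ allJobs c a Z U, ∀ j ∈ it.2,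
          Runs s.O A (enc j.2) (s.law (enc j.2)) s.time 0) →
        TRuns s.O (learnerC pre main) a (pz.bind fun Z => circuitLaw c s.law a Z)
          (tz + P.eval (hgt a + hz + s.time)) qz) := by
  obtain ⟨B, hq, P, hB⟩ := exists_circuit_program c A hA
  refine ⟨B, P.comp (.X + 1) + 50, hq, fun pre s a pz tz qz hz hlen => ?_⟩
  obtain ⟨par, S⟩ := a
  obtain ⟨n, d, m, E, rfl⟩ : ∃ n d m E, par = [n, d, m, E] := by
    match par, hlen with
    | [n, d, m, E], _ => exact ⟨n, d, m, E, rfl⟩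
  have hE : Expr.eval (initStore (enc (([n, d, m, E], S) : Inp)))
      (.tail (.head (.tail (.tail (.tail (.head (.var 0))))))) = (Data.ofNat E).tail := rfl
  have hE' : Inp.E ([n, d, m, E], S) = E := rfl
  rw [hE']
  constructor
  · intro h
    have h0 : (Data.ofNat E).tail = Data.nil := by
      interval_cases E <;> rfl
    have := SRuns.branch_false (O := s.O)
      (c₁ := .call 0 (compC (keepC pre) B) (.var 0)) (hE.trans h0)
      (SRuns.assign (O := s.O) 0 Expr.nil)
    exact this.runs_out (by simp [Expr.eval]) (by simp [Expr.size])
  · intro h hpre hh hD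
    obtain ⟨E, rfl⟩ : ∃ E', E = E' + 2 := ⟨E - 2, by omega⟩
    have h0 : (Data.ofNat (E + 2)).tail ≠ Data.nil := by simp [Data.ofNat, Data.tail]
    have r1 := TRuns.comp hpre.keep (p₂ := fun x => circuitLaw c s.law x.1 x.2) (c₂ := B)
      (q₂ := 0) (t₂ := P.eval (hgt (([n, d, m, E + 2], S) : Inp) + hz + s.time + 1)) (fun b hb => by
        rw [PMF.support_map] at hb
        obtain ⟨Z, hZ, rfl⟩ := hb
        refine (hB s (_, Z) (hD Z hZ)).mono (polyEval_mono _ ?_) le_rfl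
        have := hh Z hZ
        rw [hgt_pair]
        omega)
    have r2 := SRuns.call (s := initStore (enc (([n, d, m, E + 2], S) : Inp))) (x := 0)
      (e := .var 0) (show Runs s.O _ _ _ _ _ from r1)
    have r3 := (SRuns.branch_true (c₂ := .assign 0 .nil) (fun h' => h0 (hE ▸ h')) r2).runs
    refine Runs.congr r3 ?_ ?_ (by simp)
    · rw [PMF.map_comp, PMF.bind_map]
      simp only [Function.comp_def, Function.update_self]
      exact PMF.map_id _
    · simp [Expr.size]; omega

end


section

open Enc (enc)

/-! ### The use of the samples from edges -/

/-- The edge in the direction `i` at the point `x`. -/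
def edgeOf (x : Pt) (i : ℕ) : Rest := (x.map some).set i none

/-- The distribution of the bits that record which of the samples `y` from the edges at `x` agree
with `x`. -/
def agreeLaw (p : Rest → PMF Pt) (n : ℕ) (x : Pt) : PMF (List Bool) :=
  listM (fun i => (p (edgeOf x i)).map fun y => y.getD i false == x.getD i false) (List.range n)

theorem toBool_enc (y : Pt) : (enc y).toList.map Data.toBool = y := by
  induction y with
  | nil => rfl
  | cons b y ih =>
    rw [enc_cons, Data.toList, List.map_cons, ih]
    cases b <;> rfl

theorem exists_query_program : ∃ (c : Cmd) (P : Polynomial ℕ), ∀ (O : Data → PMF Data)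
    (p : Rest → PMF Pt) (ν : ℕ), (∀ q, O (enc q) = (p q).map enc) →
    (∀ q, (p q).support.Finite ∧ ∀ y ∈ (p q).support, hgt y ≤ ν) → ∀ w : Rest × ℕ × Bool,
    TRuns O c w ((p w.1).map fun y => y.getD w.2.1 false == w.2.2) (P.eval (hgt w + ν)) 1 := by
  obtain ⟨cd, P, -, hd⟩ := PT.beq (PT.getD (PT.fst PT.id) (PT.fst (PT.snd PT.id)) (PT.const false))
    (PT.snd (PT.snd (PT.id (α := Pt × ℕ × Bool))))
  refine ⟨.seq (.query 1 (.head (.var 0))) (.call 0 cd (.cons (.var 1) (.tail (.var 0)))),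
    P.comp (.X + 1) + 20, fun O p ν hO hp w => ?_⟩
  have e1 : Expr.eval (initStore (enc w)) (.head (.var 0)) = enc w.1 := rfl
  have r1 := SRuns.query (O := O) (s := initStore (enc w)) (x := 1) (e := .head (.var 0)) (by
    rw [e1, hO]; exact finite_support_map (hp w.1).1 _)
  rw [e1, hO, PMF.map_comp] at r1
  have r2 := (r1.seq (c₂ := .call 0 cd (.cons (.var 1) (.tail (.var 0))))
    (P₂ := fun s => PMF.pure (Function.update s 0
      (enc ((s 1).toList.map Data.toBool |>.getD w.2.1 false |> fun b => b == w.2.2))))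
    (t₂ := P.eval (hgt w + ν + 1) + 6) (q₂ := 0) (fun s hs => by
      rw [PMF.support_map] at hs
      obtain ⟨y, hy, rfl⟩ := hs
      have h1 := hd O (y, w.2)
      have h2 : P.eval (hgt (y, w.2)) ≤ P.eval (hgt w + ν + 1) := polyEval_mono P (by
        have := (hp w.1).2 y hy
        have e1 : hgt w = max (hgt w.1) (hgt w.2) + 1 := rfl
        have e2 : hgt (y, w.2) = max (hgt y) (hgt w.2) + 1 := rfl
        omega)
      have h3 := SRuns.call_pure (x := 0) (e := .cons (.var 1) (.tail (.var 0)))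
        (s := Function.update (initStore (enc w)) 1 (enc y)) (c := cd) (O := O)
        (show Runs O cd (enc (y, w.2)) _ _ _ from h1)
      refine h3.congr ?_ (by simp [Expr.size]; omega) le_rfl
      simp [toBool_enc])).runs
  refine Runs.congr r2 ?_ (by simp [Expr.size]; omega) le_rfl
  rw [PMF.bind_map, PMF.map_bind, PMF.map_comp, ← PMF.bind_pure_comp]
  congr 1; funext y
  simp [PMF.pure_map, Function.comp, toBool_enc]

theorem exists_edge_program : ∃ (c : Cmd) (P : Polynomial ℕ), ∀ (O : Data → PMF Data)
    (p : Rest → PMF Pt) (ν : ℕ), (∀ q, O (enc q) = (p q).map enc) →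
    (∀ q, (p q).support.Finite ∧ ∀ y ∈ (p q).support, hgt y ≤ ν) → ∀ a : Inp,
    TRuns O c a (listM (fun e => (agreeLaw p a.n e.2).map fun z => (e.2, z)) a.S₁)
      (P.eval (hgt a + ν)) (a.S₁.length * a.n) := by
  obtain ⟨cq, Pq, hq⟩ := exists_query_program
  have hx : PT (fun w : (Inp × (Bool × Pt)) => w.2.2) := PT.snd PT.arg
  have hE : PT (fun w : (Inp × (Bool × Pt)) × ℕ => edgeOf w.1.2.2 w.2) :=
    PT.set (PT.map hx.lift (PT.optSome PT.arg)) PT.arg (PT.const none)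
  have hF := PT.map (g := fun (a : Inp) (e : Bool × Pt) => (e.2, (List.range (a.1.getD 0 0)).map
      fun i => (edgeOf e.2 i, i, e.2.getD i false))) PT.inpS₁ (PT.pair hx (PT.map
    (g := fun (w : Inp × (Bool × Pt)) i => (edgeOf w.2.2 i, i, w.2.2.getD i false)) (PT.range (PT.lift (PT.inpPar 0)))
    (PT.pair hE (PT.pair PT.arg (PT.getD hx.lift PT.arg (PT.const false))))))
  obtain ⟨QF, hQF⟩ := hF.height
  obtain ⟨cF, PF, -, hF⟩ := hF
  refine ⟨compC cF (mapC (sndC (mapC cq))), PF + (QF * ((QF * (Pq.comp (QF + .X) + 50) + 20) + 50)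
    + 10) + 7, fun O p ν hO hp a => ?_⟩
  set l := a.S₁.map fun e => (e.2, (List.range a.n).map fun i => (edgeOf e.2 i, i, e.2.getD i false))
    with hl
  have hlQ : hgt l ≤ QF.eval (hgt a + ν) := (hQF a).trans (polyEval_mono _ (by omega))
  have r1 : TRuns O cF a (PMF.pure l) _ 0 := TRuns.of_pure (hF O a)
  have r2 : ∀ x ∈ l, TRuns O (sndC (mapC cq)) x
      ((listM (fun w : Rest × ℕ × Bool => (p w.1).map fun y => y.getD w.2.1 false == w.2.2) x.2).map
        fun z => (x.1, z))
      (QF.eval (hgt a + ν) * (Pq.eval (QF.eval (hgt a + ν) + (hgt a + ν)) + 50) + 20) a.n := by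
    intro x hxl
    have hxQ := (hgt_le_of_mem hxl).trans hlQ
    have hlen : x.2.length = a.n := by
      obtain ⟨e, _, rfl⟩ := List.mem_map.1 hxl
      simp
    obtain ⟨x1, x2⟩ := x
    rw [hgt_pair] at hxQ
    have h2 : x2.length ≤ QF.eval (hgt a + ν) := (length_le_hgt x2).trans (by omega)
    refine (TRuns.snd (TRuns.mapC (t := Pq.eval (QF.eval (hgt a + ν) + (hgt a + ν))) (q := 1)
      fun w hw => (hq O p ν hO hp w).mono (polyEval_mono _ ?_) le_rfl)).mono ?_ (by
        simp only at hlen; omega)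
    · have := hgt_le_of_mem hw
      omega
    · have := Nat.mul_le_mul_right (Pq.eval (QF.eval (hgt a + ν) + (hgt a + ν)) + 50) h2
      omega
  have r3 := TRuns.comp r1 (p₂ := fun l => listM (fun x => (listM (fun w : Rest × ℕ × Bool =>
    (p w.1).map fun y => y.getD w.2.1 false == w.2.2) x.2).map fun z => (x.1, z)) l) (c₂ := mapC (sndC (mapC cq))) fun b hb => by
    simp only [PMF.support_pure, Set.mem_singleton_iff] at hb
    subst hb
    exact TRuns.mapC r2
  rw [PMF.pure_bind] at r3
  refine Runs.congr r3 ?_ ?_ ?_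
  · rw [hl, listM_map_left]
    simp only [listM_map_left]
    rfl
  · have h2 : l.length ≤ QF.eval (hgt a + ν) := (length_le_hgt l).trans hlQ
    have h3 := Nat.mul_le_mul_right (QF.eval (hgt a + ν) *
      (Pq.eval (QF.eval (hgt a + ν) + (hgt a + ν)) + 50) + 20 + 50) h2
    have h4 := polyEval_mono PF (a := hgt a) (b := hgt a + ν) (by omega)
    simp only [Polynomial.eval_add, Polynomial.eval_mul, Polynomial.eval_comp, Polynomial.eval_X,
      Polynomial.eval_ofNat]
    omega
  · simp [hl]

end


/-! ### Correctness of the compiled circuit -/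

/-- The values of all wires. -/
def wires (g : Gates) (x : Pt) : List Bool :=
  g.foldl (fun w p => w ++ [!(w.getD p.1 false && w.getD p.2 false)]) x

/-- The value of the wire `t`. -/
def wire (g : Gates) (x : Pt) (t : ℕ) : Bool := (wires g x).getD t false

theorem wires_append_singleton (g : Gates) (x : Pt) (p : ℕ × ℕ) :
    wires (g ++ [p]) x = wires g x ++ [!(wire g x p.1 && wire g x p.2)] := by
  simp [wires, wire]

theorem length_wires (g : Gates) (x : Pt) : (wires g x).length = x.length + g.length := by
  induction g using List.reverseRecOn with
  | nil => simp [wires]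
  | append_singleton g p ih => rw [wires_append_singleton]; simp [ih]; omega

theorem wire_append_of_lt {g : Gates} {x : Pt} {t : ℕ} (h : Gates) (ht : t < x.length + g.length) :
    wire (g ++ h) x t = wire g x t := by
  induction h using List.reverseRecOn with
  | nil => simp
  | append_singleton h p ih =>
    rw [← ih, ← List.append_assoc]
    unfold wire
    rw [wires_append_singleton, List.getD_append]
    rw [length_wires]; simp; omega

theorem wire_append_last (g : Gates) (x : Pt) (a b : ℕ) :
    wire (g ++ [(a, b)]) x (x.length + g.length) = !(wire g x a && wire g x b) := by
  unfold wire
  rw [wires_append_singleton, List.getD_append_right _ _ _ _ (by rw [length_wires]), length_wires]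
  simp [wire]

theorem wire_of_le {g : Gates} {x : Pt} {t : ℕ} (ht : x.length + g.length ≤ t) :
    wire g x t = false := by
  unfold wire
  rw [List.getD_eq_default _ _ (by rw [length_wires]; exact ht)]

theorem evalGates_eq_wire (g : Gates) (x : Pt) :
    evalGates g x = wire g x (x.length + g.length - 1) := by
  have : evalGates g x = (wires g x).getLastD false := rfl
  rw [this, wire, ← length_wires, List.getLastD_eq_getLast?, List.getLast?_eq_getElem?,
    List.getD_eq_getElem?_getD]

theorem wire_append_two (g : Gates) (x : Pt) (a b c d : ℕ) :
    wire (g ++ [(a, b), (c, d)]) x (x.length + g.length + 1) =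
      !(wire (g ++ [(a, b)]) x c && wire (g ++ [(a, b)]) x d) := by
  have := wire_append_last (g ++ [(a, b)]) x c d
  rw [List.append_assoc, List.length_append] at this
  exact this

theorem wire_append_three (g : Gates) (x : Pt) (a b c d e f : ℕ) :
    wire (g ++ [(a, b), (c, d), (e, f)]) x (x.length + g.length + 2) =
      !(wire (g ++ [(a, b), (c, d)]) x e && wire (g ++ [(a, b), (c, d)]) x f) := by
  have := wire_append_last (g ++ [(a, b), (c, d)]) x e f
  rw [List.append_assoc, List.length_append] at this
  exact this

/-- The condition that `ρ` imposes on the coordinate `i`. -/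
def litHolds (ρ : Rest) (x : Pt) (i : ℕ) : Bool :=
  (ρ.getD i none).elim true fun b => b == x.getD i false

theorem wire_input {g : Gates} {x : Pt} {i : ℕ} (hi : i < x.length) :
    wire g x i = x.getD i false := by
  have := wire_append_of_lt (g := []) g (x := x) (t := i) (by simpa using hi)
  rw [List.nil_append] at this
  rw [this]; rfl

theorem addLit_spec {x : Pt} {ρ : Rest} {i : ℕ} {s : Gates × ℕ} (hi : i < x.length)
    (hs : s.2 < x.length + s.1.length) :
    (∃ h, (addLit x.length ρ i s).1 = s.1 ++ h) ∧
    (addLit x.length ρ i s).2 < x.length + (addLit x.length ρ i s).1.length ∧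
    wire (addLit x.length ρ i s).1 x (addLit x.length ρ i s).2 =
      (wire s.1 x s.2 && litHolds ρ x i) := by
  obtain ⟨g, t⟩ := s
  simp only at hs
  unfold addLit litHolds
  cases ρ.getD i none with
  | none => exact ⟨⟨[], by simp⟩, by simpa using hs, by simp⟩
  | some b =>
    have hin : ∀ h : Gates, wire h x i = x.getD i false := fun h => wire_input hi
    cases b
    · refine ⟨⟨_, rfl⟩, by simp; omega, ?_⟩
      simp only [Option.elim, Bool.false_eq_true, if_false]
      rw [wire_append_three, wire_append_two, wire_append_last, wire_append_of_lt _ hs, hin]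
      cases wire g x t <;> cases x.getD i false <;> rfl
    · refine ⟨⟨_, rfl⟩, by simp; omega, ?_⟩
      simp only [Option.elim, if_true]
      rw [wire_append_two, wire_append_last, hin]
      cases wire g x t <;> cases x.getD i false <;> rfl

theorem foldl_addLit_spec {x : Pt} {ρ : Rest} : ∀ (l : List ℕ) (s : Gates × ℕ),
    (∀ i ∈ l, i < x.length) → s.2 < x.length + s.1.length →
    (∃ h, (l.foldl (fun s i => addLit x.length ρ i s) s).1 = s.1 ++ h) ∧
    (l.foldl (fun s i => addLit x.length ρ i s) s).2 <
      x.length + (l.foldl (fun s i => addLit x.length ρ i s) s).1.length ∧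
    wire (l.foldl (fun s i => addLit x.length ρ i s) s).1 x
      (l.foldl (fun s i => addLit x.length ρ i s) s).2 =
      (wire s.1 x s.2 && l.all (litHolds ρ x)) := by
  intro l
  induction l with
  | nil => intro s _ hs; exact ⟨⟨[], by simp⟩, hs, by simp⟩
  | cons i l ih =>
    intro s h hs
    obtain ⟨⟨h1, e1⟩, a1, b1⟩ := addLit_spec (ρ := ρ) (h i (by simp)) hs
    obtain ⟨⟨h2, e2⟩, a2, b2⟩ := ih _ (fun j hj => h j (by simp [hj])) a1
    rw [List.foldl_cons]
    refine ⟨⟨h1 ++ h2, by rw [e2, e1, List.append_assoc]⟩, a2, ?_⟩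
    rw [b2, b1, List.all_cons, Bool.and_assoc]

theorem length_overwrite (ρ : Rest) (x u : Pt) : (overwrite ρ x u).length = x.length := by
  simp [overwrite]

theorem getD_overwrite (ρ : Rest) (x u : Pt) {i : ℕ} (hi : i < x.length) :
    (overwrite ρ x u).getD i false =
      if (ρ.getD i none).isSome then u.getD i false else x.getD i false := by
  unfold overwrite
  rw [List.getD_eq_getElem?_getD, List.getElem?_map, List.getElem?_range hi]
  rfl

theorem wire_remap {x : Pt} {ℓ : Leaf} {gs : Gates} (h2 : 2 ≤ gs.length)
    (ht : wire gs x x.length = true) (hf : wire gs x (x.length + 1) = false) (g : Gates) (i : ℕ) :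
    wire (gs ++ g.map (fun p => (remap x.length ℓ (x.length + gs.length) p.1,
      remap x.length ℓ (x.length + gs.length) p.2))) x (remap x.length ℓ (x.length + gs.length) i) =
    wire g (overwrite ℓ.1 x ℓ.2.1) i := by
  have hlow : ∀ i, i < x.length → remap x.length ℓ (x.length + gs.length) i <
      x.length + gs.length := by
    intro i hi
    unfold remap
    split_ifs <;> simp_all <;> omega
  have hhigh : ∀ i, x.length ≤ i → remap x.length ℓ (x.length + gs.length) i =
      x.length + gs.length + (i - x.length) := by
    intro i hi
    unfold remap
    rw [if_neg (by simp; omega)]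
  induction g using List.reverseRecOn generalizing i with
  | nil =>
    simp only [List.map_nil, List.append_nil]
    by_cases hi : i < x.length
    · have : wire [] (overwrite ℓ.1 x ℓ.2.1) i = (overwrite ℓ.1 x ℓ.2.1).getD i false := rfl
      rw [this, getD_overwrite _ _ _ hi]
      unfold remap
      rw [if_pos (by simp; omega)]
      split_ifs with h3 h4
      · rw [ht]; exact h4.symm
      · rw [hf]; exact (Bool.not_eq_true _ ▸ h4).symm
      · exact wire_input hi
    · rw [hhigh i (by omega), wire_of_le (by omega), wire_of_le]
      simp [length_overwrite]; omega
  | append_singleton g p ih =>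
    rw [List.map_append, ← List.append_assoc, List.map_singleton]
    set G := gs ++ g.map (fun p => (remap x.length ℓ (x.length + gs.length) p.1,
      remap x.length ℓ (x.length + gs.length) p.2)) with hG
    have hGl : G.length = gs.length + g.length := by simp [hG]
    have hy := length_overwrite ℓ.1 x ℓ.2.1
    rcases lt_trichotomy i (x.length + g.length) with hi | hi | hi
    · rw [wire_append_of_lt, ih, wire_append_of_lt]
      · rw [hy]; exact hi
      · by_cases h : i < x.length
        · have := hlow i h; omega
        · rw [hhigh i (by omega)]; omega
    · have e1 : remap x.length ℓ (x.length + gs.length) i = x.length + G.length := by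
        rw [hhigh i (by omega)]; omega
      have e2 : i = (overwrite ℓ.1 x ℓ.2.1).length + g.length := by rw [hy]; exact hi
      rw [e1, wire_append_last, ih, ih]
      conv_rhs => rw [e2]
      rw [wire_append_last]
    · rw [hhigh i (by omega), wire_of_le, wire_of_le]
      · rw [hy]; simp; omega
      · simp; omega

/-- The value of a leaf as a function on the whole cube. -/
def leafHolds (x : Pt) (ℓ : Leaf) : Bool :=
  inCube ℓ.1 x && evalGates ℓ.2.2 (overwrite ℓ.1 x ℓ.2.1)

theorem addCube_spec {x : Pt} {ℓ : Leaf} {gs : Gates} (hx : 1 ≤ x.length)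
    (hl : ℓ.1.length = x.length) (h2 : 2 ≤ gs.length)
    (ht : wire gs x x.length = true) (hf : wire gs x (x.length + 1) = false) :
    (∃ h, (addCube x.length ℓ gs).1 = gs ++ h) ∧
    (addCube x.length ℓ gs).2 < x.length + (addCube x.length ℓ gs).1.length ∧
    wire (addCube x.length ℓ gs).1 x (addCube x.length ℓ gs).2 = leafHolds x ℓ := by
  have hw := wire_remap (ℓ := ℓ) h2 ht hf ℓ.2.2 (x.length + ℓ.2.2.length - 1)
  obtain ⟨⟨h, e⟩, a, b⟩ := foldl_addLit_spec (x := x) (ρ := ℓ.1) (List.range x.length)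
    (gs ++ ℓ.2.2.map (fun p => (remap x.length ℓ (x.length + gs.length) p.1,
      remap x.length ℓ (x.length + gs.length) p.2)),
      remap x.length ℓ (x.length + gs.length) (x.length + ℓ.2.2.length - 1))
    (fun i hi => List.mem_range.1 hi) (by
      simp only [List.length_append, List.length_map]
      unfold remap
      split_ifs with h3 <;> simp at h3 <;> omega)
  refine ⟨⟨_, by unfold addCube; rw [e, List.append_assoc]⟩, a, ?_⟩
  unfold addCube
  rw [b, hw, leafHolds, evalGates_eq_wire, length_overwrite, Bool.and_comm]
  congr 1
  unfold inCube
  rw [hl]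
  rfl

theorem evalGates_compileLeaves {x : Pt} {ls : List Leaf} (hx : 1 ≤ x.length)
    (hl : ∀ ℓ ∈ ls, ℓ.1.length = x.length) :
    evalGates (compileLeaves x.length ls) x = ls.any (leafHolds x) := by
  have key : ∀ (ls : List Leaf) (s : Gates × ℕ), (∀ ℓ ∈ ls, ℓ.1.length = x.length) →
      2 ≤ s.1.length → wire s.1 x x.length = true → wire s.1 x (x.length + 1) = false →
      s.2 + 1 = x.length + s.1.length →
      evalGates (ls.foldl (fun s ℓ => addOr x.length s.2 (addCube x.length ℓ s.1)) s).1 x =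
        (wire s.1 x s.2 || ls.any (leafHolds x)) := by
    intro ls
    induction ls with
    | nil =>
      intro s _ _ _ _ h
      rw [List.foldl_nil, evalGates_eq_wire, ← h]
      simp
    | cons ℓ ls ih =>
      intro s hls h2 ht hf hs
      obtain ⟨⟨h, e⟩, a, b⟩ := addCube_spec hx (hls ℓ (by simp)) h2 ht hf
      rw [List.foldl_cons, List.any_cons, ← Bool.or_assoc]
      set s' := addCube x.length ℓ s.1 with hs'
      have hlen : s.1.length ≤ s'.1.length := by rw [e]; simp
      rw [ih _ (fun ℓ' h' => hls ℓ' (by simp [h']))]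
      · congr 1
        unfold addOr
        have e3 : wire (s'.1 ++ [(s.2, s.2), (s'.2, s'.2)]) x (x.length + s'.1.length) =
            wire (s'.1 ++ [(s.2, s.2)]) x (x.length + s'.1.length) := by
          have := wire_append_of_lt (g := s'.1 ++ [(s.2, s.2)]) (x := x)
            (t := x.length + s'.1.length) [(s'.2, s'.2)] (by simp)
          rwa [List.append_assoc] at this
        rw [wire_append_three, e3, wire_append_two, wire_append_last, wire_append_of_lt _ a, b]
        rw [show wire s'.1 x s.2 = wire s.1 x s.2 by rw [e, wire_append_of_lt _ (by omega)]]
        cases wire s.1 x s.2 <;> cases leafHolds x ℓ <;> rfl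
      · unfold addOr; simp
      · unfold addOr; simp only
        rw [wire_append_of_lt _ (by omega), e, wire_append_of_lt _ (by omega), ht]
      · unfold addOr; simp only
        rw [wire_append_of_lt _ (by omega), e, wire_append_of_lt _ (by omega), hf]
      · unfold addOr; simp; omega
  have h1 : wire [(x.length, x.length), (x.length, x.length)] x x.length = true := by
    have := wire_append_of_lt (g := [(x.length, x.length)]) [(x.length, x.length)] (x := x)
      (t := x.length) (by simp)
    rw [List.singleton_append] at this
    rw [this]
    have := wire_append_last [] x x.length x.length
    simp only [List.nil_append, List.length_nil, add_zero] at this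
    rw [this, wire_of_le (by simp)]; rfl
  have h2 : wire [(x.length, x.length), (x.length, x.length)] x (x.length + 1) = false := by
    have := wire_append_two [] x x.length x.length x.length x.length
    simp only [List.nil_append, List.length_nil, add_zero] at this
    rw [this]
    have := wire_append_last [] x x.length x.length
    simp only [List.nil_append, List.length_nil, add_zero] at this
    rw [this, wire_of_le (by simp)]; rfl
  unfold compileLeaves
  rw [key ls _ hl (by simp) h1 h2 (by simp), h2, Bool.false_or]

theorem decodeCircuit_enc (g : Gates) : decodeCircuit (Enc.enc g) = g := by
  have hn : ∀ k : ℕ, (Enc.enc k).toNat = k := by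
    intro k
    induction k with
    | zero => rfl
    | succ k ih => show (Enc.enc k).toNat + 1 = _; rw [ih]
  have : ∀ g : Gates, (Enc.enc g).toList = g.map Enc.enc := by
    intro g
    induction g with
    | nil => rfl
    | cons p g ih => rw [enc_cons, Data.toList, ih]; rfl
  rw [decodeCircuit, this, List.map_map]
  conv_rhs => rw [← List.map_id g]
  refine List.map_congr_left fun p _ => ?_
  show ((Enc.enc p.1).toNat, (Enc.enc p.2).toNat) = p
  rw [hn, hn]

/-! ### The search for the best subdivision -/

/-- The part of the search space that starts from the subcube `ρ`, up to `r` subdivisions. -/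
def seg (T : ℕ) (Z : List (Pt × Pt)) : ℕ → Rest → List Item
  | 0, ρ => [some (ρ, true)]
  | r + 1, ρ => some (ρ, false) :: (cands T Z ρ).flatMap fun i =>
      seg T Z r (ρ.set i (some false)) ++ (seg T Z r (ρ.set i (some true)) ++ [none])

theorem length_cands (T : ℕ) (Z : List (Pt × Pt)) (ρ : Rest) : (cands T Z ρ).length ≤ T ^ 2 := by
  unfold cands
  exact (List.length_take_le _ _)

theorem length_seg {T : ℕ} (hT : 1 ≤ T) (Z : List (Pt × Pt)) : ∀ (r : ℕ) (ρ : Rest),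
    (seg T Z r ρ).length ≤ (4 * T ^ 2) ^ r := by
  intro r
  induction r with
  | zero => intro ρ; simp [seg]
  | succ r ih =>
    intro ρ
    have h : ∀ l : List ℕ, (l.flatMap fun i => seg T Z r (ρ.set i (some false)) ++
        (seg T Z r (ρ.set i (some true)) ++ [none])).length ≤ l.length * (2 * (4 * T ^ 2) ^ r + 1) := by
      intro l
      induction l with
      | nil => simp
      | cons i l ihl =>
        have h0 := ih (ρ.set i (some false))
        have h1 := ih (ρ.set i (some true))
        rw [List.flatMap_cons, List.length_append, List.length_cons, Nat.add_mul]
        simp only [List.length_append, List.length_singleton]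
        omega
    have h1 := (h (cands T Z ρ)).trans (Nat.mul_le_mul_right _ (length_cands T Z ρ))
    have h2 : 1 ≤ (4 * T ^ 2) ^ r := Nat.one_le_pow _ _ (by positivity)
    have h3 : 1 ≤ T ^ 2 := Nat.one_le_pow _ _ hT
    rw [seg, List.length_cons, pow_succ]
    nlinarith [Nat.mul_le_mul h3 h2]

/-- One round of subdivisions. -/
def expandAll (T : ℕ) (Z : List (Pt × Pt)) (s : List Item) : List Item := s.flatMap (expand T Z)

theorem iterate_expandAll_append (T : ℕ) (Z : List (Pt × Pt)) (r : ℕ) (s t : List Item) :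
    (expandAll T Z)^[r] (s ++ t) = (expandAll T Z)^[r] s ++ (expandAll T Z)^[r] t := by
  induction r generalizing s t with
  | zero => rfl
  | succ r ih => simp only [Function.iterate_succ, Function.comp, expandAll, List.flatMap_append, ih]

theorem iterate_expandAll (T : ℕ) (Z : List (Pt × Pt)) (r : ℕ) (ρ : Rest) :
    (expandAll T Z)^[r] [some (ρ, true)] = seg T Z r ρ := by
  have h0 : ∀ r, (expandAll T Z)^[r] [] = [] := fun r => Function.iterate_fixed rfl r
  induction r generalizing ρ with
  | zero => rfl
  | succ r ih =>
    have h1 : ∀ ρ, (expandAll T Z)^[r] [some (ρ, false)] = [some (ρ, false)] := fun ρ =>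
      Function.iterate_fixed rfl r
    have h2 : (expandAll T Z)^[r] [none] = [none] := Function.iterate_fixed rfl r
    have h3 : ∀ l : List ℕ, (expandAll T Z)^[r] (l.flatMap fun i => [some (ρ.set i (some false), true),
        some (ρ.set i (some true), true), none]) = l.flatMap fun i =>
        seg T Z r (ρ.set i (some false)) ++ (seg T Z r (ρ.set i (some true)) ++ [none]) := by
      intro l
      induction l with
      | nil => exact h0 r
      | cons i l ihl =>
        rw [List.flatMap_cons, List.flatMap_cons, iterate_expandAll_append, ihl,
          show [some (ρ.set i (some false), true), some (ρ.set i (some true), true), none] =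
            [some (ρ.set i (some false), true)] ++ ([some (ρ.set i (some true), true)] ++ [none])
            from rfl, iterate_expandAll_append, iterate_expandAll_append, ih, ih, h2]
    rw [Function.iterate_succ, Function.comp, show expandAll T Z [some (ρ, true)] =
      [some (ρ, false)] ++ (cands T Z ρ).flatMap (fun i => [some (ρ.set i (some false), true),
        some (ρ.set i (some true), true), none]) by simp [expandAll, expand],
      iterate_expandAll_append, h1, h3, seg, List.singleton_append]

/-- The cut-off in `codeOf` has no effect if `L` is at least the length of the code. -/
theorem codeOf_eq_seg {T : ℕ} (hT : 1 ≤ T) (Z : List (Pt × Pt)) (n d L : ℕ)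
    (hL : (4 * T ^ 2) ^ d ≤ L) : codeOf T Z n d L = seg T Z d (List.replicate n none) := by
  have key : ∀ k ≤ d, (List.replicate k ()).foldl (fun s _ => (s.flatMap (expand T Z)).take L)
      [some (List.replicate n none, true)] = seg T Z k (List.replicate n none) := by
    intro k
    induction k with
    | zero => intro _; rfl
    | succ k ih =>
      intro hk
      rw [List.replicate_succ', List.foldl_append, ih (by omega), List.foldl_cons, List.foldl_nil,
        ← iterate_expandAll, ← iterate_expandAll, Function.iterate_succ_apply']
      refine List.take_of_length_le ?_
      have := length_seg hT Z (k + 1) (List.replicate n none)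
      rw [← iterate_expandAll, Function.iterate_succ_apply'] at this
      exact this.trans ((Nat.pow_le_pow_right (by positivity) hk).trans hL)
  exact key d le_rfl

theorem minV_le_left (a b : Value) : (minV a b).1 ≤ a.1 := by
  unfold minV; split_ifs with h <;> simp at h <;> omega

theorem minV_le_right (a b : Value) : (minV a b).1 ≤ b.1 := by
  unfold minV; split_ifs with h <;> simp at h <;> omega

theorem minV_eq (a b : Value) : minV a b = a ∨ minV a b = b := by
  unfold minV; split_ifs <;> simp

theorem foldl_minV (f : α → Value) (l : List α) (v : Value) :
    (l.foldl (fun s h => minV s (f h)) v).1 ≤ v.1 ∧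
    (∀ h ∈ l, (l.foldl (fun s h => minV s (f h)) v).1 ≤ (f h).1) ∧
    (l.foldl (fun s h => minV s (f h)) v = v ∨
      ∃ h ∈ l, l.foldl (fun s h => minV s (f h)) v = f h) := by
  induction l generalizing v with
  | nil => simp
  | cons a l ih =>
    obtain ⟨h1, h2, h3⟩ := ih (minV v (f a))
    have e1 := minV_le_left v (f a)
    have e2 := minV_le_right v (f a)
    rw [List.foldl_cons]
    refine ⟨h1.trans e1, fun h hh => ?_, ?_⟩
    · rcases List.mem_cons.1 hh with rfl | hh
      · exact h1.trans e2
      · exact h2 h hh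
    · rcases h3 with h3 | ⟨h, hh, h3⟩
      · rcases minV_eq v (f a) with e | e
        · exact Or.inl (h3.trans e)
        · exact Or.inr ⟨a, by simp, h3.trans e⟩
      · exact Or.inr ⟨h, by simp [hh], h3⟩

/-- The hypotheses that are tried on a subcube: those that are given, and the empty circuit, so that
there always is one. -/
def tried (hs : List (Pt × Gates)) : Set (Pt × Gates) := {h | h ∈ hs ∨ h = ([], [])}

theorem leafVal_spec (S : List (Bool × Pt)) (ρ : Rest) (hs : List (Pt × Gates)) :
    (∀ h ∈ tried hs, (leafVal S ρ hs).1 ≤ leafErr S (ρ, h)) ∧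
    ∃ h ∈ tried hs, leafVal S ρ hs = (leafErr S (ρ, h), [(ρ, h)]) := by
  obtain ⟨h1, h2, h3⟩ := foldl_minV (fun h => ((leafErr S (ρ, h), [(ρ, h)]) : Value)) hs
    (leafErr S (ρ, [], []), [(ρ, [], [])])
  refine ⟨fun h hh => ?_, ?_⟩
  · rcases hh with hh | rfl
    · exact h2 h hh
    · exact h1
  · rcases h3 with h3 | ⟨h, hh, h3⟩
    · exact ⟨([], []), Or.inr rfl, h3⟩
    · exact ⟨h, Or.inl hh, h3⟩

/-- `v` is an optimal value over the search space `seg T Z r ρ`, with the hypotheses from `res`. -/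
def IsOpt (T : ℕ) (Z : List (Pt × Pt)) (S : List (Bool × Pt))
    (res : List (Option Rest × List (Pt × Gates))) : ℕ → Rest → Value → Prop
  | 0, ρ, v => ∃ hs, (some ρ, hs) ∈ res ∧ v = leafVal S ρ hs
  | r + 1, ρ, v => ∃ hs, (some ρ, hs) ∈ res ∧ v.1 ≤ (leafVal S ρ hs).1 ∧
      (∀ i ∈ cands T Z ρ, ∃ v₀ v₁, IsOpt T Z S res r (ρ.set i (some false)) v₀ ∧
        IsOpt T Z S res r (ρ.set i (some true)) v₁ ∧ v.1 ≤ v₀.1 + v₁.1) ∧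
      (v = leafVal S ρ hs ∨ ∃ i ∈ cands T Z ρ, ∃ v₀ v₁,
        IsOpt T Z S res r (ρ.set i (some false)) v₀ ∧
        IsOpt T Z S res r (ρ.set i (some true)) v₁ ∧ v = (v₀.1 + v₁.1, v₀.2 ++ v₁.2))

/-- The evaluation of the code for the subcube `ρ` pushes one value onto the stack, which is optimal. -/
theorem foldl_stackStep (T : ℕ) (Z : List (Pt × Pt)) (S : List (Bool × Pt))
    (res₀ : List (Option Rest × List (Pt × Gates))) : ∀ (r : ℕ) (ρ : Rest)
    (res : List (Option Rest × List (Pt × Gates))), (∀ x ∈ res, x ∈ res₀) →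
    res.map Prod.fst = (seg T Z r ρ).map (Option.map Prod.fst) →
    ∃ v, IsOpt T Z S res₀ r ρ v ∧ ∀ st, res.foldl (fun st it => stackStep S it st) st = v :: st := by
  intro r
  induction r with
  | zero =>
    intro ρ res hmem h
    rw [seg, List.map_singleton, Option.map_some] at h
    obtain ⟨⟨o, hs⟩, rfl, rfl⟩ := List.map_eq_singleton_iff.1 h
    exact ⟨_, ⟨hs, hmem _ (by simp), rfl⟩, fun st => rfl⟩
  | succ r ih =>
    intro ρ res hmem h
    rw [seg, List.map_cons, Option.map_some] at h
    obtain ⟨⟨o, hs⟩, res', rfl, rfl, h'⟩ := List.map_eq_cons_iff.1 h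
    have key : ∀ (l : List ℕ) (res : List (Option Rest × List (Pt × Gates))) (v : Value),
        (∀ x ∈ res, x ∈ res₀) →
        res.map Prod.fst = (l.flatMap fun i => seg T Z r (ρ.set i (some false)) ++
          (seg T Z r (ρ.set i (some true)) ++ [none])).map (Option.map Prod.fst) →
        ∃ w : Value, w.1 ≤ v.1 ∧
        (∀ i ∈ l, ∃ v₀ v₁, IsOpt T Z S res₀ r (ρ.set i (some false)) v₀ ∧
          IsOpt T Z S res₀ r (ρ.set i (some true)) v₁ ∧ w.1 ≤ v₀.1 + v₁.1) ∧
        (w = v ∨ ∃ i ∈ l, ∃ v₀ v₁, IsOpt T Z S res₀ r (ρ.set i (some false)) v₀ ∧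
          IsOpt T Z S res₀ r (ρ.set i (some true)) v₁ ∧ w = (v₀.1 + v₁.1, v₀.2 ++ v₁.2)) ∧
        ∀ st, res.foldl (fun st it => stackStep S it st) (v :: st) = w :: st := by
      intro l
      induction l with
      | nil =>
        intro res v _ h
        rw [List.flatMap_nil, List.map_nil, List.map_eq_nil_iff] at h
        subst h
        exact ⟨v, le_rfl, by simp, Or.inl rfl, fun st => rfl⟩
      | cons i l ihl =>
        intro res v hmem h
        rw [List.flatMap_cons, List.append_assoc, List.append_assoc, List.map_append,
          List.map_append] at h
        obtain ⟨r0, res1, rfl, e0, h⟩ := List.map_eq_append_iff.1 h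
        obtain ⟨r1, res2, rfl, e1, h⟩ := List.map_eq_append_iff.1 h
        rw [List.singleton_append, List.map_cons] at h
        obtain ⟨⟨o, hs⟩, res', rfl, ho, h'⟩ := List.map_eq_cons_iff.1 h
        simp only [Option.map_none] at ho
        subst ho
        obtain ⟨v0, o0, f0⟩ := ih _ r0 (fun x hx => hmem x (by simp [hx])) e0
        obtain ⟨v1, o1, f1⟩ := ih _ r1 (fun x hx => hmem x (by simp [hx])) e1
        obtain ⟨w, w1, w2, w3, w4⟩ := ihl res' (minV v (v0.1 + v1.1, v0.2 ++ v1.2))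
          (fun x hx => hmem x (by simp [hx])) h'
        refine ⟨w, w1.trans (minV_le_left _ _), fun j hj => ?_, ?_, fun st => ?_⟩
        · rcases List.mem_cons.1 hj with rfl | hj
          · exact ⟨v0, v1, o0, o1, w1.trans (minV_le_right _ _)⟩
          · exact w2 j hj
        · rcases w3 with w3 | ⟨j, hj, w3⟩
          · rcases minV_eq v (v0.1 + v1.1, v0.2 ++ v1.2) with e | e
            · exact Or.inl (w3.trans e)
            · exact Or.inr ⟨i, by simp, v0, v1, o0, o1, w3.trans e⟩
          · exact Or.inr ⟨j, by simp [hj], w3⟩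
        · rw [List.foldl_append, List.foldl_append, f0, f1, List.foldl_cons]
          exact w4 st
    obtain ⟨w, w1, w2, w3, w4⟩ := key _ res' (leafVal S ρ hs) (fun x hx => hmem x (by simp [hx])) h'
    exact ⟨w, ⟨hs, hmem _ (by simp), w1, w2, w3⟩, fun st => w4 st⟩

theorem exists_isOpt (T : ℕ) (Z : List (Pt × Pt)) (S : List (Bool × Pt))
    (res : List (Option Rest × List (Pt × Gates))) (r : ℕ) (ρ : Rest)
    (h : res.map Prod.fst = (seg T Z r ρ).map (Option.map Prod.fst)) :
    ∃ v, IsOpt T Z S res r ρ v ∧ bestLeaves S res = v.2 := by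
  obtain ⟨v, hv, hf⟩ := foldl_stackStep T Z S res r ρ res (fun _ h => h) h
  exact ⟨v, hv, by rw [bestLeaves, hf]; rfl⟩

theorem cands_spec {T : ℕ} {Z : List (Pt × Pt)} {ρ : Rest} {i : ℕ} (h : i ∈ cands T Z ρ) :
    i < ρ.length ∧ ρ.getD i none = none ∧ isCand T Z ρ i = true := by
  have := List.mem_filter.1 (List.mem_of_mem_take h)
  refine ⟨List.mem_range.1 this.1, ?_, this.2⟩
  have h2 := this.2
  simp only [isCand, Bool.and_eq_true, Bool.not_eq_true', Option.isSome_eq_false_iff,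
    Option.isNone_iff_eq_none] at h2
  exact h2.1

theorem getD_set_eq (ρ : Rest) {i : ℕ} (hi : i < ρ.length) (o : Option Bool) :
    (ρ.set i o).getD i none = o := by
  simp [List.getD_eq_getElem?_getD, hi]

theorem getD_set_ne (ρ : Rest) {i j : ℕ} (hij : i ≠ j) (o : Option Bool) :
    (ρ.set i o).getD j none = ρ.getD j none := by
  simp [List.getD_eq_getElem?_getD, hij]

theorem inCube_iff {ρ : Rest} {x : Pt} :
    inCube ρ x = true ↔ ∀ i < ρ.length, ∀ b, ρ.getD i none = some b → b = x.getD i false := by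
  simp only [inCube, List.all_eq_true, List.mem_range]
  refine forall₂_congr fun i _ => ?_
  cases ρ.getD i none <;> simp

theorem inCube_set {ρ : Rest} {x : Pt} {i : ℕ} (hi : i < ρ.length) (hρ : ρ.getD i none = none)
    (b : Bool) : inCube (ρ.set i (some b)) x = (inCube ρ x && (x.getD i false == b)) := by
  rw [Bool.eq_iff_iff, Bool.and_eq_true, inCube_iff, inCube_iff, beq_iff_eq, List.length_set]
  constructor
  · intro h
    refine ⟨fun j hj c hc => ?_, (h i hi b (getD_set_eq _ hi _)).symm⟩
    have hij : i ≠ j := by rintro rfl; rw [hρ] at hc; cases hc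
    exact h j hj c (by rw [getD_set_ne _ hij, hc])
  · rintro ⟨h1, h2⟩ j hj c hc
    by_cases hij : i = j
    · subst hij
      rw [getD_set_eq _ hi, Option.some.injEq] at hc
      rw [h2, hc]
    · rw [getD_set_ne _ hij] at hc
      exact h1 j hj c hc

theorem inCube_replicate (n : ℕ) (x : Pt) : inCube (List.replicate n none) x = true := by
  rw [inCube_iff]
  intro i hi b h
  simp at hi
  simp [List.getD_eq_getElem?_getD, hi] at h

/-- The leaves of an optimal value: they are at most `2 ^ r` hypotheses that were tried, their
errors add up, and each point of the subcube lies in exactly one of them. -/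
theorem IsOpt.leaves {T : ℕ} {Z : List (Pt × Pt)} {S : List (Bool × Pt)}
    {res : List (Option Rest × List (Pt × Gates))} : ∀ {r : ℕ} {ρ : Rest} {v : Value},
    IsOpt T Z S res r ρ v →
    v.2.length ≤ 2 ^ r ∧ (∀ ℓ ∈ v.2, ℓ.1.length = ρ.length ∧
      ∃ hs, (some ℓ.1, hs) ∈ res ∧ ℓ.2 ∈ tried hs) ∧
    v.1 = (v.2.map (leafErr S)).sum ∧
    ∀ x, v.2.countP (fun ℓ => inCube ℓ.1 x) = if inCube ρ x then 1 else 0 := by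
  have leaf : ∀ (r : ℕ) (ρ : Rest) (hs : List (Pt × Gates)), (some ρ, hs) ∈ res →
      (leafVal S ρ hs).2.length ≤ 2 ^ r ∧ (∀ ℓ ∈ (leafVal S ρ hs).2, ℓ.1.length = ρ.length ∧
      ∃ hs, (some ℓ.1, hs) ∈ res ∧ ℓ.2 ∈ tried hs) ∧
      (leafVal S ρ hs).1 = ((leafVal S ρ hs).2.map (leafErr S)).sum ∧
      ∀ x, (leafVal S ρ hs).2.countP (fun ℓ => inCube ℓ.1 x) = if inCube ρ x then 1 else 0 := by
    intro r ρ hs hmem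
    obtain ⟨h, hh, e⟩ := (leafVal_spec S ρ hs).2
    rw [e]
    refine ⟨by simpa using Nat.one_le_two_pow, fun ℓ hl => ?_, by simp, fun x => by
      simp [List.countP_cons]⟩
    rw [List.mem_singleton.1 hl]
    exact ⟨rfl, hs, hmem, hh⟩
  intro r
  induction r with
  | zero =>
    rintro ρ v ⟨hs, hmem, rfl⟩
    exact leaf 0 ρ hs hmem
  | succ r ih =>
    rintro ρ v ⟨hs, hmem, -, -, rfl | ⟨i, hi, v0, v1, o0, o1, rfl⟩⟩
    · exact leaf (r + 1) ρ hs hmem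
    · obtain ⟨a0, b0, c0, d0⟩ := ih o0
      obtain ⟨a1, b1, c1, d1⟩ := ih o1
      obtain ⟨hi, hf, -⟩ := cands_spec hi
      refine ⟨by simp only [List.length_append, pow_succ]; omega, fun ℓ hl => ?_, by
        simp [c0, c1], fun x => ?_⟩
      · rcases List.mem_append.1 hl with hl | hl
        · simpa using b0 ℓ hl
        · simpa using b1 ℓ hl
      · rw [List.countP_append, d0, d1, inCube_set hi hf, inCube_set hi hf]
        cases inCube ρ x <;> cases x.getD i false <;> rfl

theorem IsOpt.le_leaf {T : ℕ} {Z : List (Pt × Pt)} {S : List (Bool × Pt)}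
    {res : List (Option Rest × List (Pt × Gates))} {r : ℕ} {ρ : Rest} {v : Value}
    (h : IsOpt T Z S res r ρ v) :
    ∃ hs, (some ρ, hs) ∈ res ∧ ∀ h ∈ tried hs, v.1 ≤ leafErr S (ρ, h) := by
  cases r with
  | zero =>
    obtain ⟨hs, hmem, rfl⟩ := h
    exact ⟨hs, hmem, (leafVal_spec S ρ hs).1⟩
  | succ r =>
    obtain ⟨hs, hmem, hle, -⟩ := h
    exact ⟨hs, hmem, fun h hh => hle.trans ((leafVal_spec S ρ hs).1 h hh)⟩

/-! ### Pruning a decision tree -/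

section

variable {n : ℕ}

/-- The neighbour of `x` in the direction `i`. -/
def flip (x : Cube n) (i : Fin n) : Cube n := Function.update x i (!x i)

@[simp] theorem flip_self (x : Cube n) (i : Fin n) : flip x i i = !x i := by simp [flip]

theorem flip_ne (x : Cube n) {i j : Fin n} (h : j ≠ i) : flip x i j = x j := by simp [flip, h]

@[simp] theorem flip_flip (x : Cube n) (i : Fin n) : flip (flip x i) i = x := by
  ext j
  by_cases h : j = i
  · subst h; simp
  · rw [flip_ne _ h, flip_ne _ h]

namespace DecisionTree

/-- The tree with the coordinate `i` fixed to `b`. -/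
def restrict (i : Fin n) (b : Bool) : DecisionTree n → DecisionTree n
  | leaf p => leaf p
  | node j l r => if j = i then (if b then r.restrict i b else l.restrict i b)
      else node j (l.restrict i b) (r.restrict i b)

theorem depth_restrict_le (i : Fin n) (b : Bool) (t : DecisionTree n) :
    (t.restrict i b).depth ≤ t.depth := by
  induction t with
  | leaf p => exact le_rfl
  | node j l r hl hr =>
    unfold restrict
    split_ifs <;> simp only [depth] <;> omega

theorem eval_restrict (i : Fin n) (b : Bool) (t : DecisionTree n) (x : Cube n) :
    (t.restrict i b).eval x = t.eval (Function.update x i b) := by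
  induction t with
  | leaf p => rfl
  | node j l r hl hr =>
    unfold restrict
    by_cases h : j = i
    · subst h
      cases b <;> simp_all [eval]
    · simp only [if_neg h, eval, hl, hr, Function.update_of_ne h]

/-- The value of a tree is sensitive to at most as many coordinates as the tree is deep. -/
theorem card_sensitive_le (t : DecisionTree n) (x : Cube n) :
    (Finset.univ.filter fun i => t.eval (flip x i) ≠ t.eval x).card ≤ t.depth := by
  induction t with
  | leaf p => simp [eval, depth]
  | node j l r hl hr =>
    have key : ∀ s : DecisionTree n, (∀ i ≠ j, (node j l r).eval (flip x i) = s.eval (flip x i)) →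
        (node j l r).eval x = s.eval x →
        (Finset.univ.filter fun i => (node j l r).eval (flip x i) ≠ (node j l r).eval x) ⊆
        insert j (Finset.univ.filter fun i => s.eval (flip x i) ≠ s.eval x) := by
      intro s h1 h2 i hi
      simp only [Finset.mem_filter, Finset.mem_univ, true_and, Finset.mem_insert] at hi ⊢
      by_cases hij : i = j
      · exact Or.inl hij
      · rw [h1 i hij, h2] at hi
        exact Or.inr hi
    have key2 := fun s h1 h2 => (Finset.card_le_card (key s h1 h2)).trans (Finset.card_insert_le _ _)
    simp only [depth]
    cases hx : x j with
    | false =>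
      have := key2 l (fun i hi => by simp [eval, flip_ne x hi.symm, hx]) (by simp [eval, hx])
      omega
    | true =>
      have := key2 r (fun i hi => by simp [eval, flip_ne x hi.symm, hx]) (by simp [eval, hx])
      omega

end DecisionTree

/-- The points of the subcube `ρ`. -/
def cubeSet (n : ℕ) (ρ : Rest) : Finset (Cube n) :=
  Finset.univ.filter fun x => inCube ρ (List.ofFn x) = true

theorem mem_cubeSet {ρ : Rest} {x : Cube n} :
    x ∈ cubeSet n ρ ↔ inCube ρ (List.ofFn x) = true := by simp [cubeSet]

theorem getD_ofFn (x : Cube n) (i : Fin n) : (List.ofFn x).getD i false = x i := by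
  simp [List.getD_eq_getElem?_getD]

theorem cubeSet_replicate : cubeSet n (List.replicate n none) = Finset.univ := by
  ext x; simp [mem_cubeSet, inCube_replicate]

theorem cubeSet_set {ρ : Rest} (hl : ρ.length = n) {i : Fin n} (hi : ρ.getD i none = none)
    (b : Bool) : cubeSet n (ρ.set i (some b)) = (cubeSet n ρ).filter fun x => x i = b := by
  ext x
  rw [Finset.mem_filter, mem_cubeSet, mem_cubeSet, inCube_set (by omega) hi, Bool.and_eq_true,
    beq_iff_eq, getD_ofFn]

theorem mem_cubeSet_iff {ρ : Rest} (hl : ρ.length = n) {x : Cube n} :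
    x ∈ cubeSet n ρ ↔ ∀ (i : Fin n) b, ρ.getD i none = some b → b = x i := by
  rw [mem_cubeSet, inCube_iff, hl]
  exact ⟨fun h i b hb => by rw [← getD_ofFn x i]; exact h i i.2 b hb,
    fun h i hi b hb => by rw [getD_ofFn x ⟨i, hi⟩]; exact h ⟨i, hi⟩ b hb⟩

theorem flip_mem_cubeSet {ρ : Rest} (hl : ρ.length = n) {i : Fin n} (hi : ρ.getD i none = none)
    {x : Cube n} : flip x i ∈ cubeSet n ρ ↔ x ∈ cubeSet n ρ := by
  rw [mem_cubeSet_iff hl, mem_cubeSet_iff hl]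
  refine forall₂_congr fun j b => ?_
  by_cases h : j = i
  · subst h; simp only [hi]; simp
  · rw [flip_ne x h]

/-- A sum over a subcube is a sum over its edges in a free direction. -/
theorem sum_cubeSet_edges {ρ : Rest} (hl : ρ.length = n) {i : Fin n} (hi : ρ.getD i none = none)
    (g : Cube n → ℝ) : ∑ x ∈ cubeSet n ρ, g x =
      ∑ x ∈ (cubeSet n ρ).filter (fun x => x i = false), (g x + g (flip x i)) := by
  rw [← Finset.sum_filter_add_sum_filter_not _ (fun x => x i = false), Finset.sum_add_distrib]
  congr 1
  refine Finset.sum_nbij' (fun x => flip x i) (fun x => flip x i) ?_ ?_ (fun x _ => flip_flip x i)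
    (fun x _ => flip_flip x i) (fun x _ => by rw [flip_flip])
  · intro x hx
    rw [Finset.mem_filter] at hx ⊢
    rw [flip_mem_cubeSet hl hi]
    exact ⟨hx.1, by simpa using hx.2⟩
  · intro x hx
    rw [Finset.mem_filter] at hx ⊢
    rw [flip_mem_cubeSet hl hi]
    exact ⟨hx.1, by simpa using hx.2⟩

theorem sum_cubeSet_halves {ρ : Rest} (hl : ρ.length = n) {i : Fin n} (hi : ρ.getD i none = none)
    (g : Cube n → ℝ) : ∑ x ∈ cubeSet n ρ, g x =
      ∑ x ∈ cubeSet n (ρ.set i (some false)), g x + ∑ x ∈ cubeSet n (ρ.set i (some true)), g x := by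
  rw [cubeSet_set hl hi, cubeSet_set hl hi,
    ← Finset.sum_filter_add_sum_filter_not _ (fun x => x i = false)]
  simp

/-- The mass of a subcube. -/
def mass (D : Cube n → ℝ) (ρ : Rest) : ℝ := ∑ x ∈ cubeSet n ρ, D x

/-- The influence of the coordinate `i` on the density `D` in the subcube `ρ`: the sum of the
differences of `D` along the edges in the direction `i`. It is not normalized. -/
def influence (D : Cube n → ℝ) (ρ : Rest) (i : Fin n) : ℝ :=
  ∑ x ∈ (cubeSet n ρ).filter (fun x => x i = false), |D x - D (flip x i)|

/-- The probability that the leaf `ℓ` is reached and errs. -/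
def trueErr (D : Cube n → ℝ) (f : Cube n → Bool) (ℓ : Leaf) : ℝ :=
  ∑ x ∈ cubeSet n ℓ.1, if evalGates ℓ.2.2 (overwrite ℓ.1 (List.ofFn x) ℓ.2.1) = f x then 0 else D x

theorem mass_nonneg {D : Cube n → ℝ} (hD : ∀ x, 0 ≤ D x) (ρ : Rest) : 0 ≤ mass D ρ :=
  Finset.sum_nonneg fun x _ => hD x

theorem trueErr_le_mass {D : Cube n → ℝ} (hD : ∀ x, 0 ≤ D x) (f : Cube n → Bool) (ℓ : Leaf) :
    trueErr D f ℓ ≤ mass D ℓ.1 := Finset.sum_le_sum fun x _ => by split_ifs <;> simp [hD]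

/-- A query of a coordinate of small influence can be skipped at a small cost: the tree is
replaced by its better half. -/
theorem exists_restrict {ρ : Rest} (hl : ρ.length = n) {i : Fin n} (hi : ρ.getD i none = none)
    (D : Cube n → ℝ) (t : DecisionTree n) :
    ∃ b, ∑ x ∈ cubeSet n ρ, |D x - (t.restrict i b).eval x| ≤
      ∑ x ∈ cubeSet n ρ, |D x - t.eval x| + influence D ρ i := by
  set F := (cubeSet n ρ).filter (fun x => x i = false) with hF
  have hup : ∀ x : Cube n, x i = false → Function.update x i false = x ∧
      Function.update x i true = flip x i ∧ Function.update (flip x i) i false = x ∧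
      Function.update (flip x i) i true = flip x i := by
    intro x hx
    refine ⟨?_, ?_, ?_, ?_⟩ <;> ext j <;> by_cases h : j = i
    all_goals first | (subst h; simp [hx]) | simp [h, flip_ne]
  have hA : ∑ x ∈ cubeSet n ρ, |D x - t.eval x| = ∑ x ∈ F, |D x - t.eval x| +
      ∑ x ∈ F, |D (flip x i) - t.eval (flip x i)| := by
    rw [sum_cubeSet_edges hl hi, Finset.sum_add_distrib]
  rcases le_total (∑ x ∈ F, |D x - t.eval x|) (∑ x ∈ F, |D (flip x i) - t.eval (flip x i)|)
    with h | h
  · refine ⟨false, ?_⟩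
    have : ∑ x ∈ cubeSet n ρ, |D x - (t.restrict i false).eval x| ≤
        ∑ x ∈ F, (|D x - t.eval x| + |D x - t.eval x| + |D x - D (flip x i)|) := by
      rw [sum_cubeSet_edges hl hi]
      refine Finset.sum_le_sum fun x hx => ?_
      obtain ⟨h1, -, h3, -⟩ := hup x (Finset.mem_filter.1 hx).2
      rw [DecisionTree.eval_restrict, DecisionTree.eval_restrict, h1, h3]
      have := abs_sub_le (D (flip x i)) (D x) (t.eval x)
      rw [abs_sub_comm (D (flip x i)) (D x)] at this
      linarith
    rw [Finset.sum_add_distrib, Finset.sum_add_distrib] at this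
    unfold influence
    linarith
  · refine ⟨true, ?_⟩
    have : ∑ x ∈ cubeSet n ρ, |D x - (t.restrict i true).eval x| ≤
        ∑ x ∈ F, (|D (flip x i) - t.eval (flip x i)| + |D (flip x i) - t.eval (flip x i)| +
          |D x - D (flip x i)|) := by
      rw [sum_cubeSet_edges hl hi]
      refine Finset.sum_le_sum fun x hx => ?_
      obtain ⟨-, h2, -, h4⟩ := hup x (Finset.mem_filter.1 hx).2
      rw [DecisionTree.eval_restrict, DecisionTree.eval_restrict, h2, h4]
      have := abs_sub_le (D x) (D (flip x i)) (t.eval (flip x i))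
      linarith
    rw [Finset.sum_add_distrib, Finset.sum_add_distrib] at this
    unfold influence
    linarith

/-- The search finds a value that is not much worse than any decision tree `t` that approximates the
density: candidates are branched on, and the other queries of `t` are skipped. By `h1`, the skipped
queries are of small influence; by `h2`, some hypothesis is good on each subcube on which the density
is close to a constant; by `h3`, the counted errors are accurate. -/
theorem IsOpt.value_le {T : ℕ} {Z : List (Pt × Pt)} {S : List (Bool × Pt)}
    {res : List (Option Rest × List (Pt × Gates))} {D : Cube n → ℝ} (hD : ∀ x, 0 ≤ D x)
    {f : Cube n → Bool} {N lam eta alpha beta : ℝ} (hN : 0 < N) (hlam : 0 ≤ lam) (heta : 0 ≤ eta)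
    (halpha : 0 ≤ alpha) (hbeta : 0 ≤ beta)
    (h1 : ∀ ρ : Rest, ρ.length = n → mass D ρ ≤ lam ∨ ∀ i : Fin n, ρ.getD i none = none →
      (i : ℕ) ∉ cands T Z ρ → influence D ρ i ≤ eta * mass D ρ)
    (h2 : ∀ ρ hs, (some ρ, hs) ∈ res → ∃ h ∈ tried hs, ∀ c : ℝ, trueErr D f (ρ, h) ≤
      beta * mass D ρ + alpha * ∑ x ∈ cubeSet n ρ, |D x - c| + lam)
    (h3 : ∀ ρ hs, (some ρ, hs) ∈ res → ∀ h ∈ tried hs,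
      |(leafErr S (ρ, h) : ℝ) / N - trueErr D f (ρ, h)| ≤ lam) :
    ∀ (k : ℕ) (t : DecisionTree n), t.depth ≤ k → ∀ (r : ℕ), k ≤ r → ∀ (ρ : Rest) (v : Value),
    ρ.length = n → IsOpt T Z S res r ρ v →
    (v.1 : ℝ) / N ≤ beta * mass D ρ + alpha * (∑ x ∈ cubeSet n ρ, |D x - t.eval x| +
      k * eta * mass D ρ) + 2 ^ k * (2 * lam) := by
  have leaf : ∀ (r k : ℕ) (ρ : Rest) (v : Value), IsOpt T Z S res r ρ v → ∀ c : ℝ,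
      (v.1 : ℝ) / N ≤ beta * mass D ρ + alpha * (∑ x ∈ cubeSet n ρ, |D x - c| +
        k * eta * mass D ρ) + 2 ^ k * (2 * lam) := by
    intro r k ρ v hv c
    obtain ⟨hs, hmem, hle⟩ := hv.le_leaf
    obtain ⟨h, hh, he⟩ := h2 ρ hs hmem
    have e1 : (v.1 : ℝ) / N ≤ (leafErr S (ρ, h) : ℝ) / N := by
      gcongr
      exact hle h hh
    have e2 := (abs_le.1 (h3 ρ hs hmem h hh)).2
    have e3 := he c
    have e4 : (0 : ℝ) ≤ k * eta * mass D ρ := by have := mass_nonneg hD ρ; positivity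
    have e5 : alpha * ∑ x ∈ cubeSet n ρ, |D x - c| ≤
        alpha * (∑ x ∈ cubeSet n ρ, |D x - c| + k * eta * mass D ρ) := by
      gcongr; linarith
    have e6 : 1 * (2 * lam) ≤ 2 ^ k * (2 * lam) := by
      gcongr; exact one_le_pow₀ (by norm_num)
    linarith
  intro k
  induction k with
  | zero =>
    intro t ht r _ ρ v hl hv
    cases t with
    | leaf c => exact leaf r 0 ρ v hv c
    | node i l r => simp [DecisionTree.depth] at ht
  | succ k ih =>
    intro t ht r hr ρ v hl hv
    have hM := mass_nonneg hD ρ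
    cases t with
    | leaf c => exact leaf r (k + 1) ρ v hv c
    | node i t₀ t₁ =>
      simp only [DecisionTree.depth, Nat.add_le_add_iff_right, max_le_iff] at ht
      have e6 : (2 : ℝ) ^ (k + 1) * (2 * lam) = 2 ^ k * (2 * lam) + 2 ^ k * (2 * lam) := by ring
      have e7 : (0 : ℝ) ≤ 2 ^ k * (2 * lam) := by positivity
      have e8 : 1 * (2 * lam) ≤ 2 ^ k * (2 * lam) := by
        gcongr; exact one_le_pow₀ (by norm_num)
      have e9 : alpha * ((k + 1 : ℕ) * eta * mass D ρ) =
        alpha * (k * eta * mass D ρ) + alpha * (eta * mass D ρ) := by push_cast; ring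
      have e10 : 0 ≤ alpha * (eta * mass D ρ) := by positivity
      by_cases hi : ρ.getD i none = none
      · rcases h1 ρ hl with hlight | hinf
        · -- a light subcube: the mass is a bound for the error
          obtain ⟨hs, hmem, hle⟩ := hv.le_leaf
          have f1 : (v.1 : ℝ) / N ≤ (leafErr S (ρ, ([], [])) : ℝ) / N := by
            gcongr
            exact hle _ (Or.inr rfl)
          have f2 := (abs_le.1 (h3 ρ hs hmem ([], []) (Or.inr rfl))).2
          have f3 := trueErr_le_mass hD f (ρ, ([], []))
          have f4 : 0 ≤ beta * mass D ρ := by positivity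
          have f5 : 0 ≤ alpha * (∑ x ∈ cubeSet n ρ, |D x - (DecisionTree.node i t₀ t₁).eval x| +
            (k + 1 : ℕ) * eta * mass D ρ) := by positivity
          linarith
        · by_cases hc : (i : ℕ) ∈ cands T Z ρ
          · -- the search branches on the queried coordinate
            obtain ⟨r, rfl⟩ : ∃ r', r = r' + 1 := ⟨r - 1, by omega⟩
            obtain ⟨hs, -, -, hsplit, -⟩ := hv
            obtain ⟨v0, v1, o0, o1, hle⟩ := hsplit i hc
            have g0 := ih t₀ ht.1 r (by omega) _ v0 (by simpa using hl) o0
            have g1 := ih t₁ ht.2 r (by omega) _ v1 (by simpa using hl) o1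
            have m : mass D ρ = _ := sum_cubeSet_halves hl hi D
            have m2 := sum_cubeSet_halves hl hi fun x => |D x - (DecisionTree.node i t₀ t₁).eval x|
            have s0 : ∑ x ∈ cubeSet n (ρ.set i (some false)),
                |D x - (DecisionTree.node i t₀ t₁).eval x| =
                ∑ x ∈ cubeSet n (ρ.set i (some false)), |D x - t₀.eval x| :=
              Finset.sum_congr rfl fun x hx => by
                rw [cubeSet_set hl hi, Finset.mem_filter] at hx
                simp [DecisionTree.eval, hx.2]
            have s1 : ∑ x ∈ cubeSet n (ρ.set i (some true)),
                |D x - (DecisionTree.node i t₀ t₁).eval x| =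
                ∑ x ∈ cubeSet n (ρ.set i (some true)), |D x - t₁.eval x| :=
              Finset.sum_congr rfl fun x hx => by
                rw [cubeSet_set hl hi, Finset.mem_filter] at hx
                simp [DecisionTree.eval, hx.2]
            have hle' : (v.1 : ℝ) / N ≤ v0.1 / N + v1.1 / N := by
              rw [← add_div]; gcongr; exact_mod_cast hle
            rw [s0, s1] at m2
            change mass D ρ = mass D _ + mass D _ at m
            rw [m2, mul_add, e9, e6]
            refine hle'.trans ((add_le_add g0 g1).trans ?_)
            rw [m] at e10 ⊢
            linarith
          · -- the query is skipped
            obtain ⟨b, hb⟩ := exists_restrict hl hi D (.node i t₀ t₁)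
            have hd : ((DecisionTree.node i t₀ t₁).restrict i b).depth ≤ k := by
              simp only [DecisionTree.restrict, if_true]
              split_ifs
              · exact (t₁.depth_restrict_le i b).trans ht.2
              · exact (t₀.depth_restrict_le i b).trans ht.1
            have g := ih _ hd r (by omega) ρ v hl hv
            have g2 := mul_le_mul_of_nonneg_left (hb.trans (add_le_add_right (hinf i hi hc) _)) halpha
            rw [mul_add, e9]
            linarith
      · -- the query is redundant on the subcube
        obtain ⟨b, hb⟩ : ∃ b, ρ.getD i none = some b := Option.ne_none_iff_exists'.1 hi
        have hs : ∃ s : DecisionTree n, s.depth ≤ k ∧ ∀ x ∈ cubeSet n ρ,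
            (DecisionTree.node i t₀ t₁).eval x = s.eval x := by
          cases b with
          | false => exact ⟨t₀, ht.1, fun x hx => by
              simp [DecisionTree.eval, ← (mem_cubeSet_iff hl).1 hx i _ hb]⟩
          | true => exact ⟨t₁, ht.2, fun x hx => by
              simp [DecisionTree.eval, ← (mem_cubeSet_iff hl).1 hx i _ hb]⟩
        obtain ⟨s, hs1, hs2⟩ := hs
        have g := ih s hs1 r (by omega) ρ v hl hv
        rw [Finset.sum_congr rfl fun x hx => by rw [hs2 x hx], mul_add, e9]
        linarith

/-- The error of a hypothesis given by its leaves. -/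
theorem sum_err_le {D : Cube n → ℝ} (hD : ∀ x, 0 ≤ D x) (f : Cube n → Bool) (ls : List Leaf)
    (hcov : ∀ x : Cube n, ∃ ℓ ∈ ls, inCube ℓ.1 (List.ofFn x) = true) :
    (∑ x, if ls.any (leafHolds (List.ofFn x)) = f x then 0 else D x) ≤
      (ls.map (trueErr D f)).sum := by
  have h : ∀ ls : List Leaf, (ls.map (trueErr D f)).sum = ∑ x, (ls.map fun ℓ =>
      if inCube ℓ.1 (List.ofFn x) = true then
        (if evalGates ℓ.2.2 (overwrite ℓ.1 (List.ofFn x) ℓ.2.1) = f x then 0 else D x) else 0).sum := by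
    intro ls
    induction ls with
    | nil => simp
    | cons ℓ ls ih =>
      simp only [List.map_cons, List.sum_cons, Finset.sum_add_distrib, ih]
      congr 1
      rw [trueErr, cubeSet, Finset.sum_filter]
  rw [h]
  refine Finset.sum_le_sum fun x _ => ?_
  have hnn : ∀ y ∈ (ls.map fun ℓ => if inCube ℓ.1 (List.ofFn x) = true then
      (if evalGates ℓ.2.2 (overwrite ℓ.1 (List.ofFn x) ℓ.2.1) = f x then 0 else D x) else 0),
      0 ≤ y := by
    intro y hy
    obtain ⟨ℓ, -, rfl⟩ := List.mem_map.1 hy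
    split_ifs <;> simp [hD]
  split_ifs with hx
  · exact List.sum_nonneg hnn
  · -- some leaf at `x` errs
    obtain ⟨ℓ, hℓ, hin, hne⟩ : ∃ ℓ ∈ ls, inCube ℓ.1 (List.ofFn x) = true ∧
        evalGates ℓ.2.2 (overwrite ℓ.1 (List.ofFn x) ℓ.2.1) ≠ f x := by
      cases hf : f x with
      | false =>
        rw [hf, Bool.not_eq_false, List.any_eq_true] at hx
        obtain ⟨ℓ, hℓ, h⟩ := hx
        rw [leafHolds, Bool.and_eq_true] at h
        exact ⟨ℓ, hℓ, h.1, by rw [h.2]; simp⟩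
      | true =>
        obtain ⟨ℓ, hℓ, hin⟩ := hcov x
        refine ⟨ℓ, hℓ, hin, fun h => hx ?_⟩
        rw [hf, List.any_eq_true]
        exact ⟨ℓ, hℓ, by rw [leafHolds, hin, h]; rfl⟩
    refine List.single_le_sum hnn _ (List.mem_map.2 ⟨ℓ, hℓ, ?_⟩)
    rw [if_pos hin, if_neg hne]

/-- The error of the hypothesis that is computed from a sample, if all estimates are correct. -/
theorem sum_err_compileLeaves_le {T : ℕ} {Z : List (Pt × Pt)} {S : List (Bool × Pt)}
    {res : List (Option Rest × List (Pt × Gates))} {D : Cube n → ℝ} (hD : ∀ x, 0 ≤ D x)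
    (hD1 : ∑ x, D x = 1) {f : Cube n → Bool} {N lam eta alpha beta : ℝ} (hN : 0 < N)
    (hlam : 0 ≤ lam) (heta : 0 ≤ eta) (halpha : 0 ≤ alpha) (hbeta : 0 ≤ beta) (hn : 1 ≤ n)
    {d : ℕ} {t : DecisionTree n} (ht : t.depth ≤ d) (hDt : ∀ x, D x = t.eval x)
    (hres : res.map Prod.fst = (seg T Z d (List.replicate n none)).map (Option.map Prod.fst))
    (h1 : ∀ ρ : Rest, ρ.length = n → mass D ρ ≤ lam ∨ ∀ i : Fin n, ρ.getD i none = none →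
      (i : ℕ) ∉ cands T Z ρ → influence D ρ i ≤ eta * mass D ρ)
    (h2 : ∀ ρ hs, (some ρ, hs) ∈ res → ∃ h ∈ tried hs, ∀ c : ℝ, trueErr D f (ρ, h) ≤
      beta * mass D ρ + alpha * ∑ x ∈ cubeSet n ρ, |D x - c| + lam)
    (h3 : ∀ ρ hs, (some ρ, hs) ∈ res → ∀ h ∈ tried hs,
      |(leafErr S (ρ, h) : ℝ) / N - trueErr D f (ρ, h)| ≤ lam) :
    (∑ x, if evalGates (compileLeaves n (bestLeaves S res)) (List.ofFn x) = f x then 0 else D x) ≤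
      beta + alpha * (d * eta) + 3 * 2 ^ d * lam := by
  obtain ⟨v, hv, hb⟩ := exists_isOpt T Z S res d _ hres
  have hval := IsOpt.value_le hD hN hlam heta halpha hbeta h1 h2 h3 d t ht d le_rfl _ v (by simp) hv
  obtain ⟨a1, a2, a3, a4⟩ := hv.leaves
  rw [hb]
  have e1 : ∀ x : Cube n, evalGates (compileLeaves n v.2) (List.ofFn x) =
      v.2.any (leafHolds (List.ofFn x)) := by
    intro x
    have := evalGates_compileLeaves (x := List.ofFn x) (ls := v.2) (by simpa using hn)
      (fun ℓ hℓ => by simpa using (a2 ℓ hℓ).1)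
    rwa [List.length_ofFn] at this
  simp only [e1]
  refine (sum_err_le hD f v.2 fun x => ?_).trans ?_
  · have := a4 (List.ofFn x)
    rw [inCube_replicate, if_pos rfl] at this
    exact List.countP_pos_iff.1 (by rw [this]; exact one_pos)
  have hm : mass D (List.replicate n none) = 1 := by rw [mass, cubeSet_replicate, hD1]
  have hz : ∑ x ∈ cubeSet n (List.replicate n none), |D x - t.eval x| = 0 :=
    Finset.sum_eq_zero fun x _ => by rw [hDt, sub_self, abs_zero]
  rw [hm, hz] at hval
  have key : ∀ ls : List Leaf, (∀ ℓ ∈ ls, ∃ hs, (some ℓ.1, hs) ∈ res ∧ ℓ.2 ∈ tried hs) →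
      (ls.map (trueErr D f)).sum ≤ ((ls.map (leafErr S)).sum : ℕ) / N + ls.length * lam := by
    intro ls
    induction ls with
    | nil => intro _; simp
    | cons ℓ ls ih =>
      intro h
      have g1 := ih fun ℓ' h' => h ℓ' (by simp [h'])
      obtain ⟨hs, m1, m2⟩ := h ℓ (by simp)
      have g2 := (abs_le.1 (h3 ℓ.1 hs m1 ℓ.2 m2)).1
      simp only [List.map_cons, List.sum_cons, List.length_cons]
      push_cast at g1 ⊢
      rw [add_div]
      linarith
  have g := key v.2 fun ℓ hℓ => (a2 ℓ hℓ).2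
  rw [← a3] at g
  have g2 : (v.2.length : ℝ) * lam ≤ 2 ^ d * lam := by
    gcongr; exact_mod_cast a1
  linarith

end

/-! ### Expectations and independent samples -/

section

variable {α β γ : Type}

/-- The expectation of a nonnegative function. -/
def ex (p : PMF α) (F : α → ℝ≥0∞) : ℝ≥0∞ := ∑' a, p a * F a

/-- The probability of an event. -/
def pr (p : PMF α) (s : α → Prop) : ℝ≥0∞ := p.toOuterMeasure {a | s a}

theorem ex_pure (a : α) (F : α → ℝ≥0∞) : ex (PMF.pure a) F = F a := by
  unfold ex
  rw [tsum_eq_single a fun b hb => by simp [hb]]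
  simp

theorem ex_bind (p : PMF α) (f : α → PMF β) (F : β → ℝ≥0∞) :
    ex (p.bind f) F = ex p fun a => ex (f a) F := by
  unfold ex
  simp only [PMF.bind_apply, ← ENNReal.tsum_mul_right, ← ENNReal.tsum_mul_left]
  rw [ENNReal.tsum_comm]
  simp only [mul_assoc]

theorem ex_map (p : PMF α) (f : α → β) (F : β → ℝ≥0∞) : ex (p.map f) F = ex p fun a => F (f a) := by
  rw [← PMF.bind_pure_comp, ex_bind]
  simp only [Function.comp, ex_pure]

theorem ex_mono {p : PMF α} {F G : α → ℝ≥0∞} (h : ∀ a ∈ p.support, F a ≤ G a) :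
    ex p F ≤ ex p G := by
  refine ENNReal.tsum_le_tsum fun a => ?_
  by_cases ha : p a = 0
  · simp [ha]
  · gcongr
    exact h a ((PMF.mem_support_iff _ _).2 ha)

theorem ex_congr {p : PMF α} {F G : α → ℝ≥0∞} (h : ∀ a ∈ p.support, F a = G a) : ex p F = ex p G :=
  le_antisymm (ex_mono fun a ha => (h a ha).le) (ex_mono fun a ha => (h a ha).ge)

theorem ex_const (p : PMF α) (c : ℝ≥0∞) : ex p (fun _ => c) = c := by
  unfold ex
  rw [ENNReal.tsum_mul_right, p.tsum_coe, one_mul]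

theorem ex_le {p : PMF α} {F : α → ℝ≥0∞} {c : ℝ≥0∞} (h : ∀ a ∈ p.support, F a ≤ c) : ex p F ≤ c :=
  (ex_mono h).trans (ex_const p c).le

theorem ex_add (p : PMF α) (F G : α → ℝ≥0∞) : ex p (fun a => F a + G a) = ex p F + ex p G := by
  unfold ex
  simp only [mul_add]
  exact ENNReal.tsum_add

theorem ex_mul_left (p : PMF α) (c : ℝ≥0∞) (F : α → ℝ≥0∞) :
    ex p (fun a => c * F a) = c * ex p F := by
  unfold ex
  rw [← ENNReal.tsum_mul_left]
  exact tsum_congr fun a => by ring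

theorem ex_comm (p : PMF α) (q : PMF β) (F : α → β → ℝ≥0∞) :
    ex p (fun a => ex q fun b => F a b) = ex q fun b => ex p fun a => F a b := by
  unfold ex
  simp only [← ENNReal.tsum_mul_left]
  rw [ENNReal.tsum_comm]
  exact tsum_congr fun a => tsum_congr fun b => by ring

theorem ex_fintype [Fintype α] (p : PMF α) (F : α → ℝ≥0∞) : ex p F = ∑ a, p a * F a := tsum_fintype _

open Classical in
theorem pr_eq_ex (p : PMF α) (s : α → Prop) : pr p s = ex p fun a => if s a then 1 else 0 := by
  unfold pr ex
  rw [PMF.toOuterMeasure_apply]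
  refine tsum_congr fun a => ?_
  by_cases h : s a <;> simp [h]

theorem pr_pure (a : α) (s : α → Prop) [Decidable (s a)] :
    pr (PMF.pure a) s = if s a then 1 else 0 := by
  rw [pr_eq_ex, ex_pure]
  split_ifs <;> rfl

theorem pr_bind (p : PMF α) (f : α → PMF β) (s : β → Prop) :
    pr (p.bind f) s = ex p fun a => pr (f a) s := by
  simp only [pr_eq_ex, ex_bind]

theorem pr_map (p : PMF α) (f : α → β) (s : β → Prop) : pr (p.map f) s = pr p fun a => s (f a) := by
  simp only [pr_eq_ex, ex_map]

theorem pr_mono {p : PMF α} {s t : α → Prop} (h : ∀ a ∈ p.support, s a → t a) : pr p s ≤ pr p t :=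
  PMF.toOuterMeasure_mono _ fun a ha => h a ha.2 ha.1

theorem pr_true {p : PMF α} {s : α → Prop} (h : ∀ a ∈ p.support, s a) : pr p s = 1 :=
  (PMF.toOuterMeasure_apply_eq_one_iff _ _).2 h

theorem pr_le_one (p : PMF α) (s : α → Prop) : pr p s ≤ 1 := by
  rw [← pr_true (p := p) (s := fun _ => True) fun _ _ => trivial]
  exact pr_mono fun _ _ _ => trivial

theorem pr_ne_top (p : PMF α) (s : α → Prop) : pr p s ≠ ∞ :=
  ((pr_le_one p s).trans_lt ENNReal.one_lt_top).ne

theorem pr_add_pr_not (p : PMF α) (s : α → Prop) : pr p s + pr p (fun a => ¬ s a) = 1 := by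
  rw [pr_eq_ex, pr_eq_ex, ← ex_add]
  refine (ex_congr fun a _ => ?_).trans (ex_const p 1)
  by_cases h : s a <;> simp [h]

theorem pr_or_le (p : PMF α) (s t : α → Prop) : pr p (fun a => s a ∨ t a) ≤ pr p s + pr p t :=
  MeasureTheory.measure_union_le _ _

theorem pr_exists_list_le {ι : Type} (p : PMF α) (l : List ι) (s : ι → α → Prop) :
    pr p (fun a => ∃ i ∈ l, s i a) ≤ (l.map fun i => pr p (s i)).sum := by
  induction l with
  | nil => simp [pr]
  | cons i l ih =>
    simp only [List.mem_cons, exists_eq_or_imp, List.map_cons, List.sum_cons]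
    exact (pr_or_le _ _ _).trans (by gcongr)

theorem pr_exists_list_le_mul {ι : Type} (p : PMF α) (l : List ι) (s : ι → α → Prop) {c : ℝ≥0∞}
    (h : ∀ i ∈ l, pr p (s i) ≤ c) : pr p (fun a => ∃ i ∈ l, s i a) ≤ l.length * c := by
  refine (pr_exists_list_le p l s).trans ((List.sum_le_card_nsmul _ c fun x hx => ?_).trans ?_)
  · obtain ⟨i, hi, rfl⟩ := List.mem_map.1 hx
    exact h i hi
  · simp

theorem pr_exists_le {ι : Type} [Fintype ι] (p : PMF α) (s : ι → α → Prop) {c : ℝ≥0∞}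
    (h : ∀ i, pr p (s i) ≤ c) : pr p (fun a => ∃ i, s i a) ≤ Fintype.card ι * c := by
  have := pr_exists_list_le_mul p (Finset.univ : Finset ι).toList s (c := c) fun i _ => h i
  simpa using this

theorem pr_bind_le {p : PMF α} {f : α → PMF β} {s : β → Prop} (bad : α → Prop) {a b : ℝ≥0∞}
    (h1 : pr p bad ≤ a) (h2 : ∀ x ∈ p.support, ¬ bad x → pr (f x) s ≤ b) :
    pr (p.bind f) s ≤ a + b := by
  classical
  rw [pr_bind]
  calc ex p (fun x => pr (f x) s) ≤ ex p fun x => (if bad x then 1 else 0) + b := by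
        refine ex_mono fun x hx => ?_
        by_cases h : bad x
        · rw [if_pos h]; exact (pr_le_one _ _).trans le_self_add
        · rw [if_neg h, zero_add]; exact h2 x hx h
    _ ≤ a + b := by
        rw [ex_add, ex_const]
        gcongr
        rw [pr_eq_ex] at h1
        convert h1

theorem ex_bool (p : PMF α) (b : α → Bool) (F : Bool → ℝ≥0∞) :
    ex p (fun a => F (b a)) = pr p (fun a => b a = true) * F true +
      pr p (fun a => b a = false) * F false := by
  rw [pr_eq_ex, pr_eq_ex, mul_comm, mul_comm _ (F false), ← ex_mul_left, ← ex_mul_left, ← ex_add]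
  refine ex_congr fun a _ => ?_
  cases b a <;> simp

/-! ### Independent draws -/

theorem length_of_mem_iid {p : PMF α} : ∀ {N : ℕ} {l : List α}, l ∈ (iid p N).support →
    l.length = N := by
  intro N
  induction N with
  | zero => intro l hl; simp [iid] at hl; simp [hl]
  | succ N ih =>
    intro l hl
    simp only [iid, PMF.support_bind, PMF.support_map, Set.mem_iUnion, Set.mem_image] at hl
    obtain ⟨x, -, l', hl', rfl⟩ := hl
    simp [ih hl']

theorem iid_add (p : PMF α) (a b : ℕ) :
    iid p (a + b) = (iid p a).bind fun l => (iid p b).map fun l' => l ++ l' := by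
  induction a with
  | zero =>
    rw [Nat.zero_add, iid, PMF.pure_bind]
    exact (PMF.map_id _).symm
  | succ a ih =>
    rw [show a + 1 + b = (a + b) + 1 by omega, iid, iid, ih, PMF.bind_bind]
    congr 1; funext x
    rw [PMF.map_bind, PMF.bind_map]
    congr 1; funext l
    rw [PMF.map_comp]; rfl

theorem iid_map (p : PMF α) (f : α → β) (N : ℕ) : iid (p.map f) N = (iid p N).map (List.map f) := by
  induction N with
  | zero => simp [iid, PMF.pure_map]
  | succ N ih =>
    rw [iid, iid, ih, PMF.bind_map, PMF.map_bind]
    congr 1; funext x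
    simp only [Function.comp, PMF.map_comp]
    rfl

theorem iid_bind (p : PMF α) (g : α → PMF β) (N : ℕ) :
    (iid p N).bind (listM g) = iid (p.bind g) N := by
  induction N with
  | zero => simp [iid, listM]
  | succ N ih =>
    rw [iid, iid, PMF.bind_bind, PMF.bind_bind]
    congr 1; funext x
    rw [PMF.bind_map, ← ih]
    simp only [Function.comp_def, listM]
    rw [PMF.bind_comm]
    congr 1; funext y
    rw [PMF.map_bind]

theorem ex_iid_prod (p : PMF α) (w : α → ℝ≥0∞) (N : ℕ) :
    ex (iid p N) (fun l => (l.map w).prod) = ex p w ^ N := by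
  induction N with
  | zero => simp [iid, ex_pure]
  | succ N ih =>
    rw [iid, ex_bind]
    simp only [ex_map, List.map_cons, List.prod_cons, ex_mul_left, ih]
    rw [pow_succ', mul_comm (ex p w), ← ex_mul_left]
    exact ex_congr fun a _ => mul_comm _ _

/-- The moment generating function of a centered Bernoulli variable of mean `x` is at most
`exp (s ^ 2)`. -/
theorem bernoulli_mgf_le {x s : ℝ} (hx : 0 ≤ x) (hx1 : x ≤ 1) (hs : 0 ≤ s) (hs1 : s ≤ 1) :
    x * Real.exp (s * (1 - x)) + (1 - x) * Real.exp (s * (0 - x)) ≤ Real.exp (s ^ 2) := by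
  have h1 : |s * (1 - x)| ≤ 1 := by rw [abs_le]; constructor <;> nlinarith
  have h2 : |s * (0 - x)| ≤ 1 := by rw [abs_le]; constructor <;> nlinarith
  have e1 := (abs_le.1 (Real.abs_exp_sub_one_sub_id_le h1)).2
  have e2 := (abs_le.1 (Real.abs_exp_sub_one_sub_id_le h2)).2
  have e3 := Real.add_one_le_exp (s ^ 2)
  have e4 := mul_le_mul_of_nonneg_left e1 hx
  have e5 := mul_le_mul_of_nonneg_left e2 (sub_nonneg.2 hx1)
  have e6 : s ^ 2 * (x * (1 - x)) ≤ s ^ 2 * 1 := by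
    gcongr; nlinarith
  nlinarith

/-- The Chernoff bound for the upper tail of a count. -/
theorem pr_countP_ge_le (p : PMF α) (b : α → Bool) (N : ℕ) {t : ℝ} (ht : 0 ≤ t) (ht1 : t ≤ 2) :
    pr (iid p N) (fun l => N * ((pr p fun a => b a = true).toReal + t) ≤ (l.countP b : ℝ)) ≤
      ENNReal.ofReal (Real.exp (-(N * t ^ 2 / 4))) := by
  classical
  set x := (pr p fun a => b a = true).toReal with hx
  have hx1 : x ≤ 1 := ENNReal.toReal_mono ENNReal.one_ne_top (pr_le_one _ _)
  have hx0 : 0 ≤ x := ENNReal.toReal_nonneg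
  have hpt : pr p (fun a => b a = true) = ENNReal.ofReal x := (ENNReal.ofReal_toReal (pr_ne_top _ _)).symm
  have hpf : pr p (fun a => b a = false) = ENNReal.ofReal (1 - x) := by
    have := pr_add_pr_not p fun a => b a = true
    simp only [Bool.not_eq_true] at this
    rw [ENNReal.ofReal_sub _ hx0, ENNReal.ofReal_one, ← hpt, ← this]
    exact (ENNReal.add_sub_cancel_left (pr_ne_top _ _)).symm
  -- the exponential moment with the parameter `t / 2`
  let v : Bool → ℝ := fun c => t / 2 * ((if c then 1 else 0) - x - t)
  let w : α → ℝ≥0∞ := fun a => ENNReal.ofReal (Real.exp (v (b a)))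
  have hw : ex p w ≤ ENNReal.ofReal (Real.exp (-(t ^ 2 / 4))) := by
    rw [ex_bool p b fun c => ENNReal.ofReal (Real.exp (v c)), hpt, hpf,
      ← ENNReal.ofReal_mul hx0, ← ENNReal.ofReal_mul (by linarith), ← ENNReal.ofReal_add
        (by positivity) (mul_nonneg (by linarith) (Real.exp_pos _).le)]
    refine ENNReal.ofReal_le_ofReal ?_
    have h1 : Real.exp (v true) = Real.exp (t / 2 * (1 - x)) * Real.exp (-(t ^ 2 / 2)) := by
      rw [← Real.exp_add]; congr 1; simp only [v, if_true]; ring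
    have h2 : Real.exp (v false) = Real.exp (t / 2 * (0 - x)) * Real.exp (-(t ^ 2 / 2)) := by
      rw [← Real.exp_add]; congr 1; simp only [v, Bool.false_eq_true, if_false]; ring
    have h3 : Real.exp (-(t ^ 2 / 4)) = Real.exp ((t / 2) ^ 2) * Real.exp (-(t ^ 2 / 2)) := by
      rw [← Real.exp_add]; congr 1; ring
    rw [h1, h2, h3]
    have := mul_le_mul_of_nonneg_right (bernoulli_mgf_le hx0 hx1 (s := t / 2) (by linarith)
      (by linarith)) (Real.exp_pos (-(t ^ 2 / 2))).le
    linarith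
  have hprod : ∀ l : List α, (l.map w).prod =
      ENNReal.ofReal (Real.exp (t / 2 * (l.countP b - l.length * (x + t)))) := by
    intro l
    induction l with
    | nil => simp
    | cons a l ih =>
      rw [List.map_cons, List.prod_cons, ih, ← ENNReal.ofReal_mul (Real.exp_pos _).le, ← Real.exp_add]
      congr 2
      rw [List.countP_cons, List.length_cons]
      simp only [v]
      cases b a <;> simp <;> ring
  calc pr (iid p N) (fun l => N * (x + t) ≤ (l.countP b : ℝ))
      ≤ ex (iid p N) fun l => (l.map w).prod := by
        rw [pr_eq_ex]
        refine ex_mono fun l hl => ?_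
        split_ifs with h
        · rw [hprod, length_of_mem_iid hl, ← ENNReal.ofReal_one]
          refine ENNReal.ofReal_le_ofReal (Real.one_le_exp ?_)
          have : 0 ≤ (l.countP b : ℝ) - N * (x + t) := by linarith
          positivity
        · exact zero_le
    _ ≤ _ := by
        rw [ex_iid_prod]
        refine (pow_le_pow_left' hw N).trans ?_
        rw [← ENNReal.ofReal_pow (Real.exp_pos _).le, ← Real.exp_nat_mul]
        refine ENNReal.ofReal_le_ofReal (Real.exp_le_exp.2 (le_of_eq ?_))
        ring

/-- The Chernoff bound for both tails of a count. -/
theorem pr_countP_dev_le (p : PMF α) (b : α → Bool) (N : ℕ) {t : ℝ} (ht : 0 ≤ t) (ht1 : t ≤ 2) :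
    pr (iid p N) (fun l => N * t ≤ |(l.countP b : ℝ) - N * (pr p fun a => b a = true).toReal|) ≤
      2 * ENNReal.ofReal (Real.exp (-(N * t ^ 2 / 4))) := by
  have h1 := pr_countP_ge_le p b N ht ht1
  have h2 := pr_countP_ge_le p (fun a => !b a) N ht ht1
  rw [two_mul]
  refine (pr_mono fun l hl h => ?_).trans ((pr_or_le _ _ _).trans (add_le_add h1 h2))
  have h3 : l.countP b + l.countP (fun a => !b a) = N := by
    rw [← length_of_mem_iid hl]
    have := List.length_eq_countP_add_countP (p := b) (l := l)
    simp only [Bool.not_eq_true, Bool.decide_eq_false] at this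
    exact this.symm
  have h4 : (pr p fun a => b a = true).toReal + (pr p fun a => (!b a) = true).toReal = 1 := by
    have := pr_add_pr_not p fun a => b a = true
    simp only [Bool.not_eq_true] at this
    simp only [Bool.not_eq_true']
    rw [← ENNReal.toReal_add (pr_ne_top _ _) (pr_ne_top _ _), this, ENNReal.toReal_one]
  have h3' : (l.countP b : ℝ) + (l.countP fun a => !b a : ℝ) = N := by exact_mod_cast h3
  have h5 : (N : ℝ) * (pr p fun a => (!b a) = true).toReal =
    N - N * (pr p fun a => b a = true).toReal := by rw [← mul_one_sub, ← h4]; ring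
  rcases le_abs.1 h with h | h
  · left; rw [mul_add]; linarith
  · right; rw [mul_add, h5]; linarith

/-- The entries of a sample that satisfy `b` are a sample from the conditional distribution, of
random length. -/
theorem exists_iid_filter (β : PMF Bool) (p₁ p₀ : PMF α) (b : α → Bool)
    (h : ∀ c ∈ β.support, ∀ x ∈ (if c then p₁ else p₀).support, b x = c) (N : ℕ) :
    ∃ L : PMF ℕ, (iid (β.bind fun c => if c then p₁ else p₀) N).map (List.filter b) =
      L.bind (iid p₁) := by
  induction N with
  | zero => exact ⟨PMF.pure 0, by simp [iid, PMF.pure_map]⟩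
  | succ N ih =>
    obtain ⟨L, hL⟩ := ih
    refine ⟨β.bind fun c => L.map fun k => if c then k + 1 else k, ?_⟩
    rw [iid, PMF.map_bind, PMF.bind_bind, PMF.bind_bind]
    refine pmf_bind_congr _ fun c hc => ?_
    have h1 : ∀ x ∈ (if c then p₁ else p₀).support, ((iid (β.bind fun c => if c then p₁ else p₀)
        N).map fun l => x :: l).map (List.filter b) =
        (L.bind (iid p₁)).map fun l => if c then x :: l else l := by
      intro x hx
      rw [PMF.map_comp, ← hL, PMF.map_comp]
      refine pmf_map_congr _ fun l _ => ?_
      have := h c hc x hx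
      cases c <;> simp [this]
    rw [pmf_bind_congr _ h1, PMF.bind_map]
    cases c with
    | false =>
      simp only [Bool.false_eq_true, if_false, Function.comp_def]
      rw [PMF.bind_const]
      exact PMF.map_id _
    | true =>
      simp only [if_true, Function.comp_def, iid]
      rw [PMF.bind_comm]
      congr 1; funext x
      rw [PMF.map_bind]

/-- The blocks of a sample are independent samples. -/
theorem ex_prod_chunk (p : PMF α) (k : ℕ) (F : List α → ℝ≥0∞) : ∀ (R N : ℕ), R * k ≤ N →
    ex (iid p N) (fun l => ((List.range R).map fun j => F (chunk k l j)).prod) =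
      ex (iid p k) F ^ R := by
  intro R
  induction R with
  | zero => intro N _; simp [ex_const]
  | succ R ih =>
    intro N hN
    obtain ⟨N', rfl⟩ : ∃ N', N = k + N' := ⟨N - k, by rw [Nat.add_mul] at hN; omega⟩
    have h1 : ∀ l ∈ (iid p k).support, ∀ l' : List α,
        ((List.range (R + 1)).map fun j => F (chunk k (l ++ l') j)).prod =
        F l * ((List.range R).map fun j => F (chunk k l' j)).prod := by
      intro l hl l'
      have hlen := length_of_mem_iid hl
      rw [List.range_succ_eq_map, List.map_cons, List.prod_cons, List.map_map]
      congr 2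
      · simp [chunk, hlen]
      · congr 1; funext j
        simp only [Function.comp, chunk, Nat.succ_eq_add_one]
        rw [show (j + 1) * k = l.length + j * k by rw [hlen]; ring, List.drop_append,
          List.drop_eq_nil_of_le (by omega)]
        simp
    rw [iid_add, ex_bind, pow_succ', ← ih N' (by rw [Nat.add_mul] at hN; omega), mul_comm,
      ← ex_mul_left]
    refine ex_congr fun l hl => ?_
    rw [ex_map, mul_comm, ← ex_mul_left]
    exact ex_congr fun l' _ => h1 l hl l'

/-- A comparison of samples from distributions that are close to each other. -/
theorem ex_iid_le {p q : PMF α} {δ : ℝ≥0∞} (h : ∀ G : α → ℝ≥0∞, (∀ a, G a ≤ 1) →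
    ex p G ≤ ex q G + δ) (N : ℕ) : ∀ (F : List α → ℝ≥0∞), (∀ l, F l ≤ 1) →
    ex (iid p N) F ≤ ex (iid q N) F + N * δ := by
  induction N with
  | zero => intro F _; simp [iid]
  | succ N ih =>
    intro F hF
    simp only [iid, ex_bind, ex_map]
    calc ex p (fun a => ex (iid p N) fun l => F (a :: l))
        ≤ ex p fun a => ex (iid q N) (fun l => F (a :: l)) + N * δ :=
          ex_mono fun a _ => ih _ fun l => hF _
      _ ≤ (ex q (fun a => ex (iid q N) fun l => F (a :: l)) + δ) + N * δ := by
          rw [ex_add, ex_const]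
          gcongr
          exact h _ fun a => ex_le fun l _ => hF _
      _ = _ := by push_cast; ring

theorem pr_listM_exists_le (g : α → PMF β) (s : β → Prop) (l : List α) :
    pr (listM g l) (fun r => ∃ y ∈ r, s y) ≤ (l.map fun a => pr (g a) s).sum := by
  induction l with
  | nil => simp [listM, pr]
  | cons a l ih =>
    rw [List.map_cons, List.sum_cons, listM]
    have h : pr ((g a).bind fun b => (listM g l).map fun l' => b :: l') (fun r => ∃ y ∈ r, s y) ≤
        pr ((g a).bind fun b => (listM g l).map fun l' => b :: l') (fun r => ∃ y ∈ r.head?, s y) +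
        pr ((g a).bind fun b => (listM g l).map fun l' => b :: l') (fun r => ∃ y ∈ r.tail, s y) := by
      refine (pr_mono fun r _ h => ?_).trans (pr_or_le _ _ _)
      cases r with
      | nil => simp at h
      | cons b r => simpa using h
    refine h.trans (add_le_add (le_of_eq ?_) (le_of_eq_of_le ?_ ih))
    · simp only [pr_bind, pr_map, List.head?_cons, Option.mem_some_iff, exists_eq_left']
      rw [pr_eq_ex]
      refine ex_congr fun b _ => ?_
      by_cases hb : s b
      · rw [if_pos hb]; exact pr_true fun _ _ => hb
      · rw [if_neg hb]; simp [hb, pr]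
    · simp only [pr_bind, pr_map, List.tail_cons, ex_const]

theorem pr_listM_forall (g : α → PMF β) (s : β → Prop) (l : List α) :
    pr (listM g l) (fun r => ∀ y ∈ r, s y) = (l.map fun a => pr (g a) s).prod := by
  induction l with
  | nil => rw [listM]; exact pr_true fun r hr => by simp at hr; simp [hr]
  | cons a l ih =>
    rw [List.map_cons, List.prod_cons, listM, pr_bind, ← ih, mul_comm, pr_eq_ex (g a),
      ← ex_mul_left]
    refine ex_congr fun b _ => ?_
    rw [pr_map]
    by_cases hb : s b
    · simp [hb]
    · simp [hb, pr]

end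

/-! ### The candidates are the influential coordinates -/

section

variable {n : ℕ}

/-- The test that the point `w.1` is in the subcube `ρ` and the `i`-th bit of `w.2` is `c`. -/
def agreeTest (ρ : Rest) (i : ℕ) (c : Bool) (w : Pt × Pt) : Bool :=
  inCube ρ w.1 && (w.2.getD i false == c)

theorem countP_agreeTest (Z : List (Pt × Pt)) (ρ : Rest) (i : ℕ) :
    Z.countP (agreeTest ρ i true) + Z.countP (agreeTest ρ i false) =
      Z.countP fun w => inCube ρ w.1 := by
  induction Z with
  | nil => rfl
  | cons w Z ih =>
    rw [List.countP_cons, List.countP_cons, List.countP_cons, ← ih]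
    unfold agreeTest
    cases inCube ρ w.1 <;> cases w.2.getD i false <;> simp <;> omega

theorem isCand_eq (T : ℕ) (Z : List (Pt × Pt)) {ρ : Rest} {i : ℕ} (hi : ρ.getD i none = none) :
    isCand T Z ρ i = true ↔ Z.countP (agreeTest ρ i false) * T + (Z.countP (agreeTest ρ i true) +
      Z.countP (agreeTest ρ i false)) ≤ Z.countP (agreeTest ρ i true) * T := by
  have h1 : (fun w : Pt × Pt => inCube ρ w.1 && !w.2.getD i false) = agreeTest ρ i false := by
    funext w; unfold agreeTest; cases w.2.getD i false <;> simp
  have h2 : (fun w : Pt × Pt => inCube ρ w.1 && w.2.getD i false) = agreeTest ρ i true := by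
    funext w; unfold agreeTest; cases w.2.getD i false <;> simp
  rw [countP_agreeTest, isCand, h1, h2, hi]
  simp

/-- The part of the bias of the `i`-th bit on the subcube `ρ`: the probability that it is set, minus
the probability that it is not. -/
def bias (q : PMF (Pt × Pt)) (ρ : Rest) (i : ℕ) : ℝ :=
  (pr q fun w => agreeTest ρ i true w = true).toReal -
    (pr q fun w => agreeTest ρ i false w = true).toReal

/-- What is needed of the distribution `q` of a random example with the bits that are used to select
the candidates: the biases of these bits detect the influences of the coordinates on `D`, and the
bias of the `i`-th bit is at most the probability that `D` changes when the `i`-th coordinate of the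
example is flipped. -/
structure Detects (q : PMF (Pt × Pt)) (D : Cube n → ℝ) : Prop where
  mass_eq : ∀ (ρ : Rest) (i : Fin n), ρ.length = n →
    (pr q fun w => agreeTest ρ i true w = true).toReal +
      (pr q fun w => agreeTest ρ i false w = true).toReal = mass D ρ
  bias_le : ∀ (ρ : Rest) (i : Fin n), ρ.length = n → ρ.getD i none = none →
    bias q ρ i ≤ ∑ x ∈ cubeSet n ρ, if D (flip x i) = D x then 0 else D x
  influence_le : ∀ (ρ : Rest) (i : Fin n), ρ.length = n → ρ.getD i none = none →
    influence D ρ i ^ 2 ≤ mass D ρ * bias q ρ i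

/-- The sum of the biases is at most the depth of the tree times the mass, since the density is
sensitive to at most as many coordinates as the tree is deep. -/
theorem Detects.sum_bias_le {q : PMF (Pt × Pt)} {D : Cube n → ℝ} (hq : Detects q D)
    (hD : ∀ x, 0 ≤ D x) {d : ℕ} {t : DecisionTree n} (ht : t.depth ≤ d) (hDt : ∀ x, D x = t.eval x)
    {ρ : Rest} (hl : ρ.length = n) (J : Finset (Fin n)) (hJ : ∀ i ∈ J, ρ.getD (i : ℕ) none = none) :
    ∑ i ∈ J, bias q ρ i ≤ d * mass D ρ := by
  calc ∑ i ∈ J, bias q ρ i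
      ≤ ∑ i ∈ J, ∑ x ∈ cubeSet n ρ, if D (flip x i) = D x then 0 else D x :=
        Finset.sum_le_sum fun i hi => hq.bias_le ρ i hl (hJ i hi)
    _ = ∑ x ∈ cubeSet n ρ, ∑ i ∈ J, if D (flip x i) = D x then 0 else D x := Finset.sum_comm
    _ ≤ ∑ x ∈ cubeSet n ρ, d * D x := by
        refine Finset.sum_le_sum fun x _ => ?_
        calc (∑ i ∈ J, if D (flip x i) = D x then 0 else D x)
            ≤ ∑ i : Fin n, if D (flip x i) = D x then 0 else D x :=
              Finset.sum_le_sum_of_subset_of_nonneg (Finset.subset_univ _) fun i _ _ => by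
                split_ifs <;> simp [hD]
          _ = (Finset.univ.filter fun i => t.eval (flip x i) ≠ t.eval x).card * D x := by
              rw [← nsmul_eq_mul, ← Finset.sum_const, Finset.sum_filter]
              refine Finset.sum_congr rfl fun i _ => ?_
              rw [← hDt, ← hDt]
              split_ifs <;> simp_all
          _ ≤ d * D x := by
              gcongr
              · exact hD x
              · exact (t.card_sensitive_le x).trans ht
    _ = d * mass D ρ := by rw [mass, Finset.mul_sum]

theorem length_filter_range (n : ℕ) (b : ℕ → Bool) :
    ((List.range n).filter b).length = (Finset.univ.filter fun i : Fin n => b i = true).card := by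
  rw [← List.toFinset_card_of_nodup (List.nodup_range.filter _)]
  symm
  refine Finset.card_bij (fun (i : Fin n) _ => (i : ℕ)) ?_ ?_ ?_
  · intro i hi
    simpa using hi
  · intro i _ j _ h; exact Fin.ext h
  · intro k hk
    simp only [List.toFinset_filter, Finset.mem_filter, List.mem_toFinset, List.mem_range] at hk
    exact ⟨⟨k, hk.1⟩, by simpa using hk.2, rfl⟩

/-- If the counts are accurate, then only coordinates of small influence are not candidates. -/
theorem influence_le_of_not_mem_cands {q : PMF (Pt × Pt)} {D : Cube n → ℝ} (hq : Detects q D)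
    (hD : ∀ x, 0 ≤ D x) {d : ℕ} {t : DecisionTree n} (ht : t.depth ≤ d) (hDt : ∀ x, D x = t.eval x)
    {T : ℕ} (hT : 1 ≤ T) (hTd : 2 * d ≤ T) {N lam : ℝ} (hN : 0 < N) (hlam : 0 < lam)
    {Z : List (Pt × Pt)} {ρ : Rest} (hl : ρ.length = n)
    (hZ : ∀ (i : Fin n) (c : Bool), |(Z.countP (agreeTest ρ i c) : ℝ) -
      N * (pr q fun w => agreeTest ρ i c w = true).toReal| < N * (lam / (8 * T))) :
    mass D ρ ≤ lam ∨ ∀ i : Fin n, ρ.getD i none = none → (i : ℕ) ∉ cands T Z ρ →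
      influence D ρ i ≤ √(2 / T) * mass D ρ := by
  refine (le_or_gt (mass D ρ) lam).imp_right fun hP => ?_
  have hT' : (1 : ℝ) ≤ T := by exact_mod_cast hT
  have hT0 : (0 : ℝ) < T := by linarith
  have hP0 : 0 < mass D ρ := hlam.trans hP
  set u := lam / (8 * T) with hu
  have hu0 : 0 < u := by positivity
  have huT : 8 * (u * T) = lam := by rw [hu]; field_simp
  have huT2 : u ≤ u * T := by nlinarith
  -- candidates have a bias of at least `mass / (2 * T)`, other free coordinates have a bias of at
  -- most `2 * mass / T`
  have key : ∀ i : Fin n, ρ.getD i none = none →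
      (isCand T Z ρ i = true → mass D ρ ≤ 2 * (bias q ρ i * T)) ∧
      (isCand T Z ρ i = false → bias q ρ i * T ≤ 2 * mass D ρ) := by
    intro i hi
    have h1 := abs_lt.1 (hZ i true)
    have h2 := abs_lt.1 (hZ i false)
    have h3 := hq.mass_eq ρ i hl
    set a := (Z.countP (agreeTest ρ i true) : ℝ) with ha
    set b := (Z.countP (agreeTest ρ i false) : ℝ) with hb
    have hbias : bias q ρ i = (pr q fun w => agreeTest ρ i true w = true).toReal -
      (pr q fun w => agreeTest ρ i false w = true).toReal := rfl
    set x := (pr q fun w => agreeTest ρ i true w = true).toReal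
    set y := (pr q fun w => agreeTest ρ i false w = true).toReal
    constructor
    · intro h
      have h4 : b * T + (a + b) ≤ a * T := by
        rw [ha, hb]; exact_mod_cast (isCand_eq T Z hi).1 h
      have h5 : N * (mass D ρ - 2 * u) ≤ N * ((bias q ρ i + 2 * u) * T) := by
        have e1 : N * (mass D ρ - 2 * u) ≤ a + b := by rw [← h3]; linarith
        have e2 : (a - b) * T ≤ (N * (bias q ρ i + 2 * u)) * T := by
          refine mul_le_mul_of_nonneg_right ?_ hT0.le
          rw [hbias]; linarith
        linarith
      have h6 := le_of_mul_le_mul_left h5 hN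
      linarith
    · intro h
      have h4 : a * T < b * T + (a + b) := by
        have := mt (isCand_eq T Z hi).2 (by rw [h]; simp)
        rw [ha, hb]; exact_mod_cast not_le.1 this
      have h5 : N * ((bias q ρ i - 2 * u) * T) ≤ N * (mass D ρ + 2 * u) := by
        have e1 : a + b ≤ N * (mass D ρ + 2 * u) := by rw [← h3]; linarith
        have e2 : (N * (bias q ρ i - 2 * u)) * T ≤ (a - b) * T := by
          refine mul_le_mul_of_nonneg_right ?_ hT0.le
          rw [hbias]; linarith
        linarith
      have h6 := le_of_mul_le_mul_left h5 hN
      linarith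
  -- the list of candidates is not cut off: as the biases sum to at most `d * mass`, there are at most
  -- `2 * d * T ≤ T ^ 2` candidates
  set J := Finset.univ.filter fun i : Fin n => isCand T Z ρ i = true with hJ
  have hfree : ∀ i ∈ J, ρ.getD (i : ℕ) none = none := by
    intro i hi
    have := (Finset.mem_filter.1 hi).2
    simp only [isCand, Bool.and_eq_true, Bool.not_eq_true', Option.isSome_eq_false_iff,
      Option.isNone_iff_eq_none] at this
    exact this.1
  have hcard : J.card ≤ T ^ 2 := by
    have h1 : (J.card : ℝ) * mass D ρ ≤ 2 * T * (d * mass D ρ) := by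
      calc (J.card : ℝ) * mass D ρ = ∑ i ∈ J, mass D ρ := by rw [Finset.sum_const, nsmul_eq_mul]
        _ ≤ ∑ i ∈ J, 2 * T * bias q ρ i := Finset.sum_le_sum fun i hi => by
            have := (key i (hfree i hi)).1 (Finset.mem_filter.1 hi).2
            linarith
        _ = 2 * T * ∑ i ∈ J, bias q ρ i := by rw [Finset.mul_sum]
        _ ≤ _ := by
            gcongr
            exact hq.sum_bias_le hD ht hDt hl J hfree
    have h2 : (J.card : ℝ) ≤ 2 * d * T :=
      le_of_mul_le_mul_right (h1.trans_eq (by ring)) hP0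
    have h3 : J.card ≤ 2 * d * T := by exact_mod_cast h2
    nlinarith
  have hcands : cands T Z ρ = (List.range ρ.length).filter (isCand T Z ρ) := by
    refine List.take_of_length_le ?_
    rw [length_filter_range, hl]
    exact hcard
  intro i hi hmem
  have h1 : isCand T Z ρ i = false := by
    rw [hcands, List.mem_filter, List.mem_range, hl] at hmem
    simpa using fun h => hmem ⟨i.2, h⟩
  have h2 := (key i hi).2 h1
  have h3 := hq.influence_le ρ i hl hi
  refine abs_le_of_sq_le_sq' (b := √(2 / T) * mass D ρ) ?_ (by positivity) |>.2
  rw [mul_pow, Real.sq_sqrt (by positivity)]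
  refine h3.trans ?_
  have h4 : bias q ρ i ≤ 2 / T * mass D ρ := by
    rw [div_mul_eq_mul_div, le_div_iff₀ hT0]; exact h2
  nlinarith

/-- With high probability only coordinates of small influence are not candidates. This is a union
bound over `3 ^ n` subcubes, `n` coordinates and the two values of a bit. -/
theorem pr_influential_le {q : PMF (Pt × Pt)} {D : Cube n → ℝ} (hq : Detects q D)
    (hD : ∀ x, 0 ≤ D x) {d : ℕ} {t : DecisionTree n} (ht : t.depth ≤ d) (hDt : ∀ x, D x = t.eval x)
    {T : ℕ} (hT : 1 ≤ T) (hTd : 2 * d ≤ T) {N : ℕ} (hN : 0 < N) {lam : ℝ} (hlam : 0 < lam)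
    (hlam1 : lam ≤ 1) :
    pr (iid q N) (fun Z => ¬ ∀ ρ : Rest, ρ.length = n → mass D ρ ≤ lam ∨
      ∀ i : Fin n, ρ.getD i none = none → (i : ℕ) ∉ cands T Z ρ →
        influence D ρ i ≤ √(2 / T) * mass D ρ) ≤
      ((3 ^ n * (n * 2) : ℕ) : ℝ≥0∞) *
        (2 * ENNReal.ofReal (Real.exp (-(N * (lam / (8 * T)) ^ 2 / 4)))) := by
  have hT' : (1 : ℝ) ≤ T := by exact_mod_cast hT
  have hu : lam / (8 * T) ≤ 2 := by
    rw [div_le_iff₀ (by positivity)]; nlinarith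
  have hcard : Fintype.card ((Fin n → Option Bool) × Fin n × Bool) = 3 ^ n * (n * 2) := by
    simp [Fintype.card_prod]
  rw [← hcard]
  refine le_trans (pr_mono fun Z hZ h => ?_) (pr_exists_le (iid q N)
    (fun (j : (Fin n → Option Bool) × Fin n × Bool) Z => (N : ℝ) * (lam / (8 * T)) ≤
      |((Z.countP (agreeTest (List.ofFn j.1) j.2.1 j.2.2) : ℕ) : ℝ) -
      N * (pr q fun w => agreeTest (List.ofFn j.1) j.2.1 j.2.2 w = true).toReal|)
    fun j => pr_countP_dev_le q _ N (by positivity) hu)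
  by_contra hne
  push Not at hne
  refine h fun ρ hl => ?_
  refine influence_le_of_not_mem_cands hq hD ht hDt hT hTd (N := N) (by exact_mod_cast hN) hlam hl
    fun i c => ?_
  have := hne (fun k => ρ.get (k.cast hl.symm), i, c)
  rwa [show List.ofFn (fun k : Fin n => ρ.get (k.cast hl.symm)) = ρ by
    subst hl; exact List.ofFn_get ρ] at this

/-! ### The estimates of the errors -/

theorem toReal_pr (D : PMF (Cube n)) (s : Cube n → Prop) [DecidablePred s] :
    (pr D s).toReal = ∑ x, if s x then (D x).toReal else 0 := by
  rw [pr_eq_ex, ex_fintype, ENNReal.toReal_sum fun x _ =>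
    ENNReal.mul_ne_top (D.apply_ne_top x) (by split_ifs <;> simp)]
  refine Finset.sum_congr rfl fun x _ => ?_
  by_cases h : s x <;> simp [h]

/-- The distribution of the labeled examples. -/
def exampleLaw (D : PMF (Cube n)) (f : Cube n → Bool) : PMF (Bool × Pt) :=
  D.map fun x => (f x, List.ofFn x)

/-- The test that the leaf `ℓ` errs on an example. -/
def errTest (ℓ : Leaf) (e : Bool × Pt) : Bool :=
  inCube ℓ.1 e.2 && !(evalGates ℓ.2.2 (overwrite ℓ.1 e.2 ℓ.2.1) == e.1)

theorem toReal_pr_errTest (D : PMF (Cube n)) (f : Cube n → Bool) (ℓ : Leaf) :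
    (pr (exampleLaw D f) fun e => errTest ℓ e = true).toReal =
      trueErr (fun x => (D x).toReal) f ℓ := by
  rw [exampleLaw, pr_map, toReal_pr, trueErr, cubeSet, Finset.sum_filter]
  refine Finset.sum_congr rfl fun x _ => ?_
  simp only [errTest]
  by_cases h1 : inCube ℓ.1 (List.ofFn x) = true <;>
  by_cases h2 : evalGates ℓ.2.2 (overwrite ℓ.1 (List.ofFn x) ℓ.2.1) = f x <;> simp [h1, h2]

/-- With high probability the errors of all hypotheses are estimated accurately. -/
theorem pr_leafErr_le (D : PMF (Cube n)) (f : Cube n → Bool)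
    (res : List (Option Rest × List (Pt × Gates))) {R N : ℕ} (hR : ∀ it ∈ res, it.2.length ≤ R)
    (hN : 0 < N) {lam : ℝ} (hlam : 0 < lam) (hlam1 : lam ≤ 1) :
    pr (iid (exampleLaw D f) N) (fun S => ¬ ∀ ρ hs, (some ρ, hs) ∈ res → ∀ h ∈ tried hs,
      |(leafErr S (ρ, h) : ℝ) / N - trueErr (fun x => (D x).toReal) f (ρ, h)| ≤ lam) ≤
      ((res.length * (R + 1) : ℕ) : ℝ≥0∞) *
        (2 * ENNReal.ofReal (Real.exp (-(N * lam ^ 2 / 4)))) := by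
  set ls : List Leaf := res.flatMap fun it => (([], []) :: it.2).map fun h => (it.1.getD [], h)
    with hls
  have hlen : ls.length ≤ res.length * (R + 1) := by
    rw [hls, List.length_flatMap]
    refine (List.sum_le_card_nsmul _ (R + 1) fun x hx => ?_).trans (by simp)
    obtain ⟨it, hit, rfl⟩ := List.mem_map.1 hx
    simpa using hR it hit
  have hN' : (0 : ℝ) < N := by exact_mod_cast hN
  refine le_trans (pr_mono fun S hS h => ?_) ((pr_exists_list_le_mul (iid (exampleLaw D f) N) ls
    (fun ℓ S => (N : ℝ) * lam ≤ |((S.countP (errTest ℓ) : ℕ) : ℝ) -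
      N * (pr (exampleLaw D f) fun e => errTest ℓ e = true).toReal|)
    fun ℓ _ => pr_countP_dev_le _ _ N hlam.le (by linarith)).trans (by gcongr))
  by_contra hne
  push Not at hne
  refine h fun ρ hs hmem h hh => ?_
  have hmem' : ((ρ, h) : Leaf) ∈ ls := by
    rw [hls, List.mem_flatMap]
    refine ⟨_, hmem, List.mem_map.2 ⟨h, ?_, rfl⟩⟩
    rcases hh with hh | rfl
    · exact List.mem_cons_of_mem _ hh
    · exact List.mem_cons_self
  have := hne _ hmem'
  rw [toReal_pr_errTest] at this
  have e : (leafErr S (ρ, h) : ℝ) / N - trueErr (fun x => (D x).toReal) f (ρ, h) =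
      (((S.countP (errTest (ρ, h)) : ℕ) : ℝ) -
        N * trueErr (fun x => (D x).toReal) f (ρ, h)) / N := by
    rw [sub_div, mul_div_cancel_left₀ _ hN'.ne']; rfl
  rw [e, abs_div, abs_of_pos hN', div_le_iff₀ hN', mul_comm lam]
  exact this.le

end

section

open Enc (enc)

/-! ### Running the given learner on a subcube -/

section

variable {n : ℕ}

/-- The uniform distribution on the cube. -/
abbrev unif (n : ℕ) : PMF (Cube n) := PMF.uniformOfFintype (Cube n)

/-- The point `x`, with the coordinates that `ρ` fixes moved into the subcube `ρ`. -/
def proj (ρ : Rest) (x : Cube n) : Cube n := fun i => (ρ.getD i none).getD (x i)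

/-- The point `x`, with the coordinates that `ρ` fixes replaced by those of `v`. -/
def mix (ρ : Rest) (x v : Cube n) : Cube n := fun i => if (ρ.getD i none).isSome then v i else x i

theorem overwrite_ofFn (ρ : Rest) (x v : Cube n) :
    overwrite ρ (List.ofFn x) (List.ofFn v) = List.ofFn (mix ρ x v) := by
  refine List.ext_getElem (by simp [overwrite]) fun k h1 h2 => ?_
  have hk : k < n := by simpa using h2
  have e1 := getD_ofFn v ⟨k, hk⟩
  have e2 := getD_ofFn x ⟨k, hk⟩
  simp only at e1 e2
  simp only [overwrite, List.getElem_map, List.getElem_range, e1, e2, List.getElem_ofFn, mix]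

theorem proj_mix {ρ : Rest} (hl : ρ.length = n) {y : Cube n} (hy : y ∈ cubeSet n ρ) (v : Cube n) :
    proj ρ (mix ρ y v) = y := by
  funext i
  have := (mem_cubeSet_iff hl).1 hy i
  unfold proj mix
  cases h : ρ.getD (i : ℕ) none with
  | none => simp
  | some b => simpa using this b h

theorem ClosedUnderRestriction.comp_proj {C : Set (Cube n → Bool)} (hC : ClosedUnderRestriction C)
    {f : Cube n → Bool} (hf : f ∈ C) (ρ : Rest) : (fun x => f (proj ρ x)) ∈ C := by
  have key : ∀ l : List (Fin n), (fun x => f fun i =>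
      if i ∈ l then (ρ.getD i none).getD (x i) else x i) ∈ C := by
    intro l
    induction l with
    | nil => simpa using hf
    | cons j l ih =>
      cases hj : ρ.getD (j : ℕ) none with
      | none =>
        convert ih using 3 with x
        funext i
        by_cases hij : i = j
        · subst hij
          rw [List.getD_eq_getElem?_getD] at hj
          simp [hj]
        · simp [hij]
      | some b =>
        convert hC _ ih j b using 3 with x
        funext i
        by_cases hij : i = j
        · subst hij
          rw [List.getD_eq_getElem?_getD] at hj
          simp [hj]
        · simp [hij]
  convert key (List.finRange n) using 3 with x
  funext i
  simp [proj]

theorem mix_mem_cubeSet {ρ : Rest} (hl : ρ.length = n) {y : Cube n} (hy : y ∈ cubeSet n ρ)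
    (v : Cube n) : mix ρ v y ∈ cubeSet n ρ := by
  rw [mem_cubeSet_iff hl] at hy ⊢
  intro i b hb
  simp only [mix, hb]
  exact hy i b hb

/-- If `y` is uniform on the subcube `ρ` and `v` is uniform, then `mix ρ y v` is uniform. -/
theorem sum_mix {ρ : Rest} (hl : ρ.length = n) (F : Cube n → ℝ≥0∞) :
    ∑ y ∈ cubeSet n ρ, ∑ v, F (mix ρ y v) = (cubeSet n ρ).card * ∑ x, F x := by
  rw [← nsmul_eq_mul, ← Finset.sum_const, ← Finset.sum_product', ← Finset.sum_product']
  refine Finset.sum_nbij' (fun z => (mix ρ z.2 z.1, mix ρ z.1 z.2))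
    (fun z => (mix ρ z.2 z.1, mix ρ z.1 z.2)) ?_ ?_ ?_ ?_ ?_
  · rintro ⟨y, v⟩ h
    simp only [Finset.mem_product, Finset.mem_univ, and_true] at h ⊢
    exact mix_mem_cubeSet hl h v
  · rintro ⟨y, v⟩ h
    simp only [Finset.mem_product, Finset.mem_univ, and_true] at h ⊢
    exact mix_mem_cubeSet hl h v
  · rintro ⟨y, v⟩ _
    simp only [Prod.mk.injEq]
    constructor <;> funext i <;> simp only [mix] <;> split_ifs <;> rfl
  · rintro ⟨y, v⟩ _
    simp only [Prod.mk.injEq]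
    constructor <;> funext i <;> simp only [mix] <;> split_ifs <;> rfl
  · rintro ⟨y, v⟩ _
    rfl

theorem ex_unif (F : Cube n → ℝ≥0∞) : ex (unif n) F = (2 ^ n : ℝ≥0∞)⁻¹ * ∑ x, F x := by
  rw [ex_fintype, Finset.mul_sum]
  simp

theorem ex_uniformOfFinset {α : Type} (s : Finset α) (hs : s.Nonempty) (F : α → ℝ≥0∞) :
    ex (PMF.uniformOfFinset s hs) F = (s.card : ℝ≥0∞)⁻¹ * ∑ x ∈ s, F x := by
  unfold ex
  rw [tsum_eq_sum (s := s) fun x hx => by simp [hx], Finset.mul_sum]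
  exact Finset.sum_congr rfl fun x hx => by simp [hx]

theorem ex_mix {ρ : Rest} (hl : ρ.length = n) (hs : (cubeSet n ρ).Nonempty) (F : Cube n → ℝ≥0∞) :
    ex (PMF.uniformOfFinset _ hs) (fun y => ex (unif n) fun v => F (mix ρ y v)) =
      ex (unif n) F := by
  have h0 : ((cubeSet n ρ).card : ℝ≥0∞) ≠ 0 := by simpa using hs.ne_empty
  simp only [ex_uniformOfFinset, ex_unif, ← Finset.mul_sum, sum_mix hl]
  rw [mul_left_comm, ← mul_assoc (_⁻¹) (_ : ℝ≥0∞) (∑ x, F x), ENNReal.inv_mul_cancel h0 (by simp),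
    one_mul]

/-- The distribution of a labeled example with a uniform point. -/
def coinedLaw (D : PMF (Cube n)) (f : Cube n → Bool) : PMF ((Bool × Pt) × Pt) :=
  D.bind fun x => (unif n).map fun v => ((f x, List.ofFn x), List.ofFn v)

/-- The example for the given learner. -/
def lifted (ρ : Rest) (e : (Bool × Pt) × Pt) : Bool × Pt := (e.1.1, overwrite ρ e.1.2 e.2)

/-- For examples that are uniform on a subcube, the given learner gets uniform examples, labeled
by the restriction of `f`. -/
theorem coinedLaw_map_lifted {ρ : Rest} (hl : ρ.length = n) (hs : (cubeSet n ρ).Nonempty)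
    (f : Cube n → Bool) (G : Bool × Pt → ℝ≥0∞) :
    ex ((coinedLaw (PMF.uniformOfFinset _ hs) f).map (lifted ρ)) G =
      ex (exampleLaw (unif n) fun x => f (proj ρ x)) G := by
  rw [ex_map, coinedLaw, ex_bind, exampleLaw, ex_map,
    ← ex_mix hl hs fun x => G (f (proj ρ x), List.ofFn x)]
  refine ex_congr fun y hy => ?_
  have hy' : y ∈ cubeSet n ρ := by simpa using hy
  rw [ex_map]
  refine ex_congr fun v _ => ?_
  rw [lifted, overwrite_ofFn, proj_mix hl hy']

/-- The total deviation of `D` from its average on the subcube `ρ`. -/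
def deviation (D : Cube n → ℝ) (ρ : Rest) : ℝ :=
  ∑ x ∈ cubeSet n ρ, |D x - mass D ρ / (cubeSet n ρ).card|

theorem deviation_le (D : Cube n → ℝ) (ρ : Rest) (c : ℝ) :
    deviation D ρ ≤ 2 * ∑ x ∈ cubeSet n ρ, |D x - c| := by
  rcases (cubeSet n ρ).eq_empty_or_nonempty with h | h
  · simp [deviation, h]
  have hc : (0 : ℝ) < (cubeSet n ρ).card := by exact_mod_cast h.card_pos
  have h1 : (cubeSet n ρ).card * |c - mass D ρ / (cubeSet n ρ).card| ≤
      ∑ x ∈ cubeSet n ρ, |D x - c| := by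
    rw [← abs_of_pos hc, ← abs_mul, abs_of_pos hc, mul_sub, mul_div_cancel₀ _ hc.ne', mass,
      ← nsmul_eq_mul, ← Finset.sum_const, ← Finset.sum_sub_distrib]
    refine (Finset.abs_sum_le_sum_abs _ _).trans_eq (Finset.sum_congr rfl fun x _ => abs_sub_comm _ _)
  have h2 : deviation D ρ ≤ ∑ x ∈ cubeSet n ρ, (|D x - c| + |c - mass D ρ / (cubeSet n ρ).card|) :=
    Finset.sum_le_sum fun x _ => abs_sub_le _ _ _
  rw [Finset.sum_add_distrib, Finset.sum_const, nsmul_eq_mul] at h2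
  linarith

theorem exists_mem_support {D : PMF (Cube n)} {ρ : Rest}
    (hP : 0 < mass (fun x => (D x).toReal) ρ) :
    ∃ x ∈ (cubeSet n ρ : Set (Cube n)), x ∈ D.support := by
  obtain ⟨x, hx, h⟩ := Finset.exists_ne_zero_of_sum_ne_zero hP.ne'
  exact ⟨x, hx, by rw [PMF.mem_support_iff]; rintro h0; simp [h0] at h⟩

theorem filter_apply_eq {D : PMF (Cube n)} {ρ : Rest} (hP : 0 < mass (fun x => (D x).toReal) ρ)
    {x : Cube n} (hx : x ∈ cubeSet n ρ) :
    D.filter (cubeSet n ρ : Set (Cube n)) (exists_mem_support hP) x =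
      ENNReal.ofReal ((D x).toReal / mass (fun x => (D x).toReal) ρ) := by
  rw [PMF.filter_apply, Set.indicator_of_mem (by exact_mod_cast hx), ENNReal.ofReal_div_of_pos hP,
    ENNReal.ofReal_toReal (D.apply_ne_top x), div_eq_mul_inv]
  congr 2
  rw [mass, ENNReal.ofReal_sum_of_nonneg fun _ _ => ENNReal.toReal_nonneg,
    tsum_eq_sum (s := cubeSet n ρ) fun y hy => by
      rw [Set.indicator_of_notMem (by exact_mod_cast hy)]]
  refine Finset.sum_congr rfl fun y hy => ?_
  rw [Set.indicator_of_mem (by exact_mod_cast hy), ENNReal.ofReal_toReal (D.apply_ne_top y)]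

/-- The uniform distribution on a subcube is close to the conditional distribution, if the density
is almost constant. -/
theorem ex_uniform_le {D : PMF (Cube n)} {ρ : Rest} (hs : (cubeSet n ρ).Nonempty)
    (hP : 0 < mass (fun x => (D x).toReal) ρ) {G : Cube n → ℝ≥0∞} (hG : ∀ x, G x ≤ 1) :
    ex (PMF.uniformOfFinset _ hs) G ≤
      ex (D.filter (cubeSet n ρ : Set (Cube n)) (exists_mem_support hP)) G +
      ENNReal.ofReal (deviation (fun x => (D x).toReal) ρ / mass (fun x => (D x).toReal) ρ) := by
  have hc : (0 : ℝ) < (cubeSet n ρ).card := by exact_mod_cast hs.card_pos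
  set P := mass (fun x => (D x).toReal) ρ with hPdef
  have h1 : ex (D.filter (cubeSet n ρ : Set (Cube n)) (exists_mem_support hP)) G =
      ∑ x ∈ cubeSet n ρ, ENNReal.ofReal ((D x).toReal / P) * G x := by
    unfold ex
    rw [tsum_eq_sum (s := cubeSet n ρ) fun x hx => by
      rw [PMF.filter_apply_eq_zero_of_notMem _ (by exact_mod_cast hx), zero_mul]]
    exact Finset.sum_congr rfl fun x hx => by rw [filter_apply_eq hP hx]
  have h2 : ENNReal.ofReal (deviation (fun x => (D x).toReal) ρ / P) =
      ∑ x ∈ cubeSet n ρ, ENNReal.ofReal (|(D x).toReal - P / (cubeSet n ρ).card| / P) := by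
    rw [← ENNReal.ofReal_sum_of_nonneg fun _ _ => by positivity, deviation, Finset.sum_div]
  rw [ex_uniformOfFinset, h1, h2, ← Finset.sum_add_distrib, Finset.mul_sum]
  refine Finset.sum_le_sum fun x _ => ?_
  have h3 : ((cubeSet n ρ).card : ℝ≥0∞)⁻¹ ≤ ENNReal.ofReal ((D x).toReal / P) +
      ENNReal.ofReal (|(D x).toReal - P / (cubeSet n ρ).card| / P) := by
    rw [← ENNReal.ofReal_add (by positivity) (by positivity), ← ENNReal.ofReal_natCast,
      ← ENNReal.ofReal_inv_of_pos hc]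
    refine ENNReal.ofReal_le_ofReal ?_
    rw [← add_div, le_div_iff₀ hP, inv_mul_eq_div]
    have := neg_abs_le ((D x).toReal - P / (cubeSet n ρ).card)
    linarith
  calc ((cubeSet n ρ).card : ℝ≥0∞)⁻¹ * G x ≤ (ENNReal.ofReal ((D x).toReal / P) +
      ENNReal.ofReal (|(D x).toReal - P / (cubeSet n ρ).card| / P)) * G x := by gcongr
    _ ≤ _ := by
      rw [add_mul]
      gcongr
      exact (mul_le_mul_right (hG x) _).trans_eq (mul_one _)

/-- The error of a hypothesis on a subcube is at most the error for the uniform distribution on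
the subcube, and the deviation. -/
theorem trueErr_le {D : PMF (Cube n)} {ρ : Rest} (hs : (cubeSet n ρ).Nonempty) (f : Cube n → Bool)
    (h : Pt × Gates) {b : ℝ} (hb : 0 ≤ b)
    (hh : pr (PMF.uniformOfFinset _ hs) (fun y => evalGates h.2 (overwrite ρ (List.ofFn y) h.1) ≠ f y)
      ≤ ENNReal.ofReal b) :
    trueErr (fun x => (D x).toReal) f (ρ, h) ≤ b * mass (fun x => (D x).toReal) ρ +
      deviation (fun x => (D x).toReal) ρ := by
  classical
  have hc : (0 : ℝ) < (cubeSet n ρ).card := by exact_mod_cast hs.card_pos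
  set P := mass (fun x => (D x).toReal) ρ with hPdef
  have hP : 0 ≤ P := mass_nonneg (fun _ => ENNReal.toReal_nonneg) ρ
  set W := (cubeSet n ρ).filter fun y => evalGates h.2 (overwrite ρ (List.ofFn y) h.1) ≠ f y with hW
  have h1 : (W.card : ℝ) ≤ b * (cubeSet n ρ).card := by
    rw [pr_eq_ex, ex_uniformOfFinset] at hh
    have hh' : ((cubeSet n ρ).card : ℝ≥0∞)⁻¹ * W.card ≤ ENNReal.ofReal b := by
      refine le_of_eq_of_le ?_ hh
      rw [hW, Finset.natCast_card_filter]
      congr 1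
      refine Finset.sum_congr rfl fun x _ => ?_
      congr
    have := ENNReal.toReal_mono ENNReal.ofReal_ne_top hh'
    rw [ENNReal.toReal_ofReal hb, ENNReal.toReal_mul, ENNReal.toReal_inv, ENNReal.toReal_natCast,
      ENNReal.toReal_natCast, inv_mul_le_iff₀ hc] at this
    linarith
  calc trueErr (fun x => (D x).toReal) f (ρ, h) = ∑ x ∈ W, (D x).toReal := by
        rw [trueErr, hW, Finset.sum_filter]
        refine Finset.sum_congr rfl fun x _ => ?_
        by_cases h0 : evalGates h.2 (overwrite ρ (List.ofFn x) h.1) = f x <;> simp [h0]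
    _ ≤ ∑ x ∈ W, (P / (cubeSet n ρ).card + |(D x).toReal - P / (cubeSet n ρ).card|) :=
        Finset.sum_le_sum fun x _ => by
          have := le_abs_self ((D x).toReal - P / (cubeSet n ρ).card)
          linarith
    _ ≤ _ := by
        rw [Finset.sum_add_distrib, Finset.sum_const, nsmul_eq_mul]
        refine add_le_add ?_ ?_
        · calc (W.card : ℝ) * (P / (cubeSet n ρ).card)
              ≤ b * (cubeSet n ρ).card * (P / (cubeSet n ρ).card) := by gcongr
            _ = b * P := by field_simp
        · exact Finset.sum_le_sum_of_subset_of_nonneg (Finset.filter_subset _ _)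
            fun _ _ _ => abs_nonneg _

/-- The output distribution of the given learner is correct for the uniform distribution: with
probability at least `1 / 2`, the error is at most `ε`. -/
def LearnsUniform (law : Data → PMF Data) (n m E : ℕ) (ε : ℝ) (f : Cube n → Bool) : Prop :=
  2⁻¹ ≤ pr ((iid (exampleLaw (unif n) f) m).bind fun S => law (enc (([n, E], S) : Job)))
    fun g => pr (unif n) (fun x => evalGates (decodeCircuit g) (List.ofFn x) ≠ f x) ≤
      ENNReal.ofReal ε

theorem mul_pr_le_ex {α : Type} (p : PMF α) (F : α → ℝ≥0∞) (c : ℝ≥0∞) :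
    c * pr p (fun a => c < F a) ≤ ex p F := by
  rw [pr_eq_ex, ← ex_mul_left]
  refine ex_mono fun a _ => ?_
  split_ifs with h
  · rw [mul_one]; exact h.le
  · simp

/-- The input for the given learner that is made from one block of examples. -/
def jobOf (n E : ℕ) (ρ : Rest) (l : List ((Bool × Pt) × Pt)) : Pt × Job :=
  (l.head?.elim [] fun e => e.2, ([n, E], l.tail.map (lifted ρ)))

/-- The distribution of the hypothesis for an input. -/
def hypLaw (law : Data → PMF Data) (j : Pt × Job) : PMF (Pt × Gates) :=
  (law (enc j.2)).map fun g => (j.1, decodeCircuit g)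

/-- One run of the given learner fails with probability bounded away from one, even if the examples
come from a distribution that is only close to the uniform one. The first point of the block,
which overwrites the fixed coordinates, is independent of the rest. -/
theorem ex_hypLaw_le {law : Data → PMF Data} {m E : ℕ} {ε κ : ℝ} (hε : 0 < ε) (hκ : 0 < κ)
    {f : Cube n → Bool} {ρ : Rest} (hl : ρ.length = n) (hs : (cubeSet n ρ).Nonempty)
    (hA : LearnsUniform law n m E ε fun x => f (proj ρ x)) (p : PMF (Cube n))
    (hp : ∀ G : Cube n → ℝ≥0∞, (∀ x, G x ≤ 1) → ex (PMF.uniformOfFinset _ hs) G ≤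
      ex p G + ENNReal.ofReal (1 / (16 * m))) :
    ex (iid (coinedLaw p f) (m + 1)) (fun l => pr (hypLaw law (jobOf n E ρ l)) fun h =>
      ¬ pr (PMF.uniformOfFinset _ hs)
        (fun y => evalGates h.2 (overwrite ρ (List.ofFn y) h.1) ≠ f y) ≤
          ENNReal.ofReal ((1 + κ) * ε)) ≤
      ENNReal.ofReal (1 - 7 / 16 * (κ / (1 + κ))) := by
  classical
  set good : Pt × Gates → Prop := fun h => pr (PMF.uniformOfFinset _ hs)
    (fun y => evalGates h.2 (overwrite ρ (List.ofFn y) h.1) ≠ f y) ≤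
      ENNReal.ofReal ((1 + κ) * ε) with hgood
  set B := (iid (coinedLaw p f) m).bind fun l => law (enc (([n, E], l.map (lifted ρ)) : Job)) with hB
  set okG : Data → Prop := fun g => pr (unif n) (fun x => evalGates (decodeCircuit g) (List.ofFn x) ≠
    f (proj ρ x)) ≤ ENNReal.ofReal ε with hokG
  -- the distribution of the first point is uniform
  have e1 : ex (iid (coinedLaw p f) (m + 1)) (fun l => pr (hypLaw law (jobOf n E ρ l)) fun h =>
      ¬ good h) = ex B fun g => pr (unif n) fun v => ¬ good (List.ofFn v, decodeCircuit g) := by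
    rw [iid, ex_bind]
    simp only [ex_map, jobOf, hypLaw, List.head?_cons, Option.elim_some, List.tail_cons, pr_map]
    simp only [← pr_bind, ← hB]
    simp only [pr_eq_ex]
    rw [ex_comm]
    refine ex_congr fun g _ => ?_
    rw [coinedLaw, ex_bind]
    simp only [ex_map]
    refine (ex_congr fun x _ => ?_).trans (ex_const p _)
    congr!
  -- Markov's inequality for the random point
  have e2 : ∀ g, okG g → pr (unif n) (fun v => ¬ good (List.ofFn v, decodeCircuit g)) ≤
      ENNReal.ofReal (1 / (1 + κ)) := by
    intro g hg
    have h1 := mul_pr_le_ex (unif n) (fun v => pr (PMF.uniformOfFinset _ hs)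
      (fun y => evalGates (decodeCircuit g) (overwrite ρ (List.ofFn y) (List.ofFn v)) ≠ f y))
      (ENNReal.ofReal ((1 + κ) * ε))
    have h2 : (ex (unif n) fun v => pr (PMF.uniformOfFinset _ hs)
        (fun y => evalGates (decodeCircuit g) (overwrite ρ (List.ofFn y) (List.ofFn v)) ≠ f y)) =
        pr (unif n) fun x => evalGates (decodeCircuit g) (List.ofFn x) ≠ f (proj ρ x) := by
      simp only [pr_eq_ex]
      rw [ex_comm, ← ex_mix hl hs]
      refine ex_congr fun y hy => ex_congr fun v _ => ?_
      rw [overwrite_ofFn, proj_mix hl (by simpa using hy)]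
    rw [h2] at h1
    have h3 := h1.trans hg
    have h4 : pr (unif n) (fun v => ¬ good (List.ofFn v, decodeCircuit g)) ≤
        ENNReal.ofReal ε / ENNReal.ofReal ((1 + κ) * ε) := by
      rw [ENNReal.le_div_iff_mul_le (Or.inl (by simp; positivity)) (Or.inl (by simp)), mul_comm]
      simpa only [hgood, not_le] using h3
    refine h4.trans_eq ?_
    rw [← ENNReal.ofReal_div_of_pos (by positivity)]
    congr 1
    field_simp
  -- the success of the given learner
  have e3 : 2⁻¹ ≤ pr B okG + ENNReal.ofReal (1 / 16) := by
    refine hA.trans ?_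
    have h0 : ∀ q : PMF (Bool × Pt), pr ((iid q m).bind fun S => law (enc (([n, E], S) : Job))) okG =
        ex (iid q m) fun S => pr (law (enc (([n, E], S) : Job))) okG := fun q => pr_bind _ _ _
    have h1 := ex_iid_le (p := exampleLaw (unif n) fun x => f (proj ρ x))
      (q := (coinedLaw p f).map (lifted ρ)) (δ := ENNReal.ofReal (1 / (16 * m))) (fun G hG => by
        rw [← coinedLaw_map_lifted hl hs, ex_map, ex_map, coinedLaw, coinedLaw, ex_bind, ex_bind]
        exact hp _ fun x => ex_le fun a _ => hG _) m
      (fun S => pr (law (enc (([n, E], S) : Job))) okG) fun S => pr_le_one _ _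
    refine (h0 _).trans_le (h1.trans (add_le_add (le_of_eq ?_) ?_))
    · rw [iid_map, ex_map, ← pr_bind]
    · rw [← ENNReal.ofReal_natCast, ← ENNReal.ofReal_mul (by positivity)]
      refine ENNReal.ofReal_le_ofReal ?_
      rcases Nat.eq_zero_or_pos m with rfl | hm
      · norm_num
      · have : (m : ℝ) ≠ 0 := by positivity
        refine le_of_eq ?_
        field_simp
  rw [e1]
  have hw0 : 0 ≤ 1 / (1 + κ) := by positivity
  have hw1 : 1 / (1 + κ) = 1 - κ / (1 + κ) := by field_simp; ring
  calc ex B (fun g => pr (unif n) fun v => ¬ good (List.ofFn v, decodeCircuit g))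
      ≤ ex B fun g => (if ¬ okG g then 1 else 0) +
          ENNReal.ofReal (1 / (1 + κ)) * (if okG g then 1 else 0) := by
        refine ex_mono fun g _ => ?_
        by_cases h : okG g
        · simpa [h] using e2 g h
        · simpa [h] using pr_le_one _ _
    _ = pr B (fun g => ¬ okG g) + ENNReal.ofReal (1 / (1 + κ)) * pr B okG := by
        rw [ex_add, ex_mul_left, pr_eq_ex, pr_eq_ex]
        congr!
    _ ≤ _ := by
        have h1 := pr_add_pr_not B okG
        set a := (pr B okG).toReal with ha
        have ha' : pr B okG = ENNReal.ofReal a := (ENNReal.ofReal_toReal (pr_ne_top _ _)).symm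
        have ha0 : 0 ≤ a := ENNReal.toReal_nonneg
        have ha1 : a ≤ 1 := ENNReal.toReal_mono ENNReal.one_ne_top (pr_le_one _ _)
        have hb : pr B (fun g => ¬ okG g) = ENNReal.ofReal (1 - a) := by
          rw [ENNReal.ofReal_sub _ ha0, ENNReal.ofReal_one, ← ha', ← h1]
          exact (ENNReal.add_sub_cancel_left (pr_ne_top _ _)).symm
        have h2 : (7 / 16 : ℝ) ≤ a := by
          rw [ha', ← ENNReal.ofReal_add ha0 (by norm_num)] at e3
          have := ENNReal.toReal_mono ENNReal.ofReal_ne_top e3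
          rw [ENNReal.toReal_ofReal (by positivity), ENNReal.toReal_inv] at this
          norm_num at this
          linarith
        rw [hb, ha', ← ENNReal.ofReal_mul hw0, ← ENNReal.ofReal_add (by linarith) (by positivity)]
        refine ENNReal.ofReal_le_ofReal ?_
        rw [hw1]
        have : 0 ≤ κ / (1 + κ) := by positivity
        nlinarith

end

end


section

open Enc (enc)

/-! ### Success on the subcubes of the search space -/

section

variable {n : ℕ}

/-- A distribution is a mixture of its conditional distributions for the two values of `b`. -/
theorem exists_mixture {α : Type} (D : PMF α) (b : α → Bool) (p₁ : PMF α)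
    (h1 : ∃ h : ∃ x ∈ {x | b x = true}, x ∈ D.support, p₁ = D.filter {x | b x = true} h) :
    ∃ (β : PMF Bool) (p₀ : PMF α), D = (β.bind fun c => if c then p₁ else p₀) ∧
      ∀ c ∈ β.support, ∀ x ∈ (if c then p₁ else p₀).support, b x = c := by
  classical
  let cond : Bool → PMF α := fun c =>
    if h : ∃ x ∈ {x | b x = c}, x ∈ D.support then D.filter {x | b x = c} h else D
  have hc1 : cond true = p₁ := by
    obtain ⟨h, rfl⟩ := h1
    simp only [cond, dif_pos h]
  have hif : ∀ c : Bool, (if c then p₁ else cond false) = cond c := by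
    intro c; cases c <;> simp [hc1]
  have hsup : ∀ c, (D.map b) c ≠ 0 → ∃ x ∈ {x | b x = c}, x ∈ D.support := by
    intro c hc
    have := (PMF.mem_support_iff _ _).2 hc
    rw [PMF.support_map] at this
    obtain ⟨x, hx, rfl⟩ := this
    exact ⟨x, rfl, hx⟩
  refine ⟨D.map b, cond false, ?_, ?_⟩
  · simp only [hif]
    ext x
    rw [PMF.bind_apply, tsum_eq_single (b x) fun c hc => ?_]
    · by_cases hx : x ∈ D.support
      · have h : ∃ y ∈ {y | b y = b x}, y ∈ D.support := ⟨x, rfl, hx⟩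
        have e1 : (D.map b) (b x) = ∑' y, ({y | b y = b x} : Set α).indicator D y := by
          rw [PMF.map_apply]
          refine tsum_congr fun y => ?_
          by_cases hy : b y = b x
          · simp [hy]
          · simp [hy, Ne.symm hy]
        have e2 : (D.map b) (b x) ≠ 0 := by
          rw [← PMF.mem_support_iff, PMF.support_map]
          exact ⟨x, hx, rfl⟩
        simp only [cond, dif_pos h]
        rw [PMF.filter_apply, Set.indicator_of_mem (by rfl), ← e1, mul_left_comm,
          ENNReal.mul_inv_cancel e2 ((D.map b).apply_ne_top _), mul_one]
      · have h0 : D x = 0 := by rwa [PMF.mem_support_iff, not_not] at hx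
        rw [h0, eq_comm, mul_eq_zero]
        right
        simp only [cond]
        split_ifs with h
        · rw [PMF.filter_apply_eq_zero_iff]; exact Or.inr hx
        · exact h0
    · by_cases h0 : (D.map b) c = 0
      · rw [h0, zero_mul]
      · simp only [cond, dif_pos (hsup c h0)]
        rw [PMF.filter_apply_eq_zero_of_notMem _ (by simpa using hc.symm), mul_zero]
  · intro c hc x hx
    rw [hif] at hx
    simp only [cond, dif_pos (hsup c ((PMF.mem_support_iff _ _).1 hc))] at hx
    exact ((PMF.mem_support_filter_iff _).1 hx).1

theorem length_jobs_le (n E m R : ℕ) (U : List ((Bool × Pt) × Pt)) (ρ : Rest) :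
    (jobs n E m R U ρ).length ≤ R := by
  unfold jobs
  rw [List.length_flatMap]
  refine (List.sum_le_card_nsmul _ 1 fun x hx => ?_).trans (by simp)
  obtain ⟨j, -, rfl⟩ := List.mem_map.1 hx
  split_ifs <;> simp

theorem length_chunk {α : Type} {k R j : ℕ} {F : List α} (hF : R * k ≤ F.length) (hj : j < R) :
    (chunk k F j).length = k := by
  unfold chunk
  rw [List.length_take, List.length_drop]
  have : (j + 1) * k ≤ R * k := Nat.mul_le_mul_right _ hj
  rw [Nat.add_mul] at this
  omega

theorem jobs_eq {n E m R : ℕ} {U : List ((Bool × Pt) × Pt)} {ρ : Rest}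
    (h : R * (m + 1) ≤ (U.filter fun e => inCube ρ e.1.2).length) :
    jobs n E m R U ρ = (List.range R).map fun j =>
      jobOf n E ρ (chunk (m + 1) (U.filter fun e => inCube ρ e.1.2) j) := by
  unfold jobs
  rw [List.map_eq_flatMap]
  have : ∀ l : List ℕ, (∀ j ∈ l, j < R) → (l.flatMap fun j =>
    if decide (m + 1 ≤ (chunk (m + 1) (U.filter fun e => inCube ρ e.1.2) j).length) then
      [((chunk (m + 1) (U.filter fun e => inCube ρ e.1.2) j).head?.elim [] fun e => e.2, ([n, E],
        (chunk (m + 1) (U.filter fun e => inCube ρ e.1.2) j).tail.map fun e =>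
          (e.1.1, overwrite ρ e.1.2 e.2)))]
    else []) = l.flatMap fun j =>
      [jobOf n E ρ (chunk (m + 1) (U.filter fun e => inCube ρ e.1.2) j)] := by
    intro l hl
    induction l with
    | nil => rfl
    | cons j l ih =>
      rw [List.flatMap_cons, List.flatMap_cons, ih fun k hk => hl k (by simp [hk]),
        length_chunk h (hl j (by simp)), if_pos (by simp)]
      rfl
  exact this _ fun j hj => List.mem_range.1 hj

/-- One of the hypotheses that are tried for the subcube `ρ` is good enough for the search: relative
to the mass its error is at most `beta`, up to `lam` and a multiple of the distance of the density
from a constant. -/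
def IsGood (D : Cube n → ℝ) (f : Cube n → Bool) (alpha beta lam : ℝ) (ρ : Rest)
    (hs : List (Pt × Gates)) : Prop :=
  ∃ h ∈ tried hs, ∀ c : ℝ, trueErr D f (ρ, h) ≤
    beta * mass D ρ + alpha * ∑ x ∈ cubeSet n ρ, |D x - c| + lam

theorem toReal_pr_coinedLaw (D : PMF (Cube n)) (f : Cube n → Bool) (ρ : Rest) :
    (pr (coinedLaw D f) fun e => inCube ρ e.1.2 = true).toReal =
      mass (fun x => (D x).toReal) ρ := by
  rw [coinedLaw, pr_bind]
  have : ∀ x : Cube n, pr ((unif n).map fun v => ((f x, List.ofFn x), List.ofFn v))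
      (fun e => inCube ρ e.1.2 = true) = if inCube ρ (List.ofFn x) = true then 1 else 0 := by
    intro x
    rw [pr_map]
    split_ifs with hx
    · exact pr_true fun _ _ => hx
    · simp [hx, pr]
  simp only [this]
  have e4 : (ex D fun x => if inCube ρ (List.ofFn x) = true then 1 else 0) =
      pr D fun x => inCube ρ (List.ofFn x) = true := by
    rw [pr_eq_ex]
    congr!
  rw [e4, toReal_pr, mass, cubeSet, Finset.sum_filter]

theorem pr_length_of_filter {α : Type} {p p₁ : PMF α} {b : α → Bool} {N : ℕ} {L : PMF ℕ}
    (hL : (iid p N).map (List.filter b) = L.bind (iid p₁)) (s : ℕ → Prop) :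
    pr L s = pr (iid p N) fun U => s (U.countP b) := by
  have e : L = ((iid p N).map (List.filter b)).map List.length := by
    rw [hL, PMF.map_bind]
    conv_lhs => rw [← PMF.bind_pure L]
    congr 1; funext k
    have : (iid p₁ k).map List.length = (iid p₁ k).map fun _ => k :=
      pmf_map_congr _ fun l hl => length_of_mem_iid hl
    rw [this]
    exact (PMF.map_const _ _).symm
  rw [e, pr_map, pr_map]
  simp only [List.countP_eq_length_filter]

theorem pr_jobs_forall {law : Data → PMF Data} {n E m R : ℕ} {U : List ((Bool × Pt) × Pt)}
    {ρ : Rest} (h : R * (m + 1) ≤ (U.filter fun e => inCube ρ e.1.2).length)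
    (s : Pt × Gates → Prop) :
    pr (listM (hypLaw law) (jobs n E m R U ρ)) (fun hs => ∀ h ∈ hs, s h) =
      ((List.range R).map fun j => pr (hypLaw law
        (jobOf n E ρ (chunk (m + 1) (U.filter fun e => inCube ρ e.1.2) j))) s).prod := by
  rw [jobs_eq h, listM_map_left, pr_listM_forall]

/-- With high probability one of the runs of the given learner on a subcube yields a good
hypothesis. If the subcube is light, or the density is far from constant on it, then all hypotheses
are good. -/
theorem ex_jobs_le {law : Data → PMF Data} {m E R N : ℕ} {ε κ lam : ℝ} (hm : 1 ≤ m) (hε : 0 < ε)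
    (hκ : 0 < κ) (hlam : 0 < lam) (hlam1 : lam ≤ 1) (hN : 2 * (R * (m + 1)) ≤ N * lam)
    (D : PMF (Cube n)) {f : Cube n → Bool} {ρ : Rest} (hl : ρ.length = n)
    (hA : LearnsUniform law n m E ε fun x => f (proj ρ x)) :
    ex (iid (coinedLaw D f) N) (fun U => pr (listM (hypLaw law) (jobs n E m R U ρ)) fun hs =>
      ¬ IsGood (fun x => (D x).toReal) f (32 * m) ((1 + κ) * ε) lam ρ hs) ≤
      2 * ENNReal.ofReal (Real.exp (-(N * (lam / 2) ^ 2 / 4))) +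
        ENNReal.ofReal (1 - 7 / 16 * (κ / (1 + κ))) ^ R := by
  classical
  set D' : Cube n → ℝ := fun x => (D x).toReal with hD'
  have hD0 : ∀ x, 0 ≤ D' x := fun x => ENNReal.toReal_nonneg
  have hM0 := mass_nonneg hD0 ρ
  have hm' : (1 : ℝ) ≤ m := by exact_mod_cast hm
  have hb0 : 0 ≤ (1 + κ) * ε * mass D' ρ := by positivity
  have hsum0 : ∀ c : ℝ, 0 ≤ ∑ x ∈ cubeSet n ρ, |D' x - c| := fun c =>
    Finset.sum_nonneg fun _ _ => abs_nonneg _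
  have triv : (∀ hs, IsGood D' f (32 * m) ((1 + κ) * ε) lam ρ hs) →
      ex (iid (coinedLaw D f) N) (fun U => pr (listM (hypLaw law) (jobs n E m R U ρ)) fun hs =>
      ¬ IsGood D' f (32 * m) ((1 + κ) * ε) lam ρ hs) = 0 := by
    intro h
    simp only [h, not_true_eq_false]
    exact (ex_congr fun _ _ => by simp [pr]).trans (ex_const _ 0)
  -- on a light subcube, the mass bounds every error
  by_cases hP : mass D' ρ ≤ lam
  · rw [triv fun hs => ⟨([], []), Or.inr rfl, fun c => ?_⟩]
    · exact zero_le
    · have h1 := trueErr_le_mass hD0 f (ρ, ([], []))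
      have h2 : 0 ≤ 32 * m * ∑ x ∈ cubeSet n ρ, |D' x - c| := by have := hsum0 c; positivity
      simp only at h1
      linarith
  -- if the density is far from constant, the term with the distance from a constant does
  by_cases hdev : mass D' ρ ≤ 16 * m * deviation D' ρ
  · rw [triv fun hs => ⟨([], []), Or.inr rfl, fun c => ?_⟩]
    · exact zero_le
    · have h1 := trueErr_le_mass hD0 f (ρ, ([], []))
      have h2 := mul_le_mul_of_nonneg_left (deviation_le D' ρ c) (by positivity : (0 : ℝ) ≤ 16 * m)
      simp only at h1
      linarith
  push Not at hP hdev
  have hP0 : 0 < mass D' ρ := hlam.trans hP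
  have hs : (cubeSet n ρ).Nonempty := by
    obtain ⟨x, hx, -⟩ := exists_mem_support hP0
    exact ⟨x, by exact_mod_cast hx⟩
  set p₁ := D.filter (cubeSet n ρ : Set (Cube n)) (exists_mem_support hP0) with hp₁
  set ψ : List ((Bool × Pt) × Pt) → ℝ≥0∞ := fun l => pr (hypLaw law (jobOf n E ρ l)) fun h =>
      ¬ pr (PMF.uniformOfFinset _ hs)
        (fun y => evalGates h.2 (overwrite ρ (List.ofFn y) h.1) ≠ f y) ≤
          ENNReal.ofReal ((1 + κ) * ε) with hψ
  have hrun : ex (iid (coinedLaw p₁ f) (m + 1)) ψ ≤ ENNReal.ofReal (1 - 7 / 16 * (κ / (1 + κ))) :=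
    ex_hypLaw_le hε hκ hl hs hA p₁ fun G hG => (ex_uniform_le hs hP0 hG).trans (by
      refine add_le_add le_rfl (ENNReal.ofReal_le_ofReal ?_)
      rw [div_le_div_iff₀ hP0 (by positivity)]
      linarith)
  -- the examples in the subcube are a sample from the conditional distribution
  have hset : (cubeSet n ρ : Set (Cube n)) = {x | inCube ρ (List.ofFn x) = true} := by
    ext x; simp [mem_cubeSet]
  obtain ⟨β, p₀, hmix, hβ⟩ := exists_mixture D (fun x => inCube ρ (List.ofFn x)) p₁
    ⟨hset ▸ exists_mem_support hP0, by simp only [hp₁, hset]⟩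
  have hmix' : coinedLaw D f = β.bind fun c => if c then coinedLaw p₁ f else coinedLaw p₀ f := by
    conv_lhs => rw [hmix]
    unfold coinedLaw
    rw [PMF.bind_bind]
    congr 1; funext c
    split_ifs <;> rfl
  obtain ⟨L, hL⟩ := exists_iid_filter β (coinedLaw p₁ f) (coinedLaw p₀ f)
    (fun e => inCube ρ e.1.2) (fun c hc e he => by
      have he' : e ∈ (coinedLaw (if c then p₁ else p₀) f).support := by
        cases c <;> simpa using he
      rw [coinedLaw, PMF.support_bind] at he'
      simp only [PMF.support_map, Set.mem_iUnion, Set.mem_image] at he'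
      obtain ⟨x, hx, v, -, rfl⟩ := he'
      exact hβ c hc x hx) N
  rw [← hmix'] at hL
  -- the number of these examples
  have hcount : pr L (fun k => ¬ R * (m + 1) ≤ k) ≤
      2 * ENNReal.ofReal (Real.exp (-(N * (lam / 2) ^ 2 / 4))) := by
    have e1 := pr_length_of_filter hL fun k => ¬ R * (m + 1) ≤ k
    rw [e1]
    refine le_trans (pr_mono fun U hU h => ?_) (pr_countP_dev_le (coinedLaw D f)
      (fun e => inCube ρ e.1.2) N (t := lam / 2) (by positivity) (by linarith))
    have e3 := toReal_pr_coinedLaw D f ρ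
    rw [e3]
    have h' : ((U.countP fun e => inCube ρ e.1.2 : ℕ) : ℝ) ≤ R * (m + 1) := by
      exact_mod_cast (not_le.1 h).le
    have h2 : (N : ℝ) * lam ≤ N * mass D' ρ := by gcongr
    rw [abs_sub_comm]
    refine le_trans ?_ (le_abs_self _)
    linarith
  -- a run that fails on the uniform distribution is the only way to fail
  have hbound : ∀ U, pr (listM (hypLaw law) (jobs n E m R U ρ)) (fun hs =>
      ¬ IsGood D' f (32 * m) ((1 + κ) * ε) lam ρ hs) ≤
      (fun F : List ((Bool × Pt) × Pt) => if R * (m + 1) ≤ F.length then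
        ((List.range R).map fun j => ψ (chunk (m + 1) F j)).prod else 1)
        (U.filter fun e => inCube ρ e.1.2) := by
    intro U
    simp only
    split_ifs with hlen
    · rw [hψ, ← pr_jobs_forall hlen]
      refine pr_mono fun hs' _ hbad => ?_
      intro h hh hgood
      refine hbad ⟨h, Or.inl hh, fun c => ?_⟩
      have h1 := trueErr_le (D := D) hs f h (by positivity) hgood
      have h2 := deviation_le D' ρ c
      have h3 : 2 * ∑ x ∈ cubeSet n ρ, |D' x - c| ≤ 32 * m * ∑ x ∈ cubeSet n ρ, |D' x - c| := by
        exact mul_le_mul_of_nonneg_right (by linarith) (hsum0 c)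
      linarith
    · exact pr_le_one _ _
  calc ex (iid (coinedLaw D f) N) (fun U => pr (listM (hypLaw law) (jobs n E m R U ρ)) fun hs =>
      ¬ IsGood D' f (32 * m) ((1 + κ) * ε) lam ρ hs)
      ≤ ex L fun k => ex (iid (coinedLaw p₁ f) k) fun F => if R * (m + 1) ≤ F.length then
        ((List.range R).map fun j => ψ (chunk (m + 1) F j)).prod else 1 := by
        rw [← ex_bind, ← hL, ex_map]
        exact ex_mono fun U _ => hbound U
    _ ≤ ex L fun k => (if ¬ R * (m + 1) ≤ k then 1 else 0) +
        ENNReal.ofReal (1 - 7 / 16 * (κ / (1 + κ))) ^ R := by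
        refine ex_mono fun k _ => ?_
        by_cases hk : R * (m + 1) ≤ k
        · refine le_trans (le_of_eq (ex_congr fun F hF => ?_))
            ((ex_prod_chunk (coinedLaw p₁ f) (m + 1) ψ R k hk).le.trans ?_)
          · rw [if_pos (by rw [length_of_mem_iid hF]; exact hk)]
          · exact (pow_le_pow_left' hrun R).trans le_add_self
        · refine le_trans (ex_le (c := 1) fun F hF => ?_) (by simp [hk])
          rw [if_neg (by rw [length_of_mem_iid hF]; exact hk)]
    _ ≤ _ := by
        rw [ex_add, ex_const]
        gcongr
        rw [pr_eq_ex] at hcount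
        refine le_of_eq_of_le ?_ hcount
        congr!

theorem length_of_mem_seg {T : ℕ} {Z : List (Pt × Pt)} : ∀ {r : ℕ} {ρ : Rest} {p : Rest × Bool},
    some p ∈ seg T Z r ρ → p.1.length = ρ.length := by
  intro r
  induction r with
  | zero => intro ρ p h; simp [seg] at h; simp [h]
  | succ r ih =>
    intro ρ p h
    rw [seg, List.mem_cons, List.mem_flatMap] at h
    rcases h with h | ⟨i, -, h⟩
    · cases h; rfl
    · simp only [List.mem_append, List.mem_singleton, reduceCtorEq, or_false] at h
      rcases h with h | h
      · simpa using ih h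
      · simpa using ih h

theorem ex_list_sum {α ι : Type} (p : PMF α) (l : List ι) (F : ι → α → ℝ≥0∞) :
    ex p (fun a => (l.map fun i => F i a).sum) = (l.map fun i => ex p (F i)).sum := by
  induction l with
  | nil => simpa using ex_const p 0
  | cons i l ih => simp only [List.map_cons, List.sum_cons, ex_add, ih]

/-- The distribution of the results of all runs of the given learner. -/
def allResLaw (law : Data → PMF Data) (n E m R : ℕ) (items : List Item)
    (pU : PMF (List ((Bool × Pt) × Pt))) : PMF (List (Option Rest × List (Pt × Gates))) :=
  pU.bind fun U => resLaw law (items.map (itemJobs n E m R U))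

theorem mem_allResLaw {law : Data → PMF Data} {n E m R : ℕ} {items : List Item}
    {pU : PMF (List ((Bool × Pt) × Pt))} {res : List (Option Rest × List (Pt × Gates))}
    (h : res ∈ (allResLaw law n E m R items pU).support) :
    res.map Prod.fst = items.map (Option.map Prod.fst) ∧ ∀ it ∈ res, it.2.length ≤ R := by
  rw [allResLaw, PMF.support_bind] at h
  simp only [Set.mem_iUnion] at h
  obtain ⟨U, -, h⟩ := h
  rw [resLaw, listM_map_left] at h
  have h2 := forall₂_of_mem_listM h
  clear h
  induction h2 with
  | nil => simp
  | @cons a b l1 l2 ha _ ih =>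
    rw [PMF.support_map] at ha
    obtain ⟨hs, hhs, rfl⟩ := ha
    refine ⟨?_, ?_⟩
    · rw [List.map_cons, List.map_cons, ih.1]
      cases a <;> rfl
    · intro it hit
      rcases List.mem_cons.1 hit with rfl | hit
      · have h3 := (forall₂_of_mem_listM hhs).length_eq
        rw [← h3]
        cases a with
        | none => exact Nat.zero_le _
        | some p => exact length_jobs_le n E m R U p.1
      · exact ih.2 it hit

/-- With high probability there is a good hypothesis for each subcube of the search space. -/
theorem pr_allResLaw_le {law : Data → PMF Data} {m E R N : ℕ} {ε κ lam : ℝ} (hm : 1 ≤ m)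
    (hε : 0 < ε) (hκ : 0 < κ) (hlam : 0 < lam) (hlam1 : lam ≤ 1)
    (hN : 2 * (R * (m + 1)) ≤ N * lam) (D : PMF (Cube n)) {C : Set (Cube n → Bool)}
    (hC : ClosedUnderRestriction C) (hA : ∀ f ∈ C, LearnsUniform law n m E ε f)
    {f : Cube n → Bool} (hf : f ∈ C) {items : List Item}
    (hitems : ∀ p, some p ∈ items → p.1.length = n) :
    pr (allResLaw law n E m R items (iid (coinedLaw D f) N)) (fun res => ¬ ∀ ρ hs,
      (some ρ, hs) ∈ res → IsGood (fun x => (D x).toReal) f (32 * m) ((1 + κ) * ε) lam ρ hs) ≤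
      items.length * (2 * ENNReal.ofReal (Real.exp (-(N * (lam / 2) ^ 2 / 4))) +
        ENNReal.ofReal (1 - 7 / 16 * (κ / (1 + κ))) ^ R) := by
  classical
  set bad : Option Rest × List (Pt × Gates) → Prop := fun it => ∃ ρ, it.1 = some ρ ∧
    ¬ IsGood (fun x => (D x).toReal) f (32 * m) ((1 + κ) * ε) lam ρ it.2 with hbad
  have h1 : pr (allResLaw law n E m R items (iid (coinedLaw D f) N)) (fun res => ¬ ∀ ρ hs,
      (some ρ, hs) ∈ res → IsGood (fun x => (D x).toReal) f (32 * m) ((1 + κ) * ε) lam ρ hs) ≤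
      pr (allResLaw law n E m R items (iid (coinedLaw D f) N)) fun res => ∃ it ∈ res, bad it := by
    refine pr_mono fun res _ h => ?_
    push Not at h
    obtain ⟨ρ, hs, hmem, h⟩ := h
    exact ⟨_, hmem, ρ, rfl, h⟩
  refine h1.trans ?_
  rw [allResLaw, pr_bind]
  simp only [resLaw, listM_map_left]
  refine (ex_mono fun U _ => pr_listM_exists_le _ bad items).trans ?_
  rw [ex_list_sum]
  refine (List.sum_le_card_nsmul _
    (2 * ENNReal.ofReal (Real.exp (-(N * (lam / 2) ^ 2 / 4))) +
      ENNReal.ofReal (1 - 7 / 16 * (κ / (1 + κ))) ^ R) fun x hx => ?_).trans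
      (by rw [List.length_map, nsmul_eq_mul])
  obtain ⟨it, hit, rfl⟩ := List.mem_map.1 hx
  cases it with
  | none =>
    refine le_trans (ex_le (c := 0) fun U _ => ?_) zero_le
    simp [itemJobs, hbad, pr]
  | some p =>
    have := ex_jobs_le hm hε hκ hlam hlam1 hN D (hitems p hit) (hA _ (hC.comp_proj hf p.1))
    simp only [pr_map, itemJobs, hbad, Option.elim_some, Option.some.injEq, exists_eq_left']
    exact this

/-- The probability that the learner fails, in terms of the failure probabilities of the three
estimates. -/
theorem pr_learner_le (hn : 1 ≤ n) {law : Data → PMF Data} {m d E N T L : ℕ} {ε κ lam : ℝ}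
    (hm : 1 ≤ m) (hε : 0 < ε) (hκ : 0 < κ) (hlam : 0 < lam) (hlam1 : lam ≤ 1) (hT : 1 ≤ T)
    (hTd : 2 * d ≤ T) (hL : (4 * T ^ 2) ^ d ≤ L) (hN0 : 0 < N)
    (hN : 2 * ((T ^ 5 : ℕ) * (m + 1)) ≤ N * lam) (D : PMF (Cube n)) {t : DecisionTree n}
    (ht : t.depth ≤ d) (hDt : ∀ x, (D x).toReal = t.eval x) {q : PMF (Pt × Pt)}
    (hq : Detects q fun x : Cube n => (D x).toReal) {C : Set (Cube n → Bool)}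
    (hC : ClosedUnderRestriction C) (hA : ∀ f ∈ C, LearnsUniform law n m E ε f)
    {f : Cube n → Bool} (hf : f ∈ C) :
    pr ((iid q N).bind fun Z => (allResLaw law n E m (T ^ 5) (codeOf T Z n d L)
      (iid (coinedLaw D f) N)).bind fun res => (iid (exampleLaw D f) N).map fun S =>
        compileLeaves n (bestLeaves S res))
      (fun g => ¬ (∑ x, if evalGates g (List.ofFn x) = f x then 0 else (D x).toReal) ≤
        (1 + κ) * ε + 32 * m * (d * √(2 / T)) + 3 * 2 ^ d * lam) ≤
      ((3 ^ n * (n * 2) : ℕ) : ℝ≥0∞) *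
        (2 * ENNReal.ofReal (Real.exp (-(N * (lam / (8 * T)) ^ 2 / 4)))) +
      (((4 * T ^ 2) ^ d : ℕ) * (2 * ENNReal.ofReal (Real.exp (-(N * (lam / 2) ^ 2 / 4))) +
        ENNReal.ofReal (1 - 7 / 16 * (κ / (1 + κ))) ^ T ^ 5) +
      (((4 * T ^ 2) ^ d * (T ^ 5 + 1) : ℕ) : ℝ≥0∞) *
        (2 * ENNReal.ofReal (Real.exp (-(N * lam ^ 2 / 4))))) := by
  have hD0 : ∀ x, 0 ≤ (D x).toReal := fun x => ENNReal.toReal_nonneg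
  have hD1 : ∑ x, (D x).toReal = 1 := by
    have := D.tsum_coe
    rw [tsum_fintype] at this
    rw [← ENNReal.toReal_sum fun x _ => D.apply_ne_top x, this, ENNReal.toReal_one]
  refine pr_bind_le _ (pr_influential_le hq hD0 ht hDt hT hTd hN0 hlam hlam1) fun Z _ hZ => ?_
  rw [not_not] at hZ
  have hcode := codeOf_eq_seg hT Z n d L hL
  have hlen : (codeOf T Z n d L).length ≤ (4 * T ^ 2) ^ d := by
    rw [hcode]; exact length_seg hT Z d _
  refine pr_bind_le _ ((pr_allResLaw_le hm hε hκ hlam hlam1 hN D hC hA hf fun p hp => ?_).trans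
    (mul_le_mul_left (Nat.cast_le.2 hlen) _)) fun res hres hgood => ?_
  · rw [hcode] at hp
    simpa using length_of_mem_seg hp
  rw [not_not] at hgood
  obtain ⟨hres1, hres2⟩ := mem_allResLaw hres
  have hlen2 : res.length ≤ (4 * T ^ 2) ^ d := by
    have := congrArg List.length hres1
    rw [List.length_map, List.length_map] at this
    omega
  rw [pr_map]
  refine le_trans (pr_mono fun S _ h => ?_) ((pr_leafErr_le D f res hres2 hN0 hlam hlam1).trans
    (by gcongr))
  intro hS
  refine h (sum_err_compileLeaves_le hD0 hD1 (N := N) (by exact_mod_cast hN0) hlam.le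
    (by positivity) (by positivity) (by positivity) hn ht hDt (hcode ▸ hres1) hZ hgood hS)

end

end


section

open Enc (enc)

/-! ### The output distribution of the learner -/

section

variable {n : ℕ}

/-- Three consecutive parts of a sample are independent samples. -/
theorem iid_split {α β : Type} (p : PMF α) {q M : ℕ} (h : q + q + q ≤ M)
    (F : List α → List α → List α → PMF β) :
    ((iid p M).bind fun S => F (S.take q) ((S.drop q).take q) ((S.drop (q + q)).take q)) =
      (iid p q).bind fun S₁ => (iid p q).bind fun S₂ => (iid p q).bind fun S₃ => F S₁ S₂ S₃ := by
  obtain ⟨r, rfl⟩ : ∃ r, M = q + (q + (q + r)) := ⟨M - (q + q + q), by omega⟩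
  rw [iid_add, PMF.bind_bind]
  refine pmf_bind_congr _ fun S₁ h1 => ?_
  rw [PMF.bind_map, iid_add, PMF.bind_bind]
  refine pmf_bind_congr _ fun S₂ h2 => ?_
  rw [PMF.bind_map, iid_add, PMF.bind_bind]
  refine pmf_bind_congr _ fun S₃ h3 => ?_
  rw [PMF.bind_map]
  have l1 := length_of_mem_iid h1
  have l2 := length_of_mem_iid h2
  have l3 := length_of_mem_iid h3
  have : ∀ S ∈ (iid p r).support, F S₁ S₂ S₃ = F ((S₁ ++ (S₂ ++ (S₃ ++ S))).take q)
      (((S₁ ++ (S₂ ++ (S₃ ++ S))).drop q).take q)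
      (((S₁ ++ (S₂ ++ (S₃ ++ S))).drop (q + q)).take q) := by
    intro S _
    rw [List.take_left' l1, List.drop_left' l1, List.take_left' l2, ← List.drop_drop,
      List.drop_left' l1, List.drop_left' l2, List.take_left' l3]
  refine Eq.trans (pmf_bind_congr _ fun S hS => (this S hS).symm) ?_
  exact PMF.bind_const _ _

theorem listM_const {α β : Type} (p : PMF β) (l : List α) : listM (fun _ => p) l = iid p l.length := by
  induction l with
  | nil => rfl
  | cons a l ih => rw [listM, ih]; rfl

theorem pmf_ext_ex {α : Type} {p q : PMF α} (h : ∀ F, ex p F = ex q F) : p = q := by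
  classical
  ext a
  have := h fun b => if b = a then 1 else 0
  simpa [ex] using this

theorem iid_uniform_bool (n : ℕ) :
    iid (PMF.uniformOfFintype Bool) n = (unif n).map List.ofFn := by
  induction n with
  | zero =>
    have : (unif 0).map (List.ofFn : Cube 0 → List Bool) = (unif 0).map fun _ => [] :=
      pmf_map_congr _ fun x _ => by simp
    rw [iid, this]
    exact (PMF.map_const _ _).symm
  | succ n ih =>
    refine pmf_ext_ex fun F => ?_
    rw [iid, ex_bind, ih]
    simp only [ex_map, ex_unif]
    rw [ex_fintype, ← (Fin.consEquiv fun _ : Fin (n + 1) => Bool).sum_comp, Fintype.sum_prod_type]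
    simp only [PMF.uniformOfFintype_apply, Fintype.card_bool, ← Finset.mul_sum]
    rw [← mul_assoc, pow_succ, mul_comm (2 ^ n : ℝ≥0∞), ENNReal.mul_inv (by simp) (by simp)]
    simp [Fin.consEquiv, List.ofFn_succ]

theorem coinLaw_eq (D : PMF (Cube n)) (f : Cube n → Bool) (N : ℕ) :
    (iid (exampleLaw D f) N).bind coinLaw = iid (coinedLaw D f) N := by
  unfold coinLaw
  rw [iid_bind, exampleLaw, PMF.bind_map]
  congr 1
  unfold coinedLaw
  congr 1; funext x
  simp only [Function.comp]
  rw [listM_const, List.length_ofFn, iid_uniform_bool, PMF.map_comp]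
  rfl

theorem bind_three_comm {α β γ δ : Type} (p₁ : PMF α) (p₂ : PMF β) (f₁ : α → PMF γ)
    (F : γ → β → PMF δ) (G : γ → PMF δ) (hG : ∀ c, G c = p₂.bind fun b => F c b) :
    (p₁.bind fun a => p₂.bind fun b => (f₁ a).bind fun c => F c b) = (p₁.bind f₁).bind G := by
  rw [PMF.bind_bind]
  congr 1; funext a
  rw [PMF.bind_comm]
  congr 1; funext c
  exact (hG c).symm

/-- The law of the learner's output, in the form in which the probability of failure is
estimated: the three parts of the sample are used independently. -/
theorem bind_circuitLaw (D : PMF (Cube n)) (f : Cube n → Bool) (c d m E M : ℕ)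
    (law : Data → PMF Data) (g : Bool × Pt → PMF (Pt × Pt)) (hn : 1 ≤ n) :
    ((iid (exampleLaw D f) M).bind fun S => (listM g (Inp.S₁ ([n, d, m, E], S))).bind fun Z =>
      circuitLaw c law ([n, d, m, E], S) Z) =
    (iid ((exampleLaw D f).bind g) (partSize n M)).bind fun Z =>
      (allResLaw law n E m ((c * (m * d * E) ^ 2) ^ 5)
        (codeOf (c * (m * d * E) ^ 2) Z n d M) (iid (coinedLaw D f) (partSize n M))).bind fun res =>
        (iid (exampleLaw D f) (partSize n M)).map fun S => compileLeaves n (bestLeaves S res) := by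
  set q := partSize n M with hq
  set T := c * (m * d * E) ^ 2 with hT
  have h3 : q + q + q ≤ M := by
    have h1 : q * (n + 2) ≤ M := Nat.div_mul_le_self M (n + 2)
    have : q * 3 ≤ q * (n + 2) := Nat.mul_le_mul_left _ (by omega)
    omega
  have e1 : ∀ S ∈ (iid (exampleLaw D f) M).support,
      ((listM g (Inp.S₁ ([n, d, m, E], S))).bind fun Z => circuitLaw c law ([n, d, m, E], S) Z) =
      (fun S₁ S₂ S₃ => (listM g S₁).bind fun Z => (coinLaw S₂).bind fun U =>
        (resLaw law ((codeOf T Z n d M).map (itemJobs n E m (T ^ 5) U))).map fun res =>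
          compileLeaves n (bestLeaves S₃ res)) (S.take q) ((S.drop q).take q)
            ((S.drop (q + q)).take q) := by
    intro S hS
    have hl := length_of_mem_iid hS
    have hq' : Inp.q ([n, d, m, E], S) = q := by
      rw [hq, ← hl]; rfl
    simp only [circuitLaw, allJobs, Inp.S₁, Inp.S₂, Inp.S₃, hq', hl]
    rfl
  refine (pmf_bind_congr _ e1).trans ((iid_split (exampleLaw D f) h3
    fun S₁ S₂ S₃ => (listM g S₁).bind fun Z => (coinLaw S₂).bind fun U =>
        (resLaw law ((codeOf T Z n d M).map (itemJobs n E m (T ^ 5) U))).map fun res =>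
          compileLeaves n (bestLeaves S₃ res)).trans ?_)
  rw [← iid_bind, PMF.bind_bind]
  congr 1; funext S₁
  have e2 : ∀ S₂ : List (Bool × Pt), ((iid (exampleLaw D f) q).bind fun S₃ =>
      (listM g S₁).bind fun Z => (coinLaw S₂).bind fun U =>
        (resLaw law ((codeOf T Z n d M).map (itemJobs n E m (T ^ 5) U))).map fun res =>
          compileLeaves n (bestLeaves S₃ res)) = (listM g S₁).bind fun Z =>
        (iid (exampleLaw D f) q).bind fun S₃ => (coinLaw S₂).bind fun U =>
        (resLaw law ((codeOf T Z n d M).map (itemJobs n E m (T ^ 5) U))).map fun res =>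
          compileLeaves n (bestLeaves S₃ res) := fun S₂ => PMF.bind_comm _ _ _
  simp only [e2]
  rw [PMF.bind_comm]
  congr 1; funext Z
  rw [bind_three_comm (iid (exampleLaw D f) q) (iid (exampleLaw D f) q) coinLaw
    (fun U S₃ => (resLaw law ((codeOf T Z n d M).map (itemJobs n E m (T ^ 5) U))).map fun res =>
          compileLeaves n (bestLeaves S₃ res))
    (fun U => (resLaw law ((codeOf T Z n d M).map (itemJobs n E m (T ^ 5) U))).bind fun res =>
        (iid (exampleLaw D f) q).map fun S => compileLeaves n (bestLeaves S res)) fun U => ?_,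
    coinLaw_eq, allResLaw, PMF.bind_bind]
  simp only [← PMF.bind_pure_comp]
  rw [PMF.bind_comm]
  rfl

/-! ### The bits that detect influences -/

theorem toReal_ex_cubeSet (D : PMF (Cube n)) (ρ : Rest) (v : Cube n → ℝ≥0∞) (hv : ∀ x, v x ≤ 1) :
    (ex D fun x => if inCube ρ (List.ofFn x) = true then v x else 0).toReal =
      ∑ x ∈ cubeSet n ρ, (D x).toReal * (v x).toReal := by
  rw [ex_fintype, ENNReal.toReal_sum fun x _ => ENNReal.mul_ne_top (D.apply_ne_top x) (by
    split_ifs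
    · exact ((hv x).trans_lt ENNReal.one_lt_top).ne
    · simp), cubeSet, Finset.sum_filter]
  refine Finset.sum_congr rfl fun x _ => ?_
  split_ifs <;> simp

/-- The probability that the bits of an example pass the test. -/
theorem toReal_pr_agreeTest (D : PMF (Cube n)) (r : Cube n → PMF Pt) (ρ : Rest) (i : Fin n)
    (c : Bool) :
    (pr (D.bind fun x => (r x).map fun z => (List.ofFn x, z)) fun w =>
      agreeTest ρ i c w = true).toReal =
    ∑ x ∈ cubeSet n ρ, (D x).toReal * (pr (r x) fun z => z.getD i false = c).toReal := by
  rw [← toReal_ex_cubeSet D ρ _ fun x => pr_le_one _ _, pr_bind]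
  congr 2; funext x
  rw [pr_map]
  by_cases h : inCube ρ (List.ofFn x) = true
  · simp only [agreeTest, h, if_true, Bool.true_and, beq_iff_eq]
  · simp [agreeTest, h, pr]

/-- If the bit `i` of an example at `x` is set with probability `v x i`, then the mass and the bias
are given by sums over the cube. -/
theorem agreeTest_sums (D : PMF (Cube n)) (r : Cube n → PMF Pt) (ρ : Rest) (i : Fin n) :
    (pr (D.bind fun x => (r x).map fun z => (List.ofFn x, z)) fun w =>
      agreeTest ρ i true w = true).toReal +
    (pr (D.bind fun x => (r x).map fun z => (List.ofFn x, z)) fun w =>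
      agreeTest ρ i false w = true).toReal = mass (fun x => (D x).toReal) ρ ∧
    bias (D.bind fun x => (r x).map fun z => (List.ofFn x, z)) ρ i =
      ∑ x ∈ cubeSet n ρ, (D x).toReal * (2 * (pr (r x) fun z => z.getD i false = true).toReal - 1) := by
  have h : ∀ x, (pr (r x) fun z => z.getD i false = false).toReal =
      1 - (pr (r x) fun z => z.getD i false = true).toReal := by
    intro x
    have := pr_add_pr_not (r x) fun z => z.getD i false = true
    simp only [Bool.not_eq_true] at this
    have h2 := congrArg ENNReal.toReal this
    rw [ENNReal.toReal_add (pr_ne_top _ _) (pr_ne_top _ _), ENNReal.toReal_one] at h2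
    linarith
  rw [bias, toReal_pr_agreeTest, toReal_pr_agreeTest, ← Finset.sum_add_distrib,
    ← Finset.sum_sub_distrib, mass]
  simp only [h]
  exact ⟨Finset.sum_congr rfl fun x _ => by ring, Finset.sum_congr rfl fun x _ => by ring⟩

/-- For a monotone distribution, the coordinates of the examples themselves detect the
influences. -/
theorem detects_of_monotone {D : PMF (Cube n)} (hD : IsMonotoneDist D) (f : Cube n → Bool) :
    Detects ((exampleLaw D f).bind fun e => PMF.pure (e.2, e.2)) fun x : Cube n => (D x).toReal := by
  have hq : ((exampleLaw D f).bind fun e => PMF.pure (e.2, e.2)) =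
      D.bind fun x => (PMF.pure (List.ofFn x)).map fun z => (List.ofFn x, z) := by
    rw [exampleLaw, PMF.bind_map]
    simp only [PMF.pure_map, Function.comp_def]
  have hbias : ∀ (ρ : Rest) (i : Fin n), ρ.length = n → ρ.getD i none = none →
      bias ((exampleLaw D f).bind fun e => PMF.pure (e.2, e.2)) ρ i =
      ∑ x ∈ (cubeSet n ρ).filter (fun x => x i = false), ((D (flip x i)).toReal - (D x).toReal) := by
    intro ρ i hl hi
    rw [hq, (agreeTest_sums _ _ _ _).2, sum_cubeSet_edges hl hi]
    refine Finset.sum_congr rfl fun x hx => ?_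
    have hx' := (Finset.mem_filter.1 hx).2
    rw [pr_pure, pr_pure, getD_ofFn, getD_ofFn, flip_self, hx']
    simp
    ring
  have hmono : ∀ (x : Cube n) (i : Fin n), x i = false → (D x).toReal ≤ (D (flip x i)).toReal := by
    intro x i hx
    refine ENNReal.toReal_mono (D.apply_ne_top _) (hD _ _ fun j => ?_)
    by_cases hj : j = i
    · subst hj; rw [hx]; exact Bool.false_le _
    · rw [flip_ne x hj]
  have hinf : ∀ (ρ : Rest) (i : Fin n), ρ.length = n → ρ.getD i none = none →
      influence (fun x => (D x).toReal) ρ i =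
      bias ((exampleLaw D f).bind fun e => PMF.pure (e.2, e.2)) ρ i := by
    intro ρ i hl hi
    rw [hbias ρ i hl hi]
    refine Finset.sum_congr rfl fun x hx => ?_
    rw [abs_sub_comm, abs_of_nonneg (sub_nonneg.2 (hmono x i (Finset.mem_filter.1 hx).2))]
  have hle : ∀ (ρ : Rest) (i : Fin n), ρ.length = n → ρ.getD i none = none →
      bias ((exampleLaw D f).bind fun e => PMF.pure (e.2, e.2)) ρ i ≤
      ∑ x ∈ cubeSet n ρ, if (D (flip x i)).toReal = (D x).toReal then 0 else (D x).toReal := by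
    intro ρ i hl hi
    rw [hbias ρ i hl hi, sum_cubeSet_edges hl hi]
    refine Finset.sum_le_sum fun x hx => ?_
    rw [flip_flip]
    have h1 : 0 ≤ (D x).toReal := ENNReal.toReal_nonneg
    have h2 : 0 ≤ (D (flip x i)).toReal := ENNReal.toReal_nonneg
    by_cases h : (D (flip x i)).toReal = (D x).toReal
    · simp [h]
    · rw [if_neg h, if_neg (Ne.symm h)]; linarith
  refine ⟨fun ρ i hl => ?_, hle, fun ρ i hl hi => ?_⟩
  · rw [hq]; exact (agreeTest_sums _ _ _ _).1
  · have h1 := (hle ρ i hl hi).trans (Finset.sum_le_sum (g := fun x => (D x).toReal) fun x _ => by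
      have : 0 ≤ (D x).toReal := ENNReal.toReal_nonneg
      split_ifs <;> simp)
    have h2 : 0 ≤ influence (fun x => (D x).toReal) ρ i :=
      Finset.sum_nonneg fun _ _ => abs_nonneg _
    rw [hinf ρ i hl hi] at h2 ⊢
    rw [pow_two]
    exact mul_le_mul_of_nonneg_right h1 h2

/-- A restriction that is given as a list, as a function on the coordinates. -/
def restFun (n : ℕ) (ρ : Rest) : Fin n → Option Bool := fun i => ρ.getD i none

/-- The answers to a query, as lists. -/
def answerLaw (D : PMF (Cube n)) (ρ : Rest) : PMF Pt := (condSubcube D (restFun n ρ)).map List.ofFn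

theorem pr_listM_getD {α β : Type} (g : α → PMF β) (s : β → Prop) (b₀ : β) (a₀ : α) :
    ∀ (l : List α) (i : ℕ), i < l.length →
    pr (listM g l) (fun r => s (r.getD i b₀)) = pr (g (l.getD i a₀)) s := by
  intro l
  induction l with
  | nil => intro i hi; simp at hi
  | cons a l ih =>
    intro i hi
    rw [listM, pr_bind]
    simp only [pr_map]
    cases i with
    | zero =>
      simp only [List.getD_cons_zero]
      rw [pr_eq_ex]
      refine ex_congr fun b _ => ?_
      by_cases hb : s b
      · rw [if_pos hb]; exact pr_true fun _ _ => hb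
      · simp [hb, pr]
    | succ i =>
      simp only [List.getD_cons_succ, List.length_cons] at hi ⊢
      rw [ih i (by omega)]
      exact ex_const _ _

theorem mem_subcube_edge (x y : Cube n) (i : Fin n) :
    y ∈ subcube (restFun n (edgeOf (List.ofFn x) i)) ↔ y = x ∨ y = flip x i := by
  have h : ∀ j : Fin n, restFun n (edgeOf (List.ofFn x) i) j = if j = i then none else some (x j) := by
    intro j
    unfold restFun edgeOf
    rw [List.getD_eq_getElem?_getD, List.getElem?_set]
    by_cases hj : j = i
    · subst hj; simp
    · have : ¬ (i : ℕ) = j := fun h => hj (Fin.ext h.symm)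
      simp [hj, this]
  constructor
  · intro hy
    have hy' : ∀ j, j ≠ i → y j = x j := fun j hj => hy j (x j) (by rw [h, if_neg hj])
    by_cases hi : y i = x i
    · left; funext j
      by_cases hj : j = i
      · subst hj; exact hi
      · exact hy' j hj
    · right; funext j
      by_cases hj : j = i
      · subst hj; rw [flip_self]; cases h1 : y j <;> cases h2 : x j <;> simp_all
      · rw [flip_ne x hj]; exact hy' j hj
  · rintro (rfl | rfl) j b hb
    · rw [h] at hb
      split_ifs at hb
      simpa using hb
    · rw [h] at hb
      split_ifs at hb with hj
      rw [flip_ne x hj]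
      simpa using hb

theorem flip_ne_self (x : Cube n) (i : Fin n) : flip x i ≠ x := fun h => by
  have := congrFun h i
  simp at this

/-- A sample from an edge at `x` agrees with `x` with probability proportional to `D x`. -/
theorem pr_edge (D : PMF (Cube n)) (x : Cube n) (i : Fin n) (hx : x ∈ D.support) :
    (pr (answerLaw D (edgeOf (List.ofFn x) i)) fun y => y.getD i false = x i).toReal =
      (D x).toReal / ((D x).toReal + (D (flip x i)).toReal) := by
  classical
  have hmem : x ∈ subcube (restFun n (edgeOf (List.ofFn x) i)) := (mem_subcube_edge x x i).2 (Or.inl rfl)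
  have h : ∃ y ∈ subcube (restFun n (edgeOf (List.ofFn x) i)), y ∈ D.support := ⟨x, hmem, hx⟩
  have hset : subcube (restFun n (edgeOf (List.ofFn x) i)) = (({x, flip x i} : Finset (Cube n)) : Set (Cube n)) := by
    ext y; rw [mem_subcube_edge]; simp
  rw [answerLaw, pr_map, condSubcube, dif_pos h, toReal_pr, Finset.sum_eq_single x]
  · rw [if_pos (getD_ofFn x i), PMF.filter_apply, Set.indicator_of_mem hmem, ENNReal.toReal_mul,
      ENNReal.toReal_inv, ← div_eq_mul_inv]
    congr 1
    rw [hset, tsum_eq_sum (s := {x, flip x i}) fun y hy => by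
      rw [Set.indicator_of_notMem (by exact_mod_cast hy)], Finset.sum_pair (flip_ne_self x i).symm,
      Set.indicator_of_mem (by simp), Set.indicator_of_mem (by simp),
      ENNReal.toReal_add (D.apply_ne_top _) (D.apply_ne_top _)]
  · intro y _ hy
    split_ifs with h2
    · rw [PMF.filter_apply_eq_zero_of_notMem, ENNReal.toReal_zero]
      rw [mem_subcube_edge]
      rintro (rfl | rfl)
      · exact hy rfl
      · rw [getD_ofFn] at h2; simp at h2
    · rfl
  · intro h; exact absurd (Finset.mem_univ x) h

/-- The agreements with samples from the edges detect the influences. -/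
theorem detects_edges (D : PMF (Cube n)) (f : Cube n → Bool) :
    Detects ((exampleLaw D f).bind fun e => (agreeLaw (answerLaw D) n e.2).map fun z => (e.2, z))
      fun x : Cube n => (D x).toReal := by
  set D' : Cube n → ℝ := fun x => (D x).toReal with hD'
  have hD0 : ∀ x, 0 ≤ D' x := fun x => ENNReal.toReal_nonneg
  have hq : ((exampleLaw D f).bind fun e => (agreeLaw (answerLaw D) n e.2).map fun z => (e.2, z)) =
      D.bind fun x => (agreeLaw (answerLaw D) n (List.ofFn x)).map fun z => (List.ofFn x, z) := by
    rw [exampleLaw, PMF.bind_map]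
    rfl
  rw [hq]
  have hterm : ∀ (x : Cube n) (i : Fin n), D' x * (2 * (pr (agreeLaw (answerLaw D) n (List.ofFn x))
      fun z => z.getD i false = true).toReal - 1) =
      D' x * ((D' x - D' (flip x i)) / (D' x + D' (flip x i))) := by
    intro x i
    by_cases hx : x ∈ D.support
    · have hpos : 0 < D' x := ENNReal.toReal_pos ((PMF.mem_support_iff _ _).1 hx) (D.apply_ne_top x)
      have hne : D' x + D' (flip x i) ≠ 0 := by have := hD0 (flip x i); positivity
      have h1 : pr (agreeLaw (answerLaw D) n (List.ofFn x)) (fun z => z.getD i false = true) =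
          pr (answerLaw D (edgeOf (List.ofFn x) i)) fun y => y.getD i false = x i := by
        rw [agreeLaw, pr_listM_getD _ (fun b => b = true) false 0 _ _ (by simp), pr_map]
        rw [show (List.range n).getD (i : ℕ) 0 = i by simp [List.getD_eq_getElem?_getD]]
        simp only [beq_iff_eq, getD_ofFn]
      rw [h1, pr_edge D x i hx]
      congr 1
      change 2 * (D' x / (D' x + D' (flip x i))) - 1 = _
      field_simp
      ring
    · have h0 : D' x = 0 := by
        rw [PMF.mem_support_iff, not_not] at hx
        simp [hD', hx]
      rw [h0, zero_mul, zero_mul]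
  have hbias : ∀ (ρ : Rest) (i : Fin n), ρ.length = n → ρ.getD i none = none →
      bias (D.bind fun x => (agreeLaw (answerLaw D) n (List.ofFn x)).map fun z => (List.ofFn x, z)) ρ i =
      ∑ x ∈ cubeSet n ρ, D' x * ((D' x - D' (flip x i)) / (D' x + D' (flip x i))) := by
    intro ρ i hl hi
    rw [(agreeTest_sums _ _ _ _).2]
    exact Finset.sum_congr rfl fun x _ => hterm x i
  refine ⟨fun ρ i hl => (agreeTest_sums _ _ _ _).1, fun ρ i hl hi => ?_, fun ρ i hl hi => ?_⟩
  · rw [hbias ρ i hl hi]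
    refine Finset.sum_le_sum fun x _ => ?_
    have h1 := hD0 x
    have h2 := hD0 (flip x i)
    split_ifs with h
    · rw [h]; simp
    · have : (D' x - D' (flip x i)) / (D' x + D' (flip x i)) ≤ 1 := div_le_one_of_le₀ (by linarith)
        (by linarith)
      exact mul_le_of_le_one_right h1 this
  · rw [hbias ρ i hl hi, mass, sum_cubeSet_edges hl hi, sum_cubeSet_edges hl hi, influence]
    refine Finset.sum_sq_le_sum_mul_sum_of_sq_le_mul _ (fun x _ => add_nonneg (hD0 _) (hD0 _))
      (fun x _ => ?_) fun x _ => ?_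
    all_goals
      rw [flip_flip]
      have h1 := hD0 x
      have h2 := hD0 (flip x i)
      have e : D' x * ((D' x - D' (flip x i)) / (D' x + D' (flip x i))) +
          D' (flip x i) * ((D' (flip x i) - D' x) / (D' (flip x i) + D' x)) =
          (D' x - D' (flip x i)) ^ 2 / (D' x + D' (flip x i)) := by
        rw [add_comm (D' (flip x i)) (D' x), ← mul_div_assoc, ← mul_div_assoc, ← add_div]
        congr 1; ring
      rw [e]
    · positivity
    · refine le_of_eq ?_
      rw [sq_abs]
      by_cases h0 : D' x + D' (flip x i) = 0
      · have e1 : D' x = 0 := by linarith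
        have e2 : D' (flip x i) = 0 := by linarith
        change (D' x - D' (flip x i)) ^ 2 = _
        rw [e1, e2]; simp
      · change (D' x - D' (flip x i)) ^ 2 = (D' x + D' (flip x i)) * _
        field_simp

end

end


/-! ### The choice of the parameters -/

/-- A length of the three parts of the sample that suffices for the union bounds over the subcubes,
of which there are at most `(4 * T ^ 2) ^ d`, with `T ^ 5` runs of the given learner on each of them
and estimates of accuracy `1 / Λ`. -/
def neededSize (n m d T Λ : ℕ) : ℕ := 2560 * n * (m + 1) * (4 * T ^ 2) ^ d * (T ^ 5 + 1) * Λ ^ 2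

theorem natCast_mul_ofReal_le {k : ℕ} {x y : ℝ} (h : k * (2 * x) ≤ y) :
    (k : ℝ≥0∞) * (2 * ENNReal.ofReal x) ≤ ENNReal.ofReal y := by
  have h2 : (2 : ℝ≥0∞) = ENNReal.ofReal 2 := by simp
  rw [h2, ← ENNReal.ofReal_mul (by norm_num), ← ENNReal.ofReal_natCast,
    ← ENNReal.ofReal_mul (by positivity)]
  exact ENNReal.ofReal_le_ofReal h

theorem exp_neg_le_two_pow (k : ℕ) {y : ℝ} (h : (k : ℝ) ≤ y) : Real.exp (-y) ≤ (2 ^ k)⁻¹ := by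
  have h2 : (2 : ℝ) ≤ Real.exp 1 := by linarith [Real.add_one_le_exp (1 : ℝ)]
  rw [Real.exp_neg]
  refine inv_anti₀ (by positivity) ?_
  calc (2 : ℝ) ^ k ≤ Real.exp 1 ^ k := by gcongr
    _ = Real.exp k := by rw [← Real.exp_nat_mul, mul_one]
    _ ≤ Real.exp y := Real.exp_le_exp.2 h

theorem exp_neg_le_inv {y z : ℝ} (hz : 0 < z) (h : z ≤ y) : Real.exp (-y) ≤ z⁻¹ := by
  rw [Real.exp_neg]
  exact inv_anti₀ hz (by linarith [Real.add_one_le_exp y])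

/-- The failure probabilities sum to at most `1 / 6`: each of the three Chernoff bounds and the bound
for the `T ^ 5` runs of the given learner, which succeed with probability `p`, gives at most
`1 / 24`. -/
theorem failure_le {n m d T Λ N : ℕ} {p : ℝ} (hn : 1 ≤ n) (hd : 1 ≤ d) (hT : 3 ≤ T)
    (hTd : 2 * d ≤ T) (hΛ : 1 ≤ Λ) (hp1 : p ≤ 1) (hpT : 1 ≤ p * T)
    (hN : neededSize n m d T Λ ≤ N) :
    ((3 ^ n * (n * 2) : ℕ) : ℝ≥0∞) *
        (2 * ENNReal.ofReal (Real.exp (-(N * ((Λ : ℝ)⁻¹ / (8 * T)) ^ 2 / 4)))) +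
      (((4 * T ^ 2) ^ d : ℕ) * (2 * ENNReal.ofReal (Real.exp (-(N * ((Λ : ℝ)⁻¹ / 2) ^ 2 / 4))) +
        ENNReal.ofReal (1 - p) ^ T ^ 5) +
      (((4 * T ^ 2) ^ d * (T ^ 5 + 1) : ℕ) : ℝ≥0∞) *
        (2 * ENNReal.ofReal (Real.exp (-(N * (Λ : ℝ)⁻¹ ^ 2 / 4))))) ≤ ENNReal.ofReal (1 / 6) := by
  set Q : ℕ := (4 * T ^ 2) ^ d with hQ
  have hTr : (3 : ℝ) ≤ T := by exact_mod_cast hT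
  have hΛr : (1 : ℝ) ≤ Λ := by exact_mod_cast hΛ
  have hnr : (1 : ℝ) ≤ n := by exact_mod_cast hn
  have hQ1 : (T : ℝ) ^ 2 ≤ Q := by
    have h1 : T ^ 2 ≤ Q := calc
      T ^ 2 ≤ 4 * T ^ 2 := by omega
      _ = (4 * T ^ 2) ^ 1 := (pow_one _).symm
      _ ≤ Q := Nat.pow_le_pow_right (by positivity) hd
    exact_mod_cast h1
  have hQ0 : (1 : ℝ) ≤ Q := by nlinarith
  have hNr : 2560 * (n : ℝ) * Q * (T ^ 5 + 1) ≤ N * (Λ : ℝ)⁻¹ ^ 2 := by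
    rw [inv_pow, ← div_eq_mul_inv, le_div_iff₀ (by positivity)]
    have h1 : 2560 * n * Q * (T ^ 5 + 1) * Λ ^ 2 ≤ N := by
      refine le_trans ?_ hN
      rw [neededSize, ← hQ]
      have : 2560 * n ≤ 2560 * n * (m + 1) := Nat.le_mul_of_pos_right _ (Nat.succ_pos m)
      gcongr
    exact_mod_cast h1
  have hT5 : (1 : ℝ) ≤ T ^ 5 := one_le_pow₀ (by linarith)
  have hexp : Real.exp (-(N * ((Λ : ℝ)⁻¹ / (8 * T)) ^ 2 / 4)) ≤ (2 ^ (10 * n))⁻¹ := by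
    refine exp_neg_le_two_pow _ ?_
    have e : N * ((Λ : ℝ)⁻¹ / (8 * T)) ^ 2 / 4 = (N * (Λ : ℝ)⁻¹ ^ 2) / (256 * T ^ 2) := by
      field_simp; ring
    rw [e, le_div_iff₀ (by positivity)]
    refine le_trans ?_ hNr
    push_cast
    have : (n : ℝ) * T ^ 2 ≤ n * Q * (T ^ 5 + 1) := by
      calc (n : ℝ) * T ^ 2 ≤ n * Q * 1 := by rw [mul_one]; gcongr
        _ ≤ n * Q * (T ^ 5 + 1) := by gcongr; linarith
    nlinarith
  have hA : ((3 ^ n * (n * 2) : ℕ) : ℝ≥0∞) *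
      (2 * ENNReal.ofReal (Real.exp (-(N * ((Λ : ℝ)⁻¹ / (8 * T)) ^ 2 / 4)))) ≤
      ENNReal.ofReal (1 / 24) := by
    refine natCast_mul_ofReal_le ?_
    have h2 : (n : ℝ) ≤ 2 ^ n := by exact_mod_cast n.lt_two_pow_self.le
    have h3 : ((6 : ℝ) / 1024) ^ n ≤ 6 / 1024 := pow_le_of_le_one (by norm_num) (by norm_num) (by omega)
    push_cast
    calc (3 : ℝ) ^ n * (n * 2) * (2 * Real.exp (-(N * ((Λ : ℝ)⁻¹ / (8 * T)) ^ 2 / 4)))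
        ≤ 3 ^ n * (2 ^ n * 2) * (2 * (2 ^ (10 * n))⁻¹) := by gcongr
      _ = 4 * (6 / 1024) ^ n := by
        rw [pow_mul, div_pow, show (6 : ℝ) = 3 * 2 by norm_num, mul_pow]
        norm_num
        ring
      _ ≤ 1 / 24 := by linarith
  have hB : ((Q : ℕ) : ℝ≥0∞) * (2 * ENNReal.ofReal (Real.exp (-(N * ((Λ : ℝ)⁻¹ / 2) ^ 2 / 4)))) ≤
      ENNReal.ofReal (1 / 24) := by
    refine natCast_mul_ofReal_le ?_
    have h1 : Real.exp (-(N * ((Λ : ℝ)⁻¹ / 2) ^ 2 / 4)) ≤ (48 * (Q : ℝ))⁻¹ := by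
      refine exp_neg_le_inv (by positivity) ?_
      have : (Q : ℝ) ≤ n * Q * (T ^ 5 + 1) := by
        nlinarith [mul_le_mul hnr (show (1 : ℝ) ≤ T ^ 5 + 1 by linarith) zero_le_one (by linarith)]
      nlinarith
    calc (Q : ℝ) * (2 * Real.exp (-(N * ((Λ : ℝ)⁻¹ / 2) ^ 2 / 4)))
        ≤ Q * (2 * (48 * (Q : ℝ))⁻¹) := by gcongr
      _ = 1 / 24 := by field_simp; norm_num
  have hD : ((Q * (T ^ 5 + 1) : ℕ) : ℝ≥0∞) *
      (2 * ENNReal.ofReal (Real.exp (-(N * (Λ : ℝ)⁻¹ ^ 2 / 4)))) ≤ ENNReal.ofReal (1 / 24) := by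
    refine natCast_mul_ofReal_le ?_
    have h1 : Real.exp (-(N * (Λ : ℝ)⁻¹ ^ 2 / 4)) ≤ (48 * (Q * (T ^ 5 + 1) : ℝ))⁻¹ := by
      refine exp_neg_le_inv (by positivity) ?_
      have : (Q : ℝ) * (T ^ 5 + 1) ≤ n * Q * (T ^ 5 + 1) := by
        rw [mul_assoc]; exact le_mul_of_one_le_left (by positivity) hnr
      nlinarith
    push_cast
    calc (Q : ℝ) * (T ^ 5 + 1) * (2 * Real.exp (-(N * (Λ : ℝ)⁻¹ ^ 2 / 4)))
        ≤ Q * (T ^ 5 + 1) * (2 * (48 * (Q * (T ^ 5 + 1) : ℝ))⁻¹) := by gcongr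
      _ = 1 / 24 := by field_simp; norm_num
  have hC : (Q : ℝ≥0∞) * ENNReal.ofReal (1 - p) ^ T ^ 5 ≤ ENNReal.ofReal (1 / 24) := by
    rw [← ENNReal.ofReal_pow (by linarith), ← ENNReal.ofReal_natCast,
      ← ENNReal.ofReal_mul (by positivity)]
    refine ENNReal.ofReal_le_ofReal ?_
    have h1 : (1 - p) ^ T ^ 5 ≤ Real.exp (-(T : ℝ) ^ 4) := by
      calc (1 - p) ^ T ^ 5 ≤ Real.exp (-p) ^ T ^ 5 := by
            have : 0 ≤ 1 - p := by linarith
            gcongr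
            exact Real.one_sub_le_exp_neg p
        _ = Real.exp (-((p * T) * T ^ 4)) := by
            rw [← Real.exp_nat_mul]; congr 1; push_cast; ring
        _ ≤ Real.exp (-(T : ℝ) ^ 4) := by
            refine Real.exp_le_exp.2 ?_
            have : (0 : ℝ) ≤ (T : ℝ) ^ 4 := by positivity
            nlinarith
    have h2 : (Q : ℝ) ≤ Real.exp (2 * T ^ 2) := by
      have hd2 : (2 : ℝ) * d ≤ T := by exact_mod_cast hTd
      calc (Q : ℝ) = ((2 * T : ℝ) ^ 2) ^ d := by rw [hQ]; push_cast; ring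
        _ ≤ (Real.exp (2 * T) ^ 2) ^ d := by
            gcongr
            linarith [Real.add_one_le_exp (2 * T : ℝ)]
        _ = Real.exp (2 * (2 * d) * T) := by
            rw [← Real.exp_nat_mul, ← Real.exp_nat_mul]; congr 1; push_cast; ring
        _ ≤ Real.exp (2 * T ^ 2) := by
            refine Real.exp_le_exp.2 ?_
            nlinarith
    calc (Q : ℝ) * (1 - p) ^ T ^ 5 ≤ Real.exp (2 * T ^ 2) * Real.exp (-(T : ℝ) ^ 4) := by
          have : (0 : ℝ) ≤ 1 - p := by linarith
          gcongr
      _ = Real.exp (-((T : ℝ) ^ 4 - 2 * T ^ 2)) := by rw [← Real.exp_add]; congr 1; ring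
      _ ≤ (2 ^ 5)⁻¹ := by
          refine exp_neg_le_two_pow 5 ?_
          have : (9 : ℝ) ≤ (T : ℝ) ^ 2 := by nlinarith
          push_cast
          nlinarith
      _ ≤ 1 / 24 := by norm_num
  rw [mul_add]
  have e : ENNReal.ofReal (1 / 6) = ENNReal.ofReal (1 / 24) + (ENNReal.ofReal (1 / 24) +
      ENNReal.ofReal (1 / 24) + ENNReal.ofReal (1 / 24)) := by
    rw [← ENNReal.ofReal_add (by norm_num) (by norm_num), ← ENNReal.ofReal_add (by norm_num)
      (by norm_num), ← ENNReal.ofReal_add (by norm_num) (by norm_num)]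
    norm_num
  rw [e]
  exact add_le_add hA (add_le_add (add_le_add hB hC) hD)

theorem ceil_inv_bounds {ε : ℝ} (hε : 0 < ε) (hε1 : ε ≤ 1) :
    1 / ε ≤ ⌈1 / ε⌉₊ ∧ (⌈1 / ε⌉₊ : ℝ) ≤ 2 / ε := by
  refine ⟨Nat.le_ceil _, (Nat.ceil_lt_add_one (by positivity)).le.trans ?_⟩
  have : 1 ≤ 1 / ε := (one_le_div hε).2 hε1
  have e : 2 / ε = 1 / ε + 1 / ε := by ring
  linarith

/-- The needed sample size is of the form of the theorem. With `X = m * d * ⌈1 / ε⌉`, the factors with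
exponent `d` contribute `X ^ (4 * d)`, and the others `X ^ 13`, so that `X ^ (17 * d)` suffices. The
numerical constants multiply to `30720 * 16 = 491520`, and the estimate `X ≤ 2 * (d * m / ε)`
contributes another factor `2 ^ 17`. -/
theorem le_sampleSize {n m d c w : ℕ} {ε : ℝ} (hn : 1 ≤ n) (hm : 1 ≤ m) (hd : 1 ≤ d) (hε : 0 < ε)
    (hε1 : ε ≤ 1) (hc : 1 ≤ c) (hw : 1 ≤ w) :
    neededSize n m d (c * (m * d * ⌈1 / ε⌉₊) ^ 2) (w * 2 ^ d * ⌈1 / ε⌉₊) * (n + 2) ≤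
      sampleSize (64424509440 * c ^ 7 * w ^ 2 + 17) n m d ε := by
  set E := ⌈1 / ε⌉₊ with hE
  set X := m * d * E with hX
  set B := 64424509440 * c ^ 7 * w ^ 2 with hB
  obtain ⟨hE1, hE2⟩ := ceil_inv_bounds hε hε1
  rw [← hE] at hE1 hE2
  have hE0 : 1 ≤ E := Nat.ceil_pos.2 (by positivity)
  have hX0 : 1 ≤ X := Nat.mul_pos (Nat.mul_pos hm hd) hE0
  have hEX : E ≤ X := Nat.le_mul_of_pos_left E (Nat.mul_pos hm hd)
  have hmX : m ≤ X := by
    rw [hX, mul_assoc]; exact Nat.le_mul_of_pos_right m (Nat.mul_pos hd hE0)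
  set T := c * X ^ 2 with hT
  have hT0 : 1 ≤ T := Nat.mul_pos hc (by positivity)
  have h1 : neededSize n m d T (w * 2 ^ d * E) * (n + 2) ≤
      n ^ 2 * (491520 * c ^ 7 * w ^ 2) ^ d * X ^ (17 * d) := by
    have hT5 : T ^ 5 + 1 ≤ 2 * T ^ 5 := by
      have : 1 ≤ T ^ 5 := Nat.one_le_pow _ _ hT0
      omega
    have hC : 30720 * c ^ 5 * w ^ 2 ≤ (30720 * c ^ 5 * w ^ 2) ^ d :=
      Nat.le_self_pow (by omega) _
    calc neededSize n m d T (w * 2 ^ d * E) * (n + 2)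
        = 2560 * n * (m + 1) * (4 * T ^ 2) ^ d * (T ^ 5 + 1) * (w * 2 ^ d * E) ^ 2 * (n + 2) := rfl
      _ ≤ 2560 * n * (2 * X) * (4 * T ^ 2) ^ d * (2 * T ^ 5) * (w * 2 ^ d * X) ^ 2 * (3 * n) := by
          gcongr
          · omega
          · omega
      _ = n ^ 2 * ((30720 * c ^ 5 * w ^ 2) * (16 * c ^ 2) ^ d) * X ^ (4 * d + 13) := by
          rw [hT]
          have e1 : (4 * (c * X ^ 2) ^ 2) ^ d = 4 ^ d * (c ^ 2) ^ d * X ^ (4 * d) := by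
            rw [pow_mul, ← mul_pow, ← mul_pow]; ring
          have e2 : (16 * c ^ 2) ^ d = 4 ^ d * (2 ^ d) ^ 2 * (c ^ 2) ^ d := by
            rw [← pow_mul, mul_comm d 2, pow_mul, ← mul_pow, ← mul_pow]; norm_num
          rw [e1, e2, pow_add]
          ring
      _ ≤ n ^ 2 * ((30720 * c ^ 5 * w ^ 2) ^ d * (16 * c ^ 2) ^ d) * X ^ (17 * d) := by
          gcongr
          omega
      _ = _ := by rw [← mul_pow]; ring_nf
  set Y : ℝ := d * m / ε with hY
  have hdr : (1 : ℝ) ≤ d := by exact_mod_cast hd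
  have hmr : (1 : ℝ) ≤ m := by exact_mod_cast hm
  have hYd : (d : ℝ) ≤ Y := by
    rw [hY, le_div_iff₀ hε]
    exact mul_le_mul le_rfl (by linarith) hε.le (by linarith)
  have hXY : (X : ℝ) ≤ 2 * Y := by
    rw [hX, hY]; push_cast
    calc (m : ℝ) * d * E ≤ m * d * (2 / ε) := by gcongr
      _ = _ := by ring
  have hnr : (1 : ℝ) ≤ n := by exact_mod_cast hn
  have h2 : (B : ℝ) ^ d * Y ^ (17 * d) ≤ ((B + 17 : ℕ) : ℝ) * Y ^ ((B + 17) * d) := by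
    have hY1 : 1 ≤ Y := hdr.trans hYd
    rcases Nat.lt_or_ge d 2 with h | h
    · have : d = 1 := by omega
      rw [this, pow_one, mul_one, mul_one]
      gcongr
      · exact_mod_cast Nat.le_add_right _ _
      · omega
    · have hY2 : (2 : ℝ) ≤ Y := le_trans (by exact_mod_cast h) hYd
      calc (B : ℝ) ^ d * Y ^ (17 * d) ≤ (Y ^ B) ^ d * Y ^ (17 * d) := by
            gcongr
            calc (B : ℝ) ≤ 2 ^ B := by exact_mod_cast B.lt_two_pow_self.le
              _ ≤ Y ^ B := by gcongr
        _ = 1 * Y ^ ((B + 17) * d) := by rw [← pow_mul, ← pow_add, add_mul, one_mul]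
        _ ≤ _ := by
            gcongr
            exact_mod_cast (by omega : 1 ≤ B + 17)
  refine (Nat.cast_le (α := ℝ)).1 (le_trans ?_ (Nat.le_ceil _))
  calc ((neededSize n m d T (w * 2 ^ d * E) * (n + 2) : ℕ) : ℝ)
      ≤ ((n ^ 2 * (491520 * c ^ 7 * w ^ 2) ^ d * X ^ (17 * d) : ℕ) : ℝ) := Nat.cast_le.2 h1
    _ = (n : ℝ) ^ 2 * ((491520 * c ^ 7 * w ^ 2 : ℕ) : ℝ) ^ d * (X : ℝ) ^ (17 * d) := by push_cast; ring
    _ ≤ (n : ℝ) ^ 2 * ((491520 * c ^ 7 * w ^ 2 : ℕ) : ℝ) ^ d * (2 * Y) ^ (17 * d) := by gcongr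
    _ = (n : ℝ) ^ 2 * ((B : ℝ) ^ d * Y ^ (17 * d)) := by
        rw [mul_pow, pow_mul 2, hB]
        rw [show (64424509440 * c ^ 7 * w ^ 2 : ℕ) = (491520 * c ^ 7 * w ^ 2) * 2 ^ 17 by ring]
        push_cast
        rw [mul_pow _ (131072 : ℝ)]
        norm_num
        ring
    _ ≤ (n : ℝ) ^ (B + 17) * (((B + 17 : ℕ) : ℝ) * Y ^ ((B + 17) * d)) := by
        gcongr
        omega
    _ = _ := by rw [hY]; ring

/-- The excess of the error is at most a multiple of `ε`: the skipped queries and the inaccuracy of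
the estimates contribute at most `κ * ε` each. -/
theorem error_le {m d c w E : ℕ} {κ ε : ℝ} (hm : 1 ≤ m) (hd : 1 ≤ d) (hw : 1 ≤ w) (hc : 1 ≤ c)
    (hκ : 0 < κ) (hε : 0 < ε) (hE : 1 / ε ≤ E) (hcκ : 2048 / κ ^ 2 ≤ c) (hwκ : 3 / κ ≤ w) :
    (1 + κ) * ε + 32 * m * (d * √(2 / (c * (m * d * E) ^ 2 : ℕ))) +
      3 * 2 ^ d * ((w * 2 ^ d * E : ℕ) : ℝ)⁻¹ ≤ (1 + 3 * κ) * ε := by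
  have hE0 : (0 : ℝ) < E := lt_of_lt_of_le (by positivity) hE
  have hm0 : (0 : ℝ) < m := by exact_mod_cast hm
  have hd0 : (0 : ℝ) < d := by exact_mod_cast hd
  have hw0 : (0 : ℝ) < w := by exact_mod_cast hw
  have hc0 : (0 : ℝ) < c := by exact_mod_cast hc
  have hEε : (E : ℝ)⁻¹ ≤ ε := by
    rw [inv_le_comm₀ hE0 hε, ← one_div]; exact hE
  have h1 : 32 * m * (d * √(2 / (c * (m * d * E) ^ 2 : ℕ))) ≤ κ * ε := by
    push_cast
    have e : √(2 / (c * (m * d * E) ^ 2 : ℝ)) = √(2 / c) / (m * d * E) := by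
      rw [← div_div, Real.sqrt_div (by positivity), Real.sqrt_sq (by positivity)]
    have hs : √(2 / (c : ℝ)) ≤ κ / 32 := by
      rw [Real.sqrt_le_iff]
      refine ⟨by positivity, ?_⟩
      rw [div_le_iff₀ (by positivity)] at hcκ ⊢
      nlinarith
    rw [e]
    calc 32 * (m : ℝ) * (d * (√(2 / c) / (m * d * E))) = 32 * √(2 / c) * (E : ℝ)⁻¹ := by
          field_simp
      _ ≤ 32 * (κ / 32) * ε := by gcongr
      _ = κ * ε := by ring
  have h2 : 3 * 2 ^ d * ((w * 2 ^ d * E : ℕ) : ℝ)⁻¹ ≤ κ * ε := by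
    push_cast
    calc 3 * 2 ^ d * ((w : ℝ) * 2 ^ d * E)⁻¹ = 3 / w * (E : ℝ)⁻¹ := by field_simp
      _ ≤ κ * ε := by
        gcongr
        rw [div_le_iff₀ hκ] at hwκ
        rw [div_le_iff₀ hw0]
        linarith
  linarith

section

open Enc (enc)

/-! ### Runs on encoded samples -/

section

variable {n : ℕ}

/-- The input of a learner, with the points as lists. -/
def toInp (params : List ℕ) (S : List (Cube n × Bool)) : Inp :=
  (params, S.map fun z => (z.2, List.ofFn z.1))

theorem encodeInput_eq (params : List ℕ) (S : List (Cube n × Bool)) :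
    encodeInput params S = enc (toInp params S) := by
  have h : ∀ z : Cube n × Bool, encodeExample z = enc (z.2, List.ofFn z.1) := fun _ => rfl
  change Data.cons _ _ = Data.cons _ _
  congr 1
  change _ = Data.ofList (List.map enc (List.map _ S))
  rw [List.map_map]
  rfl

theorem iid_labeled (D : PMF (Cube n)) (f : Cube n → Bool) (M : ℕ) :
    iid (exampleLaw D f) M = (iid (D.map fun x => (x, f x)) M).map
      (List.map fun z => (z.2, List.ofFn z.1)) := by
  rw [← iid_map, PMF.map_comp]
  rfl

theorem subcubeOracle_enc (D : PMF (Cube n)) (ρ : Rest) :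
    subcubeOracle D (enc ρ) = (answerLaw D ρ).map enc := by
  have h1 : ∀ ρ : Rest, (enc ρ).toList = ρ.map enc := by
    intro ρ
    induction ρ with
    | nil => rfl
    | cons a ρ ih => rw [enc_cons, Data.toList, ih, List.map_cons]
  have h : decodeSubcube n (enc ρ) = restFun n ρ := by
    funext i
    unfold decodeSubcube restFun
    rw [h1]
    simp only [List.getD_eq_getElem?_getD, List.getElem?_map]
    cases h2 : ρ[(i : ℕ)]? with
    | none => rfl
    | some o =>
      cases o with
      | none => rfl
      | some b => cases b <;> rfl
  rw [subcubeOracle, h, answerLaw, PMF.map_comp]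
  rfl

theorem hgt_ofFn (x : Cube n) : hgt (List.ofFn x) ≤ n + 1 := by
  have := hgt_list_le (l := List.ofFn x) (B := 1) fun b _ => hgt_bool b
  rwa [List.length_ofFn] at this

theorem hgt_toInp_le (params : List ℕ) (S : List (Cube n × Bool)) {B : ℕ} (hB : ∀ k ∈ params, k ≤ B) :
    hgt (toInp params S) ≤ params.length + B + S.length + n + 4 := by
  have h1 : hgt params ≤ params.length + B := hgt_list_le fun k hk => by
    rw [hgt_nat]; exact hB k hk
  have h2 : hgt (S.map fun z => (z.2, List.ofFn z.1)) ≤ S.length + (n + 3) := by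
    have := hgt_list_le (l := S.map fun z => (z.2, List.ofFn z.1)) (B := n + 3) fun e he => by
      obtain ⟨z, _, rfl⟩ := List.mem_map.1 he
      rw [hgt_pair]
      have := hgt_ofFn z.1
      have := hgt_bool z.2
      omega
    rwa [List.length_map] at this
  rw [toInp, hgt_pair]
  omega

/-- The output distribution of a program on an input on which it halts for all coins; `nil` on the
other inputs. -/
def outputLaw (A : Cmd) (x : Data) : PMF Data :=
  open Classical in
  if h : ∃ (p : PMF Data) (t : ℕ), Runs (fun _ => PMF.pure Data.nil) A x p t 0 then h.choose
  else PMF.pure Data.nil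

theorem runs_outputLaw {A : Cmd} (hA : A.QueryFree) {O O' : Data → PMF Data} {x : Data}
    {p : PMF Data} {t q : ℕ} (h : Runs O A x p t q) : Runs O' A x (outputLaw A x) t 0 := by
  have h0 := h.queryFree (O' := fun _ => PMF.pure Data.nil) hA
  have hex : ∃ (p : PMF Data) (t : ℕ), Runs (fun _ => PMF.pure Data.nil) A x p t 0 := ⟨p, t, h0⟩
  have h1 := h.queryFree (O' := O') hA
  obtain ⟨t', h2⟩ := hex.choose_spec
  have e : outputLaw A x = p := by
    rw [outputLaw, dif_pos hex]
    exact h2.unique h0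
  rw [e]; exact h1

theorem RunsInTime.runs {A : Cmd} (hA : A.QueryFree) {params : List ℕ} {m t : ℕ}
    (h : RunsInTime A params n m t) {S : List (Cube n × Bool)} (hS : S.length = m)
    (O : Data → PMF Data) :
    Runs O A (enc (toInp params S)) (outputLaw A (enc (toInp params S))) t 0 := by
  obtain ⟨k, hk⟩ := h (unif n) S hS
  rw [← encodeInput_eq]
  obtain ⟨p, hp⟩ := exists_runs hA hk
  exact runs_outputLaw hA hp

/-- The success of the given learner, as a statement about its output distribution, which does not
depend on the oracle. -/
theorem Learns.learnsUniform {A : Cmd} (hA : A.QueryFree) {m E t : ℕ} {ε : ℝ}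
    {C : Set (Cube n → Bool)} (ht : RunsInTime A [n, E] n m t)
    (h : Learns A [n, E] ε (1 / 2) C {PMF.uniformOfFintype (Cube n)} m) {f : Cube n → Bool}
    (hf : f ∈ C) : LearnsUniform (outputLaw A) n m E ε f := by
  obtain ⟨k, hk⟩ := h _ rfl f hf
  have e : ENNReal.ofReal (1 - 1 / 2) = 2⁻¹ := by
    rw [show (1 - 1 / 2 : ℝ) = 2⁻¹ by norm_num, ENNReal.ofReal_inv_of_pos (by norm_num)]
    simp
  rw [e] at hk
  refine hk.trans ?_
  rw [iid_labeled, PMF.bind_map]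
  change pr _ _ ≤ _
  rw [pr_bind, pr_bind]
  refine ex_mono fun S hS => ?_
  have hr := ht.runs hA (length_of_mem_iid hS) (subcubeOracle (unif n))
  have hle := hr.le k {g | pr (unif n) (fun x => evalGates (decodeCircuit g) (List.ofFn x) ≠ f x) ≤
    ENNReal.ofReal ε}
  refine le_trans (le_of_eq ?_) hle
  unfold pr runOn
  rw [encodeInput_eq]
  congr 1
  ext r
  refine exists_congr fun o => and_congr_right fun _ => ?_
  have : {x : Cube n | f x ≠ o.hypothesis n x} =
    {x | evalGates (decodeCircuit o.output) (List.ofFn x) ≠ f x} := by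
    ext x
    exact ne_comm
  rw [err, this]
  exact Iff.rfl

theorem Runs.exec_eq {O : Data → PMF Data} {c : Cmd} {x : Data} {p : PMF Data} {t q : ℕ}
    (h : Runs O c x p t q) : ∃ k₀, ∀ k ≥ k₀,
    (∀ G : Data → Prop, pr (c.exec O k (initStore x)) (fun r => ∃ o : Outcome, r = some o ∧
      G o.output) = pr p G) ∧
    ∀ r ∈ (c.exec O k (initStore x)).support, ∃ o : Outcome, r = some o ∧ o.steps ≤ t ∧
      o.queries ≤ q := by
  obtain ⟨P, ⟨R, -, ⟨k₀, hk₀⟩, rfl, h4⟩, rfl⟩ := h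
  refine ⟨k₀, fun k hk => ?_⟩
  rw [show c.exec O k (initStore x) = _ from hk₀ k hk]
  constructor
  · intro G
    rw [pr_map, pr_map, pr_map]
    congr 1
    ext o
    simp [Outcome.output]
  · intro r hr
    rw [PMF.support_map] at hr
    obtain ⟨o, ho, rfl⟩ := hr
    exact ⟨o, rfl, h4 o ho⟩

theorem alwaysHaltsWith_of_runs {P : Cmd} {params : List ℕ} {M t q : ℕ} {Q : Outcome → Prop}
    (h : ∀ (D : PMF (Cube n)) (S : List (Cube n × Bool)), S.length = M → ∃ p,
      Runs (subcubeOracle D) P (enc (toInp params S)) p t q)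
    (hQ : ∀ o : Outcome, o.steps ≤ t → o.queries ≤ q → Q o) : AlwaysHaltsWith P params n M Q := by
  intro D S hS
  obtain ⟨p, hp⟩ := h D S hS
  obtain ⟨k, hk⟩ := hp.exec_eq
  refine ⟨k, fun r hr => ?_⟩
  rw [runOn, encodeInput_eq] at hr
  obtain ⟨o, rfl, h1, h2⟩ := (hk k le_rfl).2 r hr
  exact ⟨o, rfl, hQ o h1 h2⟩

/-- A bound for the probability of failure of the output distributions of a program. -/
theorem success_of_runs {P : Cmd} {params : List ℕ} {M t q : ℕ} {δ ε : ℝ} (D : PMF (Cube n))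
    (f : Cube n → Bool) (law : List (Bool × Pt) → PMF Data)
    (h : ∀ S : List (Cube n × Bool), S.length = M →
      Runs (subcubeOracle D) P (enc (toInp params S)) (law (toInp params S).2) t q) (hδ : 0 ≤ δ)
    (hfail : pr ((iid (exampleLaw D f) M).bind law) (fun g =>
      ¬ err D f (evalCircuit (decodeCircuit g)) ≤ ENNReal.ofReal ε) ≤ ENNReal.ofReal δ) :
    ∃ k : ℕ, ENNReal.ofReal (1 - δ) ≤
      ((iid (D.map fun x => (x, f x)) M).bind fun S => runOn P params D k S).toOuterMeasure
        {r | ∃ o : Outcome, r = some o ∧ err D f (o.hypothesis n) ≤ ENNReal.ofReal ε} := by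
  set good : Data → Prop := fun g => err D f (evalCircuit (decodeCircuit g)) ≤ ENNReal.ofReal ε
    with hgood
  set p := iid (D.map fun x => (x, f x)) M with hp
  have hfin : {S : List (Cube n × Bool) | S.length = M}.Finite := List.finite_length_eq _ _
  have hev : ∀ᶠ k in Filter.atTop, ∀ S ∈ {S : List (Cube n × Bool) | S.length = M},
      pr (runOn P params D k S) (fun r => ∃ o : Outcome, r = some o ∧ good o.output) =
        pr (law (toInp params S).2) good := by
    rw [Filter.eventually_all_finite hfin]
    intro S hS
    obtain ⟨k₀, hk⟩ := (h S hS).exec_eq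
    filter_upwards [Filter.eventually_ge_atTop k₀] with k hk'
    rw [runOn, encodeInput_eq]
    exact (hk k hk').1 good
  obtain ⟨k, hk⟩ := hev.exists
  refine ⟨k, ?_⟩
  have e : pr (p.bind fun S => runOn P params D k S)
      (fun r => ∃ o : Outcome, r = some o ∧ good o.output) =
      pr ((iid (exampleLaw D f) M).bind law) good := by
    rw [iid_labeled, PMF.bind_map, pr_bind, pr_bind]
    refine ex_congr fun S hS => ?_
    exact hk S (length_of_mem_iid hS)
  change _ ≤ pr (p.bind fun S => runOn P params D k S)
      (fun r => ∃ o : Outcome, r = some o ∧ good o.output)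
  rw [e, ENNReal.ofReal_sub _ hδ, ENNReal.ofReal_one, tsub_le_iff_right, ← pr_add_pr_not ((iid (exampleLaw D f) M).bind law) good]
  gcongr

/-! ### The inputs for the given learner -/

theorem exists_of_mem_listM {α β : Type} {g : α → PMF β} {l : List α} {r : List β}
    (h : r ∈ (listM g l).support) {b : β} (hb : b ∈ r) : ∃ a ∈ l, b ∈ (g a).support := by
  induction l generalizing r with
  | nil => simp [listM] at h; simp [h] at hb
  | cons a l ih =>
    simp only [listM, PMF.support_bind, PMF.support_map, Set.mem_iUnion, Set.mem_image] at h
    obtain ⟨b', hb', r', hr', rfl⟩ := h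
    rcases List.mem_cons.1 hb with rfl | hb
    · exact ⟨a, List.mem_cons_self, hb'⟩
    · obtain ⟨a', ha', h'⟩ := ih hr' hb
      exact ⟨a', List.mem_cons_of_mem _ ha', h'⟩

theorem mem_chunk {α : Type} {k j : ℕ} {F : List α} {a : α} (h : a ∈ chunk k F j) : a ∈ F :=
  List.mem_of_mem_drop (List.mem_of_mem_take h)

/-- All runs of the given learner are on samples of `m` points of the cube. -/
theorem exists_sample_of_mem_jobs {E m R : ℕ} {S₂ : List (Bool × Pt)}
    (hS : ∀ e ∈ S₂, e.2.length = n) {U : List ((Bool × Pt) × Pt)} (hU : U ∈ (coinLaw S₂).support)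
    {ρ : Rest} {j : Pt × Job} (hj : j ∈ jobs n E m R U ρ) :
    ∃ S : List (Cube n × Bool), S.length = m ∧ j.2 = toInp [n, E] S := by
  have hU' : ∀ e ∈ U, e.1.2.length = n := by
    intro e he
    obtain ⟨a, ha, he⟩ := exists_of_mem_listM hU he
    rw [PMF.support_map] at he
    obtain ⟨u, _, rfl⟩ := he
    exact hS a ha
  unfold jobs at hj
  rw [List.mem_flatMap] at hj
  obtain ⟨i, -, hj⟩ := hj
  split_ifs at hj with hlen
  · rw [List.mem_singleton] at hj
    subst hj
    set l := (chunk (m + 1) (U.filter fun e => inCube ρ e.1.2) i).tail with hl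
    have hl1 : l.length = m := by
      have h1 : (chunk (m + 1) (U.filter fun e => inCube ρ e.1.2) i).length ≤ m + 1 :=
        List.length_take_le _ _
      have h2 := of_decide_eq_true hlen
      rw [hl, List.length_tail]
      omega
    refine ⟨l.map fun e => (fun i => (overwrite ρ e.1.2 e.2).getD i false, e.1.1), by simpa using hl1, ?_⟩
    unfold toInp
    rw [List.map_map]
    refine Prod.ext rfl (List.map_congr_left fun e he => ?_)
    have he' : e.1.2.length = n :=
      hU' e (List.mem_of_mem_filter (mem_chunk (List.mem_of_mem_tail he)))
    simp only [Function.comp]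
    congr 1
    refine List.ext_getElem (by simp [length_overwrite, he']) fun i h1 h2 => ?_
    rw [List.getElem_ofFn, List.getD_eq_getElem]
  · simp at hj

end

end


section

open Enc (enc)

/-! ### The lifted learners -/

/-- The program `pre` adds to every example of the first part of the sample a second point, drawn
from `g D`, in time given by the polynomial `P`. -/
structure Prepares (pre : Cmd) (g : ∀ {n : ℕ}, PMF (Cube n) → Bool × Pt → PMF (Pt × Pt))
    (P : Polynomial ℕ) : Prop where
  runs : ∀ {n : ℕ} (D : PMF (Cube n)) (a : Inp), a.n = n →
    TRuns (subcubeOracle D) pre a (listM (g D) a.S₁) (P.eval (hgt a + n)) (a.S₁.length * n)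
  length : ∀ {n : ℕ} (D : PMF (Cube n)) (e : Bool × Pt) (z : Pt × Pt), e.2.length = n →
    z ∈ (g D e).support → z.1.length = n ∧ z.2.length = n

/-- For monotone distributions, the second point is the example itself. -/
theorem exists_prepares_self : ∃ (pre : Cmd) (P : Polynomial ℕ), pre.QueryFree ∧
    Prepares pre (fun _ e => PMF.pure (e.2, e.2)) P := by
  obtain ⟨c, P, hq, hc⟩ := PT.map (g := fun (_ : Inp) (e : Bool × Pt) => (e.2, e.2)) PT.inpS₁
    (PT.pair (PT.snd PT.arg) (PT.snd PT.arg))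
  refine ⟨c, P, hq, ⟨fun D a _ => ?_, fun D e z he hz => ?_⟩⟩
  · rw [listM_pure]
    exact (TRuns.of_pure (hc _ a)).mono (polyEval_mono _ (Nat.le_add_right _ _)) (Nat.zero_le _)
  · simp only [PMF.support_pure, Set.mem_singleton_iff] at hz
    subst hz
    exact ⟨he, he⟩

/-- For general distributions, the second point records the agreements with samples from the edges at
the example. -/
theorem exists_prepares_edges : ∃ (pre : Cmd) (P : Polynomial ℕ),
    Prepares pre (fun {n} D e => (agreeLaw (answerLaw D) n e.2).map fun z => (e.2, z)) P := by
  obtain ⟨c, P, hc⟩ := exists_edge_program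
  refine ⟨c, P.comp (.X + 1), ⟨fun {n} D a ha => ?_, fun {n} D e z he hz => ?_⟩⟩
  · have := hc (subcubeOracle D) (answerLaw D) (n + 1) (subcubeOracle_enc D) (fun q => by
      refine ⟨finite_support_map (Set.toFinite _) _, fun y hy => ?_⟩
      rw [answerLaw, PMF.support_map] at hy
      obtain ⟨x, -, rfl⟩ := hy
      exact hgt_ofFn x) a
    rw [ha] at this
    refine this.mono ?_ le_rfl
    simp [add_assoc]
  · rw [PMF.support_map] at hz
    obtain ⟨y, hy, rfl⟩ := hz
    exact ⟨he, by simpa using (forall₂_of_mem_listM hy).length_eq.symm⟩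

theorem exists_poly_bound (Q : Polynomial ℕ) : ∃ b : ℕ, ∀ x : ℕ, 1 ≤ x → Q.eval x ≤ b * x ^ b := by
  induction Q using Polynomial.induction_on' with
  | add p q hp hq =>
    obtain ⟨b₁, h₁⟩ := hp
    obtain ⟨b₂, h₂⟩ := hq
    refine ⟨b₁ + b₂, fun x hx => ?_⟩
    rw [Polynomial.eval_add, add_mul]
    refine add_le_add ((h₁ x hx).trans ?_) ((h₂ x hx).trans ?_)
    · exact Nat.mul_le_mul_left _ (Nat.pow_le_pow_right hx (Nat.le_add_right _ _))
    · exact Nat.mul_le_mul_left _ (Nat.pow_le_pow_right hx (Nat.le_add_left _ _))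
  | monomial k r =>
    refine ⟨k + r, fun x hx => ?_⟩
    rw [Polynomial.eval_monomial]
    exact Nat.mul_le_mul (Nat.le_add_left _ _) (Nat.pow_le_pow_right hx (Nat.le_add_right _ _))

/-- The output distribution of the learner on the sample `S`. -/
def learnerLaw (c : ℕ) (A : Cmd) (n d m E : ℕ) (g : Bool × Pt → PMF (Pt × Pt))
    (S : List (Bool × Pt)) : PMF Data :=
  if E ≤ 1 then PMF.pure Data.nil else
    ((listM g (Inp.S₁ ([n, d, m, E], S))).bind fun Z =>
      circuitLaw c (outputLaw A) ([n, d, m, E], S) Z).map enc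

/-- The learner as a program that runs in time polynomial in `n + M`, with at most `M` queries. The
parameters must be at most `M` since the time bound of the given learner depends on them. -/
theorem exists_lifted_learner (c : ℕ) (A : Cmd) (hA : A.QueryFree) (a : ℕ) {pre : Cmd}
    {g : ∀ {n : ℕ}, PMF (Cube n) → Bool × Pt → PMF (Pt × Pt)} {Pp : Polynomial ℕ}
    (hp : Prepares pre g Pp) :
    ∃ (B : Cmd) (b : ℕ), (pre.QueryFree → B.QueryFree) ∧ ∀ n m d E M : ℕ, 1 ≤ n →
      RunsInTime A [n, E] n m (a * (n + m + E) ^ a) → (2 ≤ E → d ≤ M ∧ m ≤ M ∧ E ≤ M) →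
      ∀ (D : PMF (Cube n)) (S : List (Cube n × Bool)), S.length = M →
      Runs (subcubeOracle D) B (enc (toInp [n, d, m, E] S))
        (learnerLaw c A n d m E (g D) (toInp [n, d, m, E] S).2) (b * (n + M) ^ b) M := by
  obtain ⟨main, P, hq, hmain⟩ := exists_learner c A hA
  obtain ⟨b, hb⟩ := exists_poly_bound
    (Pp.comp (4 * .X + 8) + P.comp (5 * .X + 10 + .C a * (3 * .X) ^ a) + 30)
  refine ⟨learnerC pre main, b, fun h => ⟨⟨⟨h, trivial⟩, hq⟩, trivial⟩, fun n m d E M hn hA' hM D S hS => ?_⟩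
  have hb' := hb (n + M) (by omega)
  simp only [Polynomial.eval_add, Polynomial.eval_mul, Polynomial.eval_comp, Polynomial.eval_X,
    Polynomial.eval_pow, Polynomial.eval_C, Polynomial.eval_ofNat] at hb'
  set I := toInp [n, d, m, E] S with hI
  have hm := hmain pre ⟨subcubeOracle D, outputLaw A, a * (n + m + E) ^ a⟩ I (listM (g D) I.S₁)
    (Pp.eval (hgt I + n)) (I.S₁.length * n) (M + n + 2) rfl
  have hIE : I.E = E := rfl
  rw [hIE] at hm
  have hlen : ∀ e ∈ I.2, e.2.length = n := by
    intro e he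
    obtain ⟨z, _, rfl⟩ := List.mem_map.1 he
    simp
  have hIM : I.2.length = M := by rw [hI, toInp, List.length_map, hS]
  by_cases hE : E ≤ 1
  · rw [learnerLaw, if_pos hE]
    exact (hm.1 hE).mono (by omega) (Nat.zero_le _)
  rw [learnerLaw, if_neg hE]
  obtain ⟨hdM, hmM, hEM⟩ := hM (by omega)
  have hS1 : I.S₁.length ≤ partSize n M := by
    have : I.q = partSize n M := by rw [← hIM]; rfl
    rw [← this]
    exact List.length_take_le _ _
  have hq1 : partSize n M * (n + 2) ≤ M := Nat.div_mul_le_self M (n + 2)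
  have hS1n : I.S₁.length * n ≤ M :=
    (Nat.mul_le_mul hS1 (Nat.le_add_right n 2)).trans hq1
  have hS1M : I.S₁.length ≤ M := by
    have := List.length_take_le I.q I.2
    exact (List.length_take_le' _ _).trans hIM.le
  have hgt1 : hgt I ≤ 2 * M + 2 * n + 8 := by
    have := hgt_toInp_le [n, d, m, E] S (B := n + M) (by
      intro k hk
      simp only [List.mem_cons, List.not_mem_nil, or_false] at hk
      omega)
    simp only [List.length_cons, List.length_nil, hS, ← hI] at this
    omega
  refine (hm.2 (by omega) (hp.runs D I rfl) (fun Z hZ => ?_) fun Z _ U hU it hit j hj => ?_).mono ?_ hS1n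
  · have hl : Z.length = I.S₁.length := (forall₂_of_mem_listM hZ).length_eq.symm
    refine (hgt_list_le (B := n + 2) fun z hz => ?_).trans (by omega)
    obtain ⟨e, he, hz⟩ := exists_of_mem_listM hZ hz
    obtain ⟨h1, h2⟩ := hp.length D e z (hlen e (List.mem_of_mem_take he)) hz
    have hpt : ∀ y : Pt, y.length = n → hgt y ≤ n + 1 := fun y hy => by
      have := hgt_list_le (l := y) (B := 1) fun b _ => hgt_bool b
      omega
    have := hpt _ h1
    have := hpt _ h2
    rw [hgt_pair]
    omega
  · obtain ⟨it', -, rfl⟩ := List.mem_map.1 hit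
    cases it' with
    | none => simp [itemJobs] at hj
    | some p =>
      obtain ⟨S', hS', hj'⟩ := exists_sample_of_mem_jobs (n := n) (E := E) (m := m)
        (fun e he => hlen e (List.mem_of_mem_drop (List.mem_of_mem_take he))) hU hj
      rw [hj']
      exact hA'.runs hA hS' _
  · refine le_trans ?_ hb'
    have h1 : Pp.eval (hgt I + n) ≤ Pp.eval (4 * (n + M) + 8) := polyEval_mono _ (by omega)
    have h2 : a * (n + m + E) ^ a ≤ a * (3 * (n + M)) ^ a := by
      gcongr
      omega
    have h3 : P.eval (hgt I + (M + n + 2) + a * (n + m + E) ^ a) ≤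
        P.eval (5 * (n + M) + 10 + a * (3 * (n + M)) ^ a) := polyEval_mono _ (by omega)
    simp only
    omega

section

variable {n : ℕ}

theorem err_le_of_sum_le {D : PMF (Cube n)} {f h : Cube n → Bool} {ε : ℝ}
    (hε : 0 ≤ ε) (hs : (∑ x, if h x = f x then 0 else (D x).toReal) ≤ ε) :
    err D f h ≤ ENNReal.ofReal ε := by
  have e : err D f h = pr D fun x => f x ≠ h x := rfl
  rw [e, ENNReal.le_ofReal_iff_toReal_le (pr_ne_top _ _) hε, toReal_pr]
  refine le_trans (le_of_eq (Finset.sum_congr rfl fun x _ => ?_)) hs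
  by_cases hx : h x = f x
  · simp [hx]
  · simp [hx, Ne.symm hx]

theorem pow_le_neededSize {n m d T Λ : ℕ} (hn : 1 ≤ n) (hΛ : 1 ≤ Λ) :
    (4 * T ^ 2) ^ d ≤ neededSize n m d T Λ := by
  have h : 1 ≤ 2560 * n * (m + 1) * (T ^ 5 + 1) * Λ ^ 2 := Nat.one_le_iff_ne_zero.2 (by positivity)
  calc (4 * T ^ 2) ^ d ≤ (4 * T ^ 2) ^ d * (2560 * n * (m + 1) * (T ^ 5 + 1) * Λ ^ 2) :=
        Nat.le_mul_of_pos_right _ h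
    _ = _ := by rw [neededSize]; ring

/-- The constant in the sample size, in terms of the constant `c` in `Inp.T` and the constant `w` in
the accuracy of the estimates. -/
def sizeConst (c w : ℕ) : ℕ := 64424509440 * c ^ 7 * w ^ 2 + 17

theorem le_sampleSize_of_two_le {m d c w : ℕ} {ε : ℝ} (hn : 1 ≤ n) (hm : 1 ≤ m) (hd : 1 ≤ d)
    (hε : 0 < ε) (hc : 1 ≤ c) (hw : 1 ≤ w) (hE : 2 ≤ ⌈1 / ε⌉₊) :
    neededSize n m d (c * (m * d * ⌈1 / ε⌉₊) ^ 2) (w * 2 ^ d * ⌈1 / ε⌉₊) ≤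
      partSize n (sampleSize (sizeConst c w) n m d ε) := by
  have hε1 : ε ≤ 1 := by
    by_contra h
    rw [not_le] at h
    have : ⌈1 / ε⌉₊ ≤ 1 := Nat.ceil_le.2 (by
      rw [div_le_iff₀ hε, Nat.cast_one]; linarith)
    omega
  rw [partSize, Nat.le_div_iff_mul_le (by omega)]
  exact le_sampleSize hn hm hd hε hε1 hc hw

theorem params_le {m d c w : ℕ} {ε : ℝ} (hn : 1 ≤ n) (hm : 1 ≤ m) (hd : 1 ≤ d)
    (hε : 0 < ε) (hc : 1 ≤ c) (hw : 1 ≤ w) (hE : 2 ≤ ⌈1 / ε⌉₊) :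
    d ≤ sampleSize (sizeConst c w) n m d ε ∧ m ≤ sampleSize (sizeConst c w) n m d ε ∧
      ⌈1 / ε⌉₊ ≤ sampleSize (sizeConst c w) n m d ε := by
  set E := ⌈1 / ε⌉₊
  set T := c * (m * d * E) ^ 2 with hT
  have hX : 1 ≤ m * d * E := Nat.mul_pos (Nat.mul_pos hm hd) (by omega)
  have hXT : m * d * E ≤ T := (Nat.le_self_pow two_ne_zero _).trans (Nat.le_mul_of_pos_left _ hc)
  have hTM : T ≤ sampleSize (sizeConst c w) n m d ε := by
    calc T ≤ T ^ 2 := Nat.le_self_pow two_ne_zero _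
      _ ≤ 4 * T ^ 2 := by omega
      _ ≤ (4 * T ^ 2) ^ d := Nat.le_self_pow (by omega) _
      _ ≤ _ := pow_le_neededSize hn (Nat.one_le_iff_ne_zero.2 (by positivity))
      _ ≤ _ := le_sampleSize_of_two_le hn hm hd hε hc hw hE
      _ ≤ _ := Nat.div_le_self _ _
  have h1 : d ≤ m * d * E := (Nat.le_mul_of_pos_left _ hm).trans (Nat.le_mul_of_pos_right _ (by omega))
  have h2 : m ≤ m * d * E := (Nat.le_mul_of_pos_right _ hd).trans (Nat.le_mul_of_pos_right _ (by omega))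
  have h3 : E ≤ m * d * E := Nat.le_mul_of_pos_left _ (Nat.mul_pos hm hd)
  omega

/-- The learner fails with probability at most `1 / 6`. -/
theorem pr_learnerLaw_le {c w m d : ℕ} {κ ε : ℝ} {A : Cmd} (hn : 1 ≤ n) (hm : 1 ≤ m) (hd : 1 ≤ d)
    (hε : 0 < ε) (hκ : 0 < κ) (hc : 3 ≤ c) (hw : 1 ≤ w) (hcκ : 2048 / κ ^ 2 ≤ c)
    (hwκ : 3 / κ ≤ w) (hcp : 1 ≤ 7 / 16 * (κ / (1 + κ)) * c) {D : PMF (Cube n)}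
    (hD : IsDecisionTreeDist d D) {C : Set (Cube n → Bool)} (hC : ClosedUnderRestriction C)
    (hA : ∀ f ∈ C, LearnsUniform (outputLaw A) n m ⌈1 / ε⌉₊ ε f) {f : Cube n → Bool} (hf : f ∈ C)
    {g : Bool × Pt → PMF (Pt × Pt)}
    (hg : Detects ((exampleLaw D f).bind g) fun x : Cube n => (D x).toReal) :
    pr ((iid (exampleLaw D f) (sampleSize (sizeConst c w) n m d ε)).bind fun S =>
      learnerLaw c A n d m ⌈1 / ε⌉₊ g S) (fun h =>
      ¬ err D f (evalCircuit (decodeCircuit h)) ≤ ENNReal.ofReal ((1 + 3 * κ) * ε)) ≤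
      ENNReal.ofReal (1 / 6) := by
  have hε3 : 0 ≤ (1 + 3 * κ) * ε := by positivity
  set E := ⌈1 / ε⌉₊ with hE
  by_cases hE1 : E ≤ 1
  · -- If `ε ≥ 1`, every hypothesis is good enough.
    have hε1 : 1 ≤ ε := by
      have h1 : 1 / ε ≤ 1 := (Nat.le_ceil _).trans (by exact_mod_cast hE1)
      rwa [div_le_one hε] at h1
    have h1 : ∀ h : Data, err D f (evalCircuit (decodeCircuit h)) ≤
        ENNReal.ofReal ((1 + 3 * κ) * ε) := fun h =>
      (pr_le_one D _).trans (ENNReal.one_le_ofReal.2 (by nlinarith))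
    have h2 : {h : Data | ¬ err D f (evalCircuit (decodeCircuit h)) ≤
        ENNReal.ofReal ((1 + 3 * κ) * ε)} = ∅ := by
      ext h
      simp [h1 h]
    rw [pr, h2]
    simp
  have hE2 : 2 ≤ E := by omega
  set M := sampleSize (sizeConst c w) n m d ε with hM
  set T := c * (m * d * E) ^ 2 with hT
  set Λ := w * 2 ^ d * E with hΛ
  have hΛ1 : 1 ≤ Λ := Nat.one_le_iff_ne_zero.2 (by positivity)
  have hΛr : (1 : ℝ) ≤ Λ := by exact_mod_cast hΛ1
  have hN := le_sampleSize_of_two_le (c := c) hn hm hd hε (by omega) hw hE2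
  have hX : 1 ≤ m * d * E := Nat.mul_pos (Nat.mul_pos hm hd) (by omega)
  have hcT : c ≤ T := Nat.le_mul_of_pos_right _ (by positivity)
  have hT3 : 3 ≤ T := hc.trans hcT
  have hTd : 2 * d ≤ T := by
    have h1 : d ≤ m * d * E :=
      (Nat.le_mul_of_pos_left _ hm).trans (Nat.le_mul_of_pos_right _ (by omega))
    calc 2 * d ≤ c * (m * d * E) := Nat.mul_le_mul (by omega) h1
      _ ≤ T := Nat.mul_le_mul_left _ (Nat.le_self_pow two_ne_zero _)
  have hpow := (pow_le_neededSize (m := m) (d := d) (T := T) hn hΛ1).trans hN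
  have hL : (4 * T ^ 2) ^ d ≤ M := hpow.trans (Nat.div_le_self _ _)
  have hN0 : 0 < partSize n M := lt_of_lt_of_le (by positivity) hpow
  have hN5 : 2 * ((T ^ 5 : ℕ) * ((m : ℝ) + 1)) ≤ partSize n M * (Λ : ℝ)⁻¹ := by
    rw [← div_eq_mul_inv, le_div_iff₀ (by positivity)]
    have h1 : 2 * (T ^ 5 * (m + 1)) * Λ ≤ partSize n M := by
      refine le_trans ?_ hN
      rw [neededSize, ← hΛ, ← hT]
      have hQ : 1 ≤ (4 * T ^ 2) ^ d := Nat.one_le_iff_ne_zero.2 (by positivity)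
      calc 2 * (T ^ 5 * (m + 1)) * Λ ≤ 2560 * n * ((T ^ 5 + 1) * (m + 1)) * Λ ^ 2 := by
            gcongr
            · omega
            · omega
            · exact Nat.le_self_pow two_ne_zero _
        _ ≤ 2560 * n * ((T ^ 5 + 1) * (m + 1)) * Λ ^ 2 * (4 * T ^ 2) ^ d :=
            Nat.le_mul_of_pos_right _ hQ
        _ = _ := by ring
    exact_mod_cast h1
  have hlaw : (fun S => learnerLaw c A n d m E g S) = fun S =>
      ((listM g (Inp.S₁ ([n, d, m, E], S))).bind fun Z =>
        circuitLaw c (outputLaw A) ([n, d, m, E], S) Z).map enc := by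
    funext S
    rw [learnerLaw, if_neg hE1]
  have hp0 : 0 < κ / (1 + κ) := by positivity
  have hp1 : 7 / 16 * (κ / (1 + κ)) ≤ 1 := by
    have : κ / (1 + κ) ≤ 1 := by rw [div_le_one (by positivity)]; linarith
    linarith
  have hpT : 1 ≤ 7 / 16 * (κ / (1 + κ)) * T := by
    refine hcp.trans ?_
    have : (c : ℝ) ≤ T := by exact_mod_cast hcT
    gcongr
  obtain ⟨t, ht, hDt⟩ := hD
  rw [hlaw, ← PMF.map_bind, pr_map, bind_circuitLaw D f c d m E M (outputLaw A) g hn]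
  refine le_trans (pr_mono ?_) ((pr_learner_le hn hm hε hκ
    (by positivity : (0 : ℝ) < (Λ : ℝ)⁻¹) (inv_le_one_of_one_le₀ hΛr) (by omega) hTd hL hN0 hN5 D ht
    hDt hg hC hA hf).trans (failure_le hn hd hT3 hTd hΛ1 hp1 hpT hN))
  refine fun h _ hh hs => hh (err_le_of_sum_le hε3 ?_)
  simp only [decodeCircuit_enc]
  exact hs.trans (error_le hm hd hw (by omega) hκ hε (Nat.le_ceil _) hcκ hwκ)

end

theorem exists_constants {κ : ℝ} (hκ : 0 < κ) : ∃ c w : ℕ, 3 ≤ c ∧ 1 ≤ w ∧ 2048 / κ ^ 2 ≤ c ∧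
    3 / κ ≤ w ∧ 1 ≤ 7 / 16 * (κ / (1 + κ)) * c := by
  set p := 7 / 16 * (κ / (1 + κ)) with hp
  have hp0 : 0 < p := by positivity
  obtain ⟨c, hc⟩ := exists_nat_ge (3 + 2048 / κ ^ 2 + 1 / p)
  obtain ⟨w, hw⟩ := exists_nat_ge (1 + 3 / κ)
  have h1 : 0 < 2048 / κ ^ 2 := by positivity
  have h2 : 0 < 1 / p := by positivity
  have h3 : 0 < 3 / κ := by positivity
  refine ⟨c, w, ?_, ?_, by linarith, by linarith, ?_⟩
  · exact_mod_cast (by linarith : (3 : ℝ) ≤ c)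
  · exact_mod_cast (by linarith : (1 : ℝ) ≤ w)
  · have : 1 / p ≤ c := by linarith
    rw [div_le_iff₀ hp0] at this
    linarith

end


end Lift

end

theorem mainTheorem1 (κ : ℝ) (hκ : 0 < κ) :
    ∃ K : ℕ, ∀ (A : Lift.Cmd) (a : ℕ), A.QueryFree →
      ∃ (B₁ B₂ : Lift.Cmd) (b : ℕ), B₁.QueryFree ∧
        ∀ (n m d : ℕ) (ε : ℝ) (C : Set (Lift.Cube n → Bool)),
          1 ≤ n → 1 ≤ m → 1 ≤ d → 0 < ε →
          Lift.ClosedUnderRestriction C →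
          Lift.RunsInTime A [n, ⌈1 / ε⌉₊] n m (a * (n + m + ⌈1 / ε⌉₊) ^ a) →
          Lift.Learns A [n, ⌈1 / ε⌉₊] ε (1 / 2) C {PMF.uniformOfFintype (Lift.Cube n)} m →
          ∀ M : ℕ, M = Lift.sampleSize K n m d ε →
            (Lift.Learns B₁ [n, d, m, ⌈1 / ε⌉₊] ((1 + κ) * ε) (1 / 6) C
                {D | Lift.IsMonotoneDist D ∧ Lift.IsDecisionTreeDist d D} M ∧
              Lift.RunsInTime B₁ [n, d, m, ⌈1 / ε⌉₊] n M (b * (n + M) ^ b)) ∧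
            (Lift.Learns B₂ [n, d, m, ⌈1 / ε⌉₊] ((1 + κ) * ε) (1 / 6) C
                {D | Lift.IsDecisionTreeDist d D} M ∧
              Lift.MakesQueries B₂ [n, d, m, ⌈1 / ε⌉₊] n M M ∧
              Lift.RunsInTime B₂ [n, d, m, ⌈1 / ε⌉₊] n M (b * (n + M) ^ b)) := by
  have hκ3 : 0 < κ / 3 := by positivity
  have hκe : 1 + 3 * (κ / 3) = 1 + κ := by ring
  obtain ⟨c, w, hc, hw, hcκ, hwκ, hcp⟩ := Lift.exists_constants hκ3
  refine ⟨Lift.sizeConst c w, fun A a hA => ?_⟩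
  obtain ⟨pre₁, P₁, hq₁, hp₁⟩ := Lift.exists_prepares_self
  obtain ⟨pre₂, P₂, hp₂⟩ := Lift.exists_prepares_edges
  obtain ⟨B₁, b₁, hB₁, h₁⟩ := Lift.exists_lifted_learner c A hA a hp₁
  obtain ⟨B₂, b₂, -, h₂⟩ := Lift.exists_lifted_learner c A hA a hp₂
  refine ⟨B₁, B₂, b₁ + b₂, hB₁ hq₁, fun n m d ε C hn hm hd hε hC hT hL M hM => ?_⟩
  have hA' : ∀ f ∈ C, Lift.LearnsUniform (Lift.outputLaw A) n m ⌈1 / ε⌉₊ ε f :=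
    fun f hf => hL.learnsUniform hA hT hf
  have hpar := fun hE => hM ▸ Lift.params_le (c := c) hn hm hd hε (by omega) hw hE
  have hr₁ := h₁ n m d ⌈1 / ε⌉₊ M hn hT hpar
  have hr₂ := h₂ n m d ⌈1 / ε⌉₊ M hn hT hpar
  have hb₁ : b₁ * (n + M) ^ b₁ ≤ (b₁ + b₂) * (n + M) ^ (b₁ + b₂) :=
    Nat.mul_le_mul (by omega) (Nat.pow_le_pow_right (by omega) (by omega))
  have hb₂ : b₂ * (n + M) ^ b₂ ≤ (b₁ + b₂) * (n + M) ^ (b₁ + b₂) :=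
    Nat.mul_le_mul (by omega) (Nat.pow_le_pow_right (by omega) (by omega))
  refine ⟨⟨fun D hD f hf => ?_, ?_⟩, fun D hD f hf => ?_, ?_, ?_⟩
  · refine Lift.success_of_runs D f _ (fun S hS => hr₁ D S hS) (by norm_num) ?_
    rw [← hκe, hM]
    exact Lift.pr_learnerLaw_le hn hm hd hε hκ3 hc hw hcκ hwκ hcp hD.2 hC hA' hf
      (Lift.detects_of_monotone hD.1 f)
  · exact Lift.alwaysHaltsWith_of_runs (fun D S hS => ⟨_, hr₁ D S hS⟩) fun o ho _ => ho.trans hb₁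
  · refine Lift.success_of_runs D f _ (fun S hS => hr₂ D S hS) (by norm_num) ?_
    rw [← hκe, hM]
    exact Lift.pr_learnerLaw_le hn hm hd hε hκ3 hc hw hcκ hwκ hcp hD hC hA' hf
      (Lift.detects_edges D f)
  · exact Lift.alwaysHaltsWith_of_runs (fun D S hS => ⟨_, hr₂ D S hS⟩) fun o _ ho => ho
  · exact Lift.alwaysHaltsWith_of_runs (fun D S hS => ⟨_, hr₂ D S hS⟩) fun o ho _ => ho.trans hb₂
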